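/- **Setting.** Let $G$ be a Lie groupoid over $M$. A representation up to homotopy of $G$ is a graded vector bundle $E$ over $M$ (smooth, of finite rank) with operators $R_k(g_1,\dots,g_k):E_{s(g_k)}\to E_{t(g_1)}$, $k\ge 0$, of degree $1-k$, smooth in the string of composable arrows, such that $$\sum_{j=1}^{k-1}(-1)^jR_{k-1}(\dots,g_jg_{j+1},\dots)=\sum_{j=0}^k(-1)^jR_j(g_1,\dots,g_j)\circ R_{k-j}(g_{j+1},\dots,g_k).$$ A morphism $\Phi:(E,R)\to(F,R')$ consists of smooth operators $\Phi_k(g_1,\dots,g_k):E_{s(g_k)}\to F_{t(g_1)}$ of degree $-k$ with $$\sum_{i+j=k}(-1)^j\Phi_j\circ R_i=\sum_{i+j=k}R'_j\circ\Phi_i+\sum_{j=1}^{k-1}(-1)^j\Phi_{k-1}(\dots,g_jg_{j+1},\dots),$$ and a homotopy between morphisms $\Phi,\Psi$ consists of smooth operators $h_k$ of degree $-k-1$ with $$\Phi_k-\Psi_k=\sum_{i=0}^k(-1)^i\big(h_i\circ R_{k-i}+R'_i\circ h_{k-i}\big)+\sum_{i=1}^{k-1}(-1)^{i+1}h_{k-1}(\dots,g_ig_{i+1},\dots).$$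 A representation is strict if $R_k=0$ for $k\ge2$, and a morphism is strict if $\Phi_k=0$ for $k\ge1$. Let $\Omega$ be the real vector space spanned by the nonempty short forests (finite nonempty sequences of planar rooted trees whose leaves all have height two), bigraded by $k=$ number of leaves and $l=$ number of roots minus number of branches, with product $\circ$ the concatenation, $d_i$ the doubling of the $i$-th leaf, and $\partial$ the derivation for $\circ$ (with sign $(-1)^l$) given on a tree by the alternating sum, over the adjacent pairs of branches, of separating minus collapsing the pair. Let $L_n$ be the tree with $n$ branches and $n$ leaves, and $e=L_1$. Let $\mathcal T$ be the $\Omega$-bimodule spanned by the triples $(A,X,B)$, with $A,B$ short forests or empty and $X$ a tree or empty, with $k=k(A)+k(X)+k(B)$, $l=l(A)-\#\{\text{branches of }X\}+l(B)$, with $d_i$ the doubling of the $i$-th leaf, and with $\partial$ the derivation commuting with the $d_i$ such that, for $T_n=(\emptyset,L_n,\emptyset)$ and $T_0=(\emptyset,\emptyset,\emptyset)$, $$\partial T_n=\sum_{i=0}^{n-1}(-1)^iT_i\circ L_{n-i}-\sum_{i=1}^nL_i\circ T_{n-i}+\sum_{i=1}^{n-1}(-1)^{i+1}d_iT_{n-1}.$$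 Let $\Omega_m$, $\mathcal T_m$ be the $m$-fold powers for the product $(\mathcal A\boxtimes\mathcal B)^k(l)=\bigoplus_{i+j=l}\mathcal A^k(i)\otimes\mathcal B^k(j)$, with $d_i$ acting diagonally and $\partial$, $\circ$ and the permutation action of $S_m$ following the Koszul sign rule for $l$. Their completions consist in total degree $n$ of the series $\sum_kx_k$ with $x_k$ of bidegree $(k,n-k)$; put $a\star b=(-1)^{k(a)|b|}a\circ b$ and $d_{\rm tot}=\partial+(-1)^n\sum_i(-1)^id_i$ in total degree $n$. For $m\ge1$ let $\mathcal{MC}_m$ be the set of $\omega\in\bar\Omega_m^1$ with $d_{\rm tot}\omega+\omega\star\omega=0$ and $\omega_1=e^{\boxtimes m}$. For $\omega,\theta\in\mathcal{MC}_m$ let $\mathcal{MC}_m(\omega,\theta)$ be the set of $x\in\bar{\mathcal T}_m^0$ with $x\star\omega-\theta\star x=d_{\rm tot}x$ and $x_0=T_0^{\boxtimes m}$; a homotopy between $x$ and $y$ is an $h\in\bar{\mathcal T}_m^{-1}$ with $x-y=d_{\rm tot}h+h\star\omega+\theta\star h$. Elements fixed by $S_m$ are called symmetric. A representation $(E,R)$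 has a characteristic map $k_E$ on $\Omega$, sending $L_n$ to $R_n$ and compatible with $\circ$ and the $d_i$; a morphism $\Phi:(E,R)\to(F,R')$ has a characteristic map $k_\Phi$ on $\mathcal T$, sending $T_n$ to $\Phi_n$ and compatible with the actions of $\Omega$ (through $k_F$ on the left and $k_E$ on the right) and the $d_i$. The representation $\otimes_\omega(E_1,\dots,E_m)$ is the tensor product complex with, for $k\ge1$, $k$-th operator the image of $\omega_k$ under $k_{E_1}\boxtimes\cdots\boxtimes k_{E_m}$ followed by the (Koszul signed) tensor product of operators; $\otimes_z(\Phi_1,\dots,\Phi_m)$ is defined in the same way from $k_{\Phi_1}\boxtimes\cdots\boxtimes k_{\Phi_m}$ and $z_k$, $k\ge0$, for any series $z$ in $\bar{\mathcal T}_m$. **Theorem.** Let $m\ge1$, $\omega,\theta\in\mathcal{MC}_m$, and let $\Phi_i:E_i\to F_i$, $1\le i\le m$, be morphisms of representations up to homotopy of $G$. Then $E=\otimes_\omega(E_1,\dots,E_m)$ and $F=\otimes_\theta(F_1,\dots,F_m)$ are representations up to homotopy, $\otimes_x(\Phi_1,\dots,\Phi_m):E\to F$ is a morphism for every $x\in\mathcal{MC}_m(\omega,\theta)$,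 and: 1. $\mathcal{MC}_m(\omega,\theta)$ is nonempty, and any two of its elements are homotopic. 2. Any homotopy $h$ between $x,y\in\mathcal{MC}_m(\omega,\theta)$ induces a homotopy, namely $\otimes_h(\Phi_1,\dots,\Phi_m)$, between $\otimes_x(\Phi_1,\dots,\Phi_m)$ and $\otimes_y(\Phi_1,\dots,\Phi_m)$. 3. For any $x\in\mathcal{MC}_m(\omega,\theta)$, the zeroth component of $\otimes_x(\Phi_1,\dots,\Phi_m)$ is $(\Phi_1)_0\otimes\cdots\otimes(\Phi_m)_0$. If moreover the $E_i$ and $F_i$ are strict representations and the $\Phi_i$ are strict morphisms, then $\otimes_x(\Phi_1,\dots,\Phi_m)$ is strict. 4. If $\omega$ and $\theta$ are symmetric, then $\mathcal{MC}_m(\omega,\theta)$ contains a symmetric element. Every symmetric $x\in\mathcal{MC}_m(\omega,\theta)$ induces a symmetric power operation on morphisms: for a morphism $\Phi_0:E_0\to F_0$ of representations up to homotopy, the ($S_m$-invariant) graded subbundles $S^mE_0\subset E_0^{\otimes m}$ and $S^mF_0\subset F_0^{\otimes m}$ are preserved by the operators of $\otimes_\omega(E_0,\dots,E_0)$ and of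 $\otimes_\theta(F_0,\dots,F_0)$, hence are representations up to homotopy, and $\otimes_x(\Phi_0,\dots,\Phi_0)$ restricts to a morphism $S^mE_0\to S^mF_0$. 5. For any $x\in\mathcal{MC}_m(\omega,\theta)$, if $\Phi'_i:E_i\to F_i$ is a morphism homotopic to $\Phi_i$ for each $i$, then $\otimes_x(\Phi'_1,\dots,\Phi'_m)$ is homotopic to $\otimes_x(\Phi_1,\dots,\Phi_m)$. 6. For any $x\in\mathcal{MC}_m(\omega,\omega)$, the morphism $\otimes_x(\operatorname{id}_{E_1},\dots,\operatorname{id}_{E_m})$ is homotopic to the identity of $\otimes_\omega(E_1,\dots,E_m)$. -/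

import Mathlib

open scoped Manifold TensorProduct
open Finset

universe uM uV

noncomputable section

/-! ## Short forests, the Maurer-Cartan algebra and the Maurer-Cartan module

A *short tree* is a planar rooted tree all of whose leaves have height two.  It is recorded by the
list of its branches from left to right, a branch being recorded by its number of leaves.  A short
forest is the list of its trees. -/

/-- The number of leaves of a tree. -/
def treeOrder (X : List ℕ+) : ℕ := (X.map (fun n : ℕ+ => (n : ℕ))).sum

/-- The number of leaves of a forest. -/
def forestOrder (F : List (List ℕ+)) : ℕ := (F.map treeOrder).sum

/-- The degree of a forest: the number of roots minus the number of branches. -/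
def forestDeg (F : List (List ℕ+)) : ℤ := (F.map (fun X => 1 - (X.length : ℤ))).sum

/-- Collapse the adjacent branches number `j` and `j + 1` (counted from `0`). -/
def mergeAt : ℕ → List ℕ+ → List ℕ+
  | 0, n :: n' :: X => (n + n') :: X
  | j + 1, n :: X => n :: mergeAt j X
  | _, X => X

/-- Replace the leaf number `i` (counted from `0`) of a tree by two leaves. -/
def dupTree : ℕ → List ℕ+ → List ℕ+
  | _, [] => []
  | i, n :: X => if i < (n : ℕ) then (n + 1) :: X else n :: dupTree (i - n) X

/-- Replace the leaf number `i` (counted from `0`) of a forest by two leaves. -/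
def dupForest : ℕ → List (List ℕ+) → List (List ℕ+)
  | _, [] => []
  | i, X :: F =>
    if i < treeOrder X then dupTree i X :: F else X :: dupForest (i - treeOrder X) F

/-- The differential of a tree: separate minus collapse the successive pairs of adjacent branches,
with alternating signs. -/
def bdryTree (X : List ℕ+) : List (List ℕ+) →₀ ℝ :=
  ∑ j ∈ range (X.length - 1), (-1 : ℝ) ^ j •
    (Finsupp.single [X.take (j + 1), X.drop (j + 1)] 1 - Finsupp.single [mergeAt j X] 1)

/-- The differential of a forest, extended from trees as a derivation for concatenation. -/
def bdryForest : List (List ℕ+) → (List (List ℕ+) →₀ ℝ)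
  | [] => 0
  | X :: F => (bdryTree X).mapDomain (fun Y => Y ++ F)
      + (-1 : ℝ) ^ (1 - (X.length : ℤ)) • (bdryForest F).mapDomain (fun Y => X :: Y)

/-- A bigraded vector space with operators `∂` and `d_i`, presented by a homogeneous basis which is
preserved by the operators `d_i`.  The basis consists of the elements of `carrier` that satisfy
`IsBasis`; `dup i` is the operator `d_{i+1}`. -/
structure BarBasis where
  carrier : Type
  IsBasis : carrier → Prop
  order : carrier → ℕ
  deg : carrier → ℤ
  bdry : carrier → (carrier →₀ ℝ)
  dup : ℕ → carrier → carrier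

/-- The Maurer-Cartan algebra `Ω`: the span of all nonempty short forests. -/
def omegaBar : BarBasis where
  carrier := List (List ℕ+)
  IsBasis F := F ≠ [] ∧ ∀ X ∈ F, X ≠ []
  order := forestOrder
  deg := forestDeg
  bdry := bdryForest
  dup := dupForest

/-- The product of `Ω`: concatenation of forests. -/
def omegaMul (F F' : omegaBar.carrier) : omegaBar.carrier :=
  List.append (α := List ℕ+) F F'

/-- Triples `(A, X, B)` with `A`, `B` short forests (possibly empty) and `X` a short tree or
empty. The triple `(∅, X, ∅)` with `X` made of `n` one-leaved branches is the generator `T_n`. -/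
structure MarkedForest where
  left : List (List ℕ+)
  mid : List ℕ+
  right : List (List ℕ+)

/-- The differential of a triple `(A, X, B)`, as a derivation, where on the middle term
`∂ T_n = ∑_{i<n} (-1)^i T_i ∘ L_{n-i} - ∑_{1≤i≤n} L_i ∘ T_{n-i} + ∑_{1≤i<n} (-1)^{i+1} d_i T_{n-1}`,
extended to all middle terms by commutation with the `d_i`. -/
def bdryMarked (t : MarkedForest) : MarkedForest →₀ ℝ :=
  (bdryForest t.left).mapDomain (fun A => ⟨A, t.mid, t.right⟩)
  + (-1 : ℝ) ^ forestDeg t.left •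
    (∑ i ∈ range t.mid.length, (-1 : ℝ) ^ i •
        Finsupp.single ⟨t.left, t.mid.take i, t.mid.drop i :: t.right⟩ 1
      - ∑ i ∈ range t.mid.length,
        Finsupp.single ⟨t.left ++ [t.mid.take (i + 1)], t.mid.drop (i + 1), t.right⟩ 1
      + ∑ j ∈ range (t.mid.length - 1), (-1 : ℝ) ^ j •
        Finsupp.single ⟨t.left, mergeAt j t.mid, t.right⟩ 1)
  + (-1 : ℝ) ^ (forestDeg t.left - (t.mid.length : ℤ)) •
    (bdryForest t.right).mapDomain (fun B => ⟨t.left, t.mid, B⟩)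

/-- Replace the leaf number `i` (counted from `0`, through `A`, `X` and `B`) by two leaves. -/
def dupMarked (i : ℕ) (t : MarkedForest) : MarkedForest :=
  if i < forestOrder t.left then ⟨dupForest i t.left, t.mid, t.right⟩
  else if i < forestOrder t.left + treeOrder t.mid then
    ⟨t.left, dupTree (i - forestOrder t.left) t.mid, t.right⟩
  else ⟨t.left, t.mid, dupForest (i - forestOrder t.left - treeOrder t.mid) t.right⟩

/-- The Maurer-Cartan module `𝒯`, an `Ω`-bimodule. -/
def moduleBar : BarBasis where
  carrier := MarkedForest
  IsBasis t := (∀ X ∈ t.left, X ≠ []) ∧ ∀ X ∈ t.right, X ≠ []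
  order t := forestOrder t.left + treeOrder t.mid + forestOrder t.right
  deg t := forestDeg t.left - (t.mid.length : ℤ) + forestDeg t.right
  bdry := bdryMarked
  dup := dupMarked

/-- The left action of `Ω` on `𝒯`: `C ∘ (A, X, B) = (C ∘ A, X, B)`. -/
def leftMul (F : omegaBar.carrier) (t : moduleBar.carrier) : moduleBar.carrier :=
  MarkedForest.mk (List.append (α := List ℕ+) F (MarkedForest.left t)) (MarkedForest.mid t)
    (MarkedForest.right t)

/-- The right action of `Ω` on `𝒯`: `(A, X, B) ∘ C = (A, X, B ∘ C)`. -/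
def rightMul (t : moduleBar.carrier) (F : omegaBar.carrier) : moduleBar.carrier :=
  MarkedForest.mk (MarkedForest.left t) (MarkedForest.mid t)
    (List.append (α := List ℕ+) (MarkedForest.right t) F)

/-! ## The powers for the tensor product `⊠`, completions, Maurer-Cartan elements -/

/-- The sign by which a permutation of graded factors of degrees `l i` acts, the factor `i` being
moved to position `σ i`. -/
def koszulSign {m : ℕ} (σ : Equiv.Perm (Fin m)) (l : Fin m → ℤ) : ℝ :=
  ∏ i, ∏ j ∈ univ.filter (fun j => i < j ∧ σ j < σ i), (-1 : ℝ) ^ (l i * l j)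

namespace BarBasis

/-- The `m`-fold power `X ⊠ ⋯ ⊠ X`, with basis the `m`-tuples `u₁ ⊠ ⋯ ⊠ u_m` (of basis elements of
equal order, see `piece`). -/
abbrev Pow (X : BarBasis) (m : ℕ) : Type := (Fin m → X.carrier) →₀ ℝ

variable (X : BarBasis) (m : ℕ)

/-- The component of bidegree `(k, l)` of `X ⊠ ⋯ ⊠ X`. -/
def piece (k : ℕ) (l : ℤ) : Submodule ℝ (X.Pow m) :=
  Finsupp.supported ℝ ℝ
    {u | (∀ i, X.IsBasis (u i) ∧ X.order (u i) = k) ∧ ∑ i, X.deg (u i) = l}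

/-- `∂(u₁ ⊠ ⋯ ⊠ u_m) = ∑ᵢ (-1)^{l(u₁) + ⋯ + l(u_{i-1})} u₁ ⊠ ⋯ ⊠ ∂uᵢ ⊠ ⋯ ⊠ u_m`. -/
def bdryPow : X.Pow m →ₗ[ℝ] X.Pow m :=
  Finsupp.linearCombination ℝ fun u =>
    ∑ i, (-1 : ℝ) ^ (∑ j ∈ univ.filter (fun j => j < i), X.deg (u j)) •
      (X.bdry (u i)).mapDomain (fun v => Function.update u i v)

/-- `d_{i+1}(u₁ ⊠ ⋯ ⊠ u_m) = d_{i+1}u₁ ⊠ ⋯ ⊠ d_{i+1}u_m`. -/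
def dupPow (i : ℕ) : X.Pow m →ₗ[ℝ] X.Pow m :=
  Finsupp.lmapDomain ℝ ℝ (fun u j => X.dup i (u j))

/-- The action of the symmetric group. -/
def permPow (σ : Equiv.Perm (Fin m)) : X.Pow m →ₗ[ℝ] X.Pow m :=
  Finsupp.linearCombination ℝ fun u =>
    Finsupp.single (fun i => u (σ.symm i)) (koszulSign σ (fun i => X.deg (u i)))

variable {X m}

/-- `(u₁ ⊠ ⋯ ⊠ u_m) ∘ (v₁ ⊠ ⋯ ⊠ v_m) = ± (u₁ ∘ v₁) ⊠ ⋯ ⊠ (u_m ∘ v_m)`, with the sign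
`(-1)^{∑_{j<i} l(uᵢ) l(vⱼ)}`. -/
def mulPow {Y Z : BarBasis} (op : X.carrier → Y.carrier → Z.carrier) (a : X.Pow m) (b : Y.Pow m) :
    Z.Pow m :=
  a.sum fun u r => b.sum fun v s =>
    Finsupp.single (fun i => op (u i) (v i))
      ((-1 : ℝ) ^ (∑ i, ∑ j ∈ univ.filter (fun j => j < i), X.deg (u i) * Y.deg (v j)) * r * s)

/-- The elements `x = x₀ + x₁ + ⋯` of total degree `n` of the completion of `X ⊠ ⋯ ⊠ X`:
`x_k` has bidegree `(k, n - k)`. -/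
def HasTotalDegree (n : ℤ) (x : ℕ → X.Pow m) : Prop :=
  ∀ k : ℕ, x k ∈ X.piece m k (n - k)

/-- The total differential `∂ + (-1)ⁿ ∑_{i=1}^{k} (-1)^i d_i` on elements of total degree `n`. -/
def dTot (n : ℤ) (x : ℕ → X.Pow m) : ℕ → X.Pow m
  | 0 => X.bdryPow m (x 0)
  | k + 1 => X.bdryPow m (x (k + 1))
      + (-1 : ℝ) ^ n • ∑ i ∈ range k, (-1 : ℝ) ^ (i + 1) • X.dupPow m i (x k)

/-- The signed product `a ⋆ b = (-1)^{k(a)|b|} a ∘ b`, where `|b| = n`. -/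
def star {Y Z : BarBasis} (op : X.carrier → Y.carrier → Z.carrier) (n : ℤ)
    (a : ℕ → X.Pow m) (b : ℕ → Y.Pow m) : ℕ → Z.Pow m :=
  fun k => ∑ p ∈ antidiagonal k, (-1 : ℝ) ^ ((p.1 : ℤ) * n) • mulPow op (a p.1) (b p.2)

/-- Invariance under all permutations of the tensor factors. -/
def IsSymmetric (x : ℕ → X.Pow m) : Prop :=
  ∀ (σ : Equiv.Perm (Fin m)) (k : ℕ), X.permPow m σ (x k) = x k

end BarBasis

/-- Universal Maurer-Cartan elements of length `m`, i.e. the elements of `MC_m`. -/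
structure IsUniversalMC (m : ℕ) (ω : ℕ → omegaBar.Pow m) : Prop where
  degree : BarBasis.HasTotalDegree 1 ω
  maurerCartan : ∀ k, BarBasis.dTot 1 ω k + BarBasis.star omegaMul 1 ω ω k = 0
  one : ω 1 = Finsupp.single (fun _ => ([[1]] : List (List ℕ+))) 1

/-- Universal Maurer-Cartan morphisms from `ω` to `θ`, i.e. the elements of `MC_m(ω, θ)`. -/
structure IsUniversalMCMorphism {m : ℕ} (ω θ : ℕ → omegaBar.Pow m) (x : ℕ → moduleBar.Pow m) :
    Prop where
  degree : BarBasis.HasTotalDegree 0 x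
  equation : ∀ k, BarBasis.star rightMul 1 x ω k - BarBasis.star leftMul 0 θ x k
    = BarBasis.dTot 0 x k
  zero : x 0 = Finsupp.single (fun _ => MarkedForest.mk [] [] []) 1

/-- `h` is a homotopy between the Maurer-Cartan morphisms `x` and `y` from `ω` to `θ`. -/
structure IsMCHomotopy {m : ℕ} (ω θ : ℕ → omegaBar.Pow m) (x y h : ℕ → moduleBar.Pow m) :
    Prop where
  degree : BarBasis.HasTotalDegree (-1) h
  equation : ∀ k, x k - y k = BarBasis.dTot (-1) h k + BarBasis.star rightMul 1 h ω k
    + BarBasis.star leftMul (-1) θ h k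

/-! ## Graded vector bundles -/

section Bundles

open scoped ContDiff

variable {EM : Type*} [NormedAddCommGroup EM] [NormedSpace ℝ EM]
  {M : Type uM} [TopologicalSpace M] [ChartedSpace EM M]

/-- A finite family of graded sections over a set `dom` (the values elsewhere are irrelevant). -/
structure LocalFrame {M : Type uM} (V : M → Type uV) where
  dom : Set M
  idx : Type
  [fintype : Fintype idx]
  deg : idx → ℤ
  sec : idx → ∀ x, V x

attribute [instance] LocalFrame.fintype

namespace LocalFrame

variable {V : M → Type uV} [∀ x, AddCommGroup (V x)] [∀ x, Module ℝ (V x)]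

/-- Over an open set the sections form bases of the fibres, and those of degree `n` form bases of
the components of degree `n`. -/
structure IsHomogeneousFrame (gr : ∀ x, ℤ → Submodule ℝ (V x)) (a : LocalFrame V) : Prop where
  isOpen : IsOpen a.dom
  linearIndependent : ∀ x ∈ a.dom, LinearIndependent ℝ (fun j => a.sec j x)
  span_eq_top : ∀ x ∈ a.dom, Submodule.span ℝ (Set.range fun j => a.sec j x) = ⊤
  gr_eq : ∀ x ∈ a.dom, ∀ n, gr x n = Submodule.span ℝ ((fun j => a.sec j x) '' {j | a.deg j = n})

/-- The sections of `b` are combinations of those of `a` with smooth coefficients, on the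
intersection of the domains. -/
def SmoothTransition (EM : Type*) [NormedAddCommGroup EM] [NormedSpace ℝ EM] [ChartedSpace EM M]
    (a b : LocalFrame V) : Prop :=
  ∃ A : b.idx → a.idx → M → ℝ,
    (∀ j i, ContMDiffOn 𝓘(ℝ, EM) 𝓘(ℝ, ℝ) ∞ (A j i) (a.dom ∩ b.dom)) ∧
    ∀ x ∈ a.dom ∩ b.dom, ∀ j, b.sec j x = ∑ i, A j i x • a.sec i x

end LocalFrame

/-- A smooth graded real vector bundle of finite rank: a family of graded vector spaces with an
atlas of homogeneous local frames whose transition matrices are smooth. -/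
structure GradedBundle (EM : Type*) [NormedAddCommGroup EM] [NormedSpace ℝ EM]
    (M : Type uM) [TopologicalSpace M] [ChartedSpace EM M] where
  fiber : M → Type uV
  [addCommGroup : ∀ x, AddCommGroup (fiber x)]
  [module : ∀ x, Module ℝ (fiber x)]
  gr : ∀ x, ℤ → Submodule ℝ (fiber x)
  atlas : Set (LocalFrame fiber)
  isFrame : ∀ a ∈ atlas, a.IsHomogeneousFrame gr
  cover : ∀ x, ∃ a ∈ atlas, x ∈ a.dom
  smooth : ∀ a ∈ atlas, ∀ b ∈ atlas, LocalFrame.SmoothTransition EM a b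

attribute [instance] GradedBundle.addCommGroup GradedBundle.module

/-- The basis of a fibre given by a homogeneous frame. -/
def LocalFrame.IsHomogeneousFrame.basis {V : M → Type uV} [∀ x, AddCommGroup (V x)]
    [∀ x, Module ℝ (V x)] {gr : ∀ x, ℤ → Submodule ℝ (V x)} {a : LocalFrame V}
    (ha : a.IsHomogeneousFrame gr) {x : M} (hx : x ∈ a.dom) : Module.Basis a.idx ℝ (V x) :=
  Module.Basis.mk (ha.linearIndependent x hx) (ha.span_eq_top x hx).ge

theorem LocalFrame.IsHomogeneousFrame.basis_apply {V : M → Type uV} [∀ x, AddCommGroup (V x)]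
    [∀ x, Module ℝ (V x)] {gr : ∀ x, ℤ → Submodule ℝ (V x)} {a : LocalFrame V}
    (ha : a.IsHomogeneousFrame gr) {x : M} (hx : x ∈ a.dom) (j : a.idx) :
    ha.basis hx j = a.sec j x := by
  simp [LocalFrame.IsHomogeneousFrame.basis]

namespace GradedBundle

variable (E : GradedBundle.{uM, uV} EM M)

/-- A frame of the atlas around `x`. -/
def frameAt (x : M) : LocalFrame E.fiber := (E.cover x).choose

theorem frameAt_mem (x : M) : E.frameAt x ∈ E.atlas := (E.cover x).choose_spec.1

theorem mem_frameAt (x : M) : x ∈ (E.frameAt x).dom := (E.cover x).choose_spec.2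

/-- The linear map which multiplies the vectors of degree `n` by `(-1)^{l n}`, see `twist_apply`. -/
def twist (x : M) (l : ℤ) : E.fiber x →ₗ[ℝ] E.fiber x :=
  ((E.isFrame _ (E.frameAt_mem x)).basis (E.mem_frameAt x)).constr ℝ
    fun j => (-1 : ℝ) ^ (l * (E.frameAt x).deg j) • (E.frameAt x).sec j x

theorem twist_apply (x : M) (l n : ℤ) (v : E.fiber x) (hv : v ∈ E.gr x n) :
    E.twist x l v = (-1 : ℝ) ^ (l * n) • v := by
  rw [(E.isFrame _ (E.frameAt_mem x)).gr_eq x (E.mem_frameAt x)] at hv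
  induction hv using Submodule.span_induction with
  | mem v hv =>
    obtain ⟨j, hj, rfl⟩ := hv
    have hj' : (E.frameAt x).deg j = n := hj
    have := ((E.isFrame _ (E.frameAt_mem x)).basis (E.mem_frameAt x)).constr_basis ℝ
      (fun j => (-1 : ℝ) ^ (l * (E.frameAt x).deg j) • (E.frameAt x).sec j x) j
    rw [LocalFrame.IsHomogeneousFrame.basis_apply, hj'] at this
    exact this
  | zero => simp
  | add u v _ _ hu hv => rw [map_add, hu, hv, smul_add]
  | smul c v _ hv => rw [map_smul, hv, smul_comm]

/-- A homogeneous local frame compatible with the smooth structure of the bundle. -/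
def IsSmoothFrame (f : LocalFrame E.fiber) : Prop :=
  f.IsHomogeneousFrame E.gr ∧
    ∀ a ∈ E.atlas, LocalFrame.SmoothTransition EM a f ∧ LocalFrame.SmoothTransition EM f a

/-! ### Tensor products -/

section Tensor

variable {m : ℕ} (E : Fin m → GradedBundle.{uM, uV} EM M)

/-- The frame of a tensor product formed by the tensor products of the members of frames. -/
def tensorFrame (a : ∀ i, LocalFrame (E i).fiber) :
    LocalFrame (fun x => ⨂[ℝ] i, (E i).fiber x) where
  dom := ⋂ i, (a i).dom
  idx := ∀ i, (a i).idx
  deg J := ∑ i, (a i).deg (J i)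
  sec J x := PiTensorProduct.tprod ℝ fun i => (a i).sec (J i) x

/-- The components of a tensor product of graded vector spaces. -/
def tensorGr (x : M) (n : ℤ) : Submodule ℝ (⨂[ℝ] i, (E i).fiber x) :=
  Submodule.span ℝ {t | ∃ (d : Fin m → ℤ) (v : ∀ i, (E i).fiber x),
    (∀ i, v i ∈ (E i).gr x (d i)) ∧ ∑ i, d i = n ∧ t = PiTensorProduct.tprod ℝ v}

theorem tensorFrame_isHomogeneousFrame (a : ∀ i, LocalFrame (E i).fiber)
    (ha : ∀ i, a i ∈ (E i).atlas) : (tensorFrame E a).IsHomogeneousFrame (tensorGr E) := by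
  have key : ∀ x (hx : ∀ i, x ∈ (a i).dom) (J : ∀ i, (a i).idx),
      Basis.piTensorProduct (fun i => ((E i).isFrame _ (ha i)).basis (hx i)) J
        = (tensorFrame E a).sec J x := by
    intro x hx J
    rw [Basis.piTensorProduct_apply]
    simp [tensorFrame, LocalFrame.IsHomogeneousFrame.basis_apply]
  refine ⟨isOpen_iInter_of_finite fun i => ((E i).isFrame _ (ha i)).isOpen, ?_, ?_, ?_⟩
  · intro x hx
    have hx' : ∀ i, x ∈ (a i).dom := Set.mem_iInter.1 hx
    have h := (Basis.piTensorProduct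
      (fun i => ((E i).isFrame _ (ha i)).basis (hx' i))).linearIndependent
    rwa [show (⇑(Basis.piTensorProduct fun i => ((E i).isFrame _ (ha i)).basis (hx' i)))
      = fun J => (tensorFrame E a).sec J x from funext (key x hx')] at h
  · intro x hx
    have hx' : ∀ i, x ∈ (a i).dom := Set.mem_iInter.1 hx
    have h := (Basis.piTensorProduct
      (fun i => ((E i).isFrame _ (ha i)).basis (hx' i))).span_eq
    rwa [show (⇑(Basis.piTensorProduct fun i => ((E i).isFrame _ (ha i)).basis (hx' i)))
      = fun J => (tensorFrame E a).sec J x from funext (key x hx')] at h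
  · intro x hx n
    have hx' : ∀ i, x ∈ (a i).dom := Set.mem_iInter.1 hx
    apply le_antisymm
    · refine Submodule.span_le.2 ?_
      rintro t ⟨d, v, hv, hd, rfl⟩
      have hv' : ∀ i, ∃ c : (a i).idx → ℝ, (∀ j, (a i).deg j ≠ d i → c j = 0) ∧
          v i = ∑ j, c j • (a i).sec j x := by
        intro i
        have h := hv i
        rw [((E i).isFrame _ (ha i)).gr_eq x (hx' i)] at h
        generalize v i = w at h ⊢
        induction h using Submodule.span_induction with
        | mem v hv =>
          classical
          obtain ⟨j, hj, rfl⟩ := hv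
          refine ⟨Pi.single j 1, fun k hk => ?_, ?_⟩
          · refine Pi.single_eq_of_ne ?_ _
            rintro rfl
            exact hk hj
          · rw [Finset.sum_eq_single j] <;> simp +contextual
        | zero => exact ⟨0, by simp, by simp⟩
        | add u v _ _ hu hv =>
          obtain ⟨c, hc, rfl⟩ := hu
          obtain ⟨c', hc', rfl⟩ := hv
          exact ⟨c + c', fun j hj => by simp [hc j hj, hc' j hj],
            by simp [add_smul, Finset.sum_add_distrib]⟩
        | smul r v _ hv =>
          obtain ⟨c, hc, rfl⟩ := hv
          exact ⟨r • c, fun j hj => by simp [hc j hj], by simp [Finset.smul_sum, smul_smul]⟩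
      choose c hc hvc using hv'
      classical
      have : v = fun i => ∑ j, c i j • (a i).sec j x := funext hvc
      rw [this, MultilinearMap.map_sum]
      refine Submodule.sum_mem _ fun J _ => ?_
      rw [MultilinearMap.map_smul_univ]
      by_cases hJ : ∀ i, (a i).deg (J i) = d i
      · refine Submodule.smul_mem _ _ (Submodule.subset_span ⟨J, ?_, rfl⟩)
        change ∑ i, (a i).deg (J i) = n
        rw [← hd]
        exact Finset.sum_congr rfl fun i _ => hJ i
      · push Not at hJ
        obtain ⟨i, hi⟩ := hJ
        rw [Finset.prod_eq_zero (Finset.mem_univ i) (hc i _ hi), zero_smul]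
        exact Submodule.zero_mem _
    · refine Submodule.span_le.2 ?_
      rintro t ⟨J, hJ, rfl⟩
      refine Submodule.subset_span ⟨fun i => (a i).deg (J i), fun i => (a i).sec (J i) x, ?_,
        hJ, rfl⟩
      intro i
      rw [((E i).isFrame _ (ha i)).gr_eq x (hx' i)]
      exact Submodule.subset_span ⟨J i, rfl, rfl⟩

/-- The tensor product of graded vector bundles. -/
def tensorBundle : GradedBundle.{uM, uV} EM M where
  fiber x := ⨂[ℝ] i, (E i).fiber x
  gr := tensorGr E
  atlas := {f | ∃ a : ∀ i, LocalFrame (E i).fiber, (∀ i, a i ∈ (E i).atlas) ∧ f = tensorFrame E a}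
  isFrame := by
    rintro f ⟨a, ha, rfl⟩
    exact tensorFrame_isHomogeneousFrame E a ha
  cover x := ⟨_, ⟨fun i => (E i).frameAt x, fun i => (E i).frameAt_mem x, rfl⟩,
    Set.mem_iInter.2 fun i => (E i).mem_frameAt x⟩
  smooth := by
    rintro f ⟨a, ha, rfl⟩ g ⟨b, hb, rfl⟩
    choose A hA hAx using fun i => (E i).smooth _ (ha i) _ (hb i)
    refine ⟨fun J I x => ∏ i, A i (J i) (I i) x, fun J I => ?_, ?_⟩
    · refine contMDiffOn_finsetProd fun i _ => (hA i (J i) (I i)).mono ?_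
      exact Set.inter_subset_inter (Set.iInter_subset _ i) (Set.iInter_subset _ i)
    · intro x hx J
      have hx' : ∀ i, x ∈ (a i).dom ∩ (b i).dom :=
        fun i => ⟨Set.mem_iInter.1 hx.1 i, Set.mem_iInter.1 hx.2 i⟩
      classical
      change PiTensorProduct.tprod ℝ (fun i => (b i).sec (J i) x) = _
      rw [show (fun i => (b i).sec (J i) x) = fun i => ∑ j, A i (J i) j x • (a i).sec j x from
        funext fun i => hAx i x (hx' i) (J i), MultilinearMap.map_sum]
      refine Finset.sum_congr rfl fun I _ => ?_
      rw [MultilinearMap.map_smul_univ]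
      rfl

end Tensor

/-- The tensor product `φ₁ ⊗ ⋯ ⊗ φ_m` of maps of degrees `l i`, with the Koszul sign rule
`(φ₁ ⊗ ⋯ ⊗ φ_m)(e₁ ⊗ ⋯ ⊗ e_m) = (-1)^{∑_{i<j} l(φⱼ)|eᵢ|} φ₁e₁ ⊗ ⋯ ⊗ φ_me_m`. -/
def koszulMap {m : ℕ} {E F : Fin m → GradedBundle.{uM, uV} EM M} {x y : M} (l : Fin m → ℤ)
    (φ : ∀ i, (E i).fiber x →ₗ[ℝ] (F i).fiber y) :
    (tensorBundle E).fiber x →ₗ[ℝ] (tensorBundle F).fiber y :=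
  PiTensorProduct.map fun i =>
    φ i ∘ₗ (E i).twist x (∑ j ∈ univ.filter (fun j => i < j), l j)

/-! ### Graded subbundles and symmetric powers -/

/-- A frame for a family of subspaces, made of some of the sections of a frame. -/
def subFrame {V : M → Type uV} [∀ x, AddCommGroup (V x)] [∀ x, Module ℝ (V x)]
    (W : ∀ x, Submodule ℝ (V x)) (f : LocalFrame V) (S : Set f.idx) :
    LocalFrame (fun x => W x) where
  dom := f.dom
  idx := S
  fintype := Fintype.ofFinite S
  deg j := f.deg j
  sec j x := by
    classical
    exact if h : f.sec j x ∈ W x then ⟨f.sec j x, h⟩ else 0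

/-- `f` is a smooth homogeneous frame of `E` whose members indexed by `S` span the subspaces `W`. -/
def IsAdapted (W : ∀ x, Submodule ℝ (E.fiber x)) (f : LocalFrame E.fiber) (S : Set f.idx) : Prop :=
  E.IsSmoothFrame f ∧ ∀ x ∈ f.dom, W x = Submodule.span ℝ ((fun j => f.sec j x) '' S)

/-- The subspaces `W x` form a graded subbundle: locally there is an adapted smooth frame. -/
def IsSubbundle (W : ∀ x, Submodule ℝ (E.fiber x)) : Prop :=
  ∀ x, ∃ (f : LocalFrame E.fiber) (S : Set f.idx), E.IsAdapted W f S ∧ x ∈ f.dom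

/-- The index in the original frame of a member of `subFrame W f S`. -/
def subIdx {V : M → Type uV} [∀ x, AddCommGroup (V x)] [∀ x, Module ℝ (V x)]
    (W : ∀ x, Submodule ℝ (V x)) (f : LocalFrame V) (S : Set f.idx)
    (j : (subFrame W f S).idx) : f.idx := Subtype.val (p := fun j => j ∈ S) j

theorem subIdx_injective (W : ∀ x, Submodule ℝ (E.fiber x)) (f : LocalFrame E.fiber)
    (S : Set f.idx) : Function.Injective (subIdx W f S) := Subtype.val_injective

theorem range_subIdx (W : ∀ x, Submodule ℝ (E.fiber x)) (f : LocalFrame E.fiber)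
    (S : Set f.idx) : Set.range (subIdx W f S) = S := Subtype.range_coe

theorem subFrame_coe {W : ∀ x, Submodule ℝ (E.fiber x)} {f : LocalFrame E.fiber} {S : Set f.idx}
    (h : E.IsAdapted W f S) {x : M} (hx : x ∈ f.dom) (j : (subFrame W f S).idx) :
    (W x).subtype ((subFrame W f S).sec j x) = f.sec (subIdx W f S j) x := by
  have : f.sec (subIdx W f S j) x ∈ W x := by
    rw [h.2 x hx]
    exact Submodule.subset_span ⟨_, (E.range_subIdx W f S).subset ⟨j, rfl⟩, rfl⟩
  exact congrArg Subtype.val (dif_pos this)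

theorem subFrame_isHomogeneousFrame {W : ∀ x, Submodule ℝ (E.fiber x)} {f : LocalFrame E.fiber}
    {S : Set f.idx} (h : E.IsAdapted W f S) :
    (subFrame W f S).IsHomogeneousFrame (fun x n => (E.gr x n).comap (W x).subtype) := by
  have him : ∀ x ∈ f.dom, ∀ T : Set (subFrame W f S).idx,
      (Submodule.span ℝ ((fun j => (subFrame W f S).sec j x) '' T)).map (W x).subtype
        = Submodule.span ℝ ((fun j => f.sec j x) '' (subIdx W f S '' T)) := by
    intro x hx T
    rw [Submodule.map_span, Set.image_image, Set.image_image]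
    congr 1
    exact Set.image_congr fun j _ => E.subFrame_coe h hx j
  refine ⟨h.1.1.isOpen, ?_, ?_, ?_⟩
  · intro x hx
    refine LinearIndependent.of_comp (W x).subtype ?_
    have h1 := (h.1.1.linearIndependent x hx).comp (subIdx W f S) (E.subIdx_injective W f S)
    rwa [show (fun j => f.sec j x) ∘ subIdx W f S
      = (W x).subtype ∘ fun j => (subFrame W f S).sec j x from
        funext fun j => (E.subFrame_coe h hx j).symm] at h1
  · intro x hx
    apply Submodule.map_injective_of_injective (W x).injective_subtype
    rw [← Set.image_univ, him x hx, Set.image_univ, Submodule.map_top, Submodule.range_subtype,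
      E.range_subIdx, h.2 x hx]
  · intro x hx n
    apply Submodule.map_injective_of_injective (W x).injective_subtype
    rw [him x hx, Submodule.map_comap_subtype, h.2 x hx, h.1.1.gr_eq x hx]
    have hb : ∀ T : Set f.idx, (fun j => f.sec j x) '' T = h.1.1.basis hx '' T := fun T =>
      Set.image_congr fun j _ => (h.1.1.basis_apply hx j).symm
    have hS : subIdx W f S '' {j | (subFrame W f S).deg j = n} = S ∩ {j | f.deg j = n} := by
      ext j
      constructor
      · rintro ⟨k, hk, rfl⟩
        exact ⟨(E.range_subIdx W f S).subset ⟨k, rfl⟩, hk⟩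
      · rintro ⟨hj, hn⟩
        exact ⟨(⟨j, hj⟩ : S), hn, rfl⟩
    ext v
    rw [Submodule.mem_inf, hb, hb, hb, Module.Basis.mem_span_image, Module.Basis.mem_span_image,
      Module.Basis.mem_span_image, ← Set.subset_inter_iff, hS]

theorem smoothTransition_of_isSmoothFrame {f g : LocalFrame E.fiber} (hf : E.IsSmoothFrame f)
    (hg : E.IsSmoothFrame g) : LocalFrame.SmoothTransition EM f g := by
  classical
  have hcoef : ∀ x (hx : x ∈ f.dom) (j : g.idx) (c : f.idx → ℝ),
      g.sec j x = ∑ i, c i • f.sec i x → ∀ i, (hf.1.basis hx).repr (g.sec j x) i = c i := by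
    intro x hx j c hc i
    rw [hc, show (fun i => c i • f.sec i x) = fun i => c i • hf.1.basis hx i from
      funext fun i => by rw [hf.1.basis_apply hx], Module.Basis.repr_sum_self]
  refine ⟨fun j i x => if hx : x ∈ f.dom then (hf.1.basis hx).repr (g.sec j x) i else 0, ?_, ?_⟩
  · intro j i x hx
    obtain ⟨a, ha, hxa⟩ := E.cover x
    obtain ⟨A, hA, hAx⟩ := (hg.2 a ha).1
    obtain ⟨B, hB, hBx⟩ := (hf.2 a ha).2
    have hxa' : f.dom ∩ g.dom ∩ a.dom ∈ nhdsWithin x (f.dom ∩ g.dom) :=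
      inter_mem_nhdsWithin _ ((E.isFrame a ha).isOpen.mem_nhds hxa)
    have hsm : ContMDiffOn 𝓘(ℝ, EM) 𝓘(ℝ, ℝ) ∞ (fun y => ∑ k, A j k y * B k i y)
        (f.dom ∩ g.dom ∩ a.dom) := by
      refine contMDiffOn_finsetSum fun k _ => ?_
      exact ((hA j k).mono fun y hy => ⟨hy.2, hy.1.2⟩).mul
        ((hB k i).mono fun y hy => ⟨hy.1.1, hy.2⟩)
    have heq : ∀ y ∈ f.dom ∩ g.dom ∩ a.dom,
        (if hy : y ∈ f.dom then (hf.1.basis hy).repr (g.sec j y) i else 0)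
          = ∑ k, A j k y * B k i y := by
      intro y hy
      rw [dif_pos hy.1.1]
      refine hcoef y hy.1.1 j (fun i => ∑ k, A j k y * B k i y) ?_ i
      rw [hAx y ⟨hy.2, hy.1.2⟩ j]
      simp_rw [Finset.sum_smul]
      rw [Finset.sum_comm]
      refine Finset.sum_congr rfl fun k _ => ?_
      rw [hBx y ⟨hy.1.1, hy.2⟩ k, Finset.smul_sum]
      simp_rw [smul_smul]
    exact ((hsm.congr heq) x ⟨hx, hxa⟩).mono_of_mem_nhdsWithin hxa'
  · intro x hx j
    simp only [dif_pos hx.1]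
    conv_lhs => rw [← (hf.1.basis hx.1).sum_repr (g.sec j x)]
    refine Finset.sum_congr rfl fun i _ => ?_
    rw [hf.1.basis_apply hx.1]

/-- A graded subbundle as a graded vector bundle. -/
def subBundle (W : ∀ x, Submodule ℝ (E.fiber x)) (hW : E.IsSubbundle W) :
    GradedBundle.{uM, uV} EM M where
  fiber x := W x
  gr x n := (E.gr x n).comap (W x).subtype
  atlas := {g | ∃ (f : LocalFrame E.fiber) (S : Set f.idx), E.IsAdapted W f S ∧ g = subFrame W f S}
  isFrame := by
    rintro g ⟨f, S, h, rfl⟩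
    exact E.subFrame_isHomogeneousFrame h
  cover x := by
    obtain ⟨f, S, h, hx⟩ := hW x
    exact ⟨_, ⟨f, S, h, rfl⟩, hx⟩
  smooth := by
    rintro g ⟨f, S, h, rfl⟩ g' ⟨f', S', h', rfl⟩
    obtain ⟨C, hC, hCx⟩ := E.smoothTransition_of_isSmoothFrame h.1 h'.1
    refine ⟨fun j i => C (subIdx W f' S' j) (subIdx W f S i), fun j i => hC _ _,
      fun x hx j => ?_⟩
    apply (W x).injective_subtype
    have hj : (W x).subtype ((subFrame W f' S').sec j x) = f'.sec (subIdx W f' S' j) x :=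
      E.subFrame_coe h' hx.2 j
    have hmem : f'.sec (subIdx W f' S' j) x ∈ W x := by
      rw [← hj]; exact ((subFrame W f' S').sec j x).2
    have hz : ∀ i, i ∉ S → C (subIdx W f' S' j) i x = 0 := by
      have h1 := hmem
      rw [h.2 x hx.1, show (fun j => f.sec j x) '' S = h.1.1.basis hx.1 '' S from
        Set.image_congr fun j _ => (h.1.1.basis_apply hx.1 j).symm,
        Module.Basis.mem_span_image] at h1
      intro i hi
      have h2 : (h.1.1.basis hx.1).repr (f'.sec (subIdx W f' S' j) x) i
          = C (subIdx W f' S' j) i x := by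
        rw [hCx x hx, show (fun i => C (subIdx W f' S' j) i x • f.sec i x)
          = fun i => C (subIdx W f' S' j) i x • h.1.1.basis hx.1 i from
            funext fun i => by rw [h.1.1.basis_apply hx.1], Module.Basis.repr_sum_self]
      rw [← h2]
      by_contra hne
      exact hi (h1 (Finsupp.mem_support_iff.2 hne))
    rw [hj, hCx x hx, map_sum]
    have h4 : ∀ i, (W x).subtype (C (subIdx W f' S' j) (subIdx W f S i) x •
        (subFrame W f S).sec i x)
        = C (subIdx W f' S' j) (subIdx W f S i) x • f.sec (subIdx W f S i) x := by
      intro i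
      rw [map_smul, E.subFrame_coe h hx.1 i]
    refine Eq.trans ?_ (Finset.sum_congr rfl fun i _ => (h4 i).symm)
    symm
    refine Finset.sum_of_injOn (subIdx W f S) (E.subIdx_injective W f S).injOn
      (fun _ _ => Finset.mem_coe.2 (Finset.mem_univ _)) ?_ (fun _ _ => rfl)
    intro i _ hi
    rw [hz i, zero_smul]
    intro hiS
    apply hi
    obtain ⟨k, hk⟩ := (E.range_subIdx W f S).superset hiS
    exact ⟨k, Finset.mem_coe.2 (Finset.mem_univ _), hk⟩

/-- The projection onto the even (`false`) or odd (`true`) part of a fibre. -/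
def parityProj (x : M) (p : Bool) : E.fiber x →ₗ[ℝ] E.fiber x :=
  (1 / 2 : ℝ) • (LinearMap.id + (if p then (-1 : ℝ) else 1) • E.twist x 1)

/-- The action of a permutation on `E ⊗ ⋯ ⊗ E`, moving the factor `i` to the position `σ i`, with
the Koszul sign of `koszulSign` (which depends only on the parities of the factors). -/
def permAction {m : ℕ} (x : M) (σ : Equiv.Perm (Fin m)) :
    (tensorBundle fun _ : Fin m => E).fiber x →ₗ[ℝ] (tensorBundle fun _ : Fin m => E).fiber x :=
  ∑ p : Fin m → Bool, koszulSign σ (fun i => if p i then 1 else 0) •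
    ((PiTensorProduct.reindex ℝ (fun _ : Fin m => E.fiber x) σ).toLinearMap ∘ₗ
      PiTensorProduct.map fun i => E.parityProj x (p i))

/-- The fibres of the `m`-th symmetric power: the invariant tensors. -/
def symPower (m : ℕ) (x : M) : Submodule ℝ ((tensorBundle fun _ : Fin m => E).fiber x) :=
  ⨅ σ : Equiv.Perm (Fin m), LinearMap.eqLocus (E.permAction x σ) LinearMap.id

end GradedBundle

end Bundles

/-! ## Lie groupoids and representations up to homotopy -/

section Groupoids

open scoped ContDiff

variable {EM : Type*} [NormedAddCommGroup EM] [NormedSpace ℝ EM]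
  {M : Type uM} [TopologicalSpace M] [ChartedSpace EM M]
  {EG : Type*} [NormedAddCommGroup EG] [NormedSpace ℝ EG]
  {G : Type*} [TopologicalSpace G] [ChartedSpace EG G]

/-- A Lie groupoid with manifold of arrows `G` and manifold of units `M`. The arrows `g`, `h` are
composable, with composition `mul g h`, if `src g = tgt h`; other values of `mul` are irrelevant. -/
structure LieGroupoid (EM : Type*) [NormedAddCommGroup EM] [NormedSpace ℝ EM]
    (M : Type*) [TopologicalSpace M] [ChartedSpace EM M]
    (EG : Type*) [NormedAddCommGroup EG] [NormedSpace ℝ EG]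
    (G : Type*) [TopologicalSpace G] [ChartedSpace EG G] where
  src : G → M
  tgt : G → M
  unit : M → G
  inv : G → G
  mul : G → G → G
  src_mul : ∀ g h, src g = tgt h → src (mul g h) = src h
  tgt_mul : ∀ g h, src g = tgt h → tgt (mul g h) = tgt g
  mul_assoc : ∀ g h k, src g = tgt h → src h = tgt k → mul (mul g h) k = mul g (mul h k)
  src_unit : ∀ x, src (unit x) = x
  tgt_unit : ∀ x, tgt (unit x) = x
  unit_mul : ∀ g, mul (unit (tgt g)) g = g
  mul_unit : ∀ g, mul g (unit (src g)) = g
  src_inv : ∀ g, src (inv g) = tgt g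
  tgt_inv : ∀ g, tgt (inv g) = src g
  inv_mul : ∀ g, mul (inv g) g = unit (src g)
  mul_inv : ∀ g, mul g (inv g) = unit (tgt g)
  src_submersion : ∀ g, Manifold.IsSubmersionAt 𝓘(ℝ, EG) 𝓘(ℝ, EM) ∞ src g
  tgt_submersion : ∀ g, Manifold.IsSubmersionAt 𝓘(ℝ, EG) 𝓘(ℝ, EM) ∞ tgt g
  smooth_unit : ContMDiff 𝓘(ℝ, EM) 𝓘(ℝ, EG) ∞ unit
  smooth_inv : ContMDiff 𝓘(ℝ, EG) 𝓘(ℝ, EG) ∞ inv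
  smooth_mul : ContMDiffOn (𝓘(ℝ, EG).prod 𝓘(ℝ, EG)) 𝓘(ℝ, EG) ∞
    (fun p : G × G => mul p.1 p.2) {p | src p.1 = tgt p.2}

namespace LieGroupoid

variable (Γ : LieGroupoid EM M EG G)

/-- The list `g₁, …, g_k` is a string of composable arrows with `s(g_k) = x` and `t(g₁) = y`; for
the empty string this means `x = y`. -/
def IsString (x : M) : M → List G → Prop
  | y, [] => x = y
  | y, g :: l => Γ.tgt g = y ∧ IsString x (Γ.src g) l

/-- The vertex `s(g_j) = t(g_{j+1})` of a string with end point `y = t(g₁)`. -/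
def vertex : M → List G → ℕ → M
  | y, _, 0 => y
  | y, [], _ + 1 => y
  | _, g :: l, j + 1 => vertex (Γ.src g) l j

/-- Compose the adjacent arrows number `j` and `j + 1` (counted from `0`). -/
def mulAt : ℕ → List G → List G
  | 0, g :: h :: l => Γ.mul g h :: l
  | j + 1, g :: l => g :: mulAt j l
  | _, l => l

/-- Compose successive blocks of arrows of the prescribed lengths. -/
def collapse : List ℕ+ → List G → List G
  | n :: X, g :: l =>
    (l.take ((n : ℕ) - 1)).foldl Γ.mul g :: collapse X (l.drop ((n : ℕ) - 1))
  | _, _ => []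

end LieGroupoid

/-- A sequence of operators `φ_k`, `k ≥ 0`, where `φ_k` associates to a string `g = (g₁, …, g_k)`
from `x = s(g_k)` to `y = t(g₁)` a linear map `φ x y g = φ_k(g) : E_x → F_y`; for `k = 0` these are
linear maps `E_x → F_x`. The values on other `x`, `y`, `g` are irrelevant. -/
abbrev OpFamily (G : Type*) (E F : GradedBundle.{uM, uV} EM M) :=
  ∀ x y : M, List G → (E.fiber x →ₗ[ℝ] F.fiber y)

variable {D E F : GradedBundle.{uM, uV} EM M} (Γ : LieGroupoid EM M EG G)

/-- All the operators `φ_k` have degree `c - k`. -/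
def HasOpDegree (c : ℤ) (φ : OpFamily G E F) : Prop :=
  ∀ x y g, Γ.IsString x y g → ∀ n, ∀ v ∈ E.gr x n, φ x y g v ∈ F.gr y (n + (c - g.length))

/-- The operators `φ_k(g₁, …, g_k)` depend smoothly on the string: along every smooth family of
strings, parametrized by an open subset of some `ℝᴺ`, the matrix of `φ_k` in local frames is
smooth. (The charts of the manifold `G_k` of strings are such families.) -/
def IsSmoothOp (φ : OpFamily G E F) : Prop :=
  ∀ (N : ℕ) (U : Set (EuclideanSpace ℝ (Fin N))), IsOpen U →
    ∀ (x y : EuclideanSpace ℝ (Fin N) → M) (γ : List (EuclideanSpace ℝ (Fin N) → G)),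
    ContMDiffOn 𝓘(ℝ, EuclideanSpace ℝ (Fin N)) 𝓘(ℝ, EM) ∞ x U →
    ContMDiffOn 𝓘(ℝ, EuclideanSpace ℝ (Fin N)) 𝓘(ℝ, EM) ∞ y U →
    (∀ c ∈ γ, ContMDiffOn 𝓘(ℝ, EuclideanSpace ℝ (Fin N)) 𝓘(ℝ, EG) ∞ c U) →
    (∀ u ∈ U, Γ.IsString (x u) (y u) (γ.map fun c => c u)) →
    ∀ a ∈ E.atlas, ∀ b ∈ F.atlas, (∀ u ∈ U, x u ∈ a.dom ∧ y u ∈ b.dom) →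
    ∃ A : a.idx → b.idx → EuclideanSpace ℝ (Fin N) → ℝ,
      (∀ j i, ContDiffOn ℝ ∞ (A j i) U) ∧
      ∀ u ∈ U, ∀ j, φ (x u) (y u) (γ.map fun c => c u) (a.sec j (x u))
        = ∑ i, A j i u • b.sec i (y u)

/-- `φ_j(g₁, …, g_j) ∘ ψ(g_{j+1}, …, g_k)`. -/
def compAt (j : ℕ) (φ : OpFamily G E F) (ψ : OpFamily G D E) : OpFamily G D F :=
  fun x y g => φ (Γ.vertex y g j) y (g.take j) ∘ₗ ψ x (Γ.vertex y g j) (g.drop j)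

/-- `R = (R_k)_{k ≥ 0}` makes `E` a representation up to homotopy. -/
structure IsRepresentation (R : OpFamily G E E) : Prop where
  degree : HasOpDegree Γ 1 R
  smooth : IsSmoothOp Γ R
  equation : ∀ x y g, Γ.IsString x y g →
    ∑ j ∈ range (g.length - 1), (-1 : ℝ) ^ (j + 1) • R x y (Γ.mulAt j g)
      = ∑ j ∈ range (g.length + 1), (-1 : ℝ) ^ j • compAt Γ j R R x y g

/-- `Φ = (Φ_k)_{k ≥ 0}` is a morphism of representations up to homotopy `(E, R) → (F, R')`. -/
structure IsMorphism (R : OpFamily G E E) (R' : OpFamily G F F) (Φ : OpFamily G E F) : Prop where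
  degree : HasOpDegree Γ 0 Φ
  smooth : IsSmoothOp Γ Φ
  equation : ∀ x y g, Γ.IsString x y g →
    ∑ j ∈ range (g.length + 1), (-1 : ℝ) ^ j • compAt Γ j Φ R x y g
      = ∑ j ∈ range (g.length + 1), compAt Γ j R' Φ x y g
        + ∑ j ∈ range (g.length - 1), (-1 : ℝ) ^ (j + 1) • Φ x y (Γ.mulAt j g)

/-- `h = (h_k)_{k ≥ 0}` is a homotopy between the morphisms `Φ` and `Ψ`. -/
structure IsHomotopy (R : OpFamily G E E) (R' : OpFamily G F F) (Φ Ψ h : OpFamily G E F) :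
    Prop where
  degree : HasOpDegree Γ (-1) h
  smooth : IsSmoothOp Γ h
  equation : ∀ x y g, Γ.IsString x y g →
    Φ x y g - Ψ x y g
      = ∑ j ∈ range (g.length + 1), (-1 : ℝ) ^ j • compAt Γ j h R x y g
        + ∑ j ∈ range (g.length + 1), (-1 : ℝ) ^ j • compAt Γ j R' h x y g
        + ∑ j ∈ range (g.length - 1), (-1 : ℝ) ^ j • h x y (Γ.mulAt j g)

/-- Homotopic morphisms. -/
def AreHomotopic (R : OpFamily G E E) (R' : OpFamily G F F) (Φ Ψ : OpFamily G E F) : Prop :=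
  ∃ h, IsHomotopy Γ R R' Φ Ψ h

/-- The components `φ_k` with `k ≥ n` vanish. -/
def VanishesFrom (n : ℕ) (φ : OpFamily G E F) : Prop :=
  ∀ x y g, Γ.IsString x y g → n ≤ g.length → φ x y g = 0

/-- The identity morphism: the identity in order `0`, zero in higher orders. -/
def idOp (G : Type*) (E : GradedBundle.{uM, uV} EM M) : OpFamily G E E := by
  classical
  exact fun x y g => if g = [] then (if h : x = y then h ▸ LinearMap.id else 0) else 0

/-! ### Characteristic maps and tensor products -/

/-- The characteristic map of a representation up to homotopy on short forests: `L_k ↦ R_k`,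
extended compatibly with products and with the `d_i`. -/
def evalForest (R : OpFamily G E E) : List (List ℕ+) → OpFamily G E E
  | [] => idOp G E
  | X :: A => compAt Γ (treeOrder X) (fun x y g => R x y (Γ.collapse X g)) (evalForest R A)

/-- The characteristic map of a morphism `Φ : (E, R) → (F, R')` (or of any `Φ`): `T_k ↦ Φ_k`,
extended compatibly with the actions of `Ω` and with the `d_i`. -/
def evalMarked (R : OpFamily G E E) (R' : OpFamily G F F) (Φ : OpFamily G E F)
    (t : MarkedForest) : OpFamily G E F :=
  compAt Γ (forestOrder t.left) (evalForest Γ R' t.left)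
    (compAt Γ (treeOrder t.mid) (fun x y g => Φ x y (Γ.collapse t.mid g))
      (evalForest Γ R t.right))

section Tensor

variable {m : ℕ} {E F : Fin m → GradedBundle.{uM, uV} EM M}

/-- The operators of `⊗_w(E₁, …, E_m)`: in order `0` the differential of the tensor product of the
complexes `E_i`, and in order `k ≥ 1` the image of `w_k` under the product of the characteristic
maps of the `E_i`. -/
def tensorRep (w : ℕ → omegaBar.Pow m) (R : ∀ i, OpFamily G (E i) (E i)) :
    OpFamily G (GradedBundle.tensorBundle E) (GradedBundle.tensorBundle E)
  | x, y, [] => ∑ i, GradedBundle.koszulMap (Pi.single i 1)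
      (fun j => if j = i then R j x y [] else idOp G (E j) x y [])
  | x, y, g :: l => (w (l.length + 1)).sum fun u r =>
      r • GradedBundle.koszulMap (fun i => omegaBar.deg (u i))
        (fun i => evalForest Γ (R i) (u i) x y (g :: l))

/-- The operators of `⊗_z(Φ₁, …, Φ_m)`: in order `k` the image of `z_k` under the product of the
characteristic maps of the `Φ_i : (E_i, R_i) → (F_i, R'_i)`. -/
def tensorMor (z : ℕ → moduleBar.Pow m) (R : ∀ i, OpFamily G (E i) (E i))
    (R' : ∀ i, OpFamily G (F i) (F i)) (Φ : ∀ i, OpFamily G (E i) (F i)) :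
    OpFamily G (GradedBundle.tensorBundle E) (GradedBundle.tensorBundle F) :=
  fun x y g => (z g.length).sum fun u r =>
    r • GradedBundle.koszulMap (fun i => moduleBar.deg (u i))
      (fun i => evalMarked Γ (R i) (R' i) (Φ i) (u i) x y g)

end Tensor

/-! ### Restriction to subbundles -/

/-- The operators map the subspaces `W` to the subspaces `W'`. -/
def PreservesSub (W : ∀ x, Submodule ℝ (E.fiber x)) (W' : ∀ x, Submodule ℝ (F.fiber x))
    (φ : OpFamily G E F) : Prop :=
  ∀ x y g, Γ.IsString x y g → ∀ v ∈ W x, φ x y g v ∈ W' y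

/-- The restriction of operators to subbundles which they preserve. -/
def restrictOp {W : ∀ x, Submodule ℝ (E.fiber x)} {W' : ∀ x, Submodule ℝ (F.fiber x)}
    (hW : E.IsSubbundle W) (hW' : F.IsSubbundle W') (φ : OpFamily G E F) :
    OpFamily G (E.subBundle W hW) (F.subBundle W' hW') := by
  classical
  exact fun x y g =>
    if h : ∀ v ∈ W x, φ x y g v ∈ W' y then (φ x y g).restrict h else 0

end Groupoids

end

noncomputable section

/-! ## Signs -/

/-- The sign `(-1)ⁿ`. -/
def sg (n : ℤ) : ℝ := (-1 : ℝ) ^ n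

theorem negOne_zpow_eq_sg (n : ℤ) : (-1 : ℝ) ^ n = sg n := rfl

theorem negOne_pow_eq_sg (n : ℕ) : (-1 : ℝ) ^ n = sg n := (zpow_natCast _ _).symm

theorem sg_add (a b : ℤ) : sg (a + b) = sg a * sg b := zpow_add₀ (by norm_num) a b

@[simp] theorem sg_zero : sg 0 = 1 := zpow_zero _

@[simp] theorem sg_one : sg 1 = -1 := zpow_one _

theorem sg_congr {a b : ℤ} (c : ℤ) (h : a = b + 2 * c) : sg a = sg b := by
  rw [h, sg_add]
  simp [sg, zpow_mul]

theorem sg_mul_self (a : ℤ) : sg a * sg a = 1 := by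
  rw [← sg_add, sg_congr a (b := 0) (by ring), sg_zero]

theorem sg_neg (a : ℤ) : sg (-a) = sg a := sg_congr (-a) (by ring)

theorem sg_add_one (a : ℤ) : sg (a + 1) = -sg a := by rw [sg_add, sg_one, mul_neg_one]

theorem sg_sub (a b : ℤ) : sg (a - b) = sg a * sg b := by rw [sub_eq_add_neg, sg_add, sg_neg]

theorem sg_sum {ι : Type*} (s : Finset ι) (f : ι → ℤ) : sg (∑ i ∈ s, f i) = ∏ i ∈ s, sg (f i) := by
  classical
  induction s using Finset.induction_on with
  | empty => simp
  | insert a s ha ih => rw [sum_insert ha, prod_insert ha, sg_add, ih]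

/-- The bilinear form `∑_{j<i} lᵢ l'ⱼ` which governs the Koszul signs. -/
def signForm {m : ℕ} (l l' : Fin m → ℤ) : ℤ := ∑ i, ∑ j ∈ univ.filter (fun j => j < i), l i * l' j

section signForm

variable {m : ℕ} (l l' l'' : Fin m → ℤ)

theorem signForm_add_left : signForm (l + l') l'' = signForm l l'' + signForm l' l'' := by
  simp [signForm, add_mul, sum_add_distrib]

theorem signForm_add_right : signForm l (l' + l'') = signForm l l' + signForm l l'' := by
  simp [signForm, mul_add, sum_add_distrib]

theorem signForm_smul_right (c : ℤ) : signForm l (c • l') = c * signForm l l' := by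
  simp [signForm, mul_sum, mul_left_comm]

@[simp] theorem signForm_zero_left : signForm 0 l = 0 := by simp [signForm]

@[simp] theorem signForm_zero_right : signForm l 0 = 0 := by simp [signForm]

theorem signForm_single_left (i : Fin m) :
    signForm (Pi.single i 1) l = ∑ j ∈ univ.filter (fun j => j < i), l j := by
  rw [signForm, sum_eq_single i]
  · simp
  · intro k _ hk
    simp [hk]
  · simp

theorem signForm_single_right (i : Fin m) :
    signForm l (Pi.single i 1) = ∑ j ∈ univ.filter (fun j => i < j), l j := by
  rw [signForm, sum_filter]
  refine sum_congr rfl fun k _ => ?_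
  rw [sum_filter]
  split_ifs with h
  · rw [sum_eq_single i] <;> simp +contextual [h]
  · refine sum_eq_zero fun j _ => ?_
    split_ifs with h'
    · have : j ≠ i := by rintro rfl; exact h h'
      simp [this]
    · rfl

theorem signForm_single_add (i : Fin m) :
    signForm (Pi.single i 1) l + l i + signForm l (Pi.single i 1) = ∑ j, l j := by
  rw [signForm_single_left, signForm_single_right, ← sum_filter_add_sum_filter_not univ (· < i) l,
    add_assoc]
  congr 1
  rw [show (univ.filter fun j => ¬ j < i) = insert i (univ.filter fun j => i < j) by
    ext j; simp [le_iff_eq_or_lt, eq_comm]]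
  rw [sum_insert (by simp)]

theorem signForm_single_single {i j : Fin m} (h : i ≠ j) :
    signForm (Pi.single i 1) (Pi.single j 1) + signForm (Pi.single j 1) (Pi.single i 1) = 1 := by
  have := signForm_single_add (Pi.single j 1) i
  simpa [h] using this

end signForm

/-! ## Linear combinations -/

section Finsupp

open Finsupp

variable {α β γ N N' : Type*} [AddCommGroup N] [Module ℝ N] [AddCommGroup N'] [Module ℝ N']

theorem linearCombination_congr {z : α →₀ ℝ} {g g' : α → N} (h : ∀ v ∈ z.support, g v = g' v) :
    linearCombination ℝ g z = linearCombination ℝ g' z := by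
  simp only [linearCombination_apply]
  exact Finsupp.sum_congr fun v hv => by rw [h v hv]

theorem map_linearCombination' (T : N →ₗ[ℝ] N') (g : α → N) (z : α →₀ ℝ) :
    T (linearCombination ℝ g z) = linearCombination ℝ (fun v => T (g v)) z :=
  apply_linearCombination ℝ T g z

theorem linearCombination_comm (g : α → β → N) (y : α →₀ ℝ) (z : β →₀ ℝ) :
    linearCombination ℝ (fun a => linearCombination ℝ (g a) z) y
      = linearCombination ℝ (fun b => linearCombination ℝ (fun a => g a b) y) z := by
  simp only [linearCombination_apply, Finsupp.sum, Finset.smul_sum]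
  rw [Finset.sum_comm]
  exact Finset.sum_congr rfl fun b _ => Finset.sum_congr rfl fun a _ => smul_comm _ _ _

theorem linearCombination_smul_right (c : ℝ) (g : α → N) (z : α →₀ ℝ) :
    linearCombination ℝ (fun a => c • g a) z = c • linearCombination ℝ g z := by
  rw [← LinearMap.lsmul_apply, map_linearCombination']
  rfl

theorem linearCombination_add_fun (g g' : α → N) (z : α →₀ ℝ) :
    linearCombination ℝ (fun a => g a + g' a) z
      = linearCombination ℝ g z + linearCombination ℝ g' z := by
  simp [linearCombination_apply, Finsupp.sum_add]

theorem linearCombination_single_one (f : α → β) (z : α →₀ ℝ) :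
    linearCombination ℝ (fun a => single (f a) (1 : ℝ)) z = z.mapDomain f := by
  simp [linearCombination_apply, mapDomain]

theorem linearCombination_mapDomain' (f : α → β) (g : β → N) (z : α →₀ ℝ) :
    linearCombination ℝ g (z.mapDomain f) = linearCombination ℝ (fun a => g (f a)) z :=
  linearCombination_mapDomain ℝ f z

theorem supported_induction {s : Set α} (P : Submodule ℝ N) (T : (α →₀ ℝ) →ₗ[ℝ] N)
    (h : ∀ u ∈ s, T (single u 1) ∈ P) {z : α →₀ ℝ} (hz : z ∈ supported ℝ ℝ s) : T z ∈ P := by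
  rw [supported_eq_span_single] at hz
  have : Submodule.span ℝ ((fun i => single i (1 : ℝ)) '' s) ≤ P.comap T := by
    rw [Submodule.span_le]
    rintro _ ⟨u, hu, rfl⟩
    exact h u hu
  exact this hz

theorem supported_ext {s : Set α} {T T' : (α →₀ ℝ) →ₗ[ℝ] N}
    (h : ∀ u ∈ s, T (single u 1) = T' (single u 1)) {z : α →₀ ℝ} (hz : z ∈ supported ℝ ℝ s) :
    T z = T' z := by
  have := supported_induction (⊥ : Submodule ℝ N) (T - T')
    (fun u hu => by simp [h u hu]) hz
  simpa [sub_eq_zero] using this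

theorem linearCombination_mem_supported {s : Set β} {g : α → β →₀ ℝ} {z : α →₀ ℝ}
    (h : ∀ v ∈ z.support, g v ∈ supported ℝ ℝ s) : linearCombination ℝ g z ∈ supported ℝ ℝ s := by
  rw [linearCombination_apply]
  exact Submodule.sum_mem _ fun v hv => Submodule.smul_mem _ _ (h v hv)

theorem support_mapDomain_mem {f : α → β} {z : α →₀ ℝ} {b : β} (h : b ∈ (z.mapDomain f).support) :
    ∃ a ∈ z.support, f a = b := by
  classical
  simpa using mapDomain_support h

end Finsupp

/-! ## Laws of bar bases and of products -/

namespace BarBasis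

open Finsupp

/-- The laws of a presentation of a bigraded space with operators `∂`, `d_i`. -/
structure IsLawful (X : BarBasis) : Prop where
  bdry_mem : ∀ u, X.IsBasis u → ∀ v ∈ (X.bdry u).support,
    X.IsBasis v ∧ X.order v = X.order u ∧ X.deg v = X.deg u + 1
  dup_mem : ∀ u, X.IsBasis u → ∀ i < X.order u,
    X.IsBasis (X.dup i u) ∧ X.order (X.dup i u) = X.order u + 1 ∧ X.deg (X.dup i u) = X.deg u
  dup_dup : ∀ u, X.IsBasis u → ∀ i j, i ≤ j → j < X.order u →
    X.dup i (X.dup j u) = X.dup (j + 1) (X.dup i u)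
  bdry_dup : ∀ u, X.IsBasis u → ∀ i < X.order u, X.bdry (X.dup i u) = (X.bdry u).mapDomain (X.dup i)
  bdry_bdry : ∀ u, X.IsBasis u → linearCombination ℝ X.bdry (X.bdry u) = 0

/-- The laws of a bilinear product compatible with the bigradings and the operators. -/
structure IsLawfulMul {X Y Z : BarBasis} (op : X.carrier → Y.carrier → Z.carrier) : Prop where
  mem : ∀ u v, X.IsBasis u → Y.IsBasis v →
    Z.IsBasis (op u v) ∧ Z.order (op u v) = X.order u + Y.order v ∧
      Z.deg (op u v) = X.deg u + Y.deg v
  dup_left : ∀ u v, X.IsBasis u → Y.IsBasis v → ∀ i < X.order u,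
    Z.dup i (op u v) = op (X.dup i u) v
  dup_right : ∀ u v, X.IsBasis u → Y.IsBasis v → ∀ i < Y.order v,
    Z.dup (X.order u + i) (op u v) = op u (Y.dup i v)
  bdry_op : ∀ u v, X.IsBasis u → Y.IsBasis v → Z.bdry (op u v)
    = (X.bdry u).mapDomain (fun u' => op u' v) + sg (X.deg u) • (Y.bdry v).mapDomain (op u)

variable {X Y Z : BarBasis} {m : ℕ}

/-- The degrees of the factors of a tensor. -/
def degs (X : BarBasis) (u : Fin m → X.carrier) : Fin m → ℤ := fun i => X.deg (u i)

/-- All factors are basis elements of order `k`. -/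
def IsPowBasis (X : BarBasis) (k : ℕ) (u : Fin m → X.carrier) : Prop :=
  ∀ i, X.IsBasis (u i) ∧ X.order (u i) = k

theorem single_mem_piece {k : ℕ} {l : ℤ} {u : Fin m → X.carrier} (hu : X.IsPowBasis k u)
    (hl : ∑ i, X.deg (u i) = l) (c : ℝ) : single u c ∈ X.piece m k l :=
  single_mem_supported ℝ c ⟨hu, hl⟩

theorem piece_induction {N : Type*} [AddCommGroup N] [Module ℝ N] {k : ℕ} {l : ℤ}
    (P : Submodule ℝ N) (T : X.Pow m →ₗ[ℝ] N)
    (h : ∀ u, X.IsPowBasis k u → ∑ i, X.deg (u i) = l → T (single u 1) ∈ P) {z : X.Pow m}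
    (hz : z ∈ X.piece m k l) : T z ∈ P :=
  supported_induction P T (fun u hu => h u hu.1 hu.2) hz

theorem piece_ext {N : Type*} [AddCommGroup N] [Module ℝ N] {k : ℕ} {l : ℤ}
    {T T' : X.Pow m →ₗ[ℝ] N}
    (h : ∀ u, X.IsPowBasis k u → ∑ i, X.deg (u i) = l → T (single u 1) = T' (single u 1))
    {z : X.Pow m} (hz : z ∈ X.piece m k l) : T z = T' z :=
  supported_ext (fun u hu => h u hu.1 hu.2) hz

/-- Insert a combination of basis elements as the `i`-th factor. -/
def ins {α : Type*} (u : Fin m → α) (i : Fin m) : (α →₀ ℝ) →ₗ[ℝ] ((Fin m → α) →₀ ℝ) :=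
  linearCombination ℝ fun v => single (Function.update u i v) 1

theorem ins_apply {α : Type*} (u : Fin m → α) (i : Fin m) (z : α →₀ ℝ) :
    ins u i z = linearCombination ℝ (fun v => single (Function.update u i v) (1 : ℝ)) z := rfl

@[simp] theorem ins_single {α : Type*} (u : Fin m → α) (i : Fin m) (v : α) (r : ℝ) :
    ins u i (single v r) = single (Function.update u i v) r := by
  simp [ins_apply]

theorem map_ins {α N : Type*} [AddCommGroup N] [Module ℝ N] (T : ((Fin m → α) →₀ ℝ) →ₗ[ℝ] N)
    (u : Fin m → α) (i : Fin m) (z : α →₀ ℝ) :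
    T (ins u i z) = linearCombination ℝ (fun v => T (single (Function.update u i v) 1)) z := by
  rw [ins_apply, map_linearCombination']

theorem ins_update {α : Type*} (u : Fin m → α) (i : Fin m) (v : α) :
    ins (Function.update u i v) i = ins u i := by
  simp [ins]

theorem ins_ins {α : Type*} (u : Fin m → α) {i j : Fin m} (h : i ≠ j) (y z : α →₀ ℝ) :
    linearCombination ℝ (fun v => ins (Function.update u j v) i y) z
      = linearCombination ℝ (fun v => ins (Function.update u i v) j z) y := by
  simp only [ins_apply]
  rw [linearCombination_comm]
  refine linearCombination_congr fun v _ => linearCombination_congr fun w _ => ?_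
  rw [Function.update_comm h]

/-- The operator of degree `e` which applies `T` to the `i`-th factor. -/
def slotOp (X : BarBasis) (e : ℤ) (T : X.carrier → (X.carrier →₀ ℝ)) (i : Fin m) :
    X.Pow m →ₗ[ℝ] X.Pow m :=
  linearCombination ℝ fun u => sg (e * signForm (Pi.single i 1) (X.degs u)) • ins u i (T (u i))

theorem slotOp_single (e : ℤ) (T : X.carrier → (X.carrier →₀ ℝ)) (i : Fin m)
    (u : Fin m → X.carrier) : X.slotOp e T i (single u 1)
      = sg (e * signForm (Pi.single i 1) (X.degs u)) • ins u i (T (u i)) := by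
  simp [slotOp]

theorem bdryPow_eq_sum : X.bdryPow m = ∑ i, X.slotOp 1 X.bdry i := by
  refine Finsupp.lhom_ext' fun u => LinearMap.ext_ring ?_
  simp only [bdryPow, LinearMap.comp_apply, lsingle_apply, linearCombination_single, one_smul,
    LinearMap.sum_apply, slotOp_single, one_mul, negOne_zpow_eq_sg]
  refine sum_congr rfl fun i _ => ?_
  rw [signForm_single_left, ins_apply, linearCombination_single_one]
  rfl

theorem degs_update (u : Fin m → X.carrier) (i : Fin m) (v : X.carrier) (e : ℤ)
    (h : X.deg v = X.deg (u i) + e) :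
    X.degs (Function.update u i v) = X.degs u + e • Pi.single i 1 := by
  ext j
  by_cases hj : j = i
  · subst hj; simp [degs, h]
  · simp [degs, hj]

/-- `T` maps basis elements to combinations of basis elements of the same order, and has
degree `e`. -/
def HasDeg (X : BarBasis) (e : ℤ) (T : X.carrier → (X.carrier →₀ ℝ)) : Prop :=
  ∀ u, X.IsBasis u → ∀ v ∈ (T u).support,
    X.IsBasis v ∧ X.order v = X.order u ∧ X.deg v = X.deg u + e

theorem IsLawful.hasDeg_bdry (hX : X.IsLawful) : X.HasDeg 1 X.bdry := hX.bdry_mem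

theorem IsPowBasis.update {k : ℕ} {u : Fin m → X.carrier} (hu : X.IsPowBasis k u) {e : ℤ}
    {T : X.carrier → (X.carrier →₀ ℝ)} (hT : X.HasDeg e T) (i : Fin m) {v : X.carrier}
    (hv : v ∈ (T (u i)).support) :
    X.IsPowBasis k (Function.update u i v) ∧
      X.degs (Function.update u i v) = X.degs u + e • Pi.single i 1 ∧
      ∑ j, X.deg (Function.update u i v j) = ∑ j, X.deg (u j) + e := by
  have h := hT _ (hu i).1 v hv
  refine ⟨fun j => ?_, X.degs_update u i v e h.2.2, ?_⟩
  · by_cases hj : j = i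
    · subst hj; simpa [h.2.1, (hu j).2] using h.1
    · simpa [hj] using hu j
  · have := congrArg (fun l : Fin m → ℤ => ∑ j, l j) (X.degs_update u i v e h.2.2)
    simpa [degs, sum_add_distrib, ← Finset.mul_sum] using this

theorem slotOp_mem_piece {e : ℤ} {T : X.carrier → (X.carrier →₀ ℝ)} (hT : X.HasDeg e T)
    (i : Fin m) {k : ℕ} {l : ℤ} {z : X.Pow m} (hz : z ∈ X.piece m k l) :
    X.slotOp e T i z ∈ X.piece m k (l + e) := by
  refine piece_induction _ _ (fun u hu hl => ?_) hz
  rw [slotOp_single]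
  refine Submodule.smul_mem _ _ (linearCombination_mem_supported fun v hv => ?_)
  obtain ⟨h1, h2, h3⟩ := hu.update hT i hv
  exact single_mem_piece h1 (by rw [h3, hl]) 1

theorem slotOp_slotOp_of_ne {e d : ℤ} {S T : X.carrier → (X.carrier →₀ ℝ)} (hS : X.HasDeg e S)
    (hT : X.HasDeg d T) {i j : Fin m} (hij : i ≠ j) {k : ℕ} {l : ℤ} {z : X.Pow m}
    (hz : z ∈ X.piece m k l) :
    X.slotOp e S i (X.slotOp d T j z) = sg (e * d) • X.slotOp d T j (X.slotOp e S i z) := by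
  refine piece_ext (T := X.slotOp e S i ∘ₗ X.slotOp d T j)
    (T' := sg (e * d) • X.slotOp d T j ∘ₗ X.slotOp e S i) (fun u hu hl => ?_) hz
  have key : ∀ {e d : ℤ} {S T : X.carrier → (X.carrier →₀ ℝ)}, X.HasDeg e S → X.HasDeg d T →
      ∀ {i j : Fin m}, i ≠ j → X.slotOp e S i (X.slotOp d T j (single u 1))
        = sg (d * signForm (Pi.single j 1) (X.degs u) + e * signForm (Pi.single i 1) (X.degs u)
            + e * d * signForm (Pi.single i 1) (Pi.single j 1)) •
          linearCombination ℝ (fun v => ins (Function.update u j v) i (S (u i))) (T (u j)) := by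
    intro e d S T hS hT i j hij
    rw [slotOp_single, map_smul, map_ins, ← linearCombination_smul_right,
      ← linearCombination_smul_right]
    refine linearCombination_congr fun v hv => ?_
    rw [slotOp_single, (hu.update hT j hv).2.1, Function.update_of_ne hij, smul_smul, ← sg_add,
      signForm_add_right, signForm_smul_right]
    congr 2
    ring
  simp only [LinearMap.comp_apply, LinearMap.smul_apply]
  rw [key hS hT hij, key hT hS hij.symm, ins_ins u hij, smul_smul, ← sg_add]
  congr 1
  have h1 : signForm (Pi.single j 1) (Pi.single i 1)
      = 1 - signForm (Pi.single i 1) (Pi.single j 1) := by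
    linarith [signForm_single_single hij]
  rw [h1]
  exact sg_congr (- (e * d) + e * d * signForm (Pi.single i 1) (Pi.single j 1)) (by ring)

theorem slotOp_slotOp_self {e d : ℤ} {S T : X.carrier → (X.carrier →₀ ℝ)}
    (hT : X.HasDeg d T) (i : Fin m) {k : ℕ} {l : ℤ} {z : X.Pow m}
    (hz : z ∈ X.piece m k l) :
    X.slotOp e S i (X.slotOp d T i z)
      = X.slotOp (e + d) (fun u => linearCombination ℝ S (T u)) i z := by
  refine piece_ext (T := X.slotOp e S i ∘ₗ X.slotOp d T i) (fun u hu hl => ?_) hz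
  rw [LinearMap.comp_apply, slotOp_single, slotOp_single, map_smul, map_ins,
    map_linearCombination', ← linearCombination_smul_right, ← linearCombination_smul_right]
  refine linearCombination_congr fun v hv => ?_
  rw [slotOp_single, (hu.update hT i hv).2.1, Function.update_self, smul_smul, ← sg_add,
    ins_update, signForm_add_right, signForm_smul_right]
  have : signForm (Pi.single i 1) (Pi.single i (1 : ℤ)) = 0 := by
    have := signForm_single_left (Pi.single i 1) i
    rw [this]
    exact sum_eq_zero fun j hj => by simp [(mem_filter.1 hj).2.ne]
  rw [this]
  congr 2
  ring

theorem slotOp_congr {e : ℤ} {S T : X.carrier → (X.carrier →₀ ℝ)} (h : ∀ u, X.IsBasis u → S u = T u)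
    (i : Fin m) {k : ℕ} {l : ℤ} {z : X.Pow m} (hz : z ∈ X.piece m k l) :
    X.slotOp e S i z = X.slotOp e T i z := by
  refine piece_ext (fun u hu hl => ?_) hz
  rw [slotOp_single, slotOp_single, h _ (hu i).1]

theorem bdryPow_mem_piece (hX : X.IsLawful) {k : ℕ} {l : ℤ} {z : X.Pow m}
    (hz : z ∈ X.piece m k l) : X.bdryPow m z ∈ X.piece m k (l + 1) := by
  rw [bdryPow_eq_sum, LinearMap.sum_apply]
  exact Submodule.sum_mem _ fun i _ => slotOp_mem_piece hX.hasDeg_bdry i hz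

theorem sum_anticomm {N : Type*} [AddCommGroup N] (f : Fin m → Fin m → N)
    (h : ∀ i j, i ≠ j → f i j = - f j i) : ∑ i, ∑ j, f i j = ∑ i, f i i := by
  have h1 : ∀ n : ℕ, ∀ f : Fin n → Fin n → N, (∀ i j, i ≠ j → f i j = - f j i) →
      ∑ i, ∑ j, f i j = ∑ i, f i i := by
    intro n
    induction n with
    | zero => simp
    | succ n ih =>
      intro f h
      simp only [Fin.sum_univ_succ, sum_add_distrib]
      rw [ih (fun i j => f i.succ j.succ) (fun i j hij => h _ _ (by simpa using hij))]
      have : ∑ i : Fin n, f i.succ 0 = - ∑ i : Fin n, f 0 i.succ := by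
        rw [← sum_neg_distrib]
        exact sum_congr rfl fun i _ => h _ _ (Fin.succ_ne_zero i)
      rw [this]
      abel
  exact h1 m f h

theorem bdryPow_bdryPow (hX : X.IsLawful) {k : ℕ} {l : ℤ} {z : X.Pow m}
    (hz : z ∈ X.piece m k l) : X.bdryPow m (X.bdryPow m z) = 0 := by
  rw [bdryPow_eq_sum, LinearMap.sum_apply]
  simp only [LinearMap.sum_apply, map_sum]
  rw [sum_anticomm]
  · refine sum_eq_zero fun i _ => ?_
    rw [slotOp_slotOp_self hX.hasDeg_bdry i hz,
      slotOp_congr (T := fun _ => 0) (fun u hu => hX.bdry_bdry u hu) i hz]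
    simp [slotOp, linearCombination_apply]
  · intro i j hij
    rw [slotOp_slotOp_of_ne hX.hasDeg_bdry hX.hasDeg_bdry hij hz]
    simp

end BarBasis


namespace BarBasis

open Finsupp

variable {X Y Z : BarBasis} {m : ℕ}

/-! ## The operators `d_i` and the products on powers -/

@[simp] theorem dupPow_single (i : ℕ) (u : Fin m → X.carrier) (r : ℝ) :
    X.dupPow m i (single u r) = single (fun j => X.dup i (u j)) r := by
  simp [dupPow, lmapDomain_apply, mapDomain_single]

theorem dupPow_mem_piece (hX : X.IsLawful) {k : ℕ} {l : ℤ} {z : X.Pow m}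
    (hz : z ∈ X.piece m k l) {i : ℕ} (hi : i < k) : X.dupPow m i z ∈ X.piece m (k + 1) l := by
  refine piece_induction _ _ (fun u hu hl => ?_) hz
  rw [dupPow_single]
  have h := fun j => hX.dup_mem (u j) (hu j).1 i ((hu j).2.symm ▸ hi)
  refine single_mem_piece (fun j => ⟨(h j).1, by rw [(h j).2.1, (hu j).2]⟩) ?_ 1
  rw [← hl]
  exact sum_congr rfl fun j _ => (h j).2.2

theorem dupPow_dupPow (hX : X.IsLawful) {k : ℕ} {l : ℤ} {z : X.Pow m}
    (hz : z ∈ X.piece m k l) {i j : ℕ} (hij : i ≤ j) (hj : j < k) :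
    X.dupPow m i (X.dupPow m j z) = X.dupPow m (j + 1) (X.dupPow m i z) := by
  refine piece_ext (T := X.dupPow m i ∘ₗ X.dupPow m j) (T' := X.dupPow m (j + 1) ∘ₗ X.dupPow m i)
    (fun u hu hl => ?_) hz
  simp only [LinearMap.comp_apply, dupPow_single]
  congr 1
  funext a
  exact hX.dup_dup _ (hu a).1 i j hij ((hu a).2.symm ▸ hj)

theorem bdryPow_dupPow (hX : X.IsLawful) {k : ℕ} {l : ℤ} {z : X.Pow m}
    (hz : z ∈ X.piece m k l) {i : ℕ} (hi : i < k) :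
    X.bdryPow m (X.dupPow m i z) = X.dupPow m i (X.bdryPow m z) := by
  refine piece_ext (T := X.bdryPow m ∘ₗ X.dupPow m i) (T' := X.dupPow m i ∘ₗ X.bdryPow m)
    (fun u hu hl => ?_) hz
  have h := fun j => (hu j).2.symm ▸ hi
  simp only [LinearMap.comp_apply, dupPow_single, bdryPow_eq_sum, LinearMap.sum_apply,
    slotOp_single, map_sum, map_smul]
  refine sum_congr rfl fun a _ => ?_
  rw [show X.degs (fun j => X.dup i (u j)) = X.degs u from
    funext fun j => (hX.dup_mem (u j) (hu j).1 i (h j)).2.2, hX.bdry_dup _ (hu a).1 i (h a),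
    map_ins, ins_apply, linearCombination_mapDomain']
  congr 1
  refine linearCombination_congr fun v _ => ?_
  rw [dupPow_single]
  congr 1
  funext j
  by_cases hj : j = a
  · subst hj; simp
  · simp [hj]

/-- The alternating sum `∑_{i=1}^k (-1)^i d_i`. -/
def dupAlt (X : BarBasis) (m k : ℕ) : X.Pow m →ₗ[ℝ] X.Pow m :=
  ∑ i ∈ range k, (-1 : ℝ) ^ (i + 1) • X.dupPow m i

theorem dupAlt_apply (k : ℕ) (z : X.Pow m) :
    X.dupAlt m k z = ∑ i ∈ range k, (-1 : ℝ) ^ (i + 1) • X.dupPow m i z := by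
  simp [dupAlt]

theorem dupAlt_mem_piece (hX : X.IsLawful) {k : ℕ} {l : ℤ} {z : X.Pow m}
    (hz : z ∈ X.piece m k l) : X.dupAlt m k z ∈ X.piece m (k + 1) l := by
  rw [dupAlt_apply]
  exact Submodule.sum_mem _ fun i hi =>
    Submodule.smul_mem _ _ (dupPow_mem_piece hX hz (mem_range.1 hi))

theorem bdryPow_dupAlt (hX : X.IsLawful) {k : ℕ} {l : ℤ} {z : X.Pow m}
    (hz : z ∈ X.piece m k l) : X.bdryPow m (X.dupAlt m k z) = X.dupAlt m k (X.bdryPow m z) := by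
  rw [dupAlt_apply, dupAlt_apply, map_sum]
  refine sum_congr rfl fun i hi => ?_
  rw [map_smul, bdryPow_dupPow hX hz (mem_range.1 hi)]

theorem dupAlt_dupAlt (hX : X.IsLawful) {k : ℕ} {l : ℤ} {z : X.Pow m}
    (hz : z ∈ X.piece m k l) : X.dupAlt m (k + 1) (X.dupAlt m k z) = 0 := by
  have key : ∀ n (T : ℕ → ℕ → X.Pow m), (∀ i j, i ≤ j → j < n → T i j = T (j + 1) i) →
      ∑ i ∈ range (n + 1), ∑ j ∈ range n, (-1 : ℝ) ^ (i + 1) • (-1 : ℝ) ^ (j + 1) • T i j = 0 := by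
    intro n
    induction n with
    | zero => simp
    | succ n ih =>
      intro T hT
      rw [sum_range_succ, sum_congr rfl (fun i _ => sum_range_succ
        (fun j => (-1 : ℝ) ^ (i + 1) • (-1 : ℝ) ^ (j + 1) • T i j) n), sum_add_distrib, ih T fun i j h1 h2 => hT i j h1 (by omega), zero_add, ← sum_add_distrib]
      refine sum_eq_zero fun i hi => ?_
      rw [hT i n (by simpa [Nat.lt_succ_iff] using hi) (by omega), smul_smul, smul_smul,
        ← add_smul]
      convert zero_smul ℝ _
      ring
  rw [dupAlt_apply]
  simp only [dupAlt_apply, map_sum, map_smul, Finset.smul_sum]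
  exact key k (fun i j => X.dupPow m i (X.dupPow m j z)) fun i j h1 h2 =>
    dupPow_dupPow hX hz h1 h2

/-- The product on powers as a bilinear map. -/
def mulL {X Y Z : BarBasis} (m : ℕ) (op : X.carrier → Y.carrier → Z.carrier) :
    X.Pow m →ₗ[ℝ] Y.Pow m →ₗ[ℝ] Z.Pow m :=
  linearCombination ℝ fun u => linearCombination ℝ fun v =>
    single (fun i => op (u i) (v i)) (sg (signForm (X.degs u) (Y.degs v)))

theorem mulPow_eq_mulL (op : X.carrier → Y.carrier → Z.carrier) (a : X.Pow m) (b : Y.Pow m) :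
    mulPow op a b = mulL m op a b := by
  have h : ∀ (b : Y.Pow m) (g : (Fin m → X.carrier) → Y.Pow m →ₗ[ℝ] Z.Pow m),
      linearCombination ℝ g a b = a.sum fun u r => r • g u b := by
    intro b g
    simp [linearCombination_apply, Finsupp.sum, LinearMap.sum_apply]
  rw [mulL, h, mulPow]
  refine Finsupp.sum_congr fun u _ => ?_
  rw [linearCombination_apply, Finsupp.smul_sum]
  refine Finsupp.sum_congr fun v _ => ?_
  rw [smul_single, smul_single, negOne_zpow_eq_sg]
  congr 1
  change sg (signForm (X.degs u) (Y.degs v)) * _ * _ = _ * (_ * sg (signForm (X.degs u) (Y.degs v)))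
  ring

@[simp] theorem mulL_single (op : X.carrier → Y.carrier → Z.carrier) (u : Fin m → X.carrier)
    (v : Fin m → Y.carrier) : mulL m op (single u 1) (single v 1)
      = single (fun i => op (u i) (v i)) (sg (signForm (X.degs u) (Y.degs v))) := by
  simp [mulL]

theorem single_eq_smul {α : Type*} (u : α) (r : ℝ) : single u r = r • single u (1 : ℝ) := by
  simp

theorem piece_ext₂ {N : Type*} [AddCommGroup N] [Module ℝ N] {k k' : ℕ} {l l' : ℤ}
    {T T' : X.Pow m →ₗ[ℝ] Y.Pow m →ₗ[ℝ] N}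
    (h : ∀ u v, X.IsPowBasis k u → ∑ i, X.deg (u i) = l → Y.IsPowBasis k' v →
      ∑ i, Y.deg (v i) = l' → T (single u 1) (single v 1) = T' (single u 1) (single v 1))
    {a : X.Pow m} (ha : a ∈ X.piece m k l) {b : Y.Pow m} (hb : b ∈ Y.piece m k' l') :
    T a b = T' a b := by
  refine piece_ext (T := T.flip b) (T' := T'.flip b) (fun u hu hl => ?_) ha
  exact piece_ext (T := T (single u 1)) (T' := T' (single u 1))
    (fun v hv hl' => h u v hu hl hv hl') hb

theorem degs_op {op : X.carrier → Y.carrier → Z.carrier} (h : IsLawfulMul op) {k k' : ℕ}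
    {u : Fin m → X.carrier} {v : Fin m → Y.carrier} (hu : X.IsPowBasis k u)
    (hv : Y.IsPowBasis k' v) : Z.degs (fun i => op (u i) (v i)) = X.degs u + Y.degs v :=
  funext fun i => (h.mem _ _ (hu i).1 (hv i).1).2.2

theorem mulL_mem_piece {op : X.carrier → Y.carrier → Z.carrier} (h : IsLawfulMul op)
    {k k' : ℕ} {l l' : ℤ} {a : X.Pow m} (ha : a ∈ X.piece m k l) {b : Y.Pow m}
    (hb : b ∈ Y.piece m k' l') : mulL m op a b ∈ Z.piece m (k + k') (l + l') := by
  refine piece_induction _ ((mulL m op).flip b) (fun u hu hl => ?_) ha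
  refine piece_induction _ (mulL m op (single u 1)) (fun v hv hl' => ?_) hb
  rw [mulL_single]
  refine single_mem_piece (fun i => ?_) ?_ _
  · have := h.mem _ _ (hu i).1 (hv i).1
    exact ⟨this.1, by rw [this.2.1, (hu i).2, (hv i).2]⟩
  · rw [← hl, ← hl', ← sum_add_distrib]
    exact sum_congr rfl fun i _ => (h.mem _ _ (hu i).1 (hv i).1).2.2

theorem update_op {α β γ : Type*} (op : α → β → γ) (u : Fin m → α) (v : Fin m → β) (i : Fin m)
    (w : α) : (fun j => op (Function.update u i w j) (v j))
      = Function.update (fun j => op (u j) (v j)) i (op w (v i)) := by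
  funext j
  by_cases hj : j = i
  · subst hj; simp
  · simp [hj]

theorem op_update {α β γ : Type*} (op : α → β → γ) (u : Fin m → α) (v : Fin m → β) (i : Fin m)
    (w : β) : (fun j => op (u j) (Function.update v i w j))
      = Function.update (fun j => op (u j) (v j)) i (op (u i) w) := by
  funext j
  by_cases hj : j = i
  · subst hj; simp
  · simp [hj]

theorem bdryPow_mulL (hX : X.IsLawful) (hY : Y.IsLawful)
    {op : X.carrier → Y.carrier → Z.carrier} (h : IsLawfulMul op)
    {k k' : ℕ} {l l' : ℤ} {a : X.Pow m} (ha : a ∈ X.piece m k l) {b : Y.Pow m}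
    (hb : b ∈ Y.piece m k' l') :
    Z.bdryPow m (mulL m op a b)
      = mulL m op (X.bdryPow m a) b + sg l • mulL m op a (Y.bdryPow m b) := by
  refine piece_ext₂ (T := (mulL m op).compr₂ (Z.bdryPow m))
    (T' := (mulL m op).comp (X.bdryPow m) + sg l • (mulL m op).compl₂ (Y.bdryPow m))
    (fun u v hu hl hv hl' => ?_) ha hb
  simp only [LinearMap.compr₂_apply, LinearMap.add_apply, LinearMap.comp_apply,
    LinearMap.smul_apply, LinearMap.compl₂_apply]
  rw [mulL_single, single_eq_smul, map_smul]
  simp only [bdryPow_eq_sum, LinearMap.sum_apply, map_sum, Finset.smul_sum, slotOp_single,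
    map_smul, LinearMap.smul_apply, degs_op h hu hv]
  rw [← sum_add_distrib]
  refine sum_congr rfl fun i _ => ?_
  rw [h.bdry_op _ _ (hu i).1 (hv i).1, map_add, map_smul, smul_add, smul_add]
  congr 1
  · change _ = _ • ((mulL m op).flip (single v 1)) (ins u i (X.bdry (u i)))
    rw [map_ins, ins_apply, linearCombination_mapDomain', smul_smul, ← sg_add,
      ← linearCombination_smul_right, ← linearCombination_smul_right]
    refine linearCombination_congr fun w hw => ?_
    rw [LinearMap.flip_apply, mulL_single, (hu.update hX.hasDeg_bdry i hw).2.1, update_op, smul_single,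
      smul_single, smul_eq_mul, smul_eq_mul, ← sg_add, mul_one]
    congr 2
    simp only [signForm_add_right, signForm_add_left, one_smul]
    ring
  · rw [map_ins, ins_apply, linearCombination_mapDomain', smul_smul, smul_smul, ← sg_add, ← sg_add,
      smul_smul, ← sg_add, ← linearCombination_smul_right, ← linearCombination_smul_right]
    refine linearCombination_congr fun w hw => ?_
    rw [mulL_single, (hv.update hY.hasDeg_bdry i hw).2.1, op_update, smul_single,
      smul_single, smul_eq_mul, smul_eq_mul, ← sg_add, mul_one]
    congr 1
    have := signForm_single_add (X.degs u) i
    rw [show ∑ j, X.degs u j = l from hl] at this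
    rw [← this]
    simp only [signForm_add_right, one_smul]
    refine sg_congr (- signForm (X.degs u) (Pi.single i 1)) ?_
    simp only [degs]
    ring

theorem dupPow_mulL_left {op : X.carrier → Y.carrier → Z.carrier} (h : IsLawfulMul op)
    (hX : X.IsLawful)
    {k k' : ℕ} {l l' : ℤ} {a : X.Pow m} (ha : a ∈ X.piece m k l) {b : Y.Pow m}
    (hb : b ∈ Y.piece m k' l') {i : ℕ} (hi : i < k) :
    Z.dupPow m i (mulL m op a b) = mulL m op (X.dupPow m i a) b := by
  refine piece_ext₂ (T := (mulL m op).compr₂ (Z.dupPow m i))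
    (T' := (mulL m op).comp (X.dupPow m i)) (fun u v hu hl hv hl' => ?_) ha hb
  simp only [LinearMap.compr₂_apply, LinearMap.comp_apply, dupPow_single, mulL_single]
  have hu' := fun j => (hu j).2.symm ▸ hi
  rw [show X.degs (fun j => X.dup i (u j)) = X.degs u from
    funext fun j => (hX.dup_mem _ (hu j).1 i (hu' j)).2.2]
  congr 1
  funext j
  exact h.dup_left _ _ (hu j).1 (hv j).1 i (hu' j)

theorem dupPow_mulL_right {op : X.carrier → Y.carrier → Z.carrier} (h : IsLawfulMul op)
    (hY : Y.IsLawful)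
    {k k' : ℕ} {l l' : ℤ} {a : X.Pow m} (ha : a ∈ X.piece m k l) {b : Y.Pow m}
    (hb : b ∈ Y.piece m k' l') {i : ℕ} (hi : i < k') :
    Z.dupPow m (k + i) (mulL m op a b) = mulL m op a (Y.dupPow m i b) := by
  refine piece_ext₂ (T := (mulL m op).compr₂ (Z.dupPow m (k + i)))
    (T' := (mulL m op).compl₂ (Y.dupPow m i)) (fun u v hu hl hv hl' => ?_) ha hb
  simp only [LinearMap.compr₂_apply, LinearMap.compl₂_apply, dupPow_single, mulL_single]
  have hv' := fun j => (hv j).2.symm ▸ hi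
  rw [show Y.degs (fun j => Y.dup i (v j)) = Y.degs v from
    funext fun j => (hY.dup_mem _ (hv j).1 i (hv' j)).2.2]
  congr 1
  funext j
  rw [← (hu j).2]
  exact h.dup_right _ _ (hu j).1 (hv j).1 i (hv' j)

theorem dupAlt_mulL {op : X.carrier → Y.carrier → Z.carrier} (h : IsLawfulMul op)
    (hX : X.IsLawful) (hY : Y.IsLawful)
    {k k' : ℕ} {l l' : ℤ} {a : X.Pow m} (ha : a ∈ X.piece m k l) {b : Y.Pow m}
    (hb : b ∈ Y.piece m k' l') :
    Z.dupAlt m (k + k') (mulL m op a b)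
      = mulL m op (X.dupAlt m k a) b + sg k • mulL m op a (Y.dupAlt m k' b) := by
  simp only [dupAlt_apply, sum_range_add, map_sum, LinearMap.sum_apply, map_smul,
    LinearMap.smul_apply, Finset.smul_sum]
  congr 1
  · refine sum_congr rfl fun i hi => ?_
    rw [dupPow_mulL_left h hX ha hb (mem_range.1 hi)]
  · refine sum_congr rfl fun i hi => ?_
    rw [dupPow_mulL_right h hY ha hb (mem_range.1 hi), smul_smul, ← negOne_pow_eq_sg, ← pow_add,
      add_assoc]

/-! ## The total differential and the product `⋆` -/

theorem dTot_zero (n : ℤ) (x : ℕ → X.Pow m) : dTot n x 0 = X.bdryPow m (x 0) := rfl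

theorem dTot_succ (n : ℤ) (x : ℕ → X.Pow m) (k : ℕ) :
    dTot n x (k + 1) = X.bdryPow m (x (k + 1)) + sg n • X.dupAlt m k (x k) := by
  rw [dupAlt_apply]; rfl

theorem star_apply (op : X.carrier → Y.carrier → Z.carrier) (n : ℤ) (a : ℕ → X.Pow m)
    (b : ℕ → Y.Pow m) (k : ℕ) : star op n a b k
      = ∑ p ∈ antidiagonal k, sg (p.1 * n) • mulL m op (a p.1) (b p.2) := by
  simp only [star, mulPow_eq_mulL]
  rfl

theorem HasTotalDegree.dTot (hX : X.IsLawful) {n : ℤ} {x : ℕ → X.Pow m}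
    (hx : HasTotalDegree n x) : HasTotalDegree (n + 1) (dTot n x) := by
  intro k
  cases k with
  | zero =>
    rw [dTot_zero, show n + 1 - ((0 : ℕ) : ℤ) = n - (0 : ℕ) + 1 by ring]
    exact bdryPow_mem_piece hX (hx 0)
  | succ k =>
    rw [dTot_succ]
    refine Submodule.add_mem _ ?_ (Submodule.smul_mem _ _ ?_)
    · rw [show n + 1 - ((k + 1 : ℕ) : ℤ) = n - (k + 1 : ℕ) + 1 by ring]
      exact bdryPow_mem_piece hX (hx _)
    · rw [show n + 1 - ((k + 1 : ℕ) : ℤ) = n - k by push_cast; ring]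
      exact dupAlt_mem_piece hX (hx _)

theorem HasTotalDegree.star {op : X.carrier → Y.carrier → Z.carrier} (h : IsLawfulMul op)
    {n n' : ℤ} {a : ℕ → X.Pow m} (ha : HasTotalDegree n a) {b : ℕ → Y.Pow m}
    (hb : HasTotalDegree n' b) : HasTotalDegree (n + n') (star op n' a b) := by
  intro k
  rw [star_apply]
  refine Submodule.sum_mem _ fun p hp => Submodule.smul_mem _ _ ?_
  have := mulL_mem_piece h (ha p.1) (hb p.2)
  rw [HasAntidiagonal.mem_antidiagonal] at hp
  rwa [hp, show n - p.1 + (n' - p.2) = n + n' - k by rw [← hp]; push_cast; ring] at this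

theorem HasTotalDegree.add {n : ℤ} {a b : ℕ → X.Pow m} (ha : HasTotalDegree n a)
    (hb : HasTotalDegree n b) : HasTotalDegree n (a + b) :=
  fun k => Submodule.add_mem _ (ha k) (hb k)

theorem HasTotalDegree.sub {n : ℤ} {a b : ℕ → X.Pow m} (ha : HasTotalDegree n a)
    (hb : HasTotalDegree n b) : HasTotalDegree n (a - b) :=
  fun k => Submodule.sub_mem _ (ha k) (hb k)

theorem HasTotalDegree.smul {n : ℤ} {a : ℕ → X.Pow m} (ha : HasTotalDegree n a) (c : ℝ) :
    HasTotalDegree n (c • a) :=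
  fun k => Submodule.smul_mem _ _ (ha k)

theorem neg_smul_seq (c : ℝ) (x : ℕ → X.Pow m) : (-c) • x = -(c • x) := by
  funext k
  simp

theorem neg_one_smul_seq (x : ℕ → X.Pow m) : (-1 : ℝ) • x = -x := by
  funext k
  simp

theorem dTot_dTot (hX : X.IsLawful) {n : ℤ} {x : ℕ → X.Pow m} (hx : HasTotalDegree n x) :
    dTot (n + 1) (dTot n x) = 0 := by
  funext k
  have h1 := fun k => bdryPow_bdryPow hX (hx k)
  have h2 := fun k => bdryPow_dupAlt hX (hx k)
  have h3 := fun k => dupAlt_dupAlt hX (hx k)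
  rcases k with _ | _ | k
  · rw [dTot_zero, dTot_zero, h1]; rfl
  · rw [dTot_succ, dTot_succ, dTot_zero, map_add, h1, map_smul, h2, sg_add_one]
    simp
  · rw [dTot_succ, dTot_succ, dTot_succ, map_add, h1, map_smul, h2, sg_add_one, map_add, map_smul,
      h3]
    simp

theorem dTot_add (n : ℤ) (x y : ℕ → X.Pow m) : dTot n (x + y) = dTot n x + dTot n y := by
  funext k
  cases k with
  | zero => simp [dTot_zero]
  | succ k => simp only [dTot_succ, Pi.add_apply, map_add, smul_add]; abel

theorem dTot_smul (n : ℤ) (c : ℝ) (x : ℕ → X.Pow m) : dTot n (c • x) = c • dTot n x := by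
  funext k
  cases k with
  | zero => simp [dTot_zero]
  | succ k => simp only [dTot_succ, Pi.smul_apply, map_smul, smul_add, smul_comm c]

theorem star_add_left (op : X.carrier → Y.carrier → Z.carrier) (n : ℤ) (a a' : ℕ → X.Pow m)
    (b : ℕ → Y.Pow m) : star op n (a + a') b = star op n a b + star op n a' b := by
  funext k
  simp [star_apply, sum_add_distrib]

theorem star_add_right (op : X.carrier → Y.carrier → Z.carrier) (n : ℤ) (a : ℕ → X.Pow m)
    (b b' : ℕ → Y.Pow m) : star op n a (b + b') = star op n a b + star op n a b' := by
  funext k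
  simp [star_apply, sum_add_distrib]

theorem star_smul_left (op : X.carrier → Y.carrier → Z.carrier) (n : ℤ) (c : ℝ) (a : ℕ → X.Pow m)
    (b : ℕ → Y.Pow m) : star op n (c • a) b = c • star op n a b := by
  funext k
  simp [star_apply, Finset.smul_sum, smul_comm c]

theorem star_smul_right (op : X.carrier → Y.carrier → Z.carrier) (n : ℤ) (c : ℝ)
    (a : ℕ → X.Pow m) (b : ℕ → Y.Pow m) : star op n a (c • b) = c • star op n a b := by
  funext k
  simp [star_apply, Finset.smul_sum, smul_comm c]

theorem dTot_star (hX : X.IsLawful) (hY : Y.IsLawful)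
    {op : X.carrier → Y.carrier → Z.carrier} (h : IsLawfulMul op) {p q : ℤ}
    {a : ℕ → X.Pow m} (ha : HasTotalDegree p a) {b : ℕ → Y.Pow m} (hb : HasTotalDegree q b) :
    dTot (p + q) (star op q a b)
      = star op q (dTot p a) b + sg p • star op (q + 1) a (dTot q b) := by
  have hbd : ∀ k, Z.bdryPow m (star op q a b k)
      = ∑ r ∈ antidiagonal k, (sg (r.1 * q) • mulL m op (X.bdryPow m (a r.1)) (b r.2)
        + sg (p + r.1 * (q + 1)) • mulL m op (a r.1) (Y.bdryPow m (b r.2))) := by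
    intro k
    rw [star_apply, map_sum]
    refine sum_congr rfl fun r _ => ?_
    rw [map_smul, bdryPow_mulL hX hY h (ha _) (hb _), smul_add, smul_smul, ← sg_add]
    congr 2
    exact sg_congr (-r.1) (by ring)
  have hdup : ∀ k, Z.dupAlt m k (star op q a b k)
      = ∑ r ∈ antidiagonal k, (sg (r.1 * q) • mulL m op (X.dupAlt m r.1 (a r.1)) (b r.2)
        + sg (r.1 * (q + 1)) • mulL m op (a r.1) (Y.dupAlt m r.2 (b r.2))) := by
    intro k
    rw [star_apply, map_sum]
    refine sum_congr rfl fun r hr => ?_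
    rw [map_smul, ← HasAntidiagonal.mem_antidiagonal.1 hr, dupAlt_mulL h hX hY (ha _) (hb _), smul_add, smul_smul,
      ← sg_add]
    congr 3
    ring
  funext k
  cases k with
  | zero =>
    rw [dTot_zero, hbd]
    simp [star_apply, dTot_zero]
  | succ k =>
    rw [dTot_succ, hbd, hdup]
    simp only [Pi.add_apply, Pi.smul_apply, star_apply]
    rw [sum_add_distrib, sum_add_distrib]
    rw [Nat.sum_antidiagonal_succ (f := fun r : ℕ × ℕ =>
        sg (r.1 * q) • mulL m op (dTot p a r.1) (b r.2)),
      Nat.sum_antidiagonal_succ' (f := fun r : ℕ × ℕ =>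
        sg (r.1 * (q + 1)) • mulL m op (a r.1) (dTot q b r.2)),
      Nat.sum_antidiagonal_succ (f := fun r : ℕ × ℕ =>
        sg (r.1 * q) • mulL m op (X.bdryPow m (a r.1)) (b r.2)),
      Nat.sum_antidiagonal_succ' (f := fun r : ℕ × ℕ =>
        sg (p + r.1 * (q + 1)) • mulL m op (a r.1) (Y.bdryPow m (b r.2)))]
    simp only [dTot_succ, dTot_zero, map_add, map_smul, LinearMap.add_apply, LinearMap.smul_apply,
      smul_add, sum_add_distrib, Finset.smul_sum, smul_smul, ← sg_add]
    have e1 : ∀ r : ℕ × ℕ, sg (p + q + r.1 * q) = sg (((r.1 + 1 : ℕ) : ℤ) * q + p) := fun r => by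
      congr 1; push_cast; ring
    have e2 : ∀ r : ℕ × ℕ, sg (p + q + r.1 * (q + 1)) = sg (p + (r.1 * (q + 1) + q)) := fun r => by
      congr 1; ring
    simp only [e1, e2]
    abel

theorem star_assoc {W V U : BarBasis} {op₁ : X.carrier → Y.carrier → W.carrier}
    {op₂ : W.carrier → Z.carrier → U.carrier} {op₃ : Y.carrier → Z.carrier → V.carrier}
    {op₄ : X.carrier → V.carrier → U.carrier} (h₁ : IsLawfulMul op₁) (h₃ : IsLawfulMul op₃)
    (h : ∀ a b c, op₂ (op₁ a b) c = op₄ a (op₃ b c)) {p q r : ℤ}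
    {a : ℕ → X.Pow m} (ha : HasTotalDegree p a) {b : ℕ → Y.Pow m} (hb : HasTotalDegree q b)
    {c : ℕ → Z.Pow m} (hc : HasTotalDegree r c) :
    star op₂ r (star op₁ q a b) c = star op₄ (q + r) a (star op₃ r b c) := by
  have hm : ∀ i j k, mulL m op₂ (mulL m op₁ (a i) (b j)) (c k)
      = mulL m op₄ (a i) (mulL m op₃ (b j) (c k)) := by
    intro i j k
    refine piece_ext (T := (mulL m op₂).flip (c k) ∘ₗ (mulL m op₁).flip (b j))
      (T' := (mulL m op₄).flip (mulL m op₃ (b j) (c k))) (fun u hu hl => ?_) (ha i)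
    refine piece_ext (T := (mulL m op₂).flip (c k) ∘ₗ mulL m op₁ (single u 1))
      (T' := mulL m op₄ (single u 1) ∘ₗ (mulL m op₃).flip (c k)) (fun v hv hl' => ?_) (hb j)
    refine piece_ext (T := mulL m op₂ (mulL m op₁ (single u 1) (single v 1)))
      (T' := mulL m op₄ (single u 1) ∘ₗ mulL m op₃ (single v 1)) (fun w hw hl'' => ?_) (hc k)
    rw [LinearMap.comp_apply, mulL_single, mulL_single, single_eq_smul, map_smul,
      single_eq_smul _ (sg (signForm (Y.degs v) _)), map_smul, LinearMap.smul_apply,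
      mulL_single, mulL_single, degs_op h₁ hu hv, degs_op h₃ hv hw]
    simp only [h, smul_single, smul_eq_mul, ← sg_add, signForm_add_left, signForm_add_right]
    congr 2
    ring
  funext k
  simp only [star_apply, map_sum, LinearMap.sum_apply, map_smul, LinearMap.smul_apply,
    Finset.smul_sum, hm, smul_smul, ← sg_add]
  rw [sum_sigma', sum_sigma']
  refine sum_nbij' (fun ⟨⟨_, j⟩, k, l⟩ => ⟨(k, l + j), (l, j)⟩)
    (fun ⟨⟨i, _⟩, k, l⟩ => ⟨(i + k, l), (i, k)⟩) ?_ ?_ ?_ ?_ ?_ <;>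
  simp only [mem_sigma, HasAntidiagonal.mem_antidiagonal, Sigma.forall, Prod.forall, and_imp]
  · rintro a b c d rfl rfl; simp [add_assoc]
  · rintro a b c d rfl rfl; simp [add_assoc]
  · rintro a b c d rfl rfl; rfl
  · rintro a b c d rfl rfl; rfl
  · rintro a b c d rfl rfl
    congr 2
    push_cast
    ring

/-! ## The twisted differential -/

/-- A pair of commuting lawful actions of `Ω`. -/
structure IsLawfulBimodule (Y : BarBasis) (L : omegaBar.carrier → Y.carrier → Y.carrier)
    (R : Y.carrier → omegaBar.carrier → Y.carrier) : Prop where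
  lawful : Y.IsLawful
  left : IsLawfulMul L
  right : IsLawfulMul R
  left_left : ∀ A B u, L (omegaMul A B) u = L A (L B u)
  right_right : ∀ u A B, R (R u A) B = R u (omegaMul A B)
  left_right : ∀ A u B, R (L A u) B = L A (R u B)

/-- The twisted differential `z ↦ d_tot z - (-1)ⁿ z ⋆ ω + θ ⋆ z` in total degree `n`. -/
def twDiff {Y : BarBasis} (L : omegaBar.carrier → Y.carrier → Y.carrier)
    (R : Y.carrier → omegaBar.carrier → Y.carrier) (ω θ : ℕ → omegaBar.Pow m) (n : ℤ)
    (z : ℕ → Y.Pow m) : ℕ → Y.Pow m :=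
  dTot n z - sg n • star R 1 z ω + star L n θ z

variable {L : omegaBar.carrier → Y.carrier → Y.carrier}
  {R : Y.carrier → omegaBar.carrier → Y.carrier} {ω θ : ℕ → omegaBar.Pow m}

theorem HasTotalDegree.twDiff (hY : IsLawfulBimodule Y L R) (hω : HasTotalDegree 1 ω)
    (hθ : HasTotalDegree 1 θ) {n : ℤ} {z : ℕ → Y.Pow m} (hz : HasTotalDegree n z) :
    HasTotalDegree (n + 1) (twDiff L R ω θ n z) := by
  refine ((hz.dTot hY.lawful).sub ((hz.star hY.right hω).smul _)).add ?_
  rw [add_comm]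
  exact hθ.star hY.left hz

theorem twDiff_add (n : ℤ) (x y : ℕ → Y.Pow m) :
    twDiff L R ω θ n (x + y) = twDiff L R ω θ n x + twDiff L R ω θ n y := by
  simp only [twDiff, dTot_add, star_add_left, star_add_right, smul_add]
  abel

theorem twDiff_smul (n : ℤ) (c : ℝ) (x : ℕ → Y.Pow m) :
    twDiff L R ω θ n (c • x) = c • twDiff L R ω θ n x := by
  simp only [twDiff, dTot_smul, star_smul_left, star_smul_right, smul_add, smul_sub, smul_comm c]

theorem twDiff_sub (n : ℤ) (x y : ℕ → Y.Pow m) :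
    twDiff L R ω θ n (x - y) = twDiff L R ω θ n x - twDiff L R ω θ n y := by
  rw [sub_eq_add_neg, ← neg_one_smul_seq y, twDiff_add, twDiff_smul, neg_one_smul_seq, sub_eq_add_neg]

theorem twDiff_twDiff (hΩ : omegaBar.IsLawful) (hm : IsLawfulMul omegaMul)
    (hY : IsLawfulBimodule Y L R)
    (hω : IsUniversalMC m ω) (hθ : IsUniversalMC m θ) {n : ℤ} {z : ℕ → Y.Pow m}
    (hz : HasTotalDegree n z) :
    twDiff L R ω θ (n + 1) (twDiff L R ω θ n z) = 0 := by
  have h1 := dTot_dTot hY.lawful hz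
  have h2 := dTot_star hY.lawful hΩ hY.right hz hω.degree
  have h3 := dTot_star hΩ hY.lawful hY.left hθ.degree hz
  have h4 := star_assoc hY.right hm hY.right_right hz hω.degree hω.degree
  have h5 := star_assoc hm hY.left hY.left_left hθ.degree hθ.degree hz
  have h6 := star_assoc hY.left hY.right hY.left_right hθ.degree hz hω.degree
  have hdω : dTot 1 ω = - star omegaMul 1 ω ω :=
    funext fun k => eq_neg_of_add_eq_zero_left (hω.maurerCartan k)
  have hdθ : dTot 1 θ = - star omegaMul 1 θ θ :=
    funext fun k => eq_neg_of_add_eq_zero_left (hθ.maurerCartan k)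
  have hneg : ∀ x : ℕ → Y.Pow m, dTot (n + 1) (-x) = - dTot (n + 1) x := fun x => by
    rw [← neg_one_smul_seq x, dTot_smul, neg_one_smul_seq]
  have hnl : ∀ {X' Y' Z' : BarBasis} (op : X'.carrier → Y'.carrier → Z'.carrier) (n : ℤ)
      (a : ℕ → X'.Pow m) (b : ℕ → Y'.Pow m), star op n (-a) b = - star op n a b := by
    intro X' Y' Z' op n a b
    rw [← neg_one_smul_seq a, star_smul_left, neg_one_smul_seq]
  have hnr : ∀ {X' Y' Z' : BarBasis} (op : X'.carrier → Y'.carrier → Z'.carrier) (n : ℤ)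
      (a : ℕ → X'.Pow m) (b : ℕ → Y'.Pow m), star op n a (-b) = - star op n a b := by
    intro X' Y' Z' op n a b
    rw [← neg_one_smul_seq b, star_smul_right, neg_one_smul_seq]
  rw [add_comm (1 : ℤ) n] at h3
  rw [hdω, hnr] at h2
  rw [hdθ, hnl] at h3
  have hs := sg_mul_self n
  simp only [twDiff, sub_eq_add_neg, dTot_add, dTot_smul, hneg, star_add_left, star_add_right,
    star_smul_left, star_smul_right, hnl, hnr, h1, h2, h3, h4, h5, smul_add, smul_neg, sg_one,
    smul_smul, hs, sg_add_one, neg_smul_seq, one_smul, h6, neg_mul, add_comm (1 : ℤ) n, show (1 : ℤ) + 1 = 2 by rfl]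
  abel

end BarBasis


namespace BarBasis

open Finsupp

variable {X Y Z : BarBasis} {m : ℕ}

/-! ## Contractions and exactness -/

/-- A homotopy `s` between the identity and a map `f` which is nilpotent in negative degrees. -/
structure Contraction (Y : BarBasis) where
  s : Y.carrier → (Y.carrier →₀ ℝ)
  f : Y.carrier → (Y.carrier →₀ ℝ)
  hasDeg_s : Y.HasDeg (-1) s
  hasDeg_f : Y.HasDeg 0 f
  homotopy : ∀ u, Y.IsBasis u →
    linearCombination ℝ Y.bdry (s u) + linearCombination ℝ s (Y.bdry u) = single u 1 - f u
  size : Y.carrier → ℕ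
  size_lt : ∀ u, Y.IsBasis u → Y.deg u < 0 → ∀ v ∈ (f u).support, size v < size u

namespace Contraction

variable (C : Contraction Y)

theorem slot_homotopy (hY : Y.IsLawful) (i : Fin m) {k : ℕ} {l : ℤ} {z : Y.Pow m}
    (hz : z ∈ Y.piece m k l) :
    Y.bdryPow m (Y.slotOp (-1) C.s i z) + Y.slotOp (-1) C.s i (Y.bdryPow m z)
      = z - Y.slotOp 0 C.f i z := by
  rw [bdryPow_eq_sum, LinearMap.sum_apply, LinearMap.sum_apply, map_sum, ← sum_add_distrib,
    Finset.sum_eq_single i]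
  · rw [slotOp_slotOp_self C.hasDeg_s i hz, slotOp_slotOp_self hY.hasDeg_bdry i hz]
    refine piece_ext (T := Y.slotOp (1 + -1) (fun u => linearCombination ℝ Y.bdry (C.s u)) i
        + Y.slotOp (-1 + 1) (fun u => linearCombination ℝ C.s (Y.bdry u)) i)
      (T' := LinearMap.id - Y.slotOp 0 C.f i) (fun u hu hl => ?_) hz
    simp only [LinearMap.add_apply, LinearMap.sub_apply, slotOp_single, LinearMap.id_apply]
    norm_num
    rw [← map_add, C.homotopy _ (hu i).1, map_sub, ins_single, Function.update_eq_self]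
  · intro j _ hj
    rw [slotOp_slotOp_of_ne hY.hasDeg_bdry C.hasDeg_s hj hz]
    norm_num [sg_neg]
  · simp

/-- Homologous cycles. -/
def Homologous (Y : BarBasis) (m k : ℕ) (l : ℤ) (z z' : Y.Pow m) : Prop :=
  z' ∈ Y.piece m k l ∧ Y.bdryPow m z' = 0 ∧ ∃ y ∈ Y.piece m k (l - 1), Y.bdryPow m y = z - z'

theorem Homologous.trans {k : ℕ} {l : ℤ} {z z' z'' : Y.Pow m} (h : Homologous Y m k l z z')
    (h' : Homologous Y m k l z' z'') : Homologous Y m k l z z'' := by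
  obtain ⟨-, -, y, hy, hy'⟩ := h
  obtain ⟨h1, h2, y', hy1, hy2⟩ := h'
  exact ⟨h1, h2, y + y', Submodule.add_mem _ hy hy1, by rw [map_add, hy', hy2]; abel⟩

theorem homologous_refl {k : ℕ} {l : ℤ} {z : Y.Pow m} (hz : z ∈ Y.piece m k l)
    (h : Y.bdryPow m z = 0) : Homologous Y m k l z z :=
  ⟨hz, h, 0, Submodule.zero_mem _, by simp⟩

theorem homologous_slot (hY : Y.IsLawful) (i : Fin m) {k : ℕ} {l : ℤ} {z : Y.Pow m}
    (hz : z ∈ Y.piece m k l) (h : Y.bdryPow m z = 0) :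
    Homologous Y m k l z (Y.slotOp 0 C.f i z) := by
  have h1 := C.slot_homotopy hY i hz
  have h2 := slotOp_mem_piece C.hasDeg_s i hz
  rw [h, map_zero, add_zero] at h1
  refine ⟨by simpa using slotOp_mem_piece C.hasDeg_f i hz, ?_, _, h2, h1⟩
  have h3 := bdryPow_bdryPow hY h2
  rw [h1, map_sub, h, zero_sub, neg_eq_zero] at h3
  exact h3

theorem slot_iterate (hY : Y.IsLawful) (i : Fin m) (S : Finset (Fin m)) {k : ℕ} {l : ℤ} (n : ℕ) :
    ∀ z : Y.Pow m, Y.bdryPow m z = 0 →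
      z ∈ supported ℝ ℝ {u | (Y.IsPowBasis k u ∧ ∑ i, Y.deg (u i) = l) ∧
        (∀ j ∈ S, 0 ≤ Y.deg (u j)) ∧ (0 ≤ Y.deg (u i) ∨ C.size (u i) < n)} →
      ∃ z', Homologous Y m k l z z' ∧ z' ∈ supported ℝ ℝ {u |
        (Y.IsPowBasis k u ∧ ∑ i, Y.deg (u i) = l) ∧ (∀ j ∈ insert i S, 0 ≤ Y.deg (u j))} := by
  induction n with
  | zero =>
    intro z h hz
    refine ⟨z, homologous_refl (supported_mono (fun u hu => hu.1) hz) h, supported_mono ?_ hz⟩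
    rintro u ⟨h1, h2, h3⟩
    exact ⟨h1, fun j hj => (mem_insert.1 hj).elim (fun e => e ▸ by simpa using h3) (h2 j)⟩
  | succ n ih =>
    intro z h hz
    have hz' : z ∈ Y.piece m k l := supported_mono (fun u hu => hu.1) hz
    have h1 := C.homologous_slot hY i hz' h
    obtain ⟨z', h2, h3⟩ := ih (Y.slotOp 0 C.f i z) h1.2.1 (by
      refine supported_induction _ _ (fun u hu => ?_) hz
      obtain ⟨⟨hu, hl⟩, hS, hi⟩ := hu
      rw [slotOp_single]
      refine Submodule.smul_mem _ _ (linearCombination_mem_supported fun v hv => ?_)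
      obtain ⟨g1, g2, g3⟩ := hu.update C.hasDeg_f i hv
      have g4 := (C.hasDeg_f _ (hu i).1 v hv).2.2
      refine single_mem_supported ℝ 1 ⟨⟨g1, by rw [g3, hl, add_zero]⟩, fun j hj => ?_, ?_⟩
      · have := hS j hj
        by_cases hji : j = i
        · subst hji; simpa [g4] using this
        · simpa [hji] using this
      · rw [Function.update_self, g4, add_zero]
        by_cases hd : 0 ≤ Y.deg (u i)
        · exact Or.inl hd
        · have := C.size_lt _ (hu i).1 (not_le.1 hd) v hv
          exact Or.inr (by have := hi.resolve_left hd; omega))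
    exact ⟨z', h1.trans h2, h3⟩

theorem exists_bdryPow_eq (C : Contraction Y) (hY : Y.IsLawful) {k : ℕ} {l : ℤ} (hl : l < 0) {z : Y.Pow m}
    (hz : z ∈ Y.piece m k l) (h : Y.bdryPow m z = 0) :
    ∃ y ∈ Y.piece m k (l - 1), Y.bdryPow m y = z := by
  have key : ∀ S : Finset (Fin m), ∃ z', Homologous Y m k l z z' ∧ z' ∈ supported ℝ ℝ {u |
        (Y.IsPowBasis k u ∧ ∑ i, Y.deg (u i) = l) ∧ (∀ j ∈ S, 0 ≤ Y.deg (u j))} := by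
    intro S
    induction S using Finset.induction_on with
    | empty => exact ⟨z, homologous_refl hz h, fun u hu => ⟨hz hu, by simp⟩⟩
    | insert i S _ ih =>
      obtain ⟨z', h1, h2⟩ := ih
      obtain ⟨z'', h3, h4⟩ := C.slot_iterate hY i S (z'.support.sup (fun u => C.size (u i)) + 1)
        z' h1.2.1 (fun u hu => ⟨(h2 hu).1, (h2 hu).2,
          Or.inr (Nat.lt_succ_of_le (Finset.le_sup (f := fun u => C.size (u i)) hu))⟩)
      exact ⟨z'', h1.trans h3, h4⟩
  obtain ⟨z', ⟨_, _, y, hy, hy'⟩, h2⟩ := key univ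
  have : z' = 0 := by
    rw [← Finsupp.support_eq_empty, eq_empty_iff_forall_notMem]
    intro u hu
    have := (h2 hu).2
    have h3 : 0 ≤ ∑ i, Y.deg (u i) := sum_nonneg fun i hi => this i hi
    rw [(h2 hu).1.2] at h3
    omega
  exact ⟨y, hy, by rw [hy', this, sub_zero]⟩

theorem exists_bdryPow_eq_single_sub (hY : Y.IsLawful) {k : ℕ} {l : ℤ} {u v w : Fin m → Y.carrier}
    (hu : C.f ∘ u = fun i => single (w i) 1) (hv : C.f ∘ v = fun i => single (w i) 1)
    (hz : single u 1 - single v 1 ∈ Y.piece m k l)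
    (h : Y.bdryPow m (single u 1 - single v 1) = 0) :
    ∃ y ∈ Y.piece m k (l - 1), Y.bdryPow m y = single u 1 - single v 1 := by
  have key : ∀ S : Finset (Fin m), Homologous Y m k l (single u 1 - single v 1)
      (single (S.piecewise w u) 1 - single (S.piecewise w v) 1) := by
    intro S
    induction S using Finset.induction_on with
    | empty => simpa using homologous_refl hz h
    | insert i S hi ih =>
      refine ih.trans ?_
      have h1 := C.homologous_slot hY i ih.1 ih.2.1
      have h2 : ∀ u, C.f ∘ u = (fun i => single (w i) 1) →
          Y.slotOp 0 C.f i (single (S.piecewise w u) 1) = single ((insert i S).piecewise w u) 1 := by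
        intro u hu
        rw [slotOp_single, zero_mul, sg_zero, one_smul, Finset.piecewise_eq_of_notMem _ _ _ hi,
          show C.f (u i) = single (w i) 1 from congrFun hu i, ins_single,
          Finset.piecewise_insert]
      rwa [map_sub, h2 u hu, h2 v hv] at h1
  obtain ⟨-, -, y, hy, hy'⟩ := key univ
  refine ⟨y, hy, ?_⟩
  simpa using hy'

end Contraction

/-! ## Solving twisted equations order by order -/

variable {L : omegaBar.carrier → Y.carrier → Y.carrier}
  {R : Y.carrier → omegaBar.carrier → Y.carrier} {ω θ : ℕ → omegaBar.Pow m}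

theorem twDiff_eq_bdryPow (hω : ω 0 = 0) (hθ : θ 0 = 0) (n : ℤ) {a : ℕ → Y.Pow m} {k : ℕ}
    (ha : ∀ j < k, a j = 0) : twDiff L R ω θ n a k = Y.bdryPow m (a k) := by
  have h1 : star R 1 a ω k = 0 := by
    rw [star_apply]
    refine sum_eq_zero fun p hp => ?_
    rw [HasAntidiagonal.mem_antidiagonal] at hp
    rcases Nat.eq_zero_or_pos p.2 with h | h
    · rw [h, hω]; simp
    · rw [ha _ (by omega)]; simp
  have h2 : star L n θ a k = 0 := by
    rw [star_apply]
    refine sum_eq_zero fun p hp => ?_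
    rw [HasAntidiagonal.mem_antidiagonal] at hp
    rcases Nat.eq_zero_or_pos p.1 with h | h
    · rw [h, hθ]; simp
    · rw [ha p.2 (by omega)]; simp
  simp only [twDiff, Pi.add_apply, Pi.sub_apply, Pi.smul_apply, h1, h2, smul_zero, sub_zero,
    add_zero]
  cases k with
  | zero => rw [dTot_zero]
  | succ k => rw [dTot_succ, ha k (by omega)]; simp

theorem twDiff_congr (hω : ω 0 = 0) (hθ : θ 0 = 0) (n : ℤ) {a b : ℕ → Y.Pow m} {k : ℕ}
    (h : ∀ j ≤ k, a j = b j) : twDiff L R ω θ n a k = twDiff L R ω θ n b k := by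
  rw [← sub_eq_zero, ← Pi.sub_apply, ← twDiff_sub, twDiff_eq_bdryPow hω hθ]
  · simp [h k le_rfl]
  · intro j hj
    simp [h j hj.le]

/-- One step in the solution of `δ z = c`. -/
theorem exists_twDiff_eq_step (hω : ω 0 = 0) (hθ : θ 0 = 0) {n : ℤ} {c z : ℕ → Y.Pow m}
    (hz : HasTotalDegree n z) {k : ℕ} (h : ∀ j < k, twDiff L R ω θ n z j = c j)
    (hy : ∃ y ∈ Y.piece m k (n - k), Y.bdryPow m y = c k - twDiff L R ω θ n z k) :
    ∃ z', HasTotalDegree n z' ∧ (∀ j < k + 1, twDiff L R ω θ n z' j = c j) ∧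
      ∀ j, j ≠ k → z' j = z j := by
  obtain ⟨y, hy, hy'⟩ := hy
  have hw : HasTotalDegree n (Pi.single k y : ℕ → Y.Pow m) := by
    intro j
    by_cases hj : j = k
    · subst hj; simpa using hy
    · simp [hj]
  have hw0 : ∀ i, i < k → (Pi.single k y : ℕ → Y.Pow m) i = 0 := fun i hi => by simp [hi.ne]
  refine ⟨z + Pi.single k y, hz.add hw, fun j hj => ?_, fun j hj => by simp [hj]⟩
  rw [twDiff_add, Pi.add_apply, twDiff_eq_bdryPow hω hθ n (a := Pi.single k y)
    (fun i hi => hw0 i (by omega))]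
  rcases Nat.lt_succ_iff_lt_or_eq.1 hj with hj' | rfl
  · rw [h j hj', hw0 j hj', map_zero, add_zero]
  · rw [Pi.single_eq_same, hy']; abel

theorem bdryPow_sub_twDiff (hΩ : omegaBar.IsLawful) (hmul : IsLawfulMul omegaMul)
    (hY : IsLawfulBimodule Y L R) (hω' : IsUniversalMC m ω) (hθ' : IsUniversalMC m θ)
    (hω : ω 0 = 0) (hθ : θ 0 = 0) {n : ℤ} {c z : ℕ → Y.Pow m}
    (hc0 : twDiff L R ω θ (n + 1) c = 0)
    (hz : HasTotalDegree n z) {k : ℕ} (h : ∀ j < k, twDiff L R ω θ n z j = c j) :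
    Y.bdryPow m (c k - twDiff L R ω θ n z k) = 0 := by
  rw [← Pi.sub_apply, ← twDiff_eq_bdryPow (L := L) (R := R) hω hθ (n + 1), twDiff_sub, hc0,
    twDiff_twDiff hΩ hmul hY hω' hθ' hz]
  · simp
  · intro j hj
    simp [h j hj]

theorem exists_twDiff_eq (hΩ : omegaBar.IsLawful) (hmul : IsLawfulMul omegaMul)
    (hY : IsLawfulBimodule Y L R) (C : Contraction Y) (hω' : IsUniversalMC m ω)
    (hθ' : IsUniversalMC m θ) (hω : ω 0 = 0) (hθ : θ 0 = 0) {n : ℤ} {c z : ℕ → Y.Pow m}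
    (hc : HasTotalDegree (n + 1) c) (hc0 : twDiff L R ω θ (n + 1) c = 0)
    (hz : HasTotalDegree n z) (N : ℕ) (hN : n + 1 < N)
    (h : ∀ j < N, twDiff L R ω θ n z j = c j) :
    ∃ z', HasTotalDegree n z' ∧ twDiff L R ω θ n z' = c ∧ ∀ j < N, z' j = z j := by
  have step : ∀ k, N ≤ k → ∀ z : ℕ → Y.Pow m,
      (HasTotalDegree n z ∧ ∀ j < k, twDiff L R ω θ n z j = c j) →
      ∃ z', (HasTotalDegree n z' ∧ ∀ j < k + 1, twDiff L R ω θ n z' j = c j) ∧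
        ∀ j, j ≠ k → z' j = z j := by
    rintro k hk z ⟨hz, h⟩
    have h1 := bdryPow_sub_twDiff hΩ hmul hY hω' hθ' hω hθ hc0 hz h
    have h2 := Submodule.sub_mem _ (hc k) (HasTotalDegree.twDiff hY hω'.degree hθ'.degree hz k)
    obtain ⟨y, hy, hy'⟩ := C.exists_bdryPow_eq hY.lawful (by omega) h2 h1
    obtain ⟨z', a, b, c⟩ := exists_twDiff_eq_step hω hθ hz h
      ⟨y, by rwa [show n + 1 - (k : ℤ) - 1 = n - k by ring] at hy, hy'⟩
    exact ⟨z', ⟨a, b⟩, c⟩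
  choose! g hg1 hg2 using step
  let Z : ℕ → ℕ → Y.Pow m := fun i => Nat.rec z (fun i w => g (N + i) w) i
  have hZ : ∀ i, HasTotalDegree n (Z i) ∧ ∀ j < N + i, twDiff L R ω θ n (Z i) j = c j := by
    intro i
    induction i with
    | zero => exact ⟨hz, h⟩
    | succ i ih => exact hg1 (N + i) (by omega) _ ih
  have hZ' : ∀ i d j, j < N + i → Z (i + d) j = Z i j := by
    intro i d j hj
    induction d with
    | zero => rfl
    | succ d ih =>
      rw [← ih]
      exact hg2 (N + (i + d)) (by omega) _ (hZ _) j (by omega)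
  have hle : ∀ j k, j ≤ k → Z (j + 1) j = Z (k + 1) j := by
    intro j k hjk
    obtain ⟨d, rfl⟩ := Nat.exists_eq_add_of_le hjk
    rw [show j + d + 1 = j + 1 + d by ring, hZ' _ _ _ (by omega)]
  refine ⟨fun j => Z (j + 1) j, fun k => (hZ (k + 1)).1 k, ?_, ?_⟩
  · funext k
    rw [← (hZ (k + 1)).2 k (by omega)]
    exact twDiff_congr hω hθ n fun j hj => hle j k hj
  · intro j hj
    have := hZ' 0 (j + 1) j (by omega)
    rw [zero_add] at this
    exact this

end BarBasis


/-! ## The Maurer-Cartan algebra -/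

section push

open Finsupp

variable {α β γ N : Type*} [AddCommGroup N] [Module ℝ N]

/-- The linear map induced by a map of bases. -/
def push (f : α → β) : (α →₀ ℝ) →ₗ[ℝ] (β →₀ ℝ) := lmapDomain ℝ ℝ f

@[simp] theorem push_single (f : α → β) (a : α) (r : ℝ) : push f (single a r) = single (f a) r :=
  mapDomain_single

theorem push_push (f : α → β) (g : β → γ) (z : α →₀ ℝ) : push g (push f z) = push (fun a => g (f a)) z :=
  mapDomain_comp.symm

theorem push_congr {f g : α → β} {z : α →₀ ℝ} (h : ∀ a ∈ z.support, f a = g a) :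
    push f z = push g z := mapDomain_congr h

theorem linearCombination_push (f : α → β) (g : β → N) (z : α →₀ ℝ) :
    linearCombination ℝ g (push f z) = linearCombination ℝ (fun a => g (f a)) z :=
  linearCombination_mapDomain' f g z

theorem linearCombination_single' (f : α → β) (z : α →₀ ℝ) :
    linearCombination ℝ (fun a => single (f a) (1 : ℝ)) z = push f z :=
  linearCombination_single_one f z

theorem mem_support_push {f : α → β} {z : α →₀ ℝ} {b : β} (h : b ∈ (push f z).support) :
    ∃ a ∈ z.support, f a = b := support_mapDomain_mem h

theorem mem_support_add' {y z : α →₀ ℝ} {b : α} (h : b ∈ (y + z).support) :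
    b ∈ y.support ∨ b ∈ z.support := by
  classical
  simpa using Finsupp.support_add h

theorem mem_support_sub' {y z : α →₀ ℝ} {b : α} (h : b ∈ (y - z).support) :
    b ∈ y.support ∨ b ∈ z.support := by
  classical
  simpa using Finsupp.support_sub h

theorem mem_support_single' {a b : α} {r : ℝ} (h : b ∈ (single a r).support) : b = a := by
  classical
  simpa using Finsupp.support_single_subset h

theorem mem_support_smul' {z : α →₀ ℝ} {b : α} {r : ℝ} (h : b ∈ (r • z).support) : b ∈ z.support :=
  Finsupp.support_smul h

theorem mem_support_linearCombination' {g : α → β →₀ ℝ} {z : α →₀ ℝ} {b : β}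
    (h : b ∈ (linearCombination ℝ g z).support) : ∃ a ∈ z.support, b ∈ (g a).support := by
  classical
  rw [linearCombination_apply] at h
  have := Finsupp.support_sum h
  simp only [Finset.mem_biUnion] at this
  obtain ⟨a, ha, hb⟩ := this
  exact ⟨a, ha, mem_support_smul' hb⟩

end push

/-- No tree of the forest is empty. -/
def GoodForest (F : List (List ℕ+)) : Prop := ∀ X ∈ F, X ≠ []

/-- Prepend a branch with `n` leaves to the first tree. -/
def consFirst (n : ℕ+) : List (List ℕ+) → List (List ℕ+)
  | [] => []
  | Y :: F => (n :: Y) :: F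

/-- Add `n` leaves to the first branch of a tree. -/
def addHead (n : ℕ+) : List ℕ+ → List ℕ+
  | [] => []
  | a :: Y => (n + a) :: Y

/-- Add `n` leaves to the first branch of the first tree. -/
def addFirst (n : ℕ+) : List (List ℕ+) → List (List ℕ+)
  | [] => []
  | Y :: F => addHead n Y :: F

theorem goodForest_induction {P : List (List ℕ+) → Prop} (nil : P [])
    (tree : ∀ n F, GoodForest F → P F → P ([n] :: F))
    (branch : ∀ n F, GoodForest F → F ≠ [] → P F → P (consFirst n F)) :
    ∀ F, GoodForest F → P F := by
  intro F
  induction F with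
  | nil => intro _; exact nil
  | cons X F ih =>
    intro h
    have hF : GoodForest F := fun X hX => h X (List.mem_cons_of_mem _ hX)
    induction X with
    | nil => exact absurd rfl (h [] List.mem_cons_self)
    | cons n Y ihY =>
      cases Y with
      | nil => exact tree n F hF (ih hF)
      | cons a Y =>
        have h' : GoodForest ((a :: Y) :: F) := by
          intro X hX
          rcases List.mem_cons.1 hX with rfl | hX
          · simp
          · exact hF X hX
        exact branch n _ h' (by simp) (ihY h')

section forestOperations

open Finsupp

variable (n : ℕ+) (F : List (List ℕ+))

@[simp] theorem treeOrder_nil : treeOrder [] = 0 := rfl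

@[simp] theorem treeOrder_cons (X : List ℕ+) : treeOrder (n :: X) = n + treeOrder X := by
  simp [treeOrder]

@[simp] theorem forestOrder_nil : forestOrder [] = 0 := rfl

@[simp] theorem forestOrder_cons (X : List ℕ+) :
    forestOrder (X :: F) = treeOrder X + forestOrder F := by
  simp [forestOrder]

@[simp] theorem forestDeg_nil : forestDeg [] = 0 := rfl

@[simp] theorem forestDeg_cons (X : List ℕ+) :
    forestDeg (X :: F) = 1 - X.length + forestDeg F := by
  simp [forestDeg]

theorem forestOrder_append (F' : List (List ℕ+)) :
    forestOrder (F ++ F') = forestOrder F + forestOrder F' := by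
  simp [forestOrder]

theorem forestDeg_append (F' : List (List ℕ+)) :
    forestDeg (F ++ F') = forestDeg F + forestDeg F' := by
  simp [forestDeg]

variable {F}

theorem goodForest_cons_singleton (hF : GoodForest F) : GoodForest ([n] :: F) := by
  intro X hX
  rcases List.mem_cons.1 hX with rfl | hX
  · simp
  · exact hF X hX

theorem goodForest_consFirst (hF : GoodForest F) : GoodForest (consFirst n F) := by
  cases F with
  | nil => exact hF
  | cons Y F =>
    intro X hX
    rcases List.mem_cons.1 hX with rfl | hX
    · simp
    · exact hF X (List.mem_cons_of_mem _ hX)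

theorem addHead_ne_nil {Y : List ℕ+} (h : Y ≠ []) : addHead n Y ≠ [] := by
  cases Y with
  | nil => exact h
  | cons a Y => simp [addHead]

theorem goodForest_addFirst (hF : GoodForest F) : GoodForest (addFirst n F) := by
  cases F with
  | nil => exact hF
  | cons Y F =>
    intro X hX
    rcases List.mem_cons.1 hX with rfl | hX
    · exact addHead_ne_nil n (hF Y List.mem_cons_self)
    · exact hF X (List.mem_cons_of_mem _ hX)

theorem consFirst_ne_nil (h : F ≠ []) : consFirst n F ≠ [] := by
  cases F with
  | nil => exact h
  | cons Y F => simp [consFirst]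

theorem addFirst_ne_nil (h : F ≠ []) : addFirst n F ≠ [] := by
  cases F with
  | nil => exact h
  | cons Y F => simp [addFirst]

theorem forestOrder_consFirst (h : F ≠ []) : forestOrder (consFirst n F) = n + forestOrder F := by
  cases F with
  | nil => exact absurd rfl h
  | cons Y F => simp [consFirst, add_assoc]

theorem forestDeg_consFirst (h : F ≠ []) : forestDeg (consFirst n F) = forestDeg F - 1 := by
  cases F with
  | nil => exact absurd rfl h
  | cons Y F => simp [consFirst]; ring

theorem treeOrder_addHead {Y : List ℕ+} (h : Y ≠ []) :
    treeOrder (addHead n Y) = n + treeOrder Y := by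
  cases Y with
  | nil => exact absurd rfl h
  | cons a Y => simp [addHead, add_assoc]

@[simp] theorem length_addHead (Y : List ℕ+) : (addHead n Y).length = Y.length := by
  cases Y <;> simp [addHead]

theorem forestOrder_addFirst (hF : GoodForest F) (h : F ≠ []) :
    forestOrder (addFirst n F) = n + forestOrder F := by
  cases F with
  | nil => exact absurd rfl h
  | cons Y F => simp [addFirst, treeOrder_addHead n (hF Y List.mem_cons_self), add_assoc]

@[simp] theorem forestDeg_addFirst : forestDeg (addFirst n F) = forestDeg F := by
  cases F with
  | nil => rfl
  | cons Y F => simp [addFirst]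

variable (F)

theorem addFirst_consFirst (a : ℕ+) : addFirst n (consFirst a F) = consFirst (n + a) F := by
  cases F <;> rfl

theorem addFirst_singleton (a : ℕ+) : addFirst n ([a] :: F) = [n + a] :: F := rfl

theorem addHead_addHead (a : ℕ+) (Y : List ℕ+) : addHead n (addHead a Y) = addHead (n + a) Y := by
  cases Y <;> simp [addHead, add_assoc]

theorem addFirst_addFirst (a : ℕ+) : addFirst n (addFirst a F) = addFirst (n + a) F := by
  cases F <;> simp [addFirst, addHead_addHead]

/-! ### The boundary -/

theorem bdryTree_singleton : bdryTree [n] = 0 := by simp [bdryTree]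

theorem bdryTree_cons_cons (a : ℕ+) (Y : List ℕ+) : bdryTree (n :: a :: Y)
    = single [[n], a :: Y] 1 - single [(n + a) :: Y] 1
      - push (consFirst n) (bdryTree (a :: Y)) := by
  simp only [bdryTree, List.length_cons, Nat.add_sub_cancel, map_sum, map_smul, map_sub, push_single]
  rw [sum_range_succ', add_comm, sub_eq_add_neg _ (Finset.sum _ _), ← sum_neg_distrib]
  congr 1
  · simp [mergeAt]
  · refine Finset.sum_congr rfl fun j _ => ?_
    rw [pow_succ]
    simp [consFirst, mergeAt]

theorem bdryForest_cons (X : List ℕ+) : bdryForest (X :: F)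
    = push (fun Y => Y ++ F) (bdryTree X)
      + sg (1 - X.length) • push (fun Y => X :: Y) (bdryForest F) := rfl

theorem bdryForest_singleton_cons :
    bdryForest ([n] :: F) = push (fun Y => [n] :: Y) (bdryForest F) := by
  rw [bdryForest_cons, bdryTree_singleton]
  simp

theorem bdryForest_consFirst (hF : GoodForest F) (h : F ≠ []) :
    bdryForest (consFirst n F)
      = single ([n] :: F) 1 - single (addFirst n F) 1 - push (consFirst n) (bdryForest F) := by
  cases F with
  | nil => exact absurd rfl h
  | cons X F =>
    cases X with
    | nil => exact absurd rfl (hF [] List.mem_cons_self)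
    | cons a Y =>
      simp only [consFirst, addFirst, addHead]
      have h1 : push (fun v => consFirst n v ++ F) (bdryTree (a :: Y))
          = push (fun v => consFirst n (v ++ F)) (bdryTree (a :: Y)) := by
        refine push_congr fun v hv => ?_
        have : v ≠ [] := by
          rintro rfl
          simp only [bdryTree] at hv
          have := Finsupp.support_finsetSum hv
          simp only [Finset.mem_biUnion] at this
          obtain ⟨j, -, hj⟩ := this
          rcases mem_support_sub' (mem_support_smul' hj) with h | h <;>
            simpa using mem_support_single' h
        cases v with
        | nil => exact absurd rfl this
        | cons Z v => rfl
      rw [bdryForest_cons, bdryForest_cons, bdryTree_cons_cons, map_sub, map_sub, push_single,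
        push_single, map_add, map_smul, push_push, push_push, push_push, h1,
        show (1 : ℤ) - ((n :: a :: Y).length : ℤ) = 1 - ((a :: Y).length : ℤ) - 1 by
          simp; ring,
        sg_sub, sg_one, mul_neg_one, neg_smul]
      simp only [consFirst, List.cons_append, List.nil_append]
      abel

theorem bdryForest_append (F' : List (List ℕ+)) : bdryForest (F ++ F')
    = push (fun Y => Y ++ F') (bdryForest F) + sg (forestDeg F) • push (fun Y => F ++ Y) (bdryForest F') := by
  induction F with
  | nil =>
    have : (fun Y : List (List ℕ+) => Y) = id := rfl
    simp [bdryForest, push, this]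
  | cons X F ih =>
    rw [List.cons_append, bdryForest_cons, ih, bdryForest_cons, map_add, map_add, map_smul, map_smul,
      push_push, push_push, push_push, push_push, smul_add, smul_smul, ← sg_add, forestDeg_cons,
      add_assoc]
    simp

variable {F}

theorem mem_bdryForest (hF : GoodForest F) : ∀ v ∈ (bdryForest F).support,
    GoodForest v ∧ forestOrder v = forestOrder F ∧ forestDeg v = forestDeg F + 1 ∧ v ≠ [] := by
  refine goodForest_induction (P := fun F => ∀ v ∈ (bdryForest F).support,
    GoodForest v ∧ forestOrder v = forestOrder F ∧ forestDeg v = forestDeg F + 1 ∧ v ≠ [])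
    ?_ ?_ ?_ F hF
  · simp [bdryForest]
  · intro n F hF ih v hv
    rw [bdryForest_singleton_cons] at hv
    obtain ⟨w, hw, rfl⟩ := mem_support_push hv
    obtain ⟨h1, h2, h3, h4⟩ := ih w hw
    exact ⟨goodForest_cons_singleton n h1, by simp [h2], by simp [h3], by simp⟩
  · intro n F hF h ih v hv
    rw [bdryForest_consFirst n F hF h] at hv
    rw [forestOrder_consFirst n h, forestDeg_consFirst n h]
    rcases mem_support_sub' hv with hv | hv
    · rcases mem_support_sub' hv with hv | hv <;> rw [mem_support_single' hv]
      · exact ⟨goodForest_cons_singleton n hF, by simp, by simp, by simp⟩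
      · exact ⟨goodForest_addFirst n hF, by simp [forestOrder_addFirst n hF h], by simp,
          addFirst_ne_nil n h⟩
    · obtain ⟨w, hw, rfl⟩ := mem_support_push hv
      obtain ⟨h1, h2, h3, h4⟩ := ih w hw
      exact ⟨goodForest_consFirst n h1, by rw [forestOrder_consFirst n h4, h2],
        by rw [forestDeg_consFirst n h4, h3]; ring, consFirst_ne_nil n h4⟩

theorem bdryForest_addFirst (hF : GoodForest F) :
    bdryForest (addFirst n F) = push (addFirst n) (bdryForest F) := by
  revert n
  refine goodForest_induction
    (P := fun F => ∀ n, bdryForest (addFirst n F) = push (addFirst n) (bdryForest F)) ?_ ?_ ?_ F hF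
  · intro n; simp [addFirst, bdryForest]
  · intro a F _ _ n
    rw [addFirst_singleton, bdryForest_singleton_cons, bdryForest_singleton_cons, push_push]
    rfl
  · intro a F hF h _ n
    rw [addFirst_consFirst, bdryForest_consFirst _ F hF h, bdryForest_consFirst _ F hF h, map_sub,
      map_sub, push_single, push_single, push_push]
    simp only [addFirst_consFirst, addFirst_addFirst, addFirst_singleton]

theorem linearCombination_bdryForest (hF : GoodForest F) :
    linearCombination ℝ bdryForest (bdryForest F) = 0 := by
  refine goodForest_induction (P := fun F => linearCombination ℝ bdryForest (bdryForest F) = 0)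
    ?_ ?_ ?_ F hF
  · simp [bdryForest]
  · intro n F _ ih
    rw [bdryForest_singleton_cons, linearCombination_push]
    simp only [bdryForest_singleton_cons]
    rw [← map_linearCombination', ih, map_zero]
  · intro n F hF h ih
    rw [bdryForest_consFirst _ F hF h, map_sub, map_sub, linearCombination_single,
      linearCombination_single, one_smul, one_smul, bdryForest_singleton_cons,
      bdryForest_addFirst n hF, linearCombination_push,
      linearCombination_congr (g' := fun v => single ([n] :: v) 1 - single (addFirst n v) 1
        - push (consFirst n) (bdryForest v))]
    · simp only [sub_eq_add_neg, linearCombination_add_fun, linearCombination_single']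
      have h1 : ∀ (g : List (List ℕ+) → List (List ℕ+) →₀ ℝ) z,
          linearCombination ℝ (fun v => - g v) z = - linearCombination ℝ g z := fun g z => by
        have := linearCombination_smul_right (-1) g z
        simpa using this
      rw [h1, h1, linearCombination_single', ← map_linearCombination', ih]
      simp
    · intro v hv
      obtain ⟨g1, -, -, g4⟩ := mem_bdryForest hF v hv
      exact bdryForest_consFirst n v g1 g4

/-! ### Doubling of leaves -/

variable (F)

theorem dupForest_cons_lt {X : List ℕ+} {i : ℕ} (h : i < treeOrder X) :
    dupForest i (X :: F) = dupTree i X :: F := by simp [dupForest, h]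

theorem dupForest_cons_ge {X : List ℕ+} {i : ℕ} (h : treeOrder X ≤ i) :
    dupForest i (X :: F) = X :: dupForest (i - treeOrder X) F := by simp [dupForest, h]

variable {n} in
theorem dupTree_cons_lt (Y : List ℕ+) {i : ℕ} (h : i < n) :
    dupTree i (n :: Y) = (n + 1) :: Y := by
  simp [dupTree, h]

variable {n} in
theorem dupTree_cons_ge (Y : List ℕ+) {i : ℕ} (h : n ≤ i) :
    dupTree i (n :: Y) = n :: dupTree (i - n) Y := by
  simp [dupTree, h]

theorem dupForest_singleton_lt {i : ℕ} (h : i < n) : dupForest i ([n] :: F) = [n + 1] :: F := by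
  simp [dupForest, dupTree, h]

theorem dupForest_singleton_ge {i : ℕ} (h : n ≤ i) :
    dupForest i ([n] :: F) = [n] :: dupForest (i - n) F := by
  simp [dupForest, h]

variable {F}

theorem dupForest_consFirst_lt (h : F ≠ []) {i : ℕ} (hi : i < n) :
    dupForest i (consFirst n F) = consFirst (n + 1) F := by
  cases F with
  | nil => exact absurd rfl h
  | cons X F => simp [consFirst, dupForest, dupTree, hi, Nat.lt_add_right]

theorem dupForest_consFirst_ge {i : ℕ} (hi : n ≤ i) :
    dupForest i (consFirst n F) = consFirst n (dupForest (i - n) F) := by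
  cases F with
  | nil => simp [consFirst, dupForest]
  | cons X F =>
    simp only [consFirst, dupForest, treeOrder_cons, dupTree, not_lt.2 hi, if_false]
    by_cases h : i - n < treeOrder X
    · rw [if_pos h, if_pos (by omega)]
    · rw [if_neg h, if_neg (by omega), Nat.sub_sub]

theorem dupForest_addFirst_lt (hF : GoodForest F) (h : F ≠ []) {i : ℕ} (hi : i < n) :
    dupForest i (addFirst n F) = addFirst (n + 1) F := by
  cases F with
  | nil => exact absurd rfl h
  | cons X F =>
    cases X with
    | nil => exact absurd rfl (hF [] List.mem_cons_self)
    | cons a Y =>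
      have h1 : i < (n : ℕ) + a := by omega
      simp [addFirst, addHead, dupForest, dupTree, h1, Nat.lt_add_right]
      ring

theorem dupForest_addFirst_ge (hF : GoodForest F) {i : ℕ} (hi : n ≤ i) :
    dupForest i (addFirst n F) = addFirst n (dupForest (i - n) F) := by
  cases F with
  | nil => simp [addFirst, dupForest]
  | cons X F =>
    cases X with
    | nil => exact absurd rfl (hF [] List.mem_cons_self)
    | cons a Y =>
      change dupForest i (((n + a) :: Y) :: F) = _
      have e : ((n + a : ℕ+) : ℕ) = n + a := rfl
      by_cases h : i - n < a
      · rw [dupForest_cons_lt _ (by simp; omega), dupForest_cons_lt _ (by simp; omega),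
          dupTree_cons_lt _ (by rw [e]; omega), dupTree_cons_lt _ h]
        simp [addFirst, addHead, add_assoc]
      · by_cases h' : i - n < a + treeOrder Y
        · rw [dupForest_cons_lt _ (by simp; omega), dupForest_cons_lt _ (by simp; omega),
            dupTree_cons_ge _ (by rw [e]; omega), dupTree_cons_ge _ (by omega), e, Nat.sub_sub]
          rfl
        · rw [dupForest_cons_ge _ (by simp; omega), dupForest_cons_ge _ (by simp; omega),
            Nat.sub_sub, treeOrder_cons, treeOrder_cons, e, add_assoc]
          rfl

theorem dupForest_ne_nil (h : F ≠ []) (i : ℕ) : dupForest i F ≠ [] := by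
  cases F with
  | nil => exact absurd rfl h
  | cons X F => simp only [dupForest]; split_ifs <;> simp

theorem dupForest_mem (hF : GoodForest F) : ∀ i < forestOrder F, GoodForest (dupForest i F) ∧
    forestOrder (dupForest i F) = forestOrder F + 1 ∧ forestDeg (dupForest i F) = forestDeg F := by
  refine goodForest_induction (P := fun F => ∀ i < forestOrder F, GoodForest (dupForest i F) ∧
    forestOrder (dupForest i F) = forestOrder F + 1 ∧ forestDeg (dupForest i F) = forestDeg F)
    ?_ ?_ ?_ F hF
  · simp
  · intro n F hF ih i hi
    rcases lt_or_ge i n with h | h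
    · rw [dupForest_singleton_lt n F h]
      exact ⟨goodForest_cons_singleton _ hF, by simp; ring, by simp⟩
    · rw [dupForest_singleton_ge n F h]
      obtain ⟨h1, h2, h3⟩ := ih (i - n) (by simp at hi; omega)
      exact ⟨goodForest_cons_singleton _ h1, by simp [h2]; ring, by simp [h3]⟩
  · intro n F hF hne ih i hi
    rw [forestOrder_consFirst n hne] at hi ⊢
    rcases lt_or_ge i n with h | h
    · rw [dupForest_consFirst_lt n hne h, forestOrder_consFirst _ hne, forestDeg_consFirst _ hne,
        forestDeg_consFirst _ hne]
      exact ⟨goodForest_consFirst _ hF, by simp; ring, rfl⟩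
    · rw [dupForest_consFirst_ge n h]
      obtain ⟨h1, h2, h3⟩ := ih (i - n) (by omega)
      have h4 := dupForest_ne_nil hne (i - n)
      rw [forestOrder_consFirst _ h4, forestDeg_consFirst _ h4, forestDeg_consFirst _ hne, h2, h3]
      exact ⟨goodForest_consFirst _ h1, by ring, rfl⟩

theorem dupForest_dupForest (hF : GoodForest F) : ∀ i j, i ≤ j → j < forestOrder F →
    dupForest i (dupForest j F) = dupForest (j + 1) (dupForest i F) := by
  refine goodForest_induction (P := fun F => ∀ i j, i ≤ j → j < forestOrder F →
    dupForest i (dupForest j F) = dupForest (j + 1) (dupForest i F)) ?_ ?_ ?_ F hF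
  · simp
  · intro n F hF ih i j hij hj
    simp only [forestOrder_cons, treeOrder_cons, treeOrder_nil, add_zero] at hj
    have e : ((n + 1 : ℕ+) : ℕ) = n + 1 := rfl
    rcases lt_or_ge j n with h | h
    · rw [dupForest_singleton_lt n F h, dupForest_singleton_lt _ F (by rw [e]; omega),
        dupForest_singleton_lt n F (by omega), dupForest_singleton_lt _ F (by rw [e]; omega)]
    · rw [dupForest_singleton_ge n F h]
      rcases lt_or_ge i n with h' | h'
      · rw [dupForest_singleton_lt n _ h', dupForest_singleton_lt n F h',
          dupForest_singleton_ge _ F (by rw [e]; omega), e, Nat.add_sub_add_right]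
      · rw [dupForest_singleton_ge n _ h', dupForest_singleton_ge n F h',
          dupForest_singleton_ge _ _ (by omega), ih _ _ (by omega) (by omega),
          show j - n + 1 = j + 1 - n by omega]
  · intro n F hF hne ih i j hij hj
    rw [forestOrder_consFirst n hne] at hj
    have e : ((n + 1 : ℕ+) : ℕ) = n + 1 := rfl
    rcases lt_or_ge j n with h | h
    · rw [dupForest_consFirst_lt n hne h, dupForest_consFirst_lt _ hne (by rw [e]; omega),
        dupForest_consFirst_lt n hne (by omega), dupForest_consFirst_lt _ hne (by rw [e]; omega)]
    · rw [dupForest_consFirst_ge n h]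
      rcases lt_or_ge i n with h' | h'
      · rw [dupForest_consFirst_lt n (dupForest_ne_nil hne _) h', dupForest_consFirst_lt n hne h',
          dupForest_consFirst_ge _ (by rw [e]; omega), e, Nat.add_sub_add_right]
      · rw [dupForest_consFirst_ge n h', dupForest_consFirst_ge n h',
          dupForest_consFirst_ge _ (by omega), ih _ _ (by omega) (by omega),
          show j - n + 1 = j + 1 - n by omega]

theorem bdryForest_dupForest (hF : GoodForest F) : ∀ i < forestOrder F,
    bdryForest (dupForest i F) = push (dupForest i) (bdryForest F) := by
  refine goodForest_induction (P := fun F => ∀ i < forestOrder F,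
    bdryForest (dupForest i F) = push (dupForest i) (bdryForest F)) ?_ ?_ ?_ F hF
  · simp
  · intro n F hF ih i hi
    rcases lt_or_ge i n with h | h
    · rw [dupForest_singleton_lt n F h, bdryForest_singleton_cons, bdryForest_singleton_cons,
        push_push]
      exact push_congr fun v _ => (dupForest_singleton_lt n v h).symm
    · rw [dupForest_singleton_ge n F h, bdryForest_singleton_cons, bdryForest_singleton_cons,
        push_push, ih (i - n) (by simp at hi; omega), push_push]
      exact push_congr fun v _ => (dupForest_singleton_ge n v h).symm
  · intro n F hF hne ih i hi
    rw [forestOrder_consFirst n hne] at hi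
    rcases lt_or_ge i n with h | h
    · rw [dupForest_consFirst_lt n hne h, bdryForest_consFirst _ F hF hne,
        bdryForest_consFirst _ F hF hne, map_sub, map_sub, push_single, push_single, push_push,
        dupForest_singleton_lt n F h, dupForest_addFirst_lt n hF hne h]
      congr 1
      exact push_congr fun v hv =>
        (dupForest_consFirst_lt n (mem_bdryForest hF v hv).2.2.2 h).symm
    · rw [dupForest_consFirst_ge n h, bdryForest_consFirst _ F hF hne,
        bdryForest_consFirst _ _ (dupForest_mem hF _ (by omega)).1 (dupForest_ne_nil hne _),
        map_sub, map_sub, push_single, push_single, push_push,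
        dupForest_singleton_ge n F h, dupForest_addFirst_ge n hF h, ih (i - n) (by omega), push_push]
      congr 1
      exact push_congr fun v hv => (dupForest_consFirst_ge n h).symm

variable (F)

theorem dupForest_append_lt (F' : List (List ℕ+)) : ∀ i < forestOrder F,
    dupForest i (F ++ F') = dupForest i F ++ F' := by
  induction F with
  | nil => simp
  | cons X F ih =>
    intro i hi
    rw [List.cons_append]
    rcases lt_or_ge i (treeOrder X) with h | h
    · rw [dupForest_cons_lt _ h, dupForest_cons_lt _ h, List.cons_append]
    · rw [dupForest_cons_ge _ h, dupForest_cons_ge _ h, ih _ (by simp at hi; omega),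
        List.cons_append]

theorem dupForest_append_ge (F' : List (List ℕ+)) (i : ℕ) :
    dupForest (forestOrder F + i) (F ++ F') = F ++ dupForest i F' := by
  induction F with
  | nil => simp
  | cons X F ih =>
    rw [List.cons_append, forestOrder_cons, add_assoc, dupForest_cons_ge _ (by omega),
      Nat.add_sub_cancel_left, ih, List.cons_append]

theorem goodForest_append {F F' : List (List ℕ+)} (h : GoodForest F) (h' : GoodForest F') :
    GoodForest (F ++ F') := by
  intro X hX
  rcases List.mem_append.1 hX with hX | hX
  · exact h X hX
  · exact h' X hX

end forestOperations

/-- The Maurer-Cartan algebra with a unit: the span of all short forests. -/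
def omegaUnital : BarBasis where
  carrier := List (List ℕ+)
  IsBasis := GoodForest
  order := forestOrder
  deg := forestDeg
  bdry := bdryForest
  dup := dupForest

theorem omegaUnital_isLawful : omegaUnital.IsLawful where
  bdry_mem _ hF v hv := ⟨(mem_bdryForest hF v hv).1, (mem_bdryForest hF v hv).2.1,
    (mem_bdryForest hF v hv).2.2.1⟩
  dup_mem _ hF := dupForest_mem hF
  dup_dup _ hF := dupForest_dupForest hF
  bdry_dup _ hF := bdryForest_dupForest hF
  bdry_bdry _ hF := linearCombination_bdryForest hF

theorem omegaBar_isLawful : omegaBar.IsLawful where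
  bdry_mem _ hF v hv := ⟨⟨(mem_bdryForest hF.2 v hv).2.2.2, (mem_bdryForest hF.2 v hv).1⟩,
    (mem_bdryForest hF.2 v hv).2.1, (mem_bdryForest hF.2 v hv).2.2.1⟩
  dup_mem _ hF i hi := ⟨⟨dupForest_ne_nil hF.1 i, (dupForest_mem hF.2 i hi).1⟩,
    (dupForest_mem hF.2 i hi).2⟩
  dup_dup _ hF := dupForest_dupForest hF.2
  bdry_dup _ hF := bdryForest_dupForest hF.2
  bdry_bdry _ hF := linearCombination_bdryForest hF.2

theorem omegaMul_isLawful : BarBasis.IsLawfulMul omegaMul where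
  mem u v hu hv := ⟨⟨List.append_ne_nil_of_left_ne_nil hu.1 v, goodForest_append hu.2 hv.2⟩,
    forestOrder_append u v, forestDeg_append u v⟩
  dup_left u v _ _ := dupForest_append_lt u v
  dup_right u v _ _ i _ := dupForest_append_ge u v i
  bdry_op u v _ _ := bdryForest_append u v

theorem forestOrder_pos {F : List (List ℕ+)} (hF : GoodForest F) (h : F ≠ []) : 0 < forestOrder F := by
  cases F with
  | nil => exact absurd rfl h
  | cons X F =>
    cases X with
    | nil => exact absurd rfl (hF [] List.mem_cons_self)
    | cons a Y => simp

theorem IsUniversalMC.zero {m : ℕ} (hm : 0 < m) {ω : ℕ → omegaBar.Pow m} (h : IsUniversalMC m ω) :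
    ω 0 = 0 := by
  rw [← Finsupp.support_eq_empty, eq_empty_iff_forall_notMem]
  intro u hu
  obtain ⟨h1, h2⟩ := (h.degree 0 hu).1 ⟨0, hm⟩
  exact (forestOrder_pos h1.2 h1.1).ne' h2

theorem omegaUnital_isLawfulBimodule :
    BarBasis.IsLawfulBimodule omegaUnital omegaMul omegaMul where
  lawful := omegaUnital_isLawful
  left := {
    mem := fun u v hu hv => ⟨goodForest_append hu.2 hv, forestOrder_append u v,
      forestDeg_append u v⟩
    dup_left := fun u v _ _ => dupForest_append_lt u v
    dup_right := fun u v _ _ i _ => dupForest_append_ge u v i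
    bdry_op := fun u v _ _ => bdryForest_append u v }
  right := {
    mem := fun u v hu hv => ⟨goodForest_append hu hv.2, forestOrder_append u v,
      forestDeg_append u v⟩
    dup_left := fun u v _ _ => dupForest_append_lt u v
    dup_right := fun u v _ _ i _ => dupForest_append_ge u v i
    bdry_op := fun u v _ _ => bdryForest_append u v }
  left_left A B u := List.append_assoc A B u
  right_right u A B := List.append_assoc u A B
  left_right A u B := List.append_assoc A u B

/-! ### The contraction of the Maurer-Cartan algebra -/

section

open Finsupp

/-- The homotopy on forests: join the first two trees if the first has only one branch. -/
def forestS : List (List ℕ+) → (List (List ℕ+) →₀ ℝ)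
  | [n] :: Y :: F => single ((n :: Y) :: F) 1
  | _ => 0

/-- The map homotopic to the identity through `forestS`. -/
def forestF : List (List ℕ+) → (List (List ℕ+) →₀ ℝ)
  | [n] :: Y :: F => single (addFirst n (Y :: F)) 1
  | (n :: a :: Y) :: F => forestS (addFirst n ((a :: Y) :: F))
  | F => single F 1

/-- The number of branches of a forest. -/
def branches (F : List (List ℕ+)) : ℕ := (F.map List.length).sum

variable {F : List (List ℕ+)} (n : ℕ+)

theorem forestS_singleton (h : F ≠ []) : forestS ([n] :: F) = single (consFirst n F) 1 := by
  cases F with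
  | nil => exact absurd rfl h
  | cons Y F => rfl

theorem forestS_consFirst (hF : GoodForest F) : forestS (consFirst n F) = 0 := by
  cases F with
  | nil => rfl
  | cons X F =>
    cases X with
    | nil => exact absurd rfl (hF [] List.mem_cons_self)
    | cons a Y => rfl

theorem forestF_singleton (h : F ≠ []) : forestF ([n] :: F) = single (addFirst n F) 1 := by
  cases F with
  | nil => exact absurd rfl h
  | cons Y F => rfl

theorem forestF_consFirst (hF : GoodForest F) (h : F ≠ []) :
    forestF (consFirst n F) = forestS (addFirst n F) := by
  cases F with
  | nil => exact absurd rfl h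
  | cons X F =>
    cases X with
    | nil => exact absurd rfl (hF [] List.mem_cons_self)
    | cons a Y => rfl

theorem mem_forestS (hF : GoodForest F) : ∀ v ∈ (forestS F).support,
    GoodForest v ∧ forestOrder v = forestOrder F ∧ forestDeg v = forestDeg F - 1 ∧ v ≠ [] ∧
      branches v = branches F := by
  match F, hF with
  | [], _ => simp [forestS]
  | [] :: F, h => exact absurd rfl (h [] List.mem_cons_self)
  | (n :: a :: Y) :: F, _ => simp [forestS]
  | [[n]], _ => simp [forestS]
  | [n] :: Y :: F, h =>
    intro v hv
    have h' : GoodForest (Y :: F) := fun X hX => h X (List.mem_cons_of_mem _ hX)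
    rw [mem_support_single' hv]
    refine ⟨goodForest_consFirst n h', by simp [add_assoc], by simp; ring, by simp, ?_⟩
    simp [branches]
    ring

theorem mem_forestF (hF : GoodForest F) : ∀ v ∈ (forestF F).support,
    GoodForest v ∧ forestOrder v = forestOrder F ∧ forestDeg v = forestDeg F ∧ (F ≠ [] → v ≠ []) ∧
      (forestDeg F < 0 → branches v < branches F) := by
  match F, hF with
  | [], _ => 
    intro v hv
    rw [mem_support_single' hv]
    simp [GoodForest]
  | [] :: F, h => exact absurd rfl (h [] List.mem_cons_self)
  | [[n]], h =>
    intro v hv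
    rw [mem_support_single' hv]
    exact ⟨h, rfl, rfl, fun h => h, by simp⟩
  | (n :: a :: Y) :: F, h =>
    intro v hv
    have h' : GoodForest ((a :: Y) :: F) := by
      intro X hX
      rcases List.mem_cons.1 hX with rfl | hX
      · simp
      · exact h X (List.mem_cons_of_mem _ hX)
    obtain ⟨h1, h2, h3, h4, h5⟩ := mem_forestS (goodForest_addFirst n h') v hv
    refine ⟨h1, ?_, ?_, fun _ => h4, fun _ => ?_⟩
    · rw [h2, forestOrder_addFirst n h' (by simp)]; simp [add_assoc]
    · rw [h3, forestDeg_addFirst]; simp; ring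
    · rw [h5]; simp [branches, addFirst, addHead]
  | [n] :: Y :: F, h =>
    intro v hv
    have h' : GoodForest (Y :: F) := fun X hX => h X (List.mem_cons_of_mem _ hX)
    rw [mem_support_single' hv]
    refine ⟨goodForest_addFirst n h', ?_, by simp, fun _ => by simp [addFirst], fun _ => ?_⟩
    · rw [forestOrder_addFirst n h' (by simp)]; simp
    · simp [branches, addFirst]

theorem forest_homotopy (hF : GoodForest F) :
    linearCombination ℝ bdryForest (forestS F) + linearCombination ℝ forestS (bdryForest F)
      = single F 1 - forestF F := by
  refine goodForest_induction (P := fun F => linearCombination ℝ bdryForest (forestS F)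
    + linearCombination ℝ forestS (bdryForest F) = single F 1 - forestF F) ?_ ?_ ?_ F hF
  · simp [forestS, bdryForest, forestF]
  · intro n F hF _
    by_cases h : F = []
    · subst h
      simp [forestS, bdryTree_singleton, bdryForest, forestF]
    · rw [forestS_singleton n h, forestF_singleton n h, linearCombination_single, one_smul,
        bdryForest_consFirst n F hF h, bdryForest_singleton_cons, linearCombination_push,
        linearCombination_congr (g' := fun v => single (consFirst n v) 1)
          (fun v hv => forestS_singleton n (mem_bdryForest hF v hv).2.2.2),
        linearCombination_single']
      abel
  · intro n F hF h _
    rw [forestS_consFirst n hF, map_zero, zero_add, bdryForest_consFirst n F hF h, map_sub, map_sub,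
      linearCombination_single, linearCombination_single, one_smul, one_smul,
      forestS_singleton n h, forestF_consFirst n hF h, linearCombination_push,
      linearCombination_congr (g' := fun v => 0)
        (fun v hv => forestS_consFirst n (mem_bdryForest hF v hv).1)]
    simp [linearCombination_apply]

/-- The contraction of the unital Maurer-Cartan algebra. -/
def omegaUnitalContraction : BarBasis.Contraction omegaUnital where
  s := forestS
  f := forestF
  hasDeg_s _ hF v hv := ⟨(mem_forestS hF v hv).1, (mem_forestS hF v hv).2.1,
    (mem_forestS hF v hv).2.2.1⟩
  hasDeg_f _ hF v hv := ⟨(mem_forestF hF v hv).1, (mem_forestF hF v hv).2.1,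
    by rw [add_zero]; exact (mem_forestF hF v hv).2.2.1⟩
  homotopy _ hF := forest_homotopy hF
  size := branches
  size_lt _ hF hd v hv := (mem_forestF hF v hv).2.2.2.2 hd

end


/-! ## The Maurer-Cartan module -/

section marked

open Finsupp

/-- All trees of `A` and `B` are nonempty. -/
def GoodMarked (t : MarkedForest) : Prop := GoodForest t.left ∧ GoodForest t.right

/-- The order of a triple. -/
def markedOrder (t : MarkedForest) : ℕ :=
  forestOrder t.left + treeOrder t.mid + forestOrder t.right

/-- The degree of a triple. -/
def markedDeg (t : MarkedForest) : ℤ := forestDeg t.left - (t.mid.length : ℤ) + forestDeg t.right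

/-- The triple `(∅, ∅, B)`. -/
def markedOf (B : List (List ℕ+)) : MarkedForest := ⟨[], [], B⟩

/-- Prepend a tree with one branch. -/
def consTree (n : ℕ+) (u : MarkedForest) : MarkedForest := ⟨[n] :: u.left, u.mid, u.right⟩

/-- Prepend a branch with `n` leaves. -/
def consBranch (n : ℕ+) (u : MarkedForest) : MarkedForest :=
  if u.left = [] then ⟨[], n :: u.mid, u.right⟩ else ⟨consFirst n u.left, u.mid, u.right⟩

/-- The sign of `consBranch` in the differential. -/
def branchSign (u : MarkedForest) : ℝ := if u.left = [] then -1 else 1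

/-- `consBranch` with its sign. -/
def signedBranch (n : ℕ+) (u : MarkedForest) : MarkedForest →₀ ℝ :=
  single (consBranch n u) (branchSign u)

/-- Add `n` leaves to the first branch (if it belongs to `A` or `X`). -/
def addMarked (n : ℕ+) (u : MarkedForest) : MarkedForest →₀ ℝ :=
  if u.left = [] then if u.mid = [] then 0 else single ⟨[], addHead n u.mid, u.right⟩ 1
  else single ⟨addFirst n u.left, u.mid, u.right⟩ 1

/-- The triple `(∅, ∅, (n X) ∘ B)` if `A = ∅`. -/
def joinMarked (n : ℕ+) (u : MarkedForest) : MarkedForest →₀ ℝ :=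
  if u.left = [] then single (markedOf ((n :: u.mid) :: u.right)) 1 else 0

theorem goodMarked_induction {P : MarkedForest → Prop}
    (base : ∀ B, GoodForest B → P (markedOf B))
    (tree : ∀ n u, GoodMarked u → P u → P (consTree n u))
    (branch : ∀ n u, GoodMarked u → P u → P (consBranch n u)) :
    ∀ u, GoodMarked u → P u := by
  rintro ⟨A, X, B⟩ ⟨hA, hB⟩
  refine goodForest_induction (P := fun A => P ⟨A, X, B⟩) ?_ ?_ ?_ A hA
  · clear hA
    induction X with
    | nil => exact base B hB
    | cons n X ih => exact branch n ⟨[], X, B⟩ ⟨by simp [GoodForest], hB⟩ (ih hB)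
  · intro n F hF h
    exact tree n ⟨F, X, B⟩ ⟨hF, hB⟩ h
  · intro n F hF hne h
    have := branch n ⟨F, X, B⟩ ⟨hF, hB⟩ h
    rwa [consBranch, if_neg hne] at this

variable (n : ℕ+) (u : MarkedForest)

theorem goodMarked_markedOf {B : List (List ℕ+)} (hB : GoodForest B) : GoodMarked (markedOf B) :=
  ⟨by simp [markedOf, GoodForest], hB⟩

variable {u} in
theorem goodMarked_consTree (hu : GoodMarked u) : GoodMarked (consTree n u) :=
  ⟨goodForest_cons_singleton n hu.1, hu.2⟩

variable {u} in
theorem goodMarked_consBranch (hu : GoodMarked u) : GoodMarked (consBranch n u) := by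
  unfold consBranch
  split_ifs with h
  · exact ⟨by simp [GoodForest], hu.2⟩
  · exact ⟨goodForest_consFirst n hu.1, hu.2⟩

@[simp] theorem markedOrder_consTree : markedOrder (consTree n u) = n + markedOrder u := by
  simp [markedOrder, consTree]; ring

@[simp] theorem markedDeg_consTree : markedDeg (consTree n u) = markedDeg u := by
  simp [markedDeg, consTree]

@[simp] theorem markedOrder_consBranch : markedOrder (consBranch n u) = n + markedOrder u := by
  unfold consBranch
  split_ifs with h
  · simp [markedOrder, h]; ring
  · simp [markedOrder, forestOrder_consFirst n h]; ring

@[simp] theorem markedDeg_consBranch : markedDeg (consBranch n u) = markedDeg u - 1 := by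
  unfold consBranch
  split_ifs with h
  · simp [markedDeg, h]; ring
  · simp [markedDeg, forestDeg_consFirst n h]; ring

theorem left_consBranch_eq_nil : (consBranch n u).left = [] ↔ u.left = [] := by
  unfold consBranch
  split_ifs with h
  · simp [h]
  · simp [h, consFirst_ne_nil n h]

theorem branchSign_mul_self : branchSign u * branchSign u = 1 := by
  unfold branchSign; split_ifs <;> norm_num

variable {u} in
theorem mem_addMarked (hu : GoodMarked u) : ∀ v ∈ (addMarked n u).support,
    GoodMarked v ∧ markedOrder v = n + markedOrder u ∧ markedDeg v = markedDeg u ∧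
      (v.left = [] ↔ u.left = []) := by
  intro v hv
  unfold addMarked at hv
  split_ifs at hv with h h'
  · simp at hv
  · rw [mem_support_single' hv]
    refine ⟨⟨by simp [GoodForest], hu.2⟩, ?_, ?_, by simp [h]⟩
    · simp [markedOrder, h, treeOrder_addHead n h']; ring
    · simp [markedDeg, h]
  · rw [mem_support_single' hv]
    refine ⟨⟨goodForest_addFirst n hu.1, hu.2⟩, ?_, ?_, by simp [h, addFirst_ne_nil n h]⟩
    · simp [markedOrder, forestOrder_addFirst n hu.1 h]; ring
    · simp [markedDeg]

variable {u} in
theorem mem_joinMarked (hu : GoodMarked u) : ∀ v ∈ (joinMarked n u).support,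
    GoodMarked v ∧ markedOrder v = n + markedOrder u ∧ markedDeg v = markedDeg u ∧
      u.left = [] := by
  intro v hv
  unfold joinMarked at hv
  split_ifs at hv with h
  · rw [mem_support_single' hv]
    refine ⟨goodMarked_markedOf ?_, ?_, ?_, h⟩
    · intro X hX
      rcases List.mem_cons.1 hX with rfl | hX
      · simp
      · exact hu.2 X hX
    · simp [markedOrder, markedOf, h]; ring
    · simp [markedDeg, markedOf, h]
  · simp at hv

/-! ### The boundary -/

/-- The part of the differential of a triple which affects the middle term. -/
def bdryMid (A : List (List ℕ+)) (X : List ℕ+) (B : List (List ℕ+)) : MarkedForest →₀ ℝ :=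
  ∑ i ∈ range X.length, (-1 : ℝ) ^ i • single ⟨A, X.take i, X.drop i :: B⟩ 1
    - ∑ i ∈ range X.length, single ⟨A ++ [X.take (i + 1)], X.drop (i + 1), B⟩ 1
    + ∑ j ∈ range (X.length - 1), (-1 : ℝ) ^ j • single ⟨A, mergeAt j X, B⟩ 1

theorem bdryMarked_mk (A : List (List ℕ+)) (X : List ℕ+) (B : List (List ℕ+)) :
    bdryMarked ⟨A, X, B⟩ = push (fun A => ⟨A, X, B⟩) (bdryForest A)
      + sg (forestDeg A) • bdryMid A X B
      + sg (forestDeg A - X.length) • push (fun B => ⟨A, X, B⟩) (bdryForest B) := rfl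

theorem bdryMarked_markedOf (B : List (List ℕ+)) :
    bdryMarked (markedOf B) = push markedOf (bdryForest B) := by
  rw [markedOf, bdryMarked_mk]
  simp only [bdryForest, map_zero, bdryMid]
  simp
  rfl

theorem bdryMarked_consTree :
    bdryMarked (consTree n u) = push (consTree n) (bdryMarked u) := by
  obtain ⟨A, X, B⟩ := u
  rw [consTree, bdryMarked_mk, bdryMarked_mk, bdryForest_singleton_cons, bdryMid, bdryMid]
  simp only [map_add, map_sub, map_sum, map_smul, push_push, push_single]
  simp [consTree]

theorem bdryMarked_consBranch_of_ne {A : List (List ℕ+)} (hA : GoodForest A) (h : A ≠ [])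
    (X : List ℕ+) (B : List (List ℕ+)) :
    bdryMarked (consBranch n ⟨A, X, B⟩) = single (consTree n ⟨A, X, B⟩) 1
      - addMarked n ⟨A, X, B⟩ - push (consBranch n) (bdryMarked ⟨A, X, B⟩) := by
  rw [consBranch, if_neg h, bdryMarked_mk, bdryMarked_mk, bdryForest_consFirst n A hA h,
    forestDeg_consFirst n h, addMarked, if_neg h, bdryMid, bdryMid]
  simp only [map_add, map_sub, map_sum, map_smul, push_push, push_single]
  have e1 : push (fun A : List (List ℕ+) => consBranch n ⟨A, X, B⟩) (bdryForest A)
      = push (fun A => ⟨consFirst n A, X, B⟩) (bdryForest A) :=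
    push_congr fun v hv => by rw [consBranch, if_neg (mem_bdryForest hA v hv).2.2.2]
  have e2 : ∀ X B, consBranch n ⟨A, X, B⟩ = ⟨consFirst n A, X, B⟩ := fun X B => by
    rw [consBranch, if_neg h]
  have e3 : ∀ Y X B, consBranch n ⟨A ++ [Y], X, B⟩ = ⟨consFirst n A ++ [Y], X, B⟩ :=
    fun Y X B => by
      rw [consBranch, if_neg (by simp)]
      cases A with
      | nil => exact absurd rfl h
      | cons => rfl
  have e4 : forestDeg A - 1 - X.length = forestDeg A - X.length - 1 := by ring
  simp only [e1, e2, e3, e4, sg_sub _ 1, sg_one, mul_neg_one, neg_smul]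
  simp only [consTree]
  abel

theorem bdryMarked_consBranch_nil (X : List ℕ+) (B : List (List ℕ+)) :
    bdryMarked (consBranch n ⟨[], X, B⟩) = - (single (consTree n ⟨[], X, B⟩) 1
      - addMarked n ⟨[], X, B⟩ - joinMarked n ⟨[], X, B⟩)
      + linearCombination ℝ (signedBranch n) (bdryMarked ⟨[], X, B⟩) := by
  have e2 : ∀ X B, signedBranch n ⟨[], X, B⟩ = - single ⟨[], n :: X, B⟩ 1 := fun X B => by
    rw [signedBranch, branchSign, consBranch, if_pos rfl, if_pos rfl, single_neg]
  have e3 : ∀ Y X B, signedBranch n ⟨[] ++ [Y], X, B⟩ = single ⟨[n :: Y], X, B⟩ 1 :=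
    fun Y X B => by
      rw [signedBranch, branchSign, consBranch, if_neg (by simp), if_neg (by simp)]
      rfl
  rw [consBranch, if_pos rfl, bdryMarked_mk, bdryMarked_mk, joinMarked, if_pos rfl, bdryMid,
    bdryMid]
  simp only [bdryForest, map_zero, forestDeg_nil, sg_zero, one_smul, map_add, map_sub, map_sum,
    map_smul, linearCombination_push, linearCombination_single, e2, e3, List.length_cons, zero_add]
  have e4 : linearCombination ℝ (fun a : List (List ℕ+) => -single ⟨[], n :: X, a⟩ (1 : ℝ))
      (bdryForest B) = - push (fun B : List (List ℕ+) => (⟨[], n :: X, B⟩ : MarkedForest)) (bdryForest B) := by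
    rw [← linearCombination_single']
    simpa using linearCombination_smul_right (-1 : ℝ)
      (fun a : List (List ℕ+) => single (⟨[], n :: X, a⟩ : MarkedForest) (1 : ℝ)) (bdryForest B)
  rw [e4, sum_range_succ', sum_range_succ']
  have e5 : sg (0 - ((X.length + 1 : ℕ) : ℤ)) = - sg (0 - X.length) := by
    rw [← sg_add_one]
    exact sg_congr (-1) (by push_cast; ring)
  have e6 : ∑ j ∈ range (X.length + 1 - 1), (-1 : ℝ) ^ j •
        (single (⟨[], mergeAt j (n :: X), B⟩ : MarkedForest) (1 : ℝ))
      = addMarked n ⟨[], X, B⟩ - ∑ j ∈ range (X.length - 1), (-1 : ℝ) ^ j •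
        (single (⟨[], n :: mergeAt j X, B⟩ : MarkedForest) (1 : ℝ)) := by
    cases X with
    | nil => simp [addMarked]
    | cons a X =>
      simp only [List.length_cons, Nat.add_sub_cancel, sum_range_succ' _ X.length]
      rw [add_comm, sub_eq_add_neg, ← sum_neg_distrib, addMarked, if_pos rfl, if_neg (by simp)]
      congr 1
      · simp [mergeAt, addHead]
      · refine Finset.sum_congr rfl fun j _ => ?_
        rw [pow_succ]
        simp [mergeAt]
  rw [e5, e6]
  simp only [List.take_succ_cons, List.drop_succ_cons, List.take_zero, List.drop_zero, pow_zero,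
    one_smul, pow_succ, mul_neg_one, neg_smul, sum_neg_distrib, smul_neg, consTree, markedOf,
    List.nil_append]
  abel

theorem mem_bdryMarked {u : MarkedForest} (hu : GoodMarked u) : ∀ v ∈ (bdryMarked u).support,
    GoodMarked v ∧ markedOrder v = markedOrder u ∧ markedDeg v = markedDeg u + 1 ∧
      (u.left ≠ [] → v.left ≠ []) := by
  refine goodMarked_induction (P := fun u => ∀ v ∈ (bdryMarked u).support,
    GoodMarked v ∧ markedOrder v = markedOrder u ∧ markedDeg v = markedDeg u + 1 ∧
      (u.left ≠ [] → v.left ≠ [])) ?_ ?_ ?_ u hu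
  · intro B hB v hv
    rw [bdryMarked_markedOf] at hv
    obtain ⟨w, hw, rfl⟩ := mem_support_push hv
    obtain ⟨h1, h2, h3, -⟩ := mem_bdryForest hB w hw
    exact ⟨goodMarked_markedOf h1, by simp [markedOrder, markedOf, h2],
      by simp [markedDeg, markedOf, h3], fun h => absurd rfl h⟩
  · intro n u hu ih v hv
    rw [bdryMarked_consTree] at hv
    obtain ⟨w, hw, rfl⟩ := mem_support_push hv
    obtain ⟨h1, h2, h3, -⟩ := ih w hw
    exact ⟨goodMarked_consTree n h1, by simp [h2], by simp [h3], fun _ => by simp [consTree]⟩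
  · intro n u hu ih v hv
    have key : v ∈ (single (consTree n u) (1 : ℝ)).support ∨ v ∈ (addMarked n u).support ∨
        v ∈ (joinMarked n u).support ∨ ∃ w ∈ (bdryMarked u).support, v = consBranch n w := by
      by_cases h : u.left = []
      · obtain ⟨A, X, B⟩ := u
        obtain rfl : A = [] := h
        rw [bdryMarked_consBranch_nil] at hv
        rcases mem_support_add' hv with hv | hv
        · rw [Finsupp.support_neg] at hv
          rcases mem_support_sub' hv with hv | hv
          · rcases mem_support_sub' hv with hv | hv
            · exact Or.inl hv
            · exact Or.inr (Or.inl hv)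
          · exact Or.inr (Or.inr (Or.inl hv))
        · obtain ⟨w, hw, hv⟩ := mem_support_linearCombination' hv
          exact Or.inr (Or.inr (Or.inr ⟨w, hw, mem_support_single' hv⟩))
      · obtain ⟨A, X, B⟩ := u
        rw [bdryMarked_consBranch_of_ne n hu.1 h] at hv
        rcases mem_support_sub' hv with hv | hv
        · rcases mem_support_sub' hv with hv | hv
          · exact Or.inl hv
          · exact Or.inr (Or.inl hv)
        · obtain ⟨w, hw, rfl⟩ := mem_support_push hv
          exact Or.inr (Or.inr (Or.inr ⟨w, hw, rfl⟩))
    rw [markedOrder_consBranch, markedDeg_consBranch, Ne, left_consBranch_eq_nil]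
    rcases key with hv | hv | hv | ⟨w, hw, rfl⟩
    · rw [mem_support_single' hv]
      exact ⟨goodMarked_consTree n hu, by simp, by simp, fun _ => by simp [consTree]⟩
    · obtain ⟨h1, h2, h3, h4⟩ := mem_addMarked n hu v hv
      exact ⟨h1, h2, by rw [h3]; ring, fun h => by rwa [Ne, h4]⟩
    · obtain ⟨h1, h2, h3, h4⟩ := mem_joinMarked n hu v hv
      exact ⟨h1, h2, by rw [h3]; ring, fun h => absurd h4 h⟩
    · obtain ⟨h1, h2, h3, h4⟩ := ih w hw
      exact ⟨goodMarked_consBranch n h1, by simp [h2], by simp [h3],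
        fun h => by rw [Ne, left_consBranch_eq_nil]; exact h4 h⟩

/-- The differential in the generic case. -/
theorem linearCombination_bdryMarked_signedBranch {u : MarkedForest} (hu : GoodMarked u) :
    linearCombination ℝ bdryMarked (signedBranch n u) = single (consTree n u) 1
      - addMarked n u - joinMarked n u - linearCombination ℝ (signedBranch n) (bdryMarked u) := by
  rw [signedBranch, linearCombination_single]
  by_cases h : u.left = []
  · obtain ⟨A, X, B⟩ := u
    obtain rfl : A = [] := h
    rw [branchSign, if_pos rfl, bdryMarked_consBranch_nil, neg_one_smul]
    abel
  · obtain ⟨A, X, B⟩ := u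
    rw [branchSign, if_neg h, one_smul, bdryMarked_consBranch_of_ne n hu.1 h, joinMarked,
      if_neg h, sub_zero, ← linearCombination_single']
    congr 1
    refine linearCombination_congr fun v hv => ?_
    rw [signedBranch, branchSign, if_neg ((mem_bdryMarked hu v hv).2.2.2 h)]

theorem bdryMarked_consBranch {u : MarkedForest} (hu : GoodMarked u) :
    bdryMarked (consBranch n u) = branchSign u • (single (consTree n u) 1
      - addMarked n u - joinMarked n u - linearCombination ℝ (signedBranch n) (bdryMarked u)) := by
  rw [← linearCombination_bdryMarked_signedBranch n hu, signedBranch, linearCombination_single,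
    smul_smul, branchSign_mul_self, one_smul]

theorem linearCombination_neg_fun {α N : Type*} [AddCommGroup N] [Module ℝ N] (g : α → N)
    (z : α →₀ ℝ) : linearCombination ℝ (fun a => - g a) z = - linearCombination ℝ g z := by
  simpa using linearCombination_smul_right (-1) g z

theorem linearCombination_sub_fun {α N : Type*} [AddCommGroup N] [Module ℝ N] (g g' : α → N)
    (z : α →₀ ℝ) : linearCombination ℝ (fun a => g a - g' a) z
      = linearCombination ℝ g z - linearCombination ℝ g' z := by
  simp only [sub_eq_add_neg, linearCombination_add_fun, linearCombination_neg_fun]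

theorem linearCombination_zero_fun {α N : Type*} [AddCommGroup N] [Module ℝ N]
    (z : α →₀ ℝ) : linearCombination ℝ (fun _ => (0 : N)) z = 0 := by
  simp [linearCombination_apply]

theorem addMarked_consTree (a : ℕ+) : addMarked n (consTree a u) = single (consTree (n + a) u) 1 := by
  rw [addMarked, if_neg (by simp [consTree])]
  rfl

theorem addMarked_signedBranch (a : ℕ+) :
    linearCombination ℝ (addMarked n) (signedBranch a u) = signedBranch (n + a) u := by
  rw [signedBranch, linearCombination_single, signedBranch, addMarked]
  by_cases h : u.left = []
  · simp [consBranch, h, addHead]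
  · simp [consBranch, h, consFirst_ne_nil, addFirst_consFirst]

theorem addMarked_addMarked (a : ℕ+) :
    linearCombination ℝ (addMarked n) (addMarked a u) = addMarked (n + a) u := by
  by_cases h : u.left = []
  · by_cases h' : u.mid = []
    · simp [addMarked, h, h']
    · simp [addMarked, h, h', addHead_ne_nil, addHead_addHead]
  · simp [addMarked, h, addFirst_ne_nil, addFirst_addFirst]

theorem addMarked_joinMarked (a : ℕ+) :
    linearCombination ℝ (addMarked n) (joinMarked a u) = 0 := by
  by_cases h : u.left = []
  · simp [joinMarked, h, addMarked, markedOf]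
  · simp [joinMarked, h]

/-- The term by which `addMarked n` and `joinMarked n` fail to commute with the differential. -/
def joinDefect (n : ℕ+) (u : MarkedForest) : MarkedForest →₀ ℝ :=
  if u.left = [] then if u.mid = [] then 0 else single (markedOf (addHead n u.mid :: u.right)) 1
  else 0

theorem linearCombination_bdryMarked_addMarked {u : MarkedForest} (hu : GoodMarked u) :
    ∀ n, linearCombination ℝ bdryMarked (addMarked n u)
      = linearCombination ℝ (addMarked n) (bdryMarked u) + joinDefect n u := by
  refine goodMarked_induction (P := fun u => ∀ n, linearCombination ℝ bdryMarked (addMarked n u)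
      = linearCombination ℝ (addMarked n) (bdryMarked u) + joinDefect n u) ?_ ?_ ?_ u hu
  · intro B hB n
    rw [bdryMarked_markedOf, linearCombination_push]
    simp [addMarked, joinDefect, markedOf, linearCombination_zero_fun]
  · intro a u hu _ n
    rw [addMarked_consTree, linearCombination_single, one_smul, bdryMarked_consTree,
      bdryMarked_consTree, linearCombination_push]
    simp only [addMarked_consTree]
    rw [linearCombination_single', joinDefect, if_neg (by simp [consTree]), add_zero]
  · intro a u hu _ n
    have h1 : addMarked n (consBranch a u) = single (consBranch (n + a) u) 1 := by
      have h := congrArg (fun z => branchSign u • z) (addMarked_signedBranch n u a)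
      simpa [signedBranch, linearCombination_single, smul_smul, branchSign_mul_self] using h
    have h2 : joinDefect n (consBranch a u) = - branchSign u • joinMarked (n + a) u := by
      rw [joinDefect, joinMarked, branchSign]
      by_cases h : u.left = []
      · simp [consBranch, h, addHead]
      · simp [consBranch, h, consFirst_ne_nil]
    rw [h1, linearCombination_single, one_smul, bdryMarked_consBranch _ hu,
      bdryMarked_consBranch _ hu, h2]
    simp only [map_smul, map_sub, linearCombination_single, addMarked_consTree, addMarked_addMarked,
      addMarked_joinMarked, one_smul, map_linearCombination', addMarked_signedBranch, smul_sub]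
    simp only [smul_zero, neg_smul]
    abel

theorem linearCombination_bdryMarked_joinMarked {u : MarkedForest} (hu : GoodMarked u) :
    ∀ n, linearCombination ℝ bdryMarked (joinMarked n u)
      = linearCombination ℝ (joinMarked n) (bdryMarked u) - joinDefect n u := by
  have hne : ∀ {u : MarkedForest}, GoodMarked u → u.left ≠ [] → ∀ n,
      linearCombination ℝ bdryMarked (joinMarked n u)
        = linearCombination ℝ (joinMarked n) (bdryMarked u) - joinDefect n u := by
    intro u hu h n
    have h0 : linearCombination ℝ (joinMarked n) (bdryMarked u) = 0 := by
      rw [linearCombination_congr (g' := fun _ => 0), linearCombination_zero_fun]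
      intro v hv
      rw [joinMarked, if_neg ((mem_bdryMarked hu v hv).2.2.2 h)]
    rw [h0, joinMarked, if_neg h, joinDefect, if_neg h]
    simp
  refine goodMarked_induction (P := fun u => ∀ n, linearCombination ℝ bdryMarked (joinMarked n u)
      = linearCombination ℝ (joinMarked n) (bdryMarked u) - joinDefect n u) ?_ ?_ ?_ u hu
  · intro B hB n
    rw [bdryMarked_markedOf, linearCombination_push]
    simp only [joinMarked, joinDefect, markedOf, if_true, sub_zero, linearCombination_single,
      one_smul]
    have := bdryMarked_markedOf ([n] :: B)
    rw [markedOf] at this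
    rw [this, bdryForest_singleton_cons, push_push, ← linearCombination_single']
    rfl
  · intro a u hu _ n
    exact hne (goodMarked_consTree a hu) (by simp [consTree]) n
  · intro a u hu ih n
    by_cases h : u.left = []
    swap
    · exact hne (goodMarked_consBranch a hu) (by rwa [Ne, left_consBranch_eq_nil]) n
    have ih := ih a
    obtain ⟨A, X, B⟩ := u
    obtain rfl : A = [] := h
    have hG : GoodForest ((a :: X) :: B) := by
      intro Y hY
      rcases List.mem_cons.1 hY with rfl | hY
      · simp
      · exact hu.2 Y hY
    let κ : MarkedForest → MarkedForest := fun v => markedOf (consFirst n v.right)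
    have e1 : joinMarked n (consBranch a ⟨[], X, B⟩)
        = single (markedOf (consFirst n ((a :: X) :: B))) 1 := rfl
    have e2 : joinMarked a ⟨[], X, B⟩ = single (markedOf ((a :: X) :: B)) 1 := rfl
    rw [e1, linearCombination_single, one_smul, bdryMarked_markedOf,
      bdryForest_consFirst n _ hG (by simp), map_sub, map_sub, push_single, push_single, push_push]
    have e3 : push (fun F => markedOf (consFirst n F)) (bdryForest ((a :: X) :: B))
        = push κ (linearCombination ℝ bdryMarked (joinMarked a ⟨[], X, B⟩)) := by
      rw [e2, linearCombination_single, one_smul, bdryMarked_markedOf, push_push]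
      rfl
    rw [e3, ih, bdryMarked_consBranch _ hu, branchSign, if_pos rfl]
    have e4 : linearCombination ℝ (joinMarked n) (joinMarked a ⟨[], X, B⟩)
        = single (markedOf ([n] :: (a :: X) :: B)) 1 := by
      rw [e2, linearCombination_single, one_smul]
      rfl
    have e5 : joinMarked n (consTree a ⟨[], X, B⟩) = 0 := by
      rw [joinMarked, if_neg (by simp [consTree])]
    have e6 : linearCombination ℝ (joinMarked n) (addMarked a ⟨[], X, B⟩)
        = push κ (joinDefect a ⟨[], X, B⟩) := by
      by_cases hX : X = []
      · simp [addMarked, joinDefect, hX]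
      · simp [addMarked, joinDefect, hX, joinMarked, κ, markedOf, consFirst]
    have e7 : ∀ v, linearCombination ℝ (joinMarked n) (signedBranch a v)
        = - push κ (joinMarked a v) := by
      intro v
      rw [signedBranch, linearCombination_single, branchSign]
      by_cases hv : v.left = []
      · simp [joinMarked, hv, consBranch, κ, markedOf, consFirst]
      · simp [joinMarked, hv, consBranch, consFirst_ne_nil]
    have e8 : joinDefect n (consBranch a ⟨[], X, B⟩)
        = single (markedOf (addFirst n ((a :: X) :: B))) 1 := rfl
    simp only [neg_one_smul, map_neg, map_sub, linearCombination_single, one_smul, e4, e5, e6,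
      map_linearCombination', e7, e8, linearCombination_neg_fun]
    abel

theorem linearCombination_bdryMarked_bdryMarked {u : MarkedForest} (hu : GoodMarked u) :
    linearCombination ℝ bdryMarked (bdryMarked u) = 0 := by
  refine goodMarked_induction (P := fun u => linearCombination ℝ bdryMarked (bdryMarked u) = 0)
    ?_ ?_ ?_ u hu
  · intro B hB
    rw [bdryMarked_markedOf, linearCombination_push]
    simp only [bdryMarked_markedOf]
    rw [← map_linearCombination', linearCombination_bdryForest hB, map_zero]
  · intro n u hu ih
    rw [bdryMarked_consTree, linearCombination_push]
    simp only [bdryMarked_consTree]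
    rw [← map_linearCombination', ih, map_zero]
  · intro n u hu ih
    rw [bdryMarked_consBranch n hu, map_smul, map_sub, map_sub, map_sub, linearCombination_single,
      one_smul, bdryMarked_consTree, linearCombination_bdryMarked_addMarked hu,
      linearCombination_bdryMarked_joinMarked hu, map_linearCombination',
      linearCombination_congr (fun v hv =>
        linearCombination_bdryMarked_signedBranch n (mem_bdryMarked hu v hv).1)]
    simp only [linearCombination_sub_fun, linearCombination_single']
    rw [← map_linearCombination', ih, map_zero]
    convert smul_zero _
    abel

/-! ### Doubling of leaves -/

theorem dupMarked_markedOf (i : ℕ) (B : List (List ℕ+)) :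
    dupMarked i (markedOf B) = markedOf (dupForest i B) := by
  simp [dupMarked, markedOf]

theorem dupMarked_consTree_lt {i : ℕ} (hi : i < n) :
    dupMarked i (consTree n u) = consTree (n + 1) u := by
  rw [dupMarked, if_pos (by simp [consTree]; omega)]
  exact congrArg (fun A => MarkedForest.mk A u.mid u.right) (dupForest_singleton_lt n _ hi)

theorem dupMarked_consTree_ge {i : ℕ} (hi : n ≤ i) :
    dupMarked i (consTree n u) = consTree n (dupMarked (i - n) u) := by
  simp only [dupMarked, consTree, forestOrder_cons, treeOrder_cons, treeOrder_nil, add_zero]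
  by_cases h : i - n < forestOrder u.left
  · rw [if_pos (by omega), if_pos h, dupForest_singleton_ge n _ hi]
  · rw [if_neg (by omega), if_neg h]
    by_cases h' : i - n < forestOrder u.left + treeOrder u.mid
    · rw [if_pos (by omega), if_pos h', Nat.sub_sub]
    · rw [if_neg (by omega), if_neg h', Nat.sub_sub, Nat.sub_sub, Nat.sub_sub, add_assoc]

theorem dupMarked_consBranch_lt {i : ℕ} (hi : i < n) :
    dupMarked i (consBranch n u) = consBranch (n + 1) u := by
  by_cases h : u.left = []
  · simp [dupMarked, consBranch, h, dupTree, hi, Nat.lt_add_right]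
  · simp only [dupMarked, consBranch, h, if_false]
    rw [if_pos (by rw [forestOrder_consFirst n h]; omega), dupForest_consFirst_lt n h hi]

theorem left_dupMarked_eq_nil (i : ℕ) : (dupMarked i u).left = [] ↔ u.left = [] := by
  unfold dupMarked
  split_ifs with h h'
  · have : u.left ≠ [] := by
      intro h'; simp [h'] at h
    simp [this, dupForest_ne_nil this]
  · rfl
  · rfl

theorem dupMarked_consBranch_ge {i : ℕ} (hi : n ≤ i) :
    dupMarked i (consBranch n u) = consBranch n (dupMarked (i - n) u) := by
  by_cases h : u.left = []
  · rw [consBranch, consBranch, if_pos h, if_pos ((left_dupMarked_eq_nil _ _).2 h)]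
    simp only [dupMarked, h, forestOrder_nil, Nat.not_lt_zero, if_false, treeOrder_cons, zero_add,
      Nat.sub_zero]
    by_cases h' : i - n < treeOrder u.mid
    · rw [if_pos (by omega), if_pos h', dupTree_cons_ge _ hi]
    · rw [if_neg (by omega), if_neg h', Nat.sub_sub]
  · rw [consBranch, consBranch, if_neg h, if_neg (by rwa [left_dupMarked_eq_nil])]
    simp only [dupMarked, forestOrder_consFirst n h]
    by_cases h1 : i - n < forestOrder u.left
    · rw [if_pos (by omega), if_pos h1, dupForest_consFirst_ge n hi]
    · rw [if_neg (by omega), if_neg h1]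
      by_cases h' : i - n < forestOrder u.left + treeOrder u.mid
      · rw [if_pos (by omega), if_pos h', Nat.sub_sub]
      · rw [if_neg (by omega), if_neg h', Nat.sub_sub, Nat.sub_sub, Nat.sub_sub, add_assoc]

theorem branchSign_dupMarked (i : ℕ) : branchSign (dupMarked i u) = branchSign u := by
  rw [branchSign, branchSign]
  simp only [left_dupMarked_eq_nil]

theorem push_dupMarked_signedBranch_lt {i : ℕ} (hi : i < n) :
    push (dupMarked i) (signedBranch n u) = signedBranch (n + 1) u := by
  rw [signedBranch, push_single, dupMarked_consBranch_lt n u hi, signedBranch]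

theorem push_dupMarked_signedBranch_ge {i : ℕ} (hi : n ≤ i) :
    push (dupMarked i) (signedBranch n u) = signedBranch n (dupMarked (i - n) u) := by
  rw [signedBranch, push_single, dupMarked_consBranch_ge n u hi, signedBranch,
    branchSign_dupMarked]

theorem dupMarked_mk_nil (i : ℕ) (X : List ℕ+) (B : List (List ℕ+)) : dupMarked i ⟨[], X, B⟩
    = if i < treeOrder X then ⟨[], dupTree i X, B⟩ else ⟨[], X, dupForest (i - treeOrder X) B⟩ := by
  simp [dupMarked]

theorem addMarked_of_signedBranch (a : ℕ+) :
    addMarked n (consBranch a u) = single (consBranch (n + a) u) 1 := by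
  have h := congrArg (fun z => branchSign u • z) (addMarked_signedBranch n u a)
  simpa [signedBranch, linearCombination_single, smul_smul, branchSign_mul_self] using h

theorem push_dupMarked_addMarked_lt {u : MarkedForest} (hu : GoodMarked u) {i : ℕ} (hi : i < n) :
    push (dupMarked i) (addMarked n u) = addMarked (n + 1) u := by
  refine goodMarked_induction (P := fun u =>
    push (dupMarked i) (addMarked n u) = addMarked (n + 1) u) ?_ ?_ ?_ u hu
  · intro B _
    simp [addMarked, markedOf]
  · intro a u _ _
    rw [addMarked_consTree, addMarked_consTree, push_single,
      dupMarked_consTree_lt _ _ (by rw [PNat.add_coe]; omega), add_right_comm]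
  · intro a u _ _
    rw [addMarked_of_signedBranch, addMarked_of_signedBranch, push_single,
      dupMarked_consBranch_lt _ _ (by rw [PNat.add_coe]; omega), add_right_comm]

theorem push_dupMarked_addMarked_ge {u : MarkedForest} (hu : GoodMarked u) {i : ℕ} (hi : n ≤ i) :
    push (dupMarked i) (addMarked n u) = addMarked n (dupMarked (i - n) u) := by
  refine goodMarked_induction (P := fun u =>
    push (dupMarked i) (addMarked n u) = addMarked n (dupMarked (i - n) u)) ?_ ?_ ?_ u hu
  · intro B _
    rw [dupMarked_markedOf]
    simp [addMarked, markedOf]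
  · intro a u _ _
    rw [addMarked_consTree, push_single]
    rcases lt_or_ge (i - n) a with h | h
    · rw [dupMarked_consTree_lt _ _ h, dupMarked_consTree_lt _ _ (by rw [PNat.add_coe]; omega),
        addMarked_consTree, add_assoc]
    · rw [dupMarked_consTree_ge _ _ h, dupMarked_consTree_ge _ _ (by rw [PNat.add_coe]; omega),
        addMarked_consTree, PNat.add_coe, Nat.sub_sub]
  · intro a u _ _
    rw [addMarked_of_signedBranch, push_single]
    rcases lt_or_ge (i - n) a with h | h
    · rw [dupMarked_consBranch_lt _ _ h, dupMarked_consBranch_lt _ _ (by rw [PNat.add_coe]; omega),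
        addMarked_of_signedBranch, add_assoc]
    · rw [dupMarked_consBranch_ge _ _ h, dupMarked_consBranch_ge _ _ (by rw [PNat.add_coe]; omega),
        addMarked_of_signedBranch, PNat.add_coe, Nat.sub_sub]

theorem push_dupMarked_joinMarked_lt {i : ℕ} (hi : i < n) :
    push (dupMarked i) (joinMarked n u) = joinMarked (n + 1) u := by
  by_cases h : u.left = []
  · rw [joinMarked, joinMarked, if_pos h, if_pos h, push_single, dupMarked_markedOf,
      dupForest_cons_lt _ (by simp; omega), dupTree_cons_lt _ hi]
  · simp [joinMarked, h]

theorem push_dupMarked_joinMarked_ge {i : ℕ} (hi : n ≤ i) :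
    push (dupMarked i) (joinMarked n u) = joinMarked n (dupMarked (i - n) u) := by
  by_cases h : u.left = []
  · obtain ⟨A, X, B⟩ := u
    obtain rfl : A = [] := h
    rw [joinMarked, joinMarked, if_pos rfl, if_pos ((left_dupMarked_eq_nil _ _).2 rfl), push_single,
      dupMarked_markedOf, dupMarked_mk_nil]
    by_cases h' : i - n < treeOrder X
    · rw [if_pos h', dupForest_cons_lt _ (by simp; omega), dupTree_cons_ge _ hi]
    · rw [if_neg h', dupForest_cons_ge _ (by simp; omega), treeOrder_cons, Nat.sub_sub]
  · rw [joinMarked, joinMarked, if_neg h, if_neg (by rwa [left_dupMarked_eq_nil]), map_zero]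

theorem dupMarked_mem {u : MarkedForest} (hu : GoodMarked u) : ∀ i < markedOrder u,
    GoodMarked (dupMarked i u) ∧ markedOrder (dupMarked i u) = markedOrder u + 1 ∧
      markedDeg (dupMarked i u) = markedDeg u ∧
      forestDeg (dupMarked i u).left = forestDeg u.left := by
  have hl : ∀ i, forestDeg (dupMarked i u).left = forestDeg u.left := by
    intro i
    unfold dupMarked
    split_ifs with h
    · exact (dupForest_mem hu.1 i h).2.2
    · rfl
    · rfl
  suffices ∀ i < markedOrder u,
    GoodMarked (dupMarked i u) ∧ markedOrder (dupMarked i u) = markedOrder u + 1 ∧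
      markedDeg (dupMarked i u) = markedDeg u from
    fun i hi => ⟨(this i hi).1, (this i hi).2.1, (this i hi).2.2, hl i⟩
  refine goodMarked_induction (P := fun u => ∀ i < markedOrder u,
    GoodMarked (dupMarked i u) ∧ markedOrder (dupMarked i u) = markedOrder u + 1 ∧
      markedDeg (dupMarked i u) = markedDeg u) ?_ ?_ ?_ u hu
  · intro B hB i hi
    obtain ⟨h1, h2, h3⟩ := dupForest_mem hB i (by simpa [markedOrder, markedOf] using hi)
    rw [dupMarked_markedOf]
    exact ⟨goodMarked_markedOf h1, by simp [markedOrder, markedOf, h2],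
      by simp [markedDeg, markedOf, h3]⟩
  · intro n u hu ih i hi
    rw [markedOrder_consTree] at hi
    rcases lt_or_ge i n with h | h
    · rw [dupMarked_consTree_lt n u h]
      exact ⟨goodMarked_consTree _ hu, by simp; ring, by simp⟩
    · rw [dupMarked_consTree_ge n u h]
      obtain ⟨h1, h2, h3⟩ := ih (i - n) (by omega)
      exact ⟨goodMarked_consTree _ h1, by simp [h2]; ring, by simp [h3]⟩
  · intro n u hu ih i hi
    rw [markedOrder_consBranch] at hi
    rcases lt_or_ge i n with h | h
    · rw [dupMarked_consBranch_lt n u h]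
      exact ⟨goodMarked_consBranch _ hu, by simp; ring, by simp⟩
    · rw [dupMarked_consBranch_ge n u h]
      obtain ⟨h1, h2, h3⟩ := ih (i - n) (by omega)
      exact ⟨goodMarked_consBranch _ h1, by simp [h2]; ring, by simp [h3]⟩

theorem dupMarked_dupMarked {u : MarkedForest} (hu : GoodMarked u) : ∀ i j, i ≤ j →
    j < markedOrder u → dupMarked i (dupMarked j u) = dupMarked (j + 1) (dupMarked i u) := by
  refine goodMarked_induction (P := fun u => ∀ i j, i ≤ j →
    j < markedOrder u → dupMarked i (dupMarked j u) = dupMarked (j + 1) (dupMarked i u)) ?_ ?_ ?_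
    u hu
  · intro B hB i j hij hj
    simp only [dupMarked_markedOf]
    rw [dupForest_dupForest hB i j hij (by simpa [markedOrder, markedOf] using hj)]
  · intro n u hu ih i j hij hj
    rw [markedOrder_consTree] at hj
    have e : ((n + 1 : ℕ+) : ℕ) = n + 1 := rfl
    rcases lt_or_ge j n with h | h
    · rw [dupMarked_consTree_lt n u h, dupMarked_consTree_lt _ u (by rw [e]; omega),
        dupMarked_consTree_lt n u (by omega), dupMarked_consTree_lt _ u (by rw [e]; omega)]
    · rw [dupMarked_consTree_ge n u h]
      rcases lt_or_ge i n with h' | h'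
      · rw [dupMarked_consTree_lt n _ h', dupMarked_consTree_lt n u h',
          dupMarked_consTree_ge _ u (by rw [e]; omega), e, Nat.add_sub_add_right]
      · rw [dupMarked_consTree_ge n _ h', dupMarked_consTree_ge n u h',
          dupMarked_consTree_ge _ _ (by omega), ih _ _ (by omega) (by omega),
          show j - n + 1 = j + 1 - n by omega]
  · intro n u hu ih i j hij hj
    rw [markedOrder_consBranch] at hj
    have e : ((n + 1 : ℕ+) : ℕ) = n + 1 := rfl
    rcases lt_or_ge j n with h | h
    · rw [dupMarked_consBranch_lt n u h, dupMarked_consBranch_lt _ u (by rw [e]; omega),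
        dupMarked_consBranch_lt n u (by omega), dupMarked_consBranch_lt _ u (by rw [e]; omega)]
    · rw [dupMarked_consBranch_ge n u h]
      rcases lt_or_ge i n with h' | h'
      · rw [dupMarked_consBranch_lt n _ h', dupMarked_consBranch_lt n u h',
          dupMarked_consBranch_ge _ u (by rw [e]; omega), e, Nat.add_sub_add_right]
      · rw [dupMarked_consBranch_ge n _ h', dupMarked_consBranch_ge n u h',
          dupMarked_consBranch_ge _ _ (by omega), ih _ _ (by omega) (by omega),
          show j - n + 1 = j + 1 - n by omega]

theorem bdryMarked_dupMarked {u : MarkedForest} (hu : GoodMarked u) : ∀ i < markedOrder u,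
    bdryMarked (dupMarked i u) = push (dupMarked i) (bdryMarked u) := by
  refine goodMarked_induction (P := fun u => ∀ i < markedOrder u,
    bdryMarked (dupMarked i u) = push (dupMarked i) (bdryMarked u)) ?_ ?_ ?_ u hu
  · intro B hB i hi
    rw [dupMarked_markedOf, bdryMarked_markedOf, bdryMarked_markedOf,
      bdryForest_dupForest hB i (by simpa [markedOrder, markedOf] using hi), push_push, push_push]
    exact push_congr fun v _ => (dupMarked_markedOf i v).symm
  · intro n u hu ih i hi
    rw [markedOrder_consTree] at hi
    rcases lt_or_ge i n with h | h
    · rw [dupMarked_consTree_lt n u h, bdryMarked_consTree, bdryMarked_consTree, push_push]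
      exact push_congr fun v _ => (dupMarked_consTree_lt n v h).symm
    · rw [dupMarked_consTree_ge n u h, bdryMarked_consTree, bdryMarked_consTree,
        ih (i - n) (by omega), push_push, push_push]
      exact push_congr fun v _ => (dupMarked_consTree_ge n v h).symm
  · intro n u hu ih i hi
    rw [markedOrder_consBranch] at hi
    rcases lt_or_ge i n with h | h
    · rw [dupMarked_consBranch_lt n u h, bdryMarked_consBranch _ hu, bdryMarked_consBranch _ hu,
        map_smul, map_sub, map_sub, map_sub, push_single, dupMarked_consTree_lt n u h,
        push_dupMarked_addMarked_lt n hu h, push_dupMarked_joinMarked_lt n u h,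
        map_linearCombination']
      simp only [push_dupMarked_signedBranch_lt n _ h]
    · rw [dupMarked_consBranch_ge n u h, bdryMarked_consBranch _ (dupMarked_mem hu _ (by omega)).1,
        bdryMarked_consBranch _ hu, branchSign_dupMarked,
        map_smul, map_sub, map_sub, map_sub, push_single, dupMarked_consTree_ge n u h,
        push_dupMarked_addMarked_ge n hu h, push_dupMarked_joinMarked_ge n u h,
        map_linearCombination', ih (i - n) (by omega), linearCombination_push]
      simp only [push_dupMarked_signedBranch_ge n _ h]

end marked


section module

open Finsupp

theorem moduleBar_isLawful : moduleBar.IsLawful where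
  bdry_mem _ hu v hv := ⟨(mem_bdryMarked hu v hv).1, (mem_bdryMarked hu v hv).2.1,
    (mem_bdryMarked hu v hv).2.2.1⟩
  dup_mem _ hu i hi := ⟨(dupMarked_mem hu i hi).1, (dupMarked_mem hu i hi).2.1,
    (dupMarked_mem hu i hi).2.2.1⟩
  dup_dup _ hu := dupMarked_dupMarked hu
  bdry_dup _ hu := bdryMarked_dupMarked hu
  bdry_bdry _ hu := linearCombination_bdryMarked_bdryMarked hu

theorem bdryMarked_leftMul (F : List (List ℕ+)) (t : MarkedForest) :
    bdryMarked (leftMul F t) = push (fun F => leftMul F t) (bdryForest F)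
      + sg (forestDeg F) • push (leftMul F) (bdryMarked t) := by
  obtain ⟨A, X, B⟩ := t
  change bdryMarked ⟨F ++ A, X, B⟩ = push (fun F => ⟨F ++ A, X, B⟩) (bdryForest F)
    + sg (forestDeg F) • push (fun t => ⟨F ++ t.left, t.mid, t.right⟩) (bdryMarked ⟨A, X, B⟩)
  rw [bdryMarked_mk, bdryMarked_mk, bdryForest_append, bdryMid, bdryMid]
  simp only [map_add, map_sub, map_sum, map_smul, push_push, push_single, smul_add, smul_smul,
    forestDeg_append, List.append_assoc, ← sg_add, add_sub_assoc, add_assoc]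

theorem bdryMarked_rightMul (t : MarkedForest) (F : List (List ℕ+)) :
    bdryMarked (rightMul t F) = push (fun t => rightMul t F) (bdryMarked t)
      + sg (markedDeg t) • push (rightMul t) (bdryForest F) := by
  obtain ⟨A, X, B⟩ := t
  change bdryMarked ⟨A, X, B ++ F⟩ = push (fun t => ⟨t.left, t.mid, t.right ++ F⟩)
    (bdryMarked ⟨A, X, B⟩) + sg (markedDeg ⟨A, X, B⟩) • push (fun F => ⟨A, X, B ++ F⟩)
      (bdryForest F)
  rw [bdryMarked_mk, bdryMarked_mk, bdryForest_append, bdryMid, bdryMid, markedDeg]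
  simp only [map_add, map_sub, map_sum, map_smul, push_push, push_single, smul_add, smul_smul,
    ← sg_add, add_assoc, List.cons_append]

theorem dupMarked_leftMul_lt (F : List (List ℕ+)) (t : MarkedForest) {i : ℕ}
    (hi : i < forestOrder F) : dupMarked i (leftMul F t) = leftMul (dupForest i F) t := by
  obtain ⟨A, X, B⟩ := t
  change dupMarked i ⟨F ++ A, X, B⟩ = ⟨dupForest i F ++ A, X, B⟩
  rw [dupMarked, if_pos (by simp only [forestOrder_append]; omega), dupForest_append_lt F A i hi]

theorem dupMarked_leftMul_ge (F : List (List ℕ+)) (t : MarkedForest) (i : ℕ) :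
    dupMarked (forestOrder F + i) (leftMul F t) = leftMul F (dupMarked i t) := by
  obtain ⟨A, X, B⟩ := t
  change dupMarked (forestOrder F + i) ⟨F ++ A, X, B⟩ = ⟨F ++ (dupMarked i ⟨A, X, B⟩).left,
    (dupMarked i ⟨A, X, B⟩).mid, (dupMarked i ⟨A, X, B⟩).right⟩
  simp only [dupMarked, forestOrder_append]
  by_cases h : i < forestOrder A
  · rw [if_pos (by omega), if_pos h, dupForest_append_ge]
  · rw [if_neg (by omega), if_neg h]
    by_cases h' : i < forestOrder A + treeOrder X
    · rw [if_pos (by omega), if_pos h', Nat.add_sub_add_left]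
    · rw [if_neg (by omega), if_neg h', Nat.add_sub_add_left]

theorem dupMarked_rightMul_lt (t : MarkedForest) (F : List (List ℕ+)) {i : ℕ}
    (hi : i < markedOrder t) : dupMarked i (rightMul t F) = rightMul (dupMarked i t) F := by
  obtain ⟨A, X, B⟩ := t
  change dupMarked i ⟨A, X, B ++ F⟩ = ⟨(dupMarked i ⟨A, X, B⟩).left,
    (dupMarked i ⟨A, X, B⟩).mid, (dupMarked i ⟨A, X, B⟩).right ++ F⟩
  simp only [dupMarked]
  split_ifs with h h'
  · rfl
  · rfl
  · simp only [markedOrder] at hi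
    rw [dupForest_append_lt B F _ (by omega)]

theorem dupMarked_rightMul_ge (t : MarkedForest) (F : List (List ℕ+)) (i : ℕ) :
    dupMarked (markedOrder t + i) (rightMul t F) = rightMul t (dupForest i F) := by
  obtain ⟨A, X, B⟩ := t
  change dupMarked (forestOrder A + treeOrder X + forestOrder B + i) ⟨A, X, B ++ F⟩
    = ⟨A, X, B ++ dupForest i F⟩
  simp only [dupMarked]
  rw [if_neg (by omega), if_neg (by omega), ← dupForest_append_ge]
  congr 2
  omega

theorem markedOrder_leftMul (F : List (List ℕ+)) (t : MarkedForest) :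
    markedOrder (leftMul F t) = forestOrder F + markedOrder t := by
  change forestOrder (F ++ t.left) + _ + _ = forestOrder F + (_ + _ + _)
  rw [forestOrder_append]
  simp only [leftMul]
  ring

theorem markedDeg_leftMul (F : List (List ℕ+)) (t : MarkedForest) :
    markedDeg (leftMul F t) = forestDeg F + markedDeg t := by
  change forestDeg (F ++ t.left) - _ + _ = forestDeg F + (_ - _ + _)
  rw [forestDeg_append]
  simp only [leftMul]
  ring

theorem markedOrder_rightMul (t : MarkedForest) (F : List (List ℕ+)) :
    markedOrder (rightMul t F) = markedOrder t + forestOrder F := by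
  change _ + _ + forestOrder (t.right ++ F) = _ + _ + _ + forestOrder F
  rw [forestOrder_append]
  simp only [rightMul]
  ring

theorem markedDeg_rightMul (t : MarkedForest) (F : List (List ℕ+)) :
    markedDeg (rightMul t F) = markedDeg t + forestDeg F := by
  change _ - _ + forestDeg (t.right ++ F) = _ - _ + _ + forestDeg F
  rw [forestDeg_append]
  simp only [rightMul]
  ring

theorem moduleBar_isLawfulBimodule :
    BarBasis.IsLawfulBimodule moduleBar leftMul rightMul where
  lawful := moduleBar_isLawful
  left := {
    mem := fun F t hF ht => ⟨⟨goodForest_append hF.2 ht.1, ht.2⟩, markedOrder_leftMul F t,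
      markedDeg_leftMul F t⟩
    dup_left := fun F t _ _ _ hi => dupMarked_leftMul_lt F t hi
    dup_right := fun F t _ _ i _ => dupMarked_leftMul_ge F t i
    bdry_op := fun F t _ _ => bdryMarked_leftMul F t }
  right := {
    mem := fun t F ht hF => ⟨⟨ht.1, goodForest_append ht.2 hF.2⟩, markedOrder_rightMul t F,
      markedDeg_rightMul t F⟩
    dup_left := fun t F _ _ _ hi => dupMarked_rightMul_lt t F hi
    dup_right := fun t F _ _ i _ => dupMarked_rightMul_ge t F i
    bdry_op := fun t F _ _ => bdryMarked_rightMul t F }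
  left_left A B u := congrArg (fun C => MarkedForest.mk C u.mid u.right)
    (List.append_assoc A B u.left)
  right_right u A B := congrArg (fun C => MarkedForest.mk u.left u.mid C)
    (List.append_assoc u.right A B)
  left_right _ _ _ := rfl

/-! ### The contraction of the Maurer-Cartan module -/

/-- The homotopy on triples. -/
def markedS : MarkedForest → (MarkedForest →₀ ℝ)
  | ⟨[], [], B⟩ => push markedOf (forestS B)
  | ⟨[n] :: A, X, B⟩ => signedBranch n ⟨A, X, B⟩
  | _ => 0

/-- The map homotopic to the identity through `markedS`. -/
def markedF (u : MarkedForest) : MarkedForest →₀ ℝ :=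
  single u 1 - linearCombination ℝ bdryMarked (markedS u)
    - linearCombination ℝ markedS (bdryMarked u)

theorem markedS_markedOf (B : List (List ℕ+)) : markedS (markedOf B) = push markedOf (forestS B) :=
  rfl

theorem markedS_consTree (n : ℕ+) (u : MarkedForest) :
    markedS (consTree n u) = signedBranch n u := rfl

theorem markedS_consBranch (n : ℕ+) {u : MarkedForest} (hu : GoodMarked u) :
    markedS (consBranch n u) = 0 := by
  obtain ⟨A, X, B⟩ := u
  cases A with
  | nil => rfl
  | cons Y A =>
    cases Y with
    | nil => exact absurd rfl (hu.1 [] List.mem_cons_self)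
    | cons a Y => rfl

theorem markedS_signedBranch (n : ℕ+) {u : MarkedForest} (hu : GoodMarked u) :
    linearCombination ℝ markedS (signedBranch n u) = 0 := by
  rw [signedBranch, linearCombination_single, markedS_consBranch n hu, smul_zero]

theorem markedF_markedOf {B : List (List ℕ+)} (hB : GoodForest B) :
    markedF (markedOf B) = push markedOf (forestF B) := by
  have h := congrArg (push markedOf) (forest_homotopy hB)
  rw [map_add, map_sub, push_single, map_linearCombination', map_linearCombination'] at h
  rw [markedF, markedS_markedOf, bdryMarked_markedOf, linearCombination_push,
    linearCombination_push]
  simp only [bdryMarked_markedOf, markedS_markedOf]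
  rw [sub_sub, h, sub_sub_cancel]

theorem markedF_consTree (n : ℕ+) {u : MarkedForest} (hu : GoodMarked u) :
    markedF (consTree n u) = addMarked n u + joinMarked n u := by
  rw [markedF, markedS_consTree, linearCombination_bdryMarked_signedBranch n hu,
    bdryMarked_consTree, linearCombination_push]
  simp only [markedS_consTree]
  abel

theorem markedF_consBranch (n : ℕ+) {u : MarkedForest} (hu : GoodMarked u) :
    markedF (consBranch n u)
      = branchSign u • linearCombination ℝ markedS (addMarked n u + joinMarked n u) := by
  have h : branchSign u • signedBranch n u = single (consBranch n u) 1 := by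
    rw [signedBranch, smul_single, smul_eq_mul, branchSign_mul_self]
  rw [markedF, markedS_consBranch n hu, bdryMarked_consBranch n hu, map_smul, map_sub, map_sub,
    map_sub, linearCombination_single, markedS_consTree, map_linearCombination',
    linearCombination_congr (g' := fun _ => 0)
      (fun v hv => markedS_signedBranch n (mem_bdryMarked hu v hv).1),
    linearCombination_zero_fun, map_add]
  simp only [smul_sub, smul_add, one_smul, h, map_zero, smul_zero]
  abel

/-- The measure which is decreased by `markedF`. -/
def markedSize (u : MarkedForest) : ℕ := 2 * branches u.left + 2 * u.mid.length + branches u.right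

theorem branches_consFirst (n : ℕ+) {F : List (List ℕ+)} (h : F ≠ []) :
    branches (consFirst n F) = branches F + 1 := by
  cases F with
  | nil => exact absurd rfl h
  | cons X F => simp [branches, consFirst]; ring

theorem branches_addFirst (n : ℕ+) (F : List (List ℕ+)) : branches (addFirst n F) = branches F := by
  cases F with
  | nil => rfl
  | cons X F => simp [branches, addFirst, length_addHead]

theorem markedSize_consTree (n : ℕ+) (u : MarkedForest) :
    markedSize (consTree n u) = markedSize u + 2 := by
  simp [markedSize, consTree, branches]; ring

theorem markedSize_consBranch (n : ℕ+) (u : MarkedForest) :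
    markedSize (consBranch n u) = markedSize u + 2 := by
  unfold consBranch
  split_ifs with h
  · simp [markedSize, h]; ring
  · simp [markedSize, branches_consFirst n h]; ring

theorem markedSize_addMarked (n : ℕ+) (u : MarkedForest) : ∀ v ∈ (addMarked n u).support,
    markedSize v = markedSize u := by
  intro v hv
  unfold addMarked at hv
  split_ifs at hv with h h'
  · simp at hv
  · rw [mem_support_single' hv]
    simp [markedSize, h, length_addHead]
  · rw [mem_support_single' hv]
    simp [markedSize, branches_addFirst]

theorem markedSize_joinMarked (n : ℕ+) (u : MarkedForest) : ∀ v ∈ (joinMarked n u).support,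
    markedSize v < markedSize u + 2 := by
  intro v hv
  unfold joinMarked at hv
  split_ifs at hv with h
  · rw [mem_support_single' hv]
    simp [markedSize, markedOf, h, branches]
    omega
  · simp at hv

theorem mem_markedS {u : MarkedForest} (hu : GoodMarked u) : ∀ v ∈ (markedS u).support,
    GoodMarked v ∧ markedOrder v = markedOrder u ∧ markedDeg v = markedDeg u - 1 ∧
      markedSize v = markedSize u := by
  refine goodMarked_induction (P := fun u => ∀ v ∈ (markedS u).support,
    GoodMarked v ∧ markedOrder v = markedOrder u ∧ markedDeg v = markedDeg u - 1 ∧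
      markedSize v = markedSize u) ?_ ?_ ?_ u hu
  · intro B hB v hv
    obtain ⟨w, hw, rfl⟩ := mem_support_push hv
    obtain ⟨h1, h2, h3, -, h4⟩ := mem_forestS hB w hw
    exact ⟨goodMarked_markedOf h1, by simp [markedOrder, markedOf, h2],
      by simp [markedDeg, markedOf, h3], by simp [markedSize, markedOf, h4]⟩
  · intro n u hu _ v hv
    rw [markedS_consTree] at hv
    rw [mem_support_single' hv]
    exact ⟨goodMarked_consBranch n hu, by simp, by simp,
      by rw [markedSize_consBranch, markedSize_consTree]⟩
  · intro n u hu _ v hv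
    rw [markedS_consBranch n hu] at hv
    simp at hv

theorem markedSize_markedF {u : MarkedForest} (hu : GoodMarked u) (h : markedDeg u < 0) :
    ∀ v ∈ (markedF u).support, markedSize v < markedSize u := by
  refine goodMarked_induction (P := fun u => markedDeg u < 0 → ∀ v ∈ (markedF u).support,
    markedSize v < markedSize u) ?_ ?_ ?_ u hu h
  · intro B hB h v hv
    rw [markedF_markedOf hB] at hv
    obtain ⟨w, hw, rfl⟩ := mem_support_push hv
    have := (mem_forestF hB w hw).2.2.2.2 (by simpa [markedDeg, markedOf] using h)
    simpa [markedSize, markedOf, branches] using this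
  · intro n u hu _ _ v hv
    rw [markedF_consTree n hu] at hv
    rw [markedSize_consTree]
    rcases mem_support_add' hv with hv | hv
    · rw [markedSize_addMarked n u v hv]; omega
    · exact markedSize_joinMarked n u v hv
  · intro n u hu _ _ v hv
    rw [markedF_consBranch n hu] at hv
    rw [markedSize_consBranch]
    obtain ⟨w, hw, hv⟩ := mem_support_linearCombination' (mem_support_smul' hv)
    rcases mem_support_add' hw with hw | hw
    · rw [(mem_markedS (mem_addMarked n hu w hw).1 v hv).2.2.2, markedSize_addMarked n u w hw]
      omega
    · rw [(mem_markedS (mem_joinMarked n hu w hw).1 v hv).2.2.2]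
      exact markedSize_joinMarked n u w hw

theorem mem_markedF {u : MarkedForest} (hu : GoodMarked u) : ∀ v ∈ (markedF u).support,
    GoodMarked v ∧ markedOrder v = markedOrder u ∧ markedDeg v = markedDeg u := by
  intro v hv
  rcases mem_support_sub' hv with hv | hv
  · rcases mem_support_sub' hv with hv | hv
    · rw [mem_support_single' hv]
      exact ⟨hu, rfl, rfl⟩
    · obtain ⟨w, hw, hv⟩ := mem_support_linearCombination' hv
      obtain ⟨h1, h2, h3, -⟩ := mem_markedS hu w hw
      obtain ⟨h4, h5, h6, -⟩ := mem_bdryMarked h1 v hv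
      exact ⟨h4, by omega, by omega⟩
  · obtain ⟨w, hw, hv⟩ := mem_support_linearCombination' hv
    obtain ⟨h1, h2, h3, -⟩ := mem_bdryMarked hu w hw
    obtain ⟨h4, h5, h6, -⟩ := mem_markedS h1 v hv
    exact ⟨h4, by omega, by omega⟩

theorem marked_homotopy (u : MarkedForest) :
    linearCombination ℝ bdryMarked (markedS u) + linearCombination ℝ markedS (bdryMarked u)
      = single u 1 - markedF u := by
  rw [markedF]
  abel

/-- The contraction of the Maurer-Cartan module. -/
def moduleContraction : BarBasis.Contraction moduleBar where
  s := markedS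
  f := markedF
  hasDeg_s _ hu v hv := ⟨(mem_markedS hu v hv).1, (mem_markedS hu v hv).2.1,
    (mem_markedS hu v hv).2.2.1⟩
  hasDeg_f _ hu v hv := ⟨(mem_markedF hu v hv).1, (mem_markedF hu v hv).2.1,
    by rw [add_zero]; exact (mem_markedF hu v hv).2.2⟩
  homotopy u _ := marked_homotopy u
  size := markedSize
  size_lt _ hu hd v hv := markedSize_markedF hu hd v hv

end module


namespace BarBasis

open Finsupp

/-! ## Weighted maps of bases -/

/-- A map `u ↦ wt u • map u` compatible with the bigradings and the operators. -/
structure WMap (X Y : BarBasis) where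
  map : X.carrier → Y.carrier
  wt : X.carrier → ℝ
  mem : ∀ u, X.IsBasis u → wt u ≠ 0 →
    Y.IsBasis (map u) ∧ Y.order (map u) = X.order u ∧ Y.deg (map u) = X.deg u
  wt_dup : ∀ u, X.IsBasis u → ∀ i < X.order u, wt (X.dup i u) = wt u
  map_dup : ∀ u, X.IsBasis u → wt u ≠ 0 → ∀ i < X.order u, map (X.dup i u) = Y.dup i (map u)
  map_bdry : ∀ u, X.IsBasis u →
    linearCombination ℝ (fun v => single (map v) (wt v)) (X.bdry u) = wt u • Y.bdry (map u)

namespace WMap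

variable {X Y : BarBasis} {m : ℕ} (P : WMap X Y)

/-- The induced map of powers. -/
def pow (m : ℕ) : X.Pow m →ₗ[ℝ] Y.Pow m :=
  linearCombination ℝ fun u => single (fun i => P.map (u i)) (∏ i, P.wt (u i))

theorem pow_single (u : Fin m → X.carrier) :
    P.pow m (single u 1) = single (fun i => P.map (u i)) (∏ i, P.wt (u i)) := by
  simp [pow]

theorem pow_mem_piece {k : ℕ} {l : ℤ} {z : X.Pow m} (hz : z ∈ X.piece m k l) :
    P.pow m z ∈ Y.piece m k l := by
  refine piece_induction _ _ (fun u hu hl => ?_) hz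
  rw [pow_single]
  by_cases h : ∏ i, P.wt (u i) = 0
  · rw [h, single_zero]; exact Submodule.zero_mem _
  · have h' := fun i => P.mem (u i) (hu i).1 (prod_ne_zero_iff.1 h i (mem_univ i))
    refine single_mem_piece (fun i => ⟨(h' i).1, (h' i).2.1.trans (hu i).2⟩) ?_ _
    rw [← hl]
    exact Finset.sum_congr rfl fun i _ => (h' i).2.2

theorem degs_map {k : ℕ} {u : Fin m → X.carrier} (hu : X.IsPowBasis k u)
    (h : ∏ i, P.wt (u i) ≠ 0) : Y.degs (fun i => P.map (u i)) = X.degs u :=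
  funext fun i => (P.mem (u i) (hu i).1 (prod_ne_zero_iff.1 h i (mem_univ i))).2.2

theorem pow_ins (u : Fin m → X.carrier) (i : Fin m) (z : X.carrier →₀ ℝ) :
    P.pow m (ins u i z) = (∏ j ∈ univ \ {i}, P.wt (u j)) • ins (fun i => P.map (u i)) i
      (linearCombination ℝ (fun v => single (P.map v) (P.wt v)) z) := by
  rw [map_ins, map_linearCombination', ← linearCombination_smul_right]
  refine linearCombination_congr fun v _ => ?_
  have h1 : (fun j => P.map (Function.update u i v j))
      = Function.update (fun j => P.map (u j)) i (P.map v) :=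
    Function.comp_update P.map u i v
  have h2 : (fun j => P.wt (Function.update u i v j))
      = Function.update (fun j => P.wt (u j)) i (P.wt v) :=
    Function.comp_update P.wt u i v
  rw [pow_single, h1, h2, Finset.prod_update_of_mem (mem_univ i), ins_single, smul_single,
    smul_eq_mul, mul_comm]

theorem bdryPow_pow {k : ℕ} {l : ℤ} {z : X.Pow m} (hz : z ∈ X.piece m k l) :
    Y.bdryPow m (P.pow m z) = P.pow m (X.bdryPow m z) := by
  refine piece_ext (T := Y.bdryPow m ∘ₗ P.pow m) (T' := P.pow m ∘ₗ X.bdryPow m)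
    (fun u hu hl => ?_) hz
  simp only [LinearMap.comp_apply, bdryPow_eq_sum, LinearMap.sum_apply, map_sum, slotOp_single,
    map_smul, pow_ins]
  rw [pow_single, single_eq_smul]
  simp only [map_smul, slotOp_single]
  refine Finset.sum_congr rfl fun i _ => ?_
  rw [P.map_bdry _ (hu i).1, map_smul, smul_smul _ (P.wt (u i)), mul_comm _ (P.wt (u i)),
    Finset.sdiff_singleton_eq_erase, Finset.mul_prod_erase _ (fun i => P.wt (u i)) (mem_univ i),
    smul_comm]
  by_cases h : ∏ i, P.wt (u i) = 0
  · simp [h]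
  · rw [P.degs_map hu h]

theorem dupPow_pow {k : ℕ} {l : ℤ} {z : X.Pow m} (hz : z ∈ X.piece m k l) {i : ℕ} (hi : i < k) :
    Y.dupPow m i (P.pow m z) = P.pow m (X.dupPow m i z) := by
  refine piece_ext (T := Y.dupPow m i ∘ₗ P.pow m) (T' := P.pow m ∘ₗ X.dupPow m i)
    (fun u hu hl => ?_) hz
  have hi' : ∀ j, i < X.order (u j) := fun j => (hu j).2.symm ▸ hi
  simp only [LinearMap.comp_apply, dupPow_single, pow_single]
  simp only [P.wt_dup _ (hu _).1 i (hi' _)]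
  by_cases h : ∏ i, P.wt (u i) = 0
  · simp [h]
  · congr 1
    funext j
    exact (P.map_dup _ (hu j).1 (prod_ne_zero_iff.1 h j (mem_univ j)) i (hi' j)).symm

theorem dupAlt_pow {k : ℕ} {l : ℤ} {z : X.Pow m} (hz : z ∈ X.piece m k l) :
    Y.dupAlt m k (P.pow m z) = P.pow m (X.dupAlt m k z) := by
  rw [dupAlt_apply, dupAlt_apply, map_sum]
  refine Finset.sum_congr rfl fun i hi => ?_
  rw [map_smul, P.dupPow_pow hz (mem_range.1 hi)]

theorem dTot_pow {n : ℤ} {x : ℕ → X.Pow m} (hx : HasTotalDegree n x) :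
    dTot n (fun k => P.pow m (x k)) = fun k => P.pow m (dTot n x k) := by
  funext k
  cases k with
  | zero => exact P.bdryPow_pow (hx 0)
  | succ k => rw [dTot_succ, dTot_succ, P.bdryPow_pow (hx _), P.dupAlt_pow (hx k), map_add, map_smul]

theorem hasTotalDegree_pow {n : ℤ} {x : ℕ → X.Pow m} (hx : HasTotalDegree n x) :
    HasTotalDegree n (fun k => P.pow m (x k)) := fun k => P.pow_mem_piece (hx k)

/-- Compatibility with left and right actions. -/
structure IsEquivariant (P : WMap X Y) (L : omegaBar.carrier → X.carrier → X.carrier)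
    (R : X.carrier → omegaBar.carrier → X.carrier) (L' : omegaBar.carrier → Y.carrier → Y.carrier)
    (R' : Y.carrier → omegaBar.carrier → Y.carrier) : Prop where
  wt_left : ∀ A u, X.IsBasis u → P.wt (L A u) = P.wt u
  wt_right : ∀ u A, X.IsBasis u → P.wt (R u A) = P.wt u
  map_left : ∀ A u, X.IsBasis u → P.wt u ≠ 0 → P.map (L A u) = L' A (P.map u)
  map_right : ∀ u A, X.IsBasis u → P.wt u ≠ 0 → P.map (R u A) = R' (P.map u) A

variable {L : omegaBar.carrier → X.carrier → X.carrier}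
  {R : X.carrier → omegaBar.carrier → X.carrier} {L' : omegaBar.carrier → Y.carrier → Y.carrier}
  {R' : Y.carrier → omegaBar.carrier → Y.carrier}

variable {P} in
theorem IsEquivariant.mulL_left (h : P.IsEquivariant L R L' R') {k k' : ℕ} {l l' : ℤ}
    {a : omegaBar.Pow m} (ha : a ∈ omegaBar.piece m k l) {b : X.Pow m} (hb : b ∈ X.piece m k' l') :
    mulL m L' a (P.pow m b) = P.pow m (mulL m L a b) := by
  refine piece_ext₂ (T := (mulL m L').compl₂ (P.pow m)) (T' := (mulL m L).compr₂ (P.pow m))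
    (fun u v hu hl hv hl' => ?_) ha hb
  simp only [LinearMap.compl₂_apply, LinearMap.compr₂_apply, mulL_single, pow_single]
  rw [single_eq_smul _ (∏ i, P.wt (v i)), map_smul, mulL_single, single_eq_smul _ (sg _),
    single_eq_smul _ (sg _), map_smul, pow_single, smul_comm]
  simp only [h.wt_left _ _ (hv _).1]
  rw [single_eq_smul _ (∏ i, P.wt (v i))]
  by_cases h0 : ∏ i, P.wt (v i) = 0
  · simp [h0]
  · rw [P.degs_map hv h0]
    congr 3
    funext j
    exact (h.map_left _ _ (hv j).1 (prod_ne_zero_iff.1 h0 j (mem_univ j))).symm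

variable {P} in
theorem IsEquivariant.mulL_right (h : P.IsEquivariant L R L' R') {k k' : ℕ} {l l' : ℤ}
    {a : omegaBar.Pow m} (ha : a ∈ omegaBar.piece m k l) {b : X.Pow m} (hb : b ∈ X.piece m k' l') :
    mulL m R' (P.pow m b) a = P.pow m (mulL m R b a) := by
  refine piece_ext₂ (T := (mulL m R').comp (P.pow m)) (T' := (mulL m R).compr₂ (P.pow m))
    (fun v u hv hl' hu hl => ?_) hb ha
  simp only [LinearMap.comp_apply, LinearMap.compr₂_apply, mulL_single, pow_single]
  rw [single_eq_smul, map_smul, LinearMap.smul_apply, mulL_single, single_eq_smul _ (sg _),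
    single_eq_smul _ (sg _), map_smul, pow_single, smul_comm]
  simp only [h.wt_right _ _ (hv _).1]
  rw [single_eq_smul _ (∏ i, P.wt (v i))]
  by_cases h0 : ∏ i, P.wt (v i) = 0
  · simp [h0]
  · rw [P.degs_map hv h0]
    congr 3
    funext j
    exact (h.map_right _ _ (hv j).1 (prod_ne_zero_iff.1 h0 j (mem_univ j))).symm

variable {P} in
theorem IsEquivariant.twDiff_pow (h : P.IsEquivariant L R L' R') {ω θ : ℕ → omegaBar.Pow m}
    (hω : HasTotalDegree 1 ω) (hθ : HasTotalDegree 1 θ) {n : ℤ} {x : ℕ → X.Pow m}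
    (hx : HasTotalDegree n x) :
    twDiff L' R' ω θ n (fun k => P.pow m (x k)) = fun k => P.pow m (twDiff L R ω θ n x k) := by
  have h1 : star R' 1 (fun k => P.pow m (x k)) ω = fun k => P.pow m (star R 1 x ω k) := by
    funext k
    rw [star_apply, star_apply, map_sum]
    refine Finset.sum_congr rfl fun p _ => ?_
    rw [map_smul, h.mulL_right (hω _) (hx _)]
  have h2 : star L' n θ (fun k => P.pow m (x k)) = fun k => P.pow m (star L n θ x k) := by
    funext k
    rw [star_apply, star_apply, map_sum]
    refine Finset.sum_congr rfl fun p _ => ?_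
    rw [map_smul, h.mulL_left (hθ _) (hx _)]
  rw [twDiff, h1, h2, P.dTot_pow hx]
  funext k
  simp [twDiff]

end WMap

end BarBasis

/-! ## Existence and uniqueness of Maurer-Cartan morphisms -/

section morphisms

open Finsupp BarBasis

variable {m : ℕ} {ω θ : ℕ → omegaBar.Pow m} {x y h : ℕ → moduleBar.Pow m}

/-- The generator `T₀`. -/
def unitTriple : moduleBar.carrier := MarkedForest.mk [] [] []

theorem isBasis_unitTriple : moduleBar.IsBasis unitTriple ∧ moduleBar.order unitTriple = 0 :=
  ⟨⟨fun _ h => absurd h List.not_mem_nil, fun _ h => absurd h List.not_mem_nil⟩, rfl⟩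

/-- The generator `e = L₁`. -/
def unitTree : omegaBar.carrier := ([[1]] : List (List ℕ+))

/-- The triple `T₀ ∘ e`. -/
def unitTripleMul : moduleBar.carrier := MarkedForest.mk [] [] [[1]]

/-- The triple `e ∘ T₀`. -/
def mulUnitTriple : moduleBar.carrier := MarkedForest.mk [[1]] [] []

theorem isUniversalMCMorphism_iff : IsUniversalMCMorphism ω θ x ↔
    HasTotalDegree 0 x ∧ twDiff leftMul rightMul ω θ 0 x = 0 ∧
      x 0 = single (fun _ => unitTriple) 1 := by
  have key : (∀ k, BarBasis.star rightMul 1 x ω k - BarBasis.star leftMul 0 θ x k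
      = dTot 0 x k) ↔ twDiff leftMul rightMul ω θ 0 x = 0 := by
    rw [funext_iff]
    refine forall_congr' fun k => ?_
    simp only [twDiff, sg_zero, Pi.add_apply, Pi.sub_apply, one_smul, Pi.zero_apply]
    rw [← sub_eq_zero, ← neg_eq_zero]
    refine iff_of_eq (congrArg (· = 0) ?_)
    abel
  exact ⟨fun h => ⟨h.degree, key.1 h.equation, h.zero⟩, fun h => ⟨h.1, key.2 h.2.1, h.2.2⟩⟩

theorem isMCHomotopy_iff : IsMCHomotopy ω θ x y h ↔
    HasTotalDegree (-1) h ∧ twDiff leftMul rightMul ω θ (-1) h = x - y := by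
  have key : (∀ k, x k - y k = dTot (-1) h k + BarBasis.star rightMul 1 h ω k
      + BarBasis.star leftMul (-1) θ h k) ↔ twDiff leftMul rightMul ω θ (-1) h = x - y := by
    rw [funext_iff]
    refine forall_congr' fun k => ?_
    simp only [twDiff, sg_neg, sg_one, Pi.add_apply, Pi.sub_apply, Pi.smul_apply, neg_one_smul,
      sub_neg_eq_add]
    exact eq_comm
  exact ⟨fun h => ⟨h.degree, key.1 h.equation⟩, fun h => ⟨h.1, key.2 h.2⟩⟩

theorem twDiff_zero {Y : BarBasis} {L : omegaBar.carrier → Y.carrier → Y.carrier}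
    {R : Y.carrier → omegaBar.carrier → Y.carrier} (n : ℤ) : twDiff L R ω θ n 0 = 0 := by
  simpa using twDiff_smul (L := L) (R := R) (ω := ω) (θ := θ) n 0 0

theorem exists_mcHomotopy (hm : 0 < m) (hω : IsUniversalMC m ω) (hθ : IsUniversalMC m θ)
    (hx : IsUniversalMCMorphism ω θ x) (hy : IsUniversalMCMorphism ω θ y) :
    ∃ h, IsMCHomotopy ω θ x y h := by
  rw [isUniversalMCMorphism_iff] at hx hy
  obtain ⟨z, hz, hz', -⟩ := exists_twDiff_eq omegaBar_isLawful omegaMul_isLawful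
    moduleBar_isLawfulBimodule moduleContraction hω hθ (hω.zero hm) (hθ.zero hm) (n := -1)
    (c := x - y) (z := 0) (hx.1.sub hy.1)
    (by rw [show (-1 : ℤ) + 1 = 0 by norm_num, twDiff_sub, hx.2.1, hy.2.1, sub_zero])
    (fun k => Submodule.zero_mem _) 1 (by norm_num)
    (fun j hj => by
      obtain rfl : j = 0 := by omega
      rw [twDiff_zero, Pi.sub_apply, hx.2.2, hy.2.2]
      exact (sub_self _).symm)
  exact ⟨z, isMCHomotopy_iff.2 ⟨hz, hz'⟩⟩

theorem bdryPow_single_eq_zero {Y : BarBasis} {u : Fin m → Y.carrier} (h : ∀ i, Y.bdry (u i) = 0) :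
    Y.bdryPow m (single u 1) = 0 := by
  rw [bdryPow_eq_sum, LinearMap.sum_apply]
  refine sum_eq_zero fun i _ => ?_
  rw [slotOp_single, h, map_zero, smul_zero]

theorem hasTotalDegree_single_zero {Y : BarBasis} {n : ℤ} {z : Y.Pow m} (hz : z ∈ Y.piece m 0 n) :
    HasTotalDegree n (Pi.single 0 z : ℕ → Y.Pow m) := by
  intro k
  by_cases hk : k = 0
  · subst hk; simpa using hz
  · simp [hk]

/-- The twisted differential of a sequence concentrated in order zero. -/
theorem twDiff_single_zero_succ {Y : BarBasis} {L : omegaBar.carrier → Y.carrier → Y.carrier}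
    {R : Y.carrier → omegaBar.carrier → Y.carrier} (n : ℤ)
    (z : Y.Pow m) (k : ℕ) : twDiff L R ω θ n (Pi.single 0 z) (k + 1)
      = - sg n • mulL m R z (ω (k + 1)) + sg ((k + 1) * n) • mulL m L (θ (k + 1)) z := by
  have h1 : BarBasis.star R 1 (Pi.single 0 z) ω (k + 1) = mulL m R z (ω (k + 1)) := by
    rw [star_apply, Finset.sum_eq_single (0, k + 1)]
    · simp
    · rintro ⟨i, j⟩ hp hne
      rw [HasAntidiagonal.mem_antidiagonal] at hp
      have : i ≠ 0 := by
        rintro rfl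
        simp at hp
        exact hne (by rw [hp])
      simp [this]
    · simp
  have h2 : BarBasis.star L n θ (Pi.single 0 z) (k + 1)
      = sg ((k + 1) * n) • mulL m L (θ (k + 1)) z := by
    rw [star_apply, Finset.sum_eq_single (k + 1, 0)]
    · simp
    · rintro ⟨i, j⟩ hp hne
      rw [HasAntidiagonal.mem_antidiagonal] at hp
      have : j ≠ 0 := by
        rintro rfl
        simp at hp
        exact hne (by rw [hp])
      simp [this]
    · simp
  have h3 : dTot n (Pi.single 0 z) (k + 1) = 0 := by
    rw [dTot_succ]
    cases k with
    | zero => simp [dupAlt]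
    | succ k => simp
  simp only [twDiff, Pi.add_apply, Pi.sub_apply, Pi.smul_apply, h1, h2, h3, zero_sub, neg_smul]

theorem exists_mcMorphism (hm : 0 < m) (hω : IsUniversalMC m ω) (hθ : IsUniversalMC m θ) :
    ∃ x, IsUniversalMCMorphism ω θ x := by
  have hω0 := hω.zero hm
  have hθ0 := hθ.zero hm
  let T : Fin m → moduleBar.carrier := fun _ => unitTriple
  let z : ℕ → moduleBar.Pow m := Pi.single 0 (single T 1)
  have hT : single T 1 ∈ moduleBar.piece m 0 0 :=
    single_mem_piece (fun _ => isBasis_unitTriple) (Finset.sum_eq_zero fun i _ => rfl) 1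
  have hz : HasTotalDegree 0 z := hasTotalDegree_single_zero hT
  have h0 : ∀ j < 1, twDiff leftMul rightMul ω θ 0 z j = (0 : ℕ → moduleBar.Pow m) j := by
    intro j hj
    obtain rfl : j = 0 := by omega
    rw [twDiff_eq_bdryPow hω0 hθ0 0 (by simp)]
    simp only [z, Pi.single_eq_same]
    exact bdryPow_single_eq_zero fun i => by
      change bdryMarked (markedOf []) = 0
      rw [bdryMarked_markedOf]
      simp [bdryForest]
  have hb := bdryPow_sub_twDiff omegaBar_isLawful omegaMul_isLawful
    moduleBar_isLawfulBimodule hω hθ hω0 hθ0 (n := 0) (c := 0) (twDiff_zero _) hz h0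
  have hp := Submodule.sub_mem _ (Submodule.zero_mem _)
    (HasTotalDegree.twDiff moduleBar_isLawfulBimodule hω.degree hθ.degree hz 1)
  have e : (0 : ℕ → moduleBar.Pow m) 1 - twDiff leftMul rightMul ω θ 0 z 1
      = single (fun _ => unitTripleMul) 1
        - single (fun _ => mulUnitTriple) 1 := by
    rw [twDiff_single_zero_succ 0, zero_add, show ω 1 = single (fun _ => unitTree) 1 from hω.one,
      show θ 1 = single (fun _ => unitTree) 1 from hθ.one, mulL_single, mulL_single]
    have hd : moduleBar.degs T = 0 := rfl
    rw [hd, signForm_zero_left, signForm_zero_right]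
    have e1 : rightMul unitTriple unitTree = unitTripleMul := rfl
    have e2 : leftMul unitTree unitTriple = mulUnitTriple := rfl
    simp [T, e1, e2]
    abel
  rw [e] at hb
  rw [show (0 : moduleBar.Pow m) = (0 : ℕ → moduleBar.Pow m) 1 from rfl, e] at hp
  obtain ⟨y, hy, hy'⟩ := moduleContraction.exists_bdryPow_eq_single_sub moduleBar_isLawful
    (u := fun _ => unitTripleMul) (v := fun _ => mulUnitTriple) (w := fun _ => unitTripleMul)
    (by
      funext i
      change markedF (markedOf [[1]]) = _
      rw [markedF_markedOf (by simp [GoodForest])]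
      simp [forestF, markedOf, unitTripleMul]
      rfl)
    (by
      funext i
      change markedF (consTree 1 (markedOf [])) = _
      rw [markedF_consTree _ (goodMarked_markedOf (by simp [GoodForest]))]
      simp [addMarked, joinMarked, markedOf, unitTripleMul]
      rfl) hp hb
  obtain ⟨z1, h1, h2, h3⟩ := exists_twDiff_eq_step (L := leftMul) (R := rightMul) hω0 hθ0 hz h0
    ⟨y, by simpa using hy, by rw [e, hy']⟩
  obtain ⟨x, hx1, hx2, hx3⟩ := exists_twDiff_eq omegaBar_isLawful omegaMul_isLawful
    moduleBar_isLawfulBimodule moduleContraction hω hθ hω0 hθ0 (n := 0) (c := 0)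
    (fun k => Submodule.zero_mem _) (twDiff_zero _) h1 2 (by norm_num) h2
  refine ⟨x, isUniversalMCMorphism_iff.2 ⟨hx1, hx2, ?_⟩⟩
  rw [hx3 0 (by omega), h3 0 (by omega)]
  simp [z, T]

end morphisms


/-! ## The cylinder of the Maurer-Cartan module -/

section cylinder

open Finsupp hiding some
open BarBasis

/-- The homotopy term of a triple in the cylinder. -/
def cylJ (t : MarkedForest) : MarkedForest × Option Bool →₀ ℝ :=
  single (t, none) (sg (forestDeg t.left))

/-- The differential of the cylinder. -/
def bdryCyl : MarkedForest × Option Bool → (MarkedForest × Option Bool →₀ ℝ)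
  | (t, some b) => push (fun v => (v, some b)) (bdryMarked t)
  | (t, none) => sg (forestDeg t.left) • (single (t, some true) 1 - single (t, some false) 1
      - linearCombination ℝ cylJ (bdryMarked t))

/-- The degree in the cylinder. -/
def cylDeg : MarkedForest × Option Bool → ℤ
  | (t, some _) => markedDeg t
  | (t, none) => markedDeg t - 1

theorem bdryCyl_cylJ (t : MarkedForest) : linearCombination ℝ bdryCyl (cylJ t)
    = single (t, some true) 1 - single (t, some false) 1
      - linearCombination ℝ cylJ (bdryMarked t) := by
  rw [cylJ, linearCombination_single, bdryCyl, smul_smul, sg_mul_self, one_smul]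

/-- The cylinder of the Maurer-Cartan module. -/
def cylBar : BarBasis where
  carrier := MarkedForest × Option Bool
  IsBasis t := GoodMarked t.1
  order t := markedOrder t.1
  deg := cylDeg
  bdry := bdryCyl
  dup i t := (dupMarked i t.1, t.2)

theorem mem_bdryCyl {t : MarkedForest × Option Bool} (ht : GoodMarked t.1) :
    ∀ v ∈ (bdryCyl t).support, GoodMarked v.1 ∧ markedOrder v.1 = markedOrder t.1 ∧
      cylDeg v = cylDeg t + 1 := by
  obtain ⟨t, _ | b⟩ := t
  · intro v hv
    rcases mem_support_sub' (mem_support_smul' hv) with hv | hv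
    · have : v = (t, some true) ∨ v = (t, some false) :=
        (mem_support_sub' hv).imp mem_support_single' mem_support_single'
      rcases this with rfl | rfl
      · exact ⟨ht, rfl, by simp [cylDeg]⟩
      · exact ⟨ht, rfl, by simp [cylDeg]⟩
    · obtain ⟨w, hw, hv⟩ := mem_support_linearCombination' hv
      rw [mem_support_single' hv]
      obtain ⟨h1, h2, h3, -⟩ := mem_bdryMarked ht w hw
      exact ⟨h1, h2, by simp [cylDeg, h3]⟩
  · intro v hv
    obtain ⟨w, hw, rfl⟩ := mem_support_push hv
    obtain ⟨h1, h2, h3, -⟩ := mem_bdryMarked ht w hw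
    exact ⟨h1, h2, h3⟩

theorem push_dupMarked_cylJ {t : MarkedForest} (ht : GoodMarked t) {i : ℕ}
    (hi : i < markedOrder t) :
    push (fun v : MarkedForest × Option Bool => (dupMarked i v.1, v.2)) (cylJ t)
      = cylJ (dupMarked i t) := by
  rw [cylJ, push_single, cylJ, (dupMarked_mem ht i hi).2.2.2]

theorem cylBar_isLawful : cylBar.IsLawful where
  bdry_mem _ ht := mem_bdryCyl ht
  dup_mem := by
    rintro ⟨t, o⟩ ht i hi
    obtain ⟨h1, h2, h3, -⟩ := dupMarked_mem ht i hi
    refine ⟨h1, h2, ?_⟩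
    cases o with
    | none => exact congrArg (· - 1) h3
    | some b => exact h3
  dup_dup := by
    rintro ⟨t, o⟩ ht i j hij hj
    exact congrArg (fun v => (v, o)) (dupMarked_dupMarked ht i j hij hj)
  bdry_dup := by
    rintro ⟨t, _ | b⟩ ht i hi
    · change bdryCyl (dupMarked i t, none)
        = push (fun v : MarkedForest × Option Bool => (dupMarked i v.1, v.2)) (bdryCyl (t, none))
      rw [bdryCyl, bdryCyl, (dupMarked_mem ht i hi).2.2.2, bdryMarked_dupMarked ht i hi,
        linearCombination_push, map_smul, map_sub, map_sub, push_single, push_single,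
        map_linearCombination']
      congr 2
      refine linearCombination_congr fun v hv => ?_
      obtain ⟨h1, h2, -⟩ := mem_bdryMarked ht v hv
      rw [push_dupMarked_cylJ h1]
      rw [h2]
      exact hi
    · change push (fun v => (v, some b)) (bdryMarked (dupMarked i t))
        = push (fun v : MarkedForest × Option Bool => (dupMarked i v.1, v.2))
          (push (fun v => (v, some b)) (bdryMarked t))
      rw [bdryMarked_dupMarked ht i hi, push_push, push_push]
  bdry_bdry := by
    rintro ⟨t, _ | b⟩ ht
    · change linearCombination ℝ bdryCyl (bdryCyl (t, none)) = 0
      rw [bdryCyl, map_smul, map_sub, map_sub, linearCombination_single, linearCombination_single,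
        map_linearCombination']
      simp only [bdryCyl_cylJ, linearCombination_sub_fun, linearCombination_single', one_smul]
      rw [← map_linearCombination', linearCombination_bdryMarked_bdryMarked ht, map_zero, bdryCyl,
        bdryCyl]
      simp
    · change linearCombination ℝ bdryCyl (push (fun v => (v, some b)) (bdryMarked t)) = 0
      rw [linearCombination_push]
      simp only [bdryCyl]
      rw [← map_linearCombination', linearCombination_bdryMarked_bdryMarked ht, map_zero]

/-- The left action on triples. -/
def leftAct (F : List (List ℕ+)) (t : MarkedForest) : MarkedForest := ⟨F ++ t.left, t.mid, t.right⟩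

/-- The right action on triples. -/
def rightAct (t : MarkedForest) (F : List (List ℕ+)) : MarkedForest := ⟨t.left, t.mid, t.right ++ F⟩

theorem bdryMarked_leftAct (F : List (List ℕ+)) (t : MarkedForest) :
    bdryMarked (leftAct F t) = push (fun F => leftAct F t) (bdryForest F)
      + sg (forestDeg F) • push (leftAct F) (bdryMarked t) := bdryMarked_leftMul F t

theorem bdryMarked_rightAct (t : MarkedForest) (F : List (List ℕ+)) :
    bdryMarked (rightAct t F) = push (fun t => rightAct t F) (bdryMarked t)
      + sg (markedDeg t) • push (rightAct t) (bdryForest F) := bdryMarked_rightMul t F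

/-- The left action on the cylinder. -/
def cylLeft (F : omegaBar.carrier) (t : cylBar.carrier) : cylBar.carrier :=
  Prod.mk (leftAct F (Prod.fst (α := MarkedForest) (β := Option Bool) t))
    (Prod.snd (α := MarkedForest) (β := Option Bool) t)

/-- The right action on the cylinder. -/
def cylRight (t : cylBar.carrier) (F : omegaBar.carrier) : cylBar.carrier :=
  Prod.mk (rightAct (Prod.fst (α := MarkedForest) (β := Option Bool) t) F)
    (Prod.snd (α := MarkedForest) (β := Option Bool) t)

theorem cylJ_leftAct (F : List (List ℕ+)) (t : MarkedForest) : cylJ (leftAct F t)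
    = sg (forestDeg F) • push (fun v : MarkedForest × Option Bool => (leftAct F v.1, v.2))
      (cylJ t) := by
  rw [cylJ, cylJ, push_single, smul_single, smul_eq_mul, ← sg_add, ← forestDeg_append]
  rfl

theorem cylJ_rightAct (F : List (List ℕ+)) (t : MarkedForest) : cylJ (rightAct t F)
    = push (fun v : MarkedForest × Option Bool => (rightAct v.1 F, v.2)) (cylJ t) := by
  rw [cylJ, cylJ, push_single]
  rfl

theorem bdryCyl_left {F : List (List ℕ+)} (hF : GoodForest F) (t : MarkedForest × Option Bool) :
    bdryCyl (leftAct F t.1, t.2) = push (fun F => (leftAct F t.1, t.2)) (bdryForest F)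
      + sg (forestDeg F) • push (fun v => (leftAct F v.1, v.2)) (bdryCyl t) := by
  obtain ⟨t, _ | b⟩ := t
  · have h1 : linearCombination ℝ (fun A => cylJ (leftAct A t)) (bdryForest F)
        = - (sg (forestDeg F) * sg (forestDeg t.left)) •
          push (fun F => (leftAct F t, none)) (bdryForest F) := by
      rw [← linearCombination_single', ← linearCombination_smul_right]
      refine linearCombination_congr fun v hv => ?_
      rw [cylJ_leftAct, (mem_bdryForest hF v hv).2.2.1, sg_add_one, cylJ, push_single, smul_single,
        smul_single, smul_eq_mul, smul_eq_mul]
      congr 1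
      ring
    have h2 : forestDeg (leftAct F t).left = forestDeg F + forestDeg t.left := forestDeg_append F _
    simp only [bdryCyl]
    rw [bdryMarked_leftAct, map_add, linearCombination_push, h1, map_smul, linearCombination_push]
    simp only [cylJ_leftAct, linearCombination_smul_right]
    rw [← map_linearCombination', map_smul, map_sub, map_sub, push_single, push_single, h2, sg_add]
    have h3 := sg_mul_self (forestDeg F)
    have h4 := sg_mul_self (forestDeg t.left)
    simp only [smul_sub, smul_add, smul_smul, neg_smul, smul_neg]
    rw [h3, show sg (forestDeg F) * sg (forestDeg t.left) * (sg (forestDeg F) * sg (forestDeg t.left))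
      = 1 by linear_combination sg (forestDeg t.left) ^ 2 * h3 + h4, one_smul, mul_one]
    abel
  · simp only [bdryCyl]
    rw [bdryMarked_leftAct, map_add, map_smul, push_push, push_push, push_push]

theorem bdryCyl_right (t : MarkedForest × Option Bool) (F : List (List ℕ+)) :
    bdryCyl (rightAct t.1 F, t.2) = push (fun v => (rightAct v.1 F, v.2)) (bdryCyl t)
      + sg (cylDeg t) • push (fun F => (rightAct t.1 F, t.2)) (bdryForest F) := by
  obtain ⟨t, _ | b⟩ := t
  · have h1 : linearCombination ℝ (fun A => cylJ (rightAct t A)) (bdryForest F)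
        = sg (forestDeg t.left) • push (fun F => (rightAct t F, none)) (bdryForest F) := by
      rw [← linearCombination_single', ← linearCombination_smul_right]
      refine linearCombination_congr fun v _ => ?_
      rw [cylJ_rightAct, cylJ, push_single, smul_single, smul_eq_mul, mul_one]
    have h2 : forestDeg (rightAct t F).left = forestDeg t.left := rfl
    simp only [bdryCyl]
    rw [bdryMarked_rightAct, map_add, linearCombination_push, map_smul, linearCombination_push, h1]
    simp only [cylJ_rightAct]
    rw [← map_linearCombination', map_smul, map_sub, map_sub, push_single, push_single, h2]
    have h4 := sg_mul_self (forestDeg t.left)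
    have h5 : sg (cylDeg (t, none)) = - sg (markedDeg t) := by
      rw [cylDeg, sg_sub, sg_one, mul_neg_one]
    rw [h5]
    simp only [smul_sub, smul_add, smul_smul, neg_smul]
    rw [show sg (forestDeg t.left) * (sg (markedDeg t) * sg (forestDeg t.left)) = sg (markedDeg t) by
      linear_combination sg (markedDeg t) * h4]
    abel
  · simp only [bdryCyl, cylDeg]
    rw [bdryMarked_rightAct, map_add, map_smul, push_push, push_push, push_push]

theorem cylBar_isLawfulBimodule : IsLawfulBimodule cylBar cylLeft cylRight where
  lawful := cylBar_isLawful
  left := {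
    mem := by
      rintro F ⟨t, o⟩ hF ht
      obtain ⟨h1, h2, h3⟩ := moduleBar_isLawfulBimodule.left.mem F t hF ht
      refine ⟨h1, h2, ?_⟩
      cases o with
      | none => exact (congrArg (· - 1) h3).trans (add_sub_assoc _ _ _)
      | some b => exact h3
    dup_left := by
      rintro F ⟨t, o⟩ _ _ i hi
      exact congrArg (fun v => (v, o)) (dupMarked_leftMul_lt F t hi)
    dup_right := by
      rintro F ⟨t, o⟩ _ _ i _
      exact congrArg (fun v => (v, o)) (dupMarked_leftMul_ge F t i)
    bdry_op := fun F t hF _ => bdryCyl_left hF.2 t }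
  right := {
    mem := by
      rintro ⟨t, o⟩ F ht hF
      obtain ⟨h1, h2, h3⟩ := moduleBar_isLawfulBimodule.right.mem t F ht hF
      refine ⟨h1, h2, ?_⟩
      cases o with
      | none =>
        refine (congrArg (· - 1) h3).trans ?_
        change markedDeg t + forestDeg F - 1 = markedDeg t - 1 + forestDeg F
        ring
      | some b => exact h3
    dup_left := by
      rintro ⟨t, o⟩ F _ _ i hi
      exact congrArg (fun v => (v, o)) (dupMarked_rightMul_lt t F hi)
    dup_right := by
      rintro ⟨t, o⟩ F _ _ i _
      exact congrArg (fun v => (v, o)) (dupMarked_rightMul_ge t F i)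
    bdry_op := fun t F _ _ => bdryCyl_right t F }
  left_left A B u := congrArg (fun v => (v, u.2)) (moduleBar_isLawfulBimodule.left_left A B u.1)
  right_right u A B := congrArg (fun v => (v, u.2)) (moduleBar_isLawfulBimodule.right_right u.1 A B)
  left_right _ _ _ := rfl

/-- The homotopy on the cylinder. -/
def cylS : MarkedForest × Option Bool → (MarkedForest × Option Bool →₀ ℝ)
  | (t, some b) => (if b then cylJ t else 0) + push (fun v => (v, some false)) (markedS t)
  | (_, none) => 0

/-- The map homotopic to the identity through `cylS`. -/
def cylF : MarkedForest × Option Bool → (MarkedForest × Option Bool →₀ ℝ)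
  | (t, some _) => push (fun v => (v, some false)) (markedF t)
  | (_, none) => 0

theorem cylS_false (t : MarkedForest) :
    cylS (t, some false) = push (fun v => (v, some false)) (markedS t) := by
  simp [cylS]

theorem cylS_true (t : MarkedForest) :
    cylS (t, some true) = cylJ t + push (fun v => (v, some false)) (markedS t) := by
  simp [cylS]

theorem cylF_some (t : MarkedForest) (b : Bool) :
    cylF (t, some b) = push (fun v => (v, some false)) (markedF t) := rfl

theorem cylS_cylJ (t : MarkedForest) : linearCombination ℝ cylS (cylJ t) = 0 := by
  simp [cylJ, cylS]

theorem cyl_homotopy (t : MarkedForest × Option Bool) :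
    linearCombination ℝ bdryCyl (cylS t) + linearCombination ℝ cylS (bdryCyl t)
      = single t 1 - cylF t := by
  have hS : ∀ t, linearCombination ℝ bdryCyl (push (fun v => (v, some false)) (markedS t))
      + push (fun v => (v, some false)) (linearCombination ℝ markedS (bdryMarked t))
      = single (t, some false) 1 - push (fun v => (v, some false)) (markedF t) := by
    intro t
    have h := congrArg (push fun v => (v, some false)) (marked_homotopy t)
    rw [map_add, map_linearCombination', map_sub, push_single] at h
    rw [linearCombination_push]
    exact h
  obtain ⟨t, _ | _ | _⟩ := t
  · simp only [cylS, cylF, map_zero, zero_add, sub_zero]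
    rw [bdryCyl, map_smul, map_sub, map_sub, linearCombination_single, linearCombination_single,
      map_linearCombination']
    simp only [cylS_cylJ, linearCombination_zero_fun, cylS, one_smul, if_true]
    simp [cylJ, sg_mul_self]
  · rw [cylS_false, cylF_some, bdryCyl, linearCombination_push (fun v => (v, some false)) cylS]
    simp only [cylS_false]
    rw [← map_linearCombination', hS]
  · rw [cylS_true, cylF_some, bdryCyl, map_add, bdryCyl_cylJ,
      linearCombination_push (fun v => (v, some true)) cylS]
    simp only [cylS_true]
    rw [linearCombination_add_fun, ← map_linearCombination' (push fun v => (v, some false))]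
    have := hS t
    rw [← eq_sub_iff_add_eq] at this
    rw [this]
    abel

/-- The contraction of the cylinder. -/
def cylContraction : Contraction cylBar where
  s := cylS
  f := cylF
  hasDeg_s := by
    rintro ⟨t, _ | b⟩ ht v hv
    · exact absurd hv (Finset.notMem_empty v)
    · rcases mem_support_add' hv with hv | hv
      · have : v = (t, none) := by
          split_ifs at hv
          · exact mem_support_single' hv
          · exact absurd hv (Finset.notMem_empty v)
        subst this
        exact ⟨ht, rfl, rfl⟩
      · obtain ⟨w, hw, rfl⟩ := mem_support_push hv
        obtain ⟨h1, h2, h3, -⟩ := mem_markedS ht w hw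
        exact ⟨h1, h2, h3⟩
  hasDeg_f := by
    rintro ⟨t, _ | b⟩ ht v hv
    · exact absurd hv (Finset.notMem_empty v)
    · obtain ⟨w, hw, rfl⟩ := mem_support_push hv
      obtain ⟨h1, h2, h3⟩ := mem_markedF ht w hw
      exact ⟨h1, h2, h3.trans (add_zero _).symm⟩
  homotopy t _ := cyl_homotopy t
  size t := markedSize t.1
  size_lt := by
    rintro ⟨t, _ | b⟩ ht hd v hv
    · exact absurd hv (Finset.notMem_empty v)
    · obtain ⟨w, hw, rfl⟩ := mem_support_push hv
      exact markedSize_markedF ht hd w hw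

/-- The inclusion of an end of the cylinder. -/
def cylIncl (b : Bool) : WMap moduleBar cylBar where
  map t := ((t, some b) : MarkedForest × Option Bool)
  wt _ := 1
  mem _ hu _ := ⟨hu, rfl, rfl⟩
  wt_dup _ _ _ _ := rfl
  map_dup _ _ _ _ _ := rfl
  map_bdry u _ := by
    rw [one_smul]
    exact linearCombination_single' _ _

theorem cylIncl_isEquivariant (b : Bool) :
    (cylIncl b).IsEquivariant leftMul rightMul cylLeft cylRight where
  wt_left _ _ _ := rfl
  wt_right _ _ _ := rfl
  map_left _ _ _ _ := rfl
  map_right _ _ _ _ := rfl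

variable {m : ℕ} {ω θ : ℕ → omegaBar.Pow m} {x : ℕ → moduleBar.Pow m}

theorem exists_cyl_homotopy (hm : 0 < m) (hω : IsUniversalMC m ω) (hθ : IsUniversalMC m θ)
    (hx : IsUniversalMCMorphism ω θ x) : ∃ h : ℕ → cylBar.Pow m, HasTotalDegree (-1) h ∧
      twDiff cylLeft cylRight ω θ (-1) h
        = (fun k => (cylIncl true).pow m (x k)) - fun k => (cylIncl false).pow m (x k) := by
  rw [isUniversalMCMorphism_iff] at hx
  have hω0 := hω.zero hm
  have hθ0 := hθ.zero hm
  set c : ℕ → cylBar.Pow m := (fun k => (cylIncl true).pow m (x k)) -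
    fun k => (cylIncl false).pow m (x k) with hcdef
  have hc : HasTotalDegree 0 c :=
    ((cylIncl true).hasTotalDegree_pow hx.1).sub ((cylIncl false).hasTotalDegree_pow hx.1)
  have hc' : twDiff cylLeft cylRight ω θ 0 c = 0 := by
    rw [hcdef, twDiff_sub, (cylIncl_isEquivariant true).twDiff_pow hω.degree hθ.degree hx.1,
      (cylIncl_isEquivariant false).twDiff_pow hω.degree hθ.degree hx.1, hx.2.1]
    funext k
    simp
  have h0 : c 0 = single (fun _ => ((unitTriple, some true) : MarkedForest × Option Bool)) 1
      - single (fun _ => ((unitTriple, some false) : MarkedForest × Option Bool)) 1 := by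
    rw [hcdef, Pi.sub_apply, hx.2.2, WMap.pow_single, WMap.pow_single]
    simp [cylIncl]
    rfl
  have hF : ∀ b, cylF (unitTriple, some b) = single (unitTriple, some false) 1 := by
    intro b
    have : markedF unitTriple = single unitTriple 1 := by
      change markedF (markedOf []) = _
      rw [markedF_markedOf (by simp [GoodForest]), show forestF [] = single [] 1 by simp [forestF],
        push_single]
      rfl
    exact (congrArg (push fun v => (v, some false)) this).trans (push_single _ _ _)
  have hb : cylBar.bdryPow m (c 0) = 0 := by
    rw [← twDiff_eq_bdryPow (L := cylLeft) (R := cylRight) hω0 hθ0 0 (by simp), hc']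
    rfl
  have hp := hc 0
  rw [h0] at hp hb
  obtain ⟨y, hy, hy'⟩ := cylContraction.exists_bdryPow_eq_single_sub cylBar_isLawful
    (u := fun _ => ((unitTriple, some true) : MarkedForest × Option Bool))
    (v := fun _ => ((unitTriple, some false) : MarkedForest × Option Bool))
    (w := fun _ => ((unitTriple, some false) : MarkedForest × Option Bool))
    (funext fun _ => hF true) (funext fun _ => hF false) hp hb
  have hz : HasTotalDegree (-1) (Pi.single 0 y : ℕ → cylBar.Pow m) :=
    hasTotalDegree_single_zero (by simpa using hy)
  obtain ⟨h, h1, h2, -⟩ := exists_twDiff_eq omegaBar_isLawful omegaMul_isLawful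
    cylBar_isLawfulBimodule cylContraction hω hθ hω0 hθ0 (n := -1) (c := c)
    (by rw [neg_add_cancel]; exact hc) (by rw [neg_add_cancel]; exact hc') hz 1
    (by norm_num)
    (fun j hj => by
      obtain rfl : j = 0 := by omega
      rw [twDiff_eq_bdryPow hω0 hθ0 _ (by simp), Pi.single_eq_same, hy', h0]
      rfl)
  exact ⟨h, h1, h2⟩

end cylinder


/-! ## From the Maurer-Cartan module to the unital Maurer-Cartan algebra -/

section unital

open Finsupp BarBasis

theorem mergeAt_ne_nil (j : ℕ) {X : List ℕ+} (h : X ≠ []) : mergeAt j X ≠ [] := by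
  match j, X with
  | 0, [] => exact absurd rfl h
  | 0, [n] => simp [mergeAt]
  | 0, n :: n' :: X => simp [mergeAt]
  | j + 1, [] => exact absurd rfl h
  | j + 1, n :: X => simp [mergeAt]

theorem dupTree_eq_nil (i : ℕ) (X : List ℕ+) : dupTree i X = [] ↔ X = [] := by
  cases X with
  | nil => simp [dupTree]
  | cons n X => rw [dupTree]; split_ifs <;> simp

theorem mid_dupMarked_eq_nil (i : ℕ) (t : MarkedForest) :
    (dupMarked i t).mid = [] ↔ t.mid = [] := by
  unfold dupMarked
  split_ifs
  · rfl
  · exact dupTree_eq_nil _ _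
  · rfl

/-- The triple `(A, X, B)` goes to `A ∘ B` if `X` is empty and to zero otherwise. -/
def joinEnds (t : MarkedForest) : List (List ℕ+) →₀ ℝ :=
  single (t.left ++ t.right) (if t.mid = [] then 1 else 0)

theorem joinEnds_nil (A B : List (List ℕ+)) : joinEnds ⟨A, [], B⟩ = single (A ++ B) 1 := by
  simp [joinEnds]

theorem joinEnds_of_ne (A B : List (List ℕ+)) {X : List ℕ+} (h : X ≠ []) :
    joinEnds ⟨A, X, B⟩ = 0 := by
  simp [joinEnds, h]

theorem joinEnds_bdryMarked (t : MarkedForest) : linearCombination ℝ joinEnds (bdryMarked t)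
    = (if t.mid = [] then (1 : ℝ) else 0) • bdryForest (t.left ++ t.right) := by
  obtain ⟨A, X, B⟩ := t
  rw [bdryMarked_mk, map_add, map_add, map_smul, map_smul, linearCombination_push,
    linearCombination_push]
  by_cases h : X = []
  · subst h
    simp only [joinEnds_nil, linearCombination_single', bdryMid]
    rw [if_pos trivial, one_smul, bdryForest_append]
    simp
  · simp only [joinEnds_of_ne _ _ h, linearCombination_zero_fun]
    rw [if_neg h, zero_smul, smul_zero, add_zero, zero_add, bdryMid]
    obtain ⟨n, X, rfl⟩ := List.exists_cons_of_ne_nil h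
    simp only [map_add, map_sub, map_sum, map_smul, linearCombination_single, one_smul]
    rw [Finset.sum_eq_single 0, Finset.sum_eq_single X.length, Finset.sum_eq_zero]
    · simp [joinEnds_nil]
    · intro j hj
      rw [joinEnds_of_ne _ _ (mergeAt_ne_nil j h), smul_zero]
    · intro i hi hne
      rw [joinEnds_of_ne]
      have := mem_range.1 hi
      simp only [List.length_cons] at this
      simp
      omega
    · simp
    · intro i hi hne
      rw [joinEnds_of_ne, smul_zero]
      simp [hne]
    · simp

/-- The map which kills the triples with nonempty middle term. -/
def joinEndsMap : WMap moduleBar omegaUnital where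
  map t := (MarkedForest.left t ++ MarkedForest.right t : List (List ℕ+))
  wt t := if MarkedForest.mid t = [] then 1 else 0
  mem t ht h := by
    have h' : MarkedForest.mid t = [] := by
      by_contra hne
      exact h (if_neg hne)
    refine ⟨goodForest_append ht.1 ht.2, (forestOrder_append _ _).trans ?_,
      (forestDeg_append _ _).trans ?_⟩
    · change _ = forestOrder (MarkedForest.left t) + treeOrder (MarkedForest.mid t)
        + forestOrder (MarkedForest.right t)
      rw [h']
      simp
    · change _ = forestDeg (MarkedForest.left t) - ((MarkedForest.mid t).length : ℤ)
        + forestDeg (MarkedForest.right t)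
      rw [h']
      simp
  wt_dup t _ i _ := by
    obtain ⟨A, X, B⟩ := t
    change (if (dupMarked i ⟨A, X, B⟩).mid = [] then (1 : ℝ) else 0) = if X = [] then 1 else 0
    simp only [mid_dupMarked_eq_nil]
  map_dup t _ h i _ := by
    have h' : MarkedForest.mid t = [] := by
      by_contra hne
      exact h (if_neg hne)
    obtain ⟨A, X, B⟩ := t
    obtain rfl : X = [] := h'
    change (dupMarked i ⟨A, [], B⟩).left ++ (dupMarked i ⟨A, [], B⟩).right = dupForest i (A ++ B)
    by_cases hi : i < forestOrder A
    · simp only [dupMarked, if_pos hi]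
      rw [dupForest_append_lt A B i hi]
    · obtain ⟨j, rfl⟩ := Nat.exists_eq_add_of_le (not_lt.1 hi)
      rw [dupForest_append_ge]
      simp [dupMarked]
  map_bdry t _ := joinEnds_bdryMarked t

/-- The left action on the unital Maurer-Cartan algebra. -/
def unitalLeft (A : omegaBar.carrier) (u : omegaUnital.carrier) : omegaUnital.carrier :=
  List.append (α := List ℕ+) A u

/-- The right action on the unital Maurer-Cartan algebra. -/
def unitalRight (u : omegaUnital.carrier) (A : omegaBar.carrier) : omegaUnital.carrier :=
  List.append (α := List ℕ+) u A

theorem unital_isLawfulBimodule : IsLawfulBimodule omegaUnital unitalLeft unitalRight :=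
  omegaUnital_isLawfulBimodule

theorem joinEndsMap_isEquivariant :
    joinEndsMap.IsEquivariant leftMul rightMul unitalLeft unitalRight where
  wt_left _ _ _ := rfl
  wt_right _ _ _ := rfl
  map_left A t _ _ := List.append_assoc A t.left t.right
  map_right t A _ _ := (List.append_assoc t.left t.right A).symm

variable {m : ℕ} {ω : ℕ → omegaBar.Pow m} {x : ℕ → moduleBar.Pow m}

/-- The unit of the Maurer-Cartan algebra. -/
def emptyForest : omegaUnital.carrier := ([] : List (List ℕ+))

/-- The unit of the completed powers of the unital Maurer-Cartan algebra. -/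
def unitSeq (m : ℕ) : ℕ → omegaUnital.Pow m := Pi.single 0 (single (fun _ => emptyForest) 1)

theorem mulL_emptyForest (a : omegaBar.Pow m) :
    mulL m unitalLeft a (single (fun _ => emptyForest) 1)
      = mulL m unitalRight (single (fun _ => emptyForest) 1) a := by
  suffices (mulL m unitalLeft).flip (single (fun _ => emptyForest) 1)
      = mulL m unitalRight (single (fun _ => emptyForest) 1) from LinearMap.congr_fun this a
  refine Finsupp.lhom_ext' fun u => LinearMap.ext_ring ?_
  simp only [LinearMap.comp_apply, lsingle_apply, LinearMap.flip_apply, mulL_single]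
  have hd : omegaUnital.degs (fun _ : Fin m => emptyForest) = 0 := rfl
  rw [hd, signForm_zero_left, signForm_zero_right]
  congr 1
  funext i
  exact List.append_nil (u i)

theorem exists_unital_homotopy (hm : 0 < m) (hω : IsUniversalMC m ω)
    (hx : IsUniversalMCMorphism ω ω x) : ∃ h : ℕ → omegaUnital.Pow m, HasTotalDegree (-1) h ∧
      twDiff unitalLeft unitalRight ω ω (-1) h
        = (fun k => joinEndsMap.pow m (x k)) - unitSeq m := by
  rw [isUniversalMCMorphism_iff] at hx
  have hω0 := hω.zero hm
  have h1 : HasTotalDegree 0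
      (unitSeq m) :=
    hasTotalDegree_single_zero (single_mem_piece
      (fun _ => ⟨fun _ h => absurd h List.not_mem_nil, rfl⟩) (Finset.sum_eq_zero fun _ _ => rfl) 1)
  have h2 : twDiff unitalLeft unitalRight ω ω 0
      (unitSeq m) = 0 := by
    funext k
    cases k with
    | zero =>
      rw [twDiff_eq_bdryPow hω0 hω0 0 (by simp), unitSeq, Pi.single_eq_same]
      exact bdryPow_single_eq_zero fun i => rfl
    | succ k =>
      rw [unitSeq, twDiff_single_zero_succ, mulL_emptyForest, sg_zero, mul_zero, sg_zero, one_smul,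
        neg_one_smul]
      exact neg_add_cancel _
  obtain ⟨h, h3, h4, -⟩ := exists_twDiff_eq omegaBar_isLawful omegaMul_isLawful
    unital_isLawfulBimodule omegaUnitalContraction hω hω hω0 hω0 (n := -1)
    (c := (fun k => joinEndsMap.pow m (x k)) - unitSeq m)
    (z := 0)
    (by
      rw [neg_add_cancel]
      exact (joinEndsMap.hasTotalDegree_pow hx.1).sub h1)
    (by
      rw [neg_add_cancel, twDiff_sub, h2, sub_zero,
        joinEndsMap_isEquivariant.twDiff_pow hω.degree hω.degree hx.1, hx.2.1]
      funext k
      simp)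
    (fun k => Submodule.zero_mem _) 1 (by norm_num)
    (fun j hj => by
      obtain rfl : j = 0 := by omega
      rw [twDiff_zero, Pi.sub_apply, hx.2.2, WMap.pow_single, unitSeq, Pi.single_eq_same]
      have e1 : joinEndsMap.wt unitTriple = 1 := by
        change (if ([] : List ℕ+) = [] then (1 : ℝ) else 0) = 1
        exact if_pos rfl
      have e2 : joinEndsMap.map unitTriple = emptyForest := rfl
      simp only [e1, e2, prod_const_one]
      exact (sub_self _).symm)
  exact ⟨h, h3, h4⟩

end unital


/-! ## The action of the symmetric group -/

section koszul

variable {m : ℕ}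

/-- The exponent of `koszulSign`. -/
def invForm (σ : Equiv.Perm (Fin m)) (l : Fin m → ℤ) : ℤ :=
  ∑ i, ∑ j, if i < j ∧ σ j < σ i then l i * l j else 0

theorem koszulSign_eq (σ : Equiv.Perm (Fin m)) (l : Fin m → ℤ) :
    koszulSign σ l = sg (invForm σ l) := by
  rw [koszulSign, invForm, sg_sum]
  refine prod_congr rfl fun i _ => ?_
  rw [← sum_filter, sg_sum]
  rfl

theorem signForm_eq (l l' : Fin m → ℤ) :
    signForm l l' = ∑ i, ∑ j, if j < i then l i * l' j else 0 :=
  sum_congr rfl fun i _ => by rw [← sum_filter]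

theorem signForm_comp_symm (σ : Equiv.Perm (Fin m)) (l l' : Fin m → ℤ) :
    signForm (fun i => l (σ.symm i)) (fun i => l' (σ.symm i))
      = ∑ i, ∑ j, if σ j < σ i then l i * l' j else 0 := by
  rw [signForm_eq, ← Equiv.sum_comp σ]
  refine sum_congr rfl fun i _ => ?_
  rw [← Equiv.sum_comp σ]
  simp

theorem sg_invForm_add (σ : Equiv.Perm (Fin m)) (l l' : Fin m → ℤ) :
    sg (invForm σ (l + l') + signForm l l') = sg (invForm σ l + invForm σ l'
      + signForm (fun i => l (σ.symm i)) (fun i => l' (σ.symm i))) := by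
  refine sg_congr (∑ i, ∑ j, if i < j ∧ σ j < σ i then l' i * l j else 0) ?_
  have h1 : ∑ i, ∑ j, (if i < j ∧ σ j < σ i then l' i * l j else 0)
      = ∑ i, ∑ j, (if j < i ∧ σ i < σ j then l i * l' j else 0) := by
    rw [sum_comm]
    simp only [mul_comm]
  have h2 : 2 * ∑ i, ∑ j, (if i < j ∧ σ j < σ i then l' i * l j else 0)
      = ∑ i, ∑ j, (if i < j ∧ σ j < σ i then l' i * l j else 0)
        + ∑ i, ∑ j, (if j < i ∧ σ i < σ j then l i * l' j else 0) := by rw [← h1]; ring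
  rw [h2, signForm_comp_symm, signForm_eq, invForm, invForm, invForm]
  simp only [← sum_add_distrib]
  refine sum_congr rfl fun i _ => sum_congr rfl fun j _ => ?_
  rcases lt_trichotomy i j with h | rfl | h
  · rcases lt_trichotomy (σ i) (σ j) with h' | h' | h'
    · simp [h, h.not_gt, h', h'.not_gt]
    · exact absurd (σ.injective h') h.ne
    · simp only [h, h.not_gt, h', h'.not_gt, Pi.add_apply, and_self, if_true, if_false]
      ring
  · simp
  · rcases lt_trichotomy (σ i) (σ j) with h' | h' | h'
    · simp [h, h.not_gt, h', h'.not_gt]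
    · exact absurd (σ.injective h') h.ne'
    · simp [h, h.not_gt, h', h'.not_gt]

theorem sum_symm_eq (S : Fin m → Fin m → ℤ) (h : ∀ i j, S i j = S j i) (h0 : ∀ i, S i i = 0) :
    ∑ i, ∑ j, S i j = 2 * ∑ i, ∑ j, if i < j then S i j else 0 := by
  have h1 : ∑ i, ∑ j, (if i < j then S i j else 0) = ∑ i, ∑ j, if j < i then S i j else 0 := by
    rw [sum_comm]
    simp only [fun i j => h j i]
  rw [two_mul]
  nth_rw 2 [h1]
  simp only [← sum_add_distrib]
  refine sum_congr rfl fun i _ => sum_congr rfl fun j _ => ?_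
  rcases lt_trichotomy i j with h' | rfl | h'
  · simp [h', h'.not_gt]
  · simp [h0]
  · simp [h', h'.not_gt]

theorem sg_invForm_mul (σ τ : Equiv.Perm (Fin m)) (l : Fin m → ℤ) :
    sg (invForm (σ * τ) l) = sg (invForm σ (fun i => l (τ.symm i)) + invForm τ l) := by
  have h1 : invForm σ (fun i => l (τ.symm i))
      = ∑ i, ∑ j, if τ i < τ j ∧ σ (τ j) < σ (τ i) then l i * l j else 0 := by
    rw [invForm, ← Equiv.sum_comp τ]
    refine sum_congr rfl fun i _ => ?_
    rw [← Equiv.sum_comp τ]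
    simp
  let S : Fin m → Fin m → ℤ := fun i j => (if i < j ∧ (σ * τ) j < (σ * τ) i then l i * l j else 0)
    - ((if τ i < τ j ∧ σ (τ j) < σ (τ i) then l i * l j else 0)
      + if i < j ∧ τ j < τ i then l i * l j else 0)
  have hS := sum_symm_eq S (fun i j => by
    simp only [S, Equiv.Perm.mul_apply, mul_comm (l j)]
    rcases lt_trichotomy i j with h | rfl | h
    · rcases lt_trichotomy (τ i) (τ j) with h' | h' | h'
      · simp [h, h.not_gt, h', h'.not_gt]
      · exact absurd (τ.injective h') h.ne
      · rcases lt_trichotomy (σ (τ i)) (σ (τ j)) with h'' | h'' | h''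
        · simp [h, h.not_gt, h', h'.not_gt, h'', h''.not_gt]
        · exact absurd (τ.injective (σ.injective h'')) h.ne
        · simp [h, h.not_gt, h', h'.not_gt, h'', h''.not_gt]
    · rfl
    · rcases lt_trichotomy (τ i) (τ j) with h' | h' | h'
      · rcases lt_trichotomy (σ (τ i)) (σ (τ j)) with h'' | h'' | h''
        · simp [h, h.not_gt, h', h'.not_gt, h'', h''.not_gt]
        · exact absurd (τ.injective (σ.injective h'')) h.ne'
        · simp [h, h.not_gt, h', h'.not_gt, h'', h''.not_gt]
      · exact absurd (τ.injective h') h.ne'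
      · simp [h, h.not_gt, h', h'.not_gt]) (fun i => by simp [S])
  refine sg_congr (∑ i, ∑ j, if i < j then S i j else 0) ?_
  rw [← hS, h1, invForm, invForm]
  simp only [S, ← sum_add_distrib]
  exact sum_congr rfl fun i _ => sum_congr rfl fun j _ => by ring

theorem invForm_single (σ : Equiv.Perm (Fin m)) (i : Fin m) : invForm σ (Pi.single i 1) = 0 := by
  refine sum_eq_zero fun a _ => sum_eq_zero fun b _ => ?_
  split_ifs with h
  · by_cases ha : a = i
    · subst ha
      simp [Pi.single_eq_of_ne h.1.ne']
    · simp [ha]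
  · rfl

end koszul

namespace BarBasis

open Finsupp

variable {X Y Z : BarBasis} {m : ℕ} (σ : Equiv.Perm (Fin m))

theorem permPow_single (u : Fin m → X.carrier) : X.permPow m σ (single u 1)
    = single (fun i => u (σ.symm i)) (sg (invForm σ (X.degs u))) := by
  simp [permPow, koszulSign_eq]
  rfl

theorem permPow_permPow (τ : Equiv.Perm (Fin m)) (z : X.Pow m) :
    X.permPow m σ (X.permPow m τ z) = X.permPow m (σ * τ) z := by
  suffices X.permPow m σ ∘ₗ X.permPow m τ = X.permPow m (σ * τ) from LinearMap.congr_fun this z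
  refine Finsupp.lhom_ext' fun u => LinearMap.ext_ring ?_
  simp only [LinearMap.comp_apply, lsingle_apply, permPow_single]
  rw [single_eq_smul, map_smul, permPow_single, sg_invForm_mul, sg_add, smul_single, smul_eq_mul,
    mul_comm]
  rfl

theorem isPowBasis_comp {k : ℕ} {u : Fin m → X.carrier} (hu : X.IsPowBasis k u) :
    X.IsPowBasis k fun i => u (σ.symm i) := fun _ => hu _

theorem permPow_mem_piece {k : ℕ} {l : ℤ} {z : X.Pow m} (hz : z ∈ X.piece m k l) :
    X.permPow m σ z ∈ X.piece m k l := by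
  refine piece_induction _ _ (fun u hu hl => ?_) hz
  rw [permPow_single]
  refine single_mem_piece (isPowBasis_comp σ hu) ?_ _
  rw [← hl]
  exact Equiv.sum_comp σ.symm fun i => X.deg (u i)

theorem bdryPow_permPow (hX : X.IsLawful) {k : ℕ} {l : ℤ} {z : X.Pow m}
    (hz : z ∈ X.piece m k l) : X.bdryPow m (X.permPow m σ z) = X.permPow m σ (X.bdryPow m z) := by
  refine piece_ext (T := X.bdryPow m ∘ₗ X.permPow m σ) (T' := X.permPow m σ ∘ₗ X.bdryPow m)
    (fun u hu _ => ?_) hz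
  simp only [LinearMap.comp_apply, bdryPow_eq_sum, LinearMap.sum_apply, map_sum, slotOp_single,
    map_smul, permPow_single]
  rw [← Equiv.sum_comp σ]
  refine Finset.sum_congr rfl fun i _ => ?_
  rw [single_eq_smul, map_smul, slotOp_single, map_ins, ins_apply, smul_smul,
    ← linearCombination_smul_right, ← linearCombination_smul_right]
  simp only [Equiv.symm_apply_apply]
  refine linearCombination_congr fun v hv => ?_
  have hd := (hu.update hX.hasDeg_bdry i hv).2.1
  have h1 : (fun j => Function.update u i v (σ.symm j))
      = Function.update (fun j => u (σ.symm j)) (σ i) v := by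
    funext j
    by_cases hj : j = σ i
    · subst hj; simp
    · have : σ.symm j ≠ i := fun h => hj (by rw [← h]; simp)
      simp [hj, this]
  have h2 : (Pi.single (σ i) 1 : Fin m → ℤ) = fun j => (Pi.single i 1 : Fin m → ℤ) (σ.symm j) := by
    funext j
    by_cases hj : j = σ i
    · subst hj; simp
    · have : σ.symm j ≠ i := fun h => hj (by rw [← h]; simp)
      simp [hj, this]
  have h3 := sg_invForm_add σ (Pi.single i 1) (X.degs u)
  rw [invForm_single, zero_add, sg_add, sg_add] at h3
  rw [permPow_single, h1, hd, smul_single, smul_single, one_smul, one_mul, one_mul, h2, smul_eq_mul,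
    smul_eq_mul, mul_one, add_comm (X.degs u)]
  change single _ (_ * sg (signForm _ fun j => X.degs u (σ.symm j))) = _
  rw [← h3, mul_comm]

theorem dupPow_permPow (hX : X.IsLawful) {k : ℕ} {l : ℤ} {z : X.Pow m}
    (hz : z ∈ X.piece m k l) {i : ℕ} (hi : i < k) :
    X.dupPow m i (X.permPow m σ z) = X.permPow m σ (X.dupPow m i z) := by
  refine piece_ext (T := X.dupPow m i ∘ₗ X.permPow m σ) (T' := X.permPow m σ ∘ₗ X.dupPow m i)
    (fun u hu hl => ?_) hz
  have h : X.degs (fun j => X.dup i (u j)) = X.degs u :=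
    funext fun j => (hX.dup_mem (u j) (hu j).1 i ((hu j).2.symm ▸ hi)).2.2
  simp only [LinearMap.comp_apply, dupPow_single, permPow_single, h]

theorem dupAlt_permPow (hX : X.IsLawful) {k : ℕ} {l : ℤ} {z : X.Pow m}
    (hz : z ∈ X.piece m k l) :
    X.dupAlt m k (X.permPow m σ z) = X.permPow m σ (X.dupAlt m k z) := by
  rw [dupAlt_apply, dupAlt_apply, map_sum]
  refine Finset.sum_congr rfl fun i hi => ?_
  rw [map_smul, dupPow_permPow σ hX hz (mem_range.1 hi)]

theorem mulL_permPow {op : X.carrier → Y.carrier → Z.carrier} (h : IsLawfulMul op)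
    {k k' : ℕ} {l l' : ℤ} {a : X.Pow m} (ha : a ∈ X.piece m k l) {b : Y.Pow m}
    (hb : b ∈ Y.piece m k' l') :
    mulL m op (X.permPow m σ a) (Y.permPow m σ b) = Z.permPow m σ (mulL m op a b) := by
  refine piece_ext₂ (T := (mulL m op).compl₁₂ (X.permPow m σ) (Y.permPow m σ))
    (T' := (mulL m op).compr₂ (Z.permPow m σ)) (fun u v hu hl hv hl' => ?_) ha hb
  simp only [LinearMap.compl₁₂_apply, LinearMap.compr₂_apply, mulL_single, permPow_single]
  rw [single_eq_smul, single_eq_smul _ (sg (invForm σ (Y.degs v))), single_eq_smul _ (sg (signForm _ _)),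
    map_smul, map_smul, map_smul, LinearMap.smul_apply, mulL_single, permPow_single, degs_op h hu hv,
    smul_single, smul_single, smul_single, smul_eq_mul, smul_eq_mul, smul_eq_mul]
  congr 1
  have h3 := sg_invForm_add σ (X.degs u) (Y.degs v)
  rw [sg_add, sg_add, sg_add] at h3
  rw [mul_comm (sg (signForm (X.degs u) (Y.degs v))), h3]
  change sg _ * (sg _ * sg (signForm (fun i => X.degs u (σ.symm i)) fun i => Y.degs v (σ.symm i))) = _
  ring

variable {L : omegaBar.carrier → Y.carrier → Y.carrier}
  {R : Y.carrier → omegaBar.carrier → Y.carrier} {ω θ : ℕ → omegaBar.Pow m}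

theorem twDiff_permPow (hY : IsLawfulBimodule Y L R) (hω : HasTotalDegree 1 ω)
    (hθ : HasTotalDegree 1 θ) (hωσ : ∀ k, omegaBar.permPow m σ (ω k) = ω k)
    (hθσ : ∀ k, omegaBar.permPow m σ (θ k) = θ k) {n : ℤ} {z : ℕ → Y.Pow m}
    (hz : HasTotalDegree n z) :
    twDiff L R ω θ n (fun k => Y.permPow m σ (z k))
      = fun k => Y.permPow m σ (twDiff L R ω θ n z k) := by
  have h1 : star R 1 (fun k => Y.permPow m σ (z k)) ω = fun k => Y.permPow m σ (star R 1 z ω k) := by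
    funext k
    rw [star_apply, star_apply, map_sum]
    refine Finset.sum_congr rfl fun p _ => ?_
    rw [map_smul, ← mulL_permPow σ hY.right (hz _) (hω _), hωσ]
  have h2 : star L n θ (fun k => Y.permPow m σ (z k)) = fun k => Y.permPow m σ (star L n θ z k) := by
    funext k
    rw [star_apply, star_apply, map_sum]
    refine Finset.sum_congr rfl fun p _ => ?_
    rw [map_smul, ← mulL_permPow σ hY.left (hθ _) (hz _), hθσ]
  have h3 : dTot n (fun k => Y.permPow m σ (z k)) = fun k => Y.permPow m σ (dTot n z k) := by
    funext k
    cases k with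
    | zero => exact bdryPow_permPow σ hY.lawful (hz 0)
    | succ k =>
      rw [dTot_succ, dTot_succ, bdryPow_permPow σ hY.lawful (hz _),
        dupAlt_permPow σ hY.lawful (hz k), map_add, map_smul]
  rw [twDiff, h1, h2, h3]
  funext k
  simp [twDiff]

end BarBasis

section symmetric

open Finsupp BarBasis

variable {m : ℕ} {ω θ : ℕ → omegaBar.Pow m}

theorem twDiff_sum {Y : BarBasis} {L : omegaBar.carrier → Y.carrier → Y.carrier}
    {R : Y.carrier → omegaBar.carrier → Y.carrier} (n : ℤ) {ι : Type*} (s : Finset ι)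
    (z : ι → ℕ → Y.Pow m) :
    twDiff L R ω θ n (∑ i ∈ s, z i) = ∑ i ∈ s, twDiff L R ω θ n (z i) := by
  classical
  induction s using Finset.induction_on with
  | empty => simp [twDiff_zero]
  | insert i s hi ih => rw [sum_insert hi, sum_insert hi, twDiff_add, ih]

theorem exists_symmetric_mcMorphism (hm : 0 < m) (hω : IsUniversalMC m ω) (hθ : IsUniversalMC m θ)
    (hωs : IsSymmetric ω) (hθs : IsSymmetric θ) :
    ∃ x, IsUniversalMCMorphism ω θ x ∧ IsSymmetric x := by
  obtain ⟨x, hx⟩ := exists_mcMorphism hm hω hθ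
  rw [isUniversalMCMorphism_iff] at hx
  obtain ⟨hx1, hx2, hx3⟩ := hx
  let c : ℝ := (Fintype.card (Equiv.Perm (Fin m)) : ℝ)⁻¹
  have hc : c * (Fintype.card (Equiv.Perm (Fin m)) : ℝ) = 1 :=
    inv_mul_cancel₀ (Nat.cast_ne_zero.2 Fintype.card_ne_zero)
  let y : ℕ → moduleBar.Pow m :=
    c • ∑ σ : Equiv.Perm (Fin m), fun k => moduleBar.permPow m σ (x k)
  have hy : ∀ k, y k = c • ∑ σ : Equiv.Perm (Fin m), moduleBar.permPow m σ (x k) := fun k => by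
    simp [y]
  refine ⟨y, isUniversalMCMorphism_iff.2 ⟨fun k => ?_, ?_, ?_⟩, fun τ k => ?_⟩
  · rw [hy]
    exact Submodule.smul_mem _ _ (Submodule.sum_mem _ fun σ _ => permPow_mem_piece σ (hx1 k))
  · simp only [y]
    rw [twDiff_smul, twDiff_sum]
    simp only [twDiff_permPow _ moduleBar_isLawfulBimodule hω.degree hθ.degree (hωs _) (hθs _) hx1,
      hx2]
    funext k
    simp
  · have : ∀ σ : Equiv.Perm (Fin m), moduleBar.permPow m σ (single (fun _ => unitTriple) 1)
        = single (fun _ => unitTriple) 1 := by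
      intro σ
      have hd : moduleBar.degs (fun _ : Fin m => unitTriple) = 0 := rfl
      rw [permPow_single, hd]
      simp [invForm]
    rw [hy, hx3]
    simp only [this, sum_const, card_univ]
    rw [← Nat.cast_smul_eq_nsmul ℝ, smul_smul, hc, one_smul]
  · rw [hy, map_smul, map_sum]
    simp only [permPow_permPow]
    rw [Fintype.sum_equiv (Equiv.mulLeft τ) (fun σ => moduleBar.permPow m (τ * σ) (x k))
      (fun σ => moduleBar.permPow m σ (x k)) fun σ => rfl]

end symmetric


/-! ## Strings of composable arrows -/

section Strings

variable {EM : Type*} [NormedAddCommGroup EM] [NormedSpace ℝ EM]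
  {M : Type uM} [TopologicalSpace M] [ChartedSpace EM M]
  {EG : Type*} [NormedAddCommGroup EG] [NormedSpace ℝ EG]
  {G : Type*} [TopologicalSpace G] [ChartedSpace EG G]

namespace LieGroupoid

variable (Γ : LieGroupoid EM M EG G)

@[simp] theorem vertex_zero (y : M) (g : List G) : Γ.vertex y g 0 = y := by
  cases g <;> rfl

@[simp] theorem vertex_nil (y : M) (j : ℕ) : Γ.vertex y [] j = y := by
  cases j <;> rfl

theorem vertex_cons_succ (y : M) (a : G) (g : List G) (j : ℕ) :
    Γ.vertex y (a :: g) (j + 1) = Γ.vertex (Γ.src a) g j := rfl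

theorem vertex_drop (y : M) (g : List G) (i j : ℕ) :
    Γ.vertex (Γ.vertex y g i) (g.drop i) j = Γ.vertex y g (i + j) := by
  induction g generalizing y i with
  | nil => simp
  | cons a g ih =>
    cases i with
    | zero => simp
    | succ i =>
      rw [Nat.add_right_comm, List.drop_succ_cons, vertex_cons_succ, vertex_cons_succ, ih]

theorem vertex_take (y : M) (g : List G) {i n : ℕ} (h : i ≤ n) :
    Γ.vertex y (g.take n) i = Γ.vertex y g i := by
  induction g generalizing y i n with
  | nil => simp
  | cons a g ih =>
    cases i with
    | zero => simp
    | succ i =>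
      obtain ⟨n, rfl⟩ : ∃ n', n = n' + 1 := ⟨n - 1, by omega⟩
      rw [List.take_succ_cons, vertex_cons_succ, vertex_cons_succ, ih _ (by omega)]

variable {Γ}

theorem IsString.vertex_length {x y : M} {g : List G} (h : Γ.IsString x y g) :
    Γ.vertex y g g.length = x := by
  induction g generalizing y with
  | nil => exact Eq.symm h
  | cons a g ih => exact ih h.2

theorem IsString.take {x y : M} {g : List G} (h : Γ.IsString x y g) (i : ℕ) :
    Γ.IsString (Γ.vertex y g i) y (g.take i) := by
  induction g generalizing y i with
  | nil => simp [IsString]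
  | cons a g ih =>
    cases i with
    | zero => simp [IsString]
    | succ i => exact ⟨h.1, ih h.2 i⟩

theorem IsString.drop {x y : M} {g : List G} (h : Γ.IsString x y g) (i : ℕ) :
    Γ.IsString x (Γ.vertex y g i) (g.drop i) := by
  induction g generalizing y i with
  | nil => simpa using h
  | cons a g ih =>
    cases i with
    | zero => simpa using h
    | succ i => exact ih h.2 i

theorem length_mulAt {j : ℕ} {g : List G} (hj : j + 1 < g.length) :
    (Γ.mulAt j g).length = g.length - 1 := by
  induction g generalizing j with
  | nil => simp at hj
  | cons a g ih =>
    cases j with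
    | zero =>
      cases g with
      | nil => simp at hj
      | cons b g => simp [mulAt]
    | succ j =>
      simp only [List.length_cons] at hj
      simp only [mulAt, List.length_cons, ih (j := j) (by omega)]
      omega

theorem IsString.mulAt {x y : M} {g : List G} (h : Γ.IsString x y g) (j : ℕ) :
    Γ.IsString x y (Γ.mulAt j g) := by
  induction g generalizing y j with
  | nil => cases j <;> exact h
  | cons a g ih =>
    cases j with
    | zero =>
      cases g with
      | nil => exact h
      | cons b g =>
        refine ⟨(Γ.tgt_mul _ _ h.2.1.symm).trans h.1, ?_⟩
        rw [Γ.src_mul _ _ h.2.1.symm]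
        exact h.2.2
    | succ j => exact ⟨h.1, ih h.2 j⟩

theorem mulAt_take {i n : ℕ} (g : List G) (h : i < n) :
    (Γ.mulAt i g).take n = Γ.mulAt i (g.take (n + 1)) := by
  induction g generalizing i n with
  | nil => cases i <;> simp [mulAt]
  | cons a g ih =>
    obtain ⟨n, rfl⟩ : ∃ n', n = n' + 1 := ⟨n - 1, by omega⟩
    cases i with
    | zero => cases g <;> simp [mulAt]
    | succ i => simp [mulAt, ih (i := i) (n := n) (by omega)]

theorem mulAt_drop {i n : ℕ} {g : List G} (h : i < n) (hn : n < g.length) :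
    (Γ.mulAt i g).drop n = g.drop (n + 1) := by
  induction g generalizing i n with
  | nil => simp at hn
  | cons a g ih =>
    obtain ⟨n, rfl⟩ : ∃ n', n = n' + 1 := ⟨n - 1, by omega⟩
    simp only [List.length_cons] at hn
    cases i with
    | zero =>
      cases g with
      | nil => simp at hn
      | cons b g => simp [mulAt]
    | succ i =>
      simp only [mulAt, List.drop_succ_cons]
      exact ih (by omega) (by omega)

theorem IsString.vertex_mulAt {x y : M} {g : List G} (hg : Γ.IsString x y g) {i n : ℕ}
    (h : i < n) (hn : n < g.length) :
    Γ.vertex y (Γ.mulAt i g) n = Γ.vertex y g (n + 1) := by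
  induction g generalizing y i n with
  | nil => simp at hn
  | cons a g ih =>
    obtain ⟨n, rfl⟩ : ∃ n', n = n' + 1 := ⟨n - 1, by omega⟩
    simp only [List.length_cons] at hn
    cases i with
    | zero =>
      cases g with
      | nil => simp at hn
      | cons b g =>
        simp only [LieGroupoid.mulAt, vertex_cons_succ]
        rw [Γ.src_mul _ _ hg.2.1.symm]
    | succ i =>
      simp only [LieGroupoid.mulAt, vertex_cons_succ]
      exact ih hg.2 (by omega) (by omega)

theorem mulAt_take_of_le {i n : ℕ} (g : List G) (h : n ≤ i) :
    (Γ.mulAt i g).take n = g.take n := by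
  induction g generalizing i n with
  | nil => cases i <;> simp [mulAt]
  | cons a g ih =>
    cases n with
    | zero => simp
    | succ n =>
      obtain ⟨i, rfl⟩ : ∃ i', i = i' + 1 := ⟨i - 1, by omega⟩
      simp [mulAt, ih (i := i) (n := n) (by omega)]

theorem mulAt_drop_of_le {i n : ℕ} (g : List G) (h : n ≤ i) :
    (Γ.mulAt i g).drop n = Γ.mulAt (i - n) (g.drop n) := by
  induction g generalizing i n with
  | nil => cases i <;> cases h' : (_ - n) <;> simp [mulAt]
  | cons a g ih =>
    cases n with
    | zero => simp
    | succ n =>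
      obtain ⟨i, rfl⟩ : ∃ i', i = i' + 1 := ⟨i - 1, by omega⟩
      simp [mulAt, ih (i := i) (n := n) (by omega)]

theorem vertex_mulAt_of_le (y : M) (g : List G) {i n : ℕ} (h : n ≤ i) :
    Γ.vertex y (Γ.mulAt i g) n = Γ.vertex y g n := by
  induction g generalizing y i n with
  | nil => cases i <;> simp [mulAt]
  | cons a g ih =>
    cases n with
    | zero => simp
    | succ n =>
      obtain ⟨i, rfl⟩ : ∃ i', i = i' + 1 := ⟨i - 1, by omega⟩
      simp only [mulAt, vertex_cons_succ]
      exact ih _ (by omega)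

/-! ### Collapsing blocks of arrows -/

theorem tgt_foldl_mul {x : M} {a : G} {g : List G} (h : Γ.IsString x (Γ.src a) g) :
    Γ.tgt (g.foldl Γ.mul a) = Γ.tgt a := by
  induction g generalizing a with
  | nil => rfl
  | cons b g ih =>
    rw [List.foldl_cons, ih, Γ.tgt_mul _ _ h.1.symm]
    rw [Γ.src_mul _ _ h.1.symm]
    exact h.2

theorem src_foldl_mul {x : M} {a : G} {g : List G} (h : Γ.IsString x (Γ.src a) g) :
    Γ.src (g.foldl Γ.mul a) = x := by
  induction g generalizing a with
  | nil => exact h.symm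
  | cons b g ih =>
    rw [List.foldl_cons, ih]
    rw [Γ.src_mul _ _ h.1.symm]
    exact h.2

theorem foldl_mul_mul {x : M} {a b : G} {g : List G} (hab : Γ.src a = Γ.tgt b)
    (h : Γ.IsString x (Γ.src b) g) :
    g.foldl Γ.mul (Γ.mul a b) = Γ.mul a (g.foldl Γ.mul b) := by
  induction g generalizing b with
  | nil => rfl
  | cons c g ih =>
    rw [List.foldl_cons, List.foldl_cons, Γ.mul_assoc _ _ _ hab h.1.symm, ih]
    · rw [hab, Γ.tgt_mul _ _ h.1.symm]
    · rw [Γ.src_mul _ _ h.1.symm]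
      exact h.2

theorem foldl_mul_mulAt {x : M} {a : G} {g : List G} (h : Γ.IsString x (Γ.src a) g) (j : ℕ) :
    (Γ.mulAt j g).foldl Γ.mul a = g.foldl Γ.mul a := by
  induction g generalizing a j with
  | nil => cases j <;> rfl
  | cons b g ih =>
    cases j with
    | zero =>
      cases g with
      | nil => rfl
      | cons c g =>
        simp only [mulAt, List.foldl_cons]
        rw [Γ.mul_assoc _ _ _ h.1.symm h.2.1.symm]
    | succ j =>
      simp only [mulAt, List.foldl_cons]
      refine ih ?_ j
      rw [Γ.src_mul _ _ h.1.symm]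
      exact h.2

@[simp] theorem collapse_nil (g : List G) : Γ.collapse [] g = [] := by
  cases g <;> rfl

theorem collapse_cons (n : ℕ+) (X : List ℕ+) (a : G) (g : List G) :
    Γ.collapse (n :: X) (a :: g)
      = (g.take ((n : ℕ) - 1)).foldl Γ.mul a :: Γ.collapse X (g.drop ((n : ℕ) - 1)) := rfl

end LieGroupoid

theorem exists_eq_cons_of_treeOrder_le {G : Type*} {n : ℕ+} {X : List ℕ+} {g : List G}
    (h : treeOrder (n :: X) ≤ g.length) : ∃ a l, g = a :: l ∧ n - 1 + treeOrder X ≤ l.length := by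
  rw [treeOrder_cons] at h
  have hn := n.pos
  cases g with
  | nil => simp at h
  | cons a l =>
    refine ⟨a, l, rfl, ?_⟩
    rw [List.length_cons] at h
    omega

namespace LieGroupoid

variable {Γ : LieGroupoid EM M EG G}

theorem length_collapse {X : List ℕ+} {g : List G} (h : treeOrder X ≤ g.length) :
    (Γ.collapse X g).length = X.length := by
  induction X generalizing g with
  | nil => simp
  | cons n X ih =>
    obtain ⟨a, l, rfl, hl⟩ := exists_eq_cons_of_treeOrder_le h
    rw [collapse_cons, List.length_cons, List.length_cons, ih]
    rw [List.length_drop]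
    omega

theorem collapse_take {X : List ℕ+} {g : List G} (h : treeOrder X ≤ g.length) (j : ℕ) :
    (Γ.collapse X g).take j = Γ.collapse (X.take j) (g.take (treeOrder (X.take j))) := by
  induction X generalizing g j with
  | nil => simp
  | cons n X ih =>
    obtain ⟨a, l, rfl, hl⟩ := exists_eq_cons_of_treeOrder_le h
    cases j with
    | zero => simp
    | succ j =>
      have hn := n.pos
      rw [collapse_cons, List.take_succ_cons, List.take_succ_cons, treeOrder_cons,
        show (n : ℕ) + treeOrder (X.take j) = (n - 1 + treeOrder (X.take j)) + 1 by omega,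
        List.take_succ_cons, collapse_cons, ih (by rw [List.length_drop]; omega),
        List.take_take, min_eq_left (by omega), List.drop_take, Nat.add_sub_cancel_left]

theorem collapse_drop {X : List ℕ+} {g : List G} (h : treeOrder X ≤ g.length) (j : ℕ) :
    (Γ.collapse X g).drop j = Γ.collapse (X.drop j) (g.drop (treeOrder (X.take j))) := by
  induction X generalizing g j with
  | nil => simp
  | cons n X ih =>
    obtain ⟨a, l, rfl, hl⟩ := exists_eq_cons_of_treeOrder_le h
    cases j with
    | zero => simp [treeOrder_nil]
    | succ j =>
      have hn := n.pos
      rw [collapse_cons, List.drop_succ_cons, List.drop_succ_cons, List.take_succ_cons,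
        treeOrder_cons,
        show (n : ℕ) + treeOrder (X.take j) = (n - 1 + treeOrder (X.take j)) + 1 by omega,
        List.drop_succ_cons, ih (by rw [List.length_drop]; omega), List.drop_drop]

theorem IsString.vertex_collapse {x y : M} {g : List G} (hg : Γ.IsString x y g) {X : List ℕ+}
    (h : treeOrder X ≤ g.length) (j : ℕ) :
    Γ.vertex y (Γ.collapse X g) j = Γ.vertex y g (treeOrder (X.take j)) := by
  induction X generalizing y g j with
  | nil => simp [treeOrder_nil]
  | cons n X ih =>
    obtain ⟨a, l, rfl, hl⟩ := exists_eq_cons_of_treeOrder_le h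
    cases j with
    | zero => simp [treeOrder_nil]
    | succ j =>
      have hn := n.pos
      rw [collapse_cons, vertex_cons_succ, List.take_succ_cons, treeOrder_cons,
        show (n : ℕ) + treeOrder (X.take j) = (n - 1 + treeOrder (X.take j)) + 1 by omega,
        vertex_cons_succ, src_foldl_mul (hg.2.take _), ih (hg.2.drop _)
          (by rw [List.length_drop]; omega), vertex_drop]

theorem IsString.collapse {x y : M} {g : List G} (hg : Γ.IsString x y g) {X : List ℕ+}
    (h : g.length = treeOrder X) : Γ.IsString x y (Γ.collapse X g) := by
  induction X generalizing y g with
  | nil =>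
    obtain rfl := List.length_eq_zero_iff.1 h
    exact hg
  | cons n X ih =>
    obtain ⟨a, l, rfl, hl⟩ := exists_eq_cons_of_treeOrder_le h.ge
    have hn := n.pos
    rw [treeOrder_cons, List.length_cons] at h
    refine ⟨(tgt_foldl_mul (hg.2.take _)).trans hg.1, ?_⟩
    rw [src_foldl_mul (hg.2.take _)]
    exact ih (hg.2.drop _) (by rw [List.length_drop]; omega)

theorem IsString.collapse_dupTree {x y : M} {g : List G} (hg : Γ.IsString x y g) {X : List ℕ+}
    (h : treeOrder X < g.length) {i : ℕ} (hi : i < treeOrder X) :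
    Γ.collapse (dupTree i X) g = Γ.collapse X (Γ.mulAt i g) := by
  induction X generalizing y g i with
  | nil => simp [treeOrder_nil] at hi
  | cons n X ih =>
    obtain ⟨a, l, rfl, hl⟩ := exists_eq_cons_of_treeOrder_le h.le
    have hn := n.pos
    rw [treeOrder_cons] at h hi
    rw [List.length_cons] at h
    rw [dupTree]
    split_ifs with hin
    · rw [collapse_cons, PNat.add_coe, PNat.one_coe, Nat.add_sub_cancel]
      cases i with
      | zero =>
        cases l with
        | nil => simp at h
        | cons b l =>
          obtain ⟨k, hk⟩ : ∃ k, (n : ℕ) = k + 1 := ⟨n - 1, by omega⟩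
          rw [LieGroupoid.mulAt, collapse_cons, hk]
          simp
      | succ i =>
        rw [LieGroupoid.mulAt, collapse_cons, mulAt_take _ (by omega), mulAt_drop (by omega) (by omega),
          Nat.sub_add_cancel (by omega), foldl_mul_mulAt (hg.2.take _)]
    · obtain ⟨i, rfl⟩ : ∃ i', i = i' + 1 := ⟨i - 1, by omega⟩
      rw [LieGroupoid.mulAt, collapse_cons, collapse_cons, mulAt_take_of_le _ (by omega),
        mulAt_drop_of_le _ (by omega), ih (hg.2.drop _) (by rw [List.length_drop]; omega)
          (by omega), show i + 1 - (n : ℕ) = i - (n - 1) by omega]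

theorem IsString.collapse_mergeAt {x y : M} {g : List G} (hg : Γ.IsString x y g) {X : List ℕ+}
    (h : treeOrder X ≤ g.length) {j : ℕ} (hj : j + 1 < X.length) :
    Γ.collapse (mergeAt j X) g = Γ.mulAt j (Γ.collapse X g) := by
  induction X generalizing y g j with
  | nil => simp at hj
  | cons n X ih =>
    obtain ⟨a, l, rfl, hl⟩ := exists_eq_cons_of_treeOrder_le h
    have hn := n.pos
    cases j with
    | zero =>
      cases X with
      | nil => simp at hj
      | cons n' X =>
        have hn' := n'.pos
        rw [treeOrder_cons] at hl
        obtain ⟨b, l', hl', hlen⟩ := exists_eq_cons_of_treeOrder_le (n := n') (X := X)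
          (g := l.drop (n - 1)) (by rw [List.length_drop, treeOrder_cons]; omega)
        have hs := hg.2.drop (n - 1)
        rw [hl'] at hs
        rw [mergeAt, collapse_cons, collapse_cons, hl', collapse_cons, LieGroupoid.mulAt, PNat.add_coe,
          show (n : ℕ) + n' - 1 = (n - 1) + n' by omega, List.take_add, List.foldl_append,
          ← List.drop_drop, hl']
        obtain ⟨k, hk⟩ : ∃ k, (n' : ℕ) = k + 1 := ⟨n' - 1, by omega⟩
        rw [hk, List.take_succ_cons, List.foldl_cons, List.drop_succ_cons, Nat.add_sub_cancel,
          foldl_mul_mul _ (hs.2.take _)]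
        rw [src_foldl_mul (hg.2.take _), hs.1]
    | succ j =>
      rw [mergeAt, collapse_cons, collapse_cons, LieGroupoid.mulAt, ih (hg.2.drop _)
        (by rw [List.length_drop]; omega) (by simpa using hj)]

end LieGroupoid

end Strings


/-! ## Smooth families of operators -/

section Smooth

open scoped ContDiff
open Filter Topology

variable {EM : Type*} [NormedAddCommGroup EM] [NormedSpace ℝ EM]
  {M : Type uM} [TopologicalSpace M] [ChartedSpace EM M]

namespace GradedBundle

theorem isSmoothFrame_of_mem (E : GradedBundle.{uM, uV} EM M) {a : LocalFrame E.fiber}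
    (ha : a ∈ E.atlas) : E.IsSmoothFrame a :=
  ⟨E.isFrame a ha, fun b hb => ⟨E.smooth b hb a ha, E.smooth a ha b hb⟩⟩

theorem twist_sec (E : GradedBundle.{uM, uV} EM M) {a : LocalFrame E.fiber}
    (ha : a.IsHomogeneousFrame E.gr) {x : M} (hx : x ∈ a.dom) (l : ℤ) (j : a.idx) :
    E.twist x l (a.sec j x) = (-1 : ℝ) ^ (l * a.deg j) • a.sec j x := by
  apply E.twist_apply
  rw [ha.gr_eq x hx]
  exact Submodule.subset_span ⟨j, rfl, rfl⟩

end GradedBundle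

variable {V : Type*} [NormedAddCommGroup V] [NormedSpace ℝ V]

/-- A family of operators between the fibres over `x u` and `y u` whose matrix in local frames is
smooth at `u₀` within `U`. -/
def SmoothFamilyAt (E F : GradedBundle.{uM, uV} EM M) (U : Set V) (u₀ : V) (x y : V → M)
    (T : ∀ u, E.fiber (x u) →ₗ[ℝ] F.fiber (y u)) : Prop :=
  ∃ a ∈ E.atlas, ∃ b ∈ F.atlas, x u₀ ∈ a.dom ∧ y u₀ ∈ b.dom ∧
    ∃ A : a.idx → b.idx → V → ℝ, (∀ j i, ContDiffWithinAt ℝ ∞ (A j i) U u₀) ∧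
      ∀ᶠ u in 𝓝[U] u₀, ∀ j, T u (a.sec j (x u)) = ∑ i, A j i u • b.sec i (y u)

theorem LocalFrame.SmoothTransition.exists_coeff {E : GradedBundle.{uM, uV} EM M}
    {a b : LocalFrame E.fiber} (h : LocalFrame.SmoothTransition EM a b)
    (ha : IsOpen a.dom) (hb : IsOpen b.dom) {U : Set V} {u₀ : V} {x : V → M}
    (hx : ContMDiffWithinAt 𝓘(ℝ, V) 𝓘(ℝ, EM) ∞ x U u₀) (hxa : x u₀ ∈ a.dom)
    (hxb : x u₀ ∈ b.dom) :
    ∃ A : b.idx → a.idx → V → ℝ, (∀ j i, ContDiffWithinAt ℝ ∞ (A j i) U u₀) ∧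
      ∀ᶠ u in 𝓝[U] u₀, ∀ j, b.sec j (x u) = ∑ i, A j i u • a.sec i (x u) := by
  obtain ⟨A, hA, hAx⟩ := h
  have hn : a.dom ∩ b.dom ∈ 𝓝 (x u₀) := (ha.inter hb).mem_nhds ⟨hxa, hxb⟩
  refine ⟨fun j i u => A j i (x u), fun j i => ?_, ?_⟩
  · rw [← contMDiffWithinAt_iff_contDiffWithinAt]
    exact ((hA j i).contMDiffAt hn).comp_contMDiffWithinAt u₀ hx
  · filter_upwards [hx.continuousWithinAt hn] with u hu j
    exact hAx _ hu j

theorem sum_smul_sum_smul {ι κ W : Type*} [Fintype ι] [Fintype κ] [AddCommGroup W] [Module ℝ W]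
    (a : ι → ℝ) (b : ι → κ → ℝ) (w : κ → W) :
    ∑ i, a i • ∑ k, b i k • w k = ∑ k, (∑ i, a i * b i k) • w k := by
  simp only [Finset.smul_sum, smul_smul, Finset.sum_smul]
  exact Finset.sum_comm

section

variable {D E F : GradedBundle.{uM, uV} EM M} {U : Set V} {u₀ : V} {x y z : V → M}
  {T T' : ∀ u, E.fiber (x u) →ₗ[ℝ] F.fiber (y u)}

theorem SmoothFamilyAt.congr (hT : SmoothFamilyAt E F U u₀ x y T)
    (h : ∀ᶠ u in 𝓝[U] u₀, T' u = T u) : SmoothFamilyAt E F U u₀ x y T' := by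
  obtain ⟨a, ha, b, hb, hxa, hyb, A, hA, hAT⟩ := hT
  refine ⟨a, ha, b, hb, hxa, hyb, A, hA, ?_⟩
  filter_upwards [hAT, h] with u hu hu' j
  rw [hu', hu]

theorem SmoothFamilyAt.exists_coeff (hT : SmoothFamilyAt E F U u₀ x y T)
    (hx : ContMDiffWithinAt 𝓘(ℝ, V) 𝓘(ℝ, EM) ∞ x U u₀)
    (hy : ContMDiffWithinAt 𝓘(ℝ, V) 𝓘(ℝ, EM) ∞ y U u₀)
    {a : LocalFrame E.fiber} (ha : E.IsSmoothFrame a) (hxa : x u₀ ∈ a.dom)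
    {b : LocalFrame F.fiber} (hb : F.IsSmoothFrame b) (hyb : y u₀ ∈ b.dom) :
    ∃ A : a.idx → b.idx → V → ℝ, (∀ j i, ContDiffWithinAt ℝ ∞ (A j i) U u₀) ∧
      ∀ᶠ u in 𝓝[U] u₀, ∀ j, T u (a.sec j (x u)) = ∑ i, A j i u • b.sec i (y u) := by
  obtain ⟨a', ha', b', hb', hxa', hyb', A, hA, hAT⟩ := hT
  obtain ⟨C, hC, hCx⟩ := (ha.2 a' ha').1.exists_coeff (E.isFrame _ ha').isOpen ha.1.isOpen hx
    hxa' hxa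
  obtain ⟨B, hB, hBy⟩ := (hb.2 b' hb').2.exists_coeff hb.1.isOpen (F.isFrame _ hb').isOpen hy
    hyb hyb'
  refine ⟨fun j i u => ∑ l, (∑ k, C j k u * A k l u) * B l i u, fun j i => ?_, ?_⟩
  · exact ContDiffWithinAt.sum fun l _ =>
      (ContDiffWithinAt.sum fun k _ => (hC j k).mul (hA k l)).mul (hB l i)
  · filter_upwards [hAT, hCx, hBy] with u h1 h2 h3 j
    rw [h2, map_sum]
    simp only [map_smul, h1, h3]
    rw [sum_smul_sum_smul, sum_smul_sum_smul]

theorem SmoothFamilyAt.comp {S : ∀ u, F.fiber (y u) →ₗ[ℝ] D.fiber (z u)}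
    (hS : SmoothFamilyAt F D U u₀ y z S) (hT : SmoothFamilyAt E F U u₀ x y T)
    (hy : ContMDiffWithinAt 𝓘(ℝ, V) 𝓘(ℝ, EM) ∞ y U u₀)
    (hz : ContMDiffWithinAt 𝓘(ℝ, V) 𝓘(ℝ, EM) ∞ z U u₀) :
    SmoothFamilyAt E D U u₀ x z (fun u => S u ∘ₗ T u) := by
  obtain ⟨a, ha, b, hb, hxa, hyb, A, hA, hAT⟩ := hT
  have hc := D.frameAt_mem (z u₀)
  obtain ⟨B, hB, hBS⟩ := hS.exists_coeff hy hz (F.isSmoothFrame_of_mem hb) hyb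
    (D.isSmoothFrame_of_mem hc) (D.mem_frameAt _)
  refine ⟨a, ha, _, hc, hxa, D.mem_frameAt _, fun j i u => ∑ k, A j k u * B k i u,
    fun j i => ContDiffWithinAt.sum fun k _ => (hA j k).mul (hB k i), ?_⟩
  filter_upwards [hAT, hBS] with u h1 h2 j
  rw [LinearMap.comp_apply, h1, map_sum]
  simp only [map_smul, h2]
  rw [sum_smul_sum_smul]

theorem SmoothFamilyAt.zero :
    SmoothFamilyAt E F U u₀ x y (fun _ => 0) :=
  ⟨_, E.frameAt_mem _, _, F.frameAt_mem _, E.mem_frameAt _, F.mem_frameAt _, fun _ _ _ => 0,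
    fun _ _ => contDiffWithinAt_const, Eventually.of_forall fun u j => by simp⟩

theorem SmoothFamilyAt.add (hT : SmoothFamilyAt E F U u₀ x y T)
    (hT' : SmoothFamilyAt E F U u₀ x y T')
    (hx : ContMDiffWithinAt 𝓘(ℝ, V) 𝓘(ℝ, EM) ∞ x U u₀)
    (hy : ContMDiffWithinAt 𝓘(ℝ, V) 𝓘(ℝ, EM) ∞ y U u₀) :
    SmoothFamilyAt E F U u₀ x y (fun u => T u + T' u) := by
  obtain ⟨a, ha, b, hb, hxa, hyb, A, hA, hAT⟩ := hT
  obtain ⟨B, hB, hBT⟩ := hT'.exists_coeff hx hy (E.isSmoothFrame_of_mem ha) hxa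
    (F.isSmoothFrame_of_mem hb) hyb
  refine ⟨a, ha, b, hb, hxa, hyb, fun j i u => A j i u + B j i u,
    fun j i => (hA j i).add (hB j i), ?_⟩
  filter_upwards [hAT, hBT] with u h1 h2 j
  rw [LinearMap.add_apply, h1, h2]
  simp only [add_smul, Finset.sum_add_distrib]

theorem SmoothFamilyAt.const_smul (c : ℝ) (hT : SmoothFamilyAt E F U u₀ x y T) :
    SmoothFamilyAt E F U u₀ x y (fun u => c • T u) := by
  obtain ⟨a, ha, b, hb, hxa, hyb, A, hA, hAT⟩ := hT
  refine ⟨a, ha, b, hb, hxa, hyb, fun j i u => c * A j i u,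
    fun j i => contDiffWithinAt_const.mul (hA j i), ?_⟩
  filter_upwards [hAT] with u h1 j
  rw [LinearMap.smul_apply, h1]
  simp only [Finset.smul_sum, smul_smul]

theorem SmoothFamilyAt.sum {ι : Type*} (s : Finset ι)
    {S : ι → ∀ u, E.fiber (x u) →ₗ[ℝ] F.fiber (y u)}
    (hS : ∀ i ∈ s, SmoothFamilyAt E F U u₀ x y (S i))
    (hx : ContMDiffWithinAt 𝓘(ℝ, V) 𝓘(ℝ, EM) ∞ x U u₀)
    (hy : ContMDiffWithinAt 𝓘(ℝ, V) 𝓘(ℝ, EM) ∞ y U u₀) :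
    SmoothFamilyAt E F U u₀ x y (fun u => ∑ i ∈ s, S i u) := by
  classical
  induction s using Finset.induction_on with
  | empty => simpa using SmoothFamilyAt.zero
  | insert i s hi ih =>
    simp only [Finset.sum_insert hi]
    exact (hS i (mem_insert_self _ _)).add (ih fun j hj => hS j (mem_insert_of_mem hj)) hx hy

theorem idOp_nil_apply (G : Type*) {p q : M} (h : p = q) (s : ∀ x, E.fiber x) :
    idOp G E p q [] (s p) = s q := by
  subst h
  simp [idOp]

theorem idOp_nil_self (G : Type*) (p : M) : idOp G E p p [] = LinearMap.id := by
  simp [idOp]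

theorem idOp_ne_nil {G : Type*} {p q : M} {g : List G} (hg : g ≠ []) : idOp G E p q g = 0 := by
  simp [idOp, hg]

theorem SmoothFamilyAt.idOp (G : Type*) (h : ∀ᶠ u in 𝓝[U] u₀, x u = y u) (hu₀ : x u₀ = y u₀) :
    SmoothFamilyAt E E U u₀ x y (fun u => idOp G E (x u) (y u) []) := by
  classical
  refine ⟨_, E.frameAt_mem (x u₀), _, E.frameAt_mem (x u₀), E.mem_frameAt _, ?_,
    fun j i _ => if i = j then 1 else 0, fun _ _ => contDiffWithinAt_const, ?_⟩
  · rw [← hu₀]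
    exact E.mem_frameAt _
  · filter_upwards [h] with u hu j
    rw [idOp_nil_apply G hu]
    simp

theorem SmoothFamilyAt.twist (l : ℤ) (hx : ContMDiffWithinAt 𝓘(ℝ, V) 𝓘(ℝ, EM) ∞ x U u₀) :
    SmoothFamilyAt E E U u₀ x x (fun u => E.twist (x u) l) := by
  classical
  have hf := E.isFrame _ (E.frameAt_mem (x u₀))
  refine ⟨_, E.frameAt_mem (x u₀), _, E.frameAt_mem (x u₀), E.mem_frameAt _, E.mem_frameAt _,
    fun j i _ => if i = j then (-1 : ℝ) ^ (l * (E.frameAt (x u₀)).deg j) else 0,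
    fun _ _ => contDiffWithinAt_const, ?_⟩
  filter_upwards [hx.continuousWithinAt (hf.isOpen.mem_nhds (E.mem_frameAt _))] with u hu j
  rw [E.twist_sec hf hu]
  simp

end

theorem SmoothFamilyAt.map {m : ℕ} {E F : Fin m → GradedBundle.{uM, uV} EM M} {U : Set V}
    {u₀ : V} {x y : V → M} {T : ∀ i u, (E i).fiber (x u) →ₗ[ℝ] (F i).fiber (y u)}
    (hT : ∀ i, SmoothFamilyAt (E i) (F i) U u₀ x y (T i)) :
    SmoothFamilyAt (GradedBundle.tensorBundle E) (GradedBundle.tensorBundle F) U u₀ x y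
      (fun u => PiTensorProduct.map fun i => T i u) := by
  classical
  choose a ha b hb hxa hyb A hA hAT using hT
  refine ⟨_, ⟨a, ha, rfl⟩, _, ⟨b, hb, rfl⟩, Set.mem_iInter.2 hxa, Set.mem_iInter.2 hyb,
    fun J I u => ∏ i, A i (J i) (I i) u, fun J I => contDiffWithinAt_prod fun i _ => hA i _ _,
    ?_⟩
  filter_upwards [eventually_all.2 hAT] with u hu J
  change PiTensorProduct.map (fun i => T i u)
    (PiTensorProduct.tprod ℝ fun i => (a i).sec (J i) (x u)) = _
  rw [PiTensorProduct.map_tprod, show (fun i => T i u ((a i).sec (J i) (x u)))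
    = fun i => ∑ j, A i (J i) j u • (b i).sec j (y u) from funext fun i => hu i (J i),
    MultilinearMap.map_sum]
  refine Finset.sum_congr rfl fun I _ => ?_
  rw [MultilinearMap.map_smul_univ]
  rfl

theorem SmoothFamilyAt.koszulMap {m : ℕ} {E F : Fin m → GradedBundle.{uM, uV} EM M} {U : Set V}
    {u₀ : V} {x y : V → M} {T : ∀ i u, (E i).fiber (x u) →ₗ[ℝ] (F i).fiber (y u)}
    (hT : ∀ i, SmoothFamilyAt (E i) (F i) U u₀ x y (T i)) (l : Fin m → ℤ)
    (hx : ContMDiffWithinAt 𝓘(ℝ, V) 𝓘(ℝ, EM) ∞ x U u₀)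
    (hy : ContMDiffWithinAt 𝓘(ℝ, V) 𝓘(ℝ, EM) ∞ y U u₀) :
    SmoothFamilyAt (GradedBundle.tensorBundle E) (GradedBundle.tensorBundle F) U u₀ x y
      (fun u => GradedBundle.koszulMap l fun i => T i u) :=
  SmoothFamilyAt.map fun i => (hT i).comp (SmoothFamilyAt.twist _ hx) hx hy

theorem SmoothFamilyAt.restrict {E F : GradedBundle.{uM, uV} EM M}
    {W : ∀ x, Submodule ℝ (E.fiber x)} {W' : ∀ x, Submodule ℝ (F.fiber x)}
    (hW : E.IsSubbundle W) (hW' : F.IsSubbundle W') {U : Set V} {u₀ : V} {x y : V → M}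
    {T : ∀ u, E.fiber (x u) →ₗ[ℝ] F.fiber (y u)} (hT : SmoothFamilyAt E F U u₀ x y T)
    {T' : ∀ u, W (x u) →ₗ[ℝ] W' (y u)}
    (h : ∀ᶠ u in 𝓝[U] u₀, ∀ v : W (x u), (W' (y u)).subtype (T' u v) = T u v)
    (hx : ContMDiffWithinAt 𝓘(ℝ, V) 𝓘(ℝ, EM) ∞ x U u₀)
    (hy : ContMDiffWithinAt 𝓘(ℝ, V) 𝓘(ℝ, EM) ∞ y U u₀) :
    SmoothFamilyAt (E.subBundle W hW) (F.subBundle W' hW') U u₀ x y T' := by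
  obtain ⟨f, S, hf, hxf⟩ := hW (x u₀)
  obtain ⟨f', S', hf', hyf'⟩ := hW' (y u₀)
  obtain ⟨A, hA, hAT⟩ := hT.exists_coeff hx hy hf.1 hxf hf'.1 hyf'
  refine ⟨_, ⟨f, S, hf, rfl⟩, _, ⟨f', S', hf', rfl⟩, hxf, hyf',
    fun j i => A (GradedBundle.subIdx W f S j) (GradedBundle.subIdx W' f' S' i),
    fun j i => hA _ _, ?_⟩
  filter_upwards [h, hAT, hx.continuousWithinAt (hf.1.1.isOpen.mem_nhds hxf),
    hy.continuousWithinAt (hf'.1.1.isOpen.mem_nhds hyf')] with u hu hu' hxu hyu j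
  apply (W' (y u)).injective_subtype
  have h1 : (W' (y u)).subtype (T' u ((GradedBundle.subFrame W f S).sec j (x u)))
      = ∑ i, A (GradedBundle.subIdx W f S j) i u • f'.sec i (y u) := by
    rw [hu, ← hu']
    exact congrArg _ (E.subFrame_coe hf hxu j)
  have hmem : ∑ i, A (GradedBundle.subIdx W f S j) i u • f'.sec i (y u) ∈ W' (y u) := by
    rw [← h1]
    exact (T' u _).2
  have hz : ∀ i, i ∉ S' → A (GradedBundle.subIdx W f S j) i u = 0 := by
    intro i hi
    rw [hf'.2 _ hyu, show (fun j => f'.sec j (y u)) '' S' = hf'.1.1.basis hyu '' S' from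
      Set.image_congr fun j _ => (hf'.1.1.basis_apply hyu j).symm,
      Module.Basis.mem_span_image, show (fun i => A (GradedBundle.subIdx W f S j) i u •
      f'.sec i (y u)) = fun i => A (GradedBundle.subIdx W f S j) i u • hf'.1.1.basis hyu i from
        funext fun i => by rw [hf'.1.1.basis_apply hyu]] at hmem
    by_contra hne
    refine hi (hmem (Finset.mem_coe.2 (Finsupp.mem_support_iff.2 ?_)))
    rwa [Module.Basis.repr_sum_self]
  refine (h1.trans ?_).trans (map_sum (W' (y u)).subtype _ _).symm
  refine Eq.trans ?_ (Finset.sum_congr rfl fun i _ =>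
    ((map_smul _ _ _).trans (congrArg _ (F.subFrame_coe hf' hyu i))).symm)
  symm
  refine Finset.sum_of_injOn (GradedBundle.subIdx W' f' S')
    (F.subIdx_injective W' f' S').injOn (fun _ _ => Finset.mem_coe.2 (Finset.mem_univ _)) ?_
    (fun _ _ => rfl)
  intro i _ hi
  rw [hz i, zero_smul]
  intro hiS
  obtain ⟨k, hk⟩ := (F.range_subIdx W' f' S').superset hiS
  exact hi ⟨k, Finset.mem_coe.2 (Finset.mem_univ _), hk⟩

end Smooth


/-! ## Operators on strings of a given length -/

section Operators

open scoped ContDiff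
open Filter Topology

variable {EM : Type*} [NormedAddCommGroup EM] [NormedSpace ℝ EM]
  {M : Type uM} [TopologicalSpace M] [ChartedSpace EM M]
  {EG : Type*} [NormedAddCommGroup EG] [NormedSpace ℝ EG]
  {G : Type*} [TopologicalSpace G] [ChartedSpace EG G]
  {C D E F : GradedBundle.{uM, uV} EM M} (Γ : LieGroupoid EM M EG G)

/-- Equality of operators on strings of length `k`. -/
def OpEqAt (k : ℕ) (φ ψ : OpFamily G E F) : Prop :=
  ∀ x y g, Γ.IsString x y g → g.length = k → φ x y g = ψ x y g

/-- The operators have degree `d` on strings of length `k`. -/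
def HasOpDegreeAt (k : ℕ) (d : ℤ) (φ : OpFamily G E F) : Prop :=
  ∀ x y g, Γ.IsString x y g → g.length = k → ∀ n, ∀ v ∈ E.gr x n, φ x y g v ∈ F.gr y (n + d)

/-- Operators precomposed with the composition of blocks of arrows. -/
def treeOp (φ : OpFamily G E F) (X : List ℕ+) : OpFamily G E F :=
  fun x y g => φ x y (Γ.collapse X g)

/-- Operators precomposed with the composition of two adjacent arrows. -/
def mulOp (i : ℕ) (φ : OpFamily G E F) : OpFamily G E F :=
  fun x y g => φ x y (Γ.mulAt i g)

variable {Γ}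

theorem OpEqAt.refl (k : ℕ) (φ : OpFamily G E F) : OpEqAt Γ k φ φ := fun _ _ _ _ _ => rfl

theorem OpEqAt.trans {k : ℕ} {φ ψ χ : OpFamily G E F} (h : OpEqAt Γ k φ ψ)
    (h' : OpEqAt Γ k ψ χ) : OpEqAt Γ k φ χ :=
  fun x y g hg hk => (h x y g hg hk).trans (h' x y g hg hk)

theorem OpEqAt.add {k : ℕ} {φ ψ φ' ψ' : OpFamily G E F} (h : OpEqAt Γ k φ ψ)
    (h' : OpEqAt Γ k φ' ψ') : OpEqAt Γ k (φ + φ') (ψ + ψ') :=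
  fun x y g hg hk => congrArg₂ (· + ·) (h x y g hg hk) (h' x y g hg hk)

theorem OpEqAt.sub {k : ℕ} {φ ψ φ' ψ' : OpFamily G E F} (h : OpEqAt Γ k φ ψ)
    (h' : OpEqAt Γ k φ' ψ') : OpEqAt Γ k (φ - φ') (ψ - ψ') :=
  fun x y g hg hk => congrArg₂ (· - ·) (h x y g hg hk) (h' x y g hg hk)

theorem OpEqAt.smul {k : ℕ} {φ ψ : OpFamily G E F} (h : OpEqAt Γ k φ ψ) (c : ℝ) :
    OpEqAt Γ k (c • φ) (c • ψ) :=
  fun x y g hg hk => congrArg (c • ·) (h x y g hg hk)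

theorem OpEqAt.sum {k : ℕ} {ι : Type*} (s : Finset ι) {φ ψ : ι → OpFamily G E F}
    (h : ∀ i ∈ s, OpEqAt Γ k (φ i) (ψ i)) : OpEqAt Γ k (∑ i ∈ s, φ i) (∑ i ∈ s, ψ i) := by
  intro x y g hg hk
  simp only [Finset.sum_apply]
  exact Finset.sum_congr rfl fun i hi => h i hi x y g hg hk

theorem OpEqAt.compAt {j k : ℕ} {φ φ' : OpFamily G E F} {ψ ψ' : OpFamily G D E}
    (h : OpEqAt Γ j φ φ') (h' : OpEqAt Γ k ψ ψ') :
    OpEqAt Γ (j + k) (compAt Γ j φ ψ) (compAt Γ j φ' ψ') := by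
  intro x y g hg hk
  unfold _root_.compAt
  rw [h _ _ _ (hg.take j) (by rw [List.length_take]; omega),
    h' _ _ _ (hg.drop j) (by rw [List.length_drop]; omega)]

theorem OpEqAt.treeOp {φ φ' : OpFamily G E F} (X : List ℕ+) (h : OpEqAt Γ X.length φ φ') :
    OpEqAt Γ (treeOrder X) (treeOp Γ φ X) (_root_.treeOp Γ φ' X) := fun _ _ _ hg hk =>
  h _ _ _ (hg.collapse hk) (LieGroupoid.length_collapse hk.ge)

variable (Γ) in
/-- Composition of operators as a bilinear map. -/
def compAtL (j : ℕ) : OpFamily G E F →ₗ[ℝ] OpFamily G D E →ₗ[ℝ] OpFamily G D F :=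
  LinearMap.mk₂ ℝ (compAt Γ j)
    (fun φ φ' ψ => by funext _ _ _; exact LinearMap.add_comp _ _ _)
    (fun c φ ψ => by funext _ _ _; exact LinearMap.smul_comp _ _ _)
    (fun φ ψ ψ' => by funext _ _ _; exact LinearMap.comp_add _ _ _)
    (fun c φ ψ => by funext _ _ _; exact LinearMap.comp_smul _ _ _)

theorem compAtL_apply (j : ℕ) (φ : OpFamily G E F) (ψ : OpFamily G D E) :
    compAtL Γ j φ ψ = compAt Γ j φ ψ := rfl

theorem compAt_assoc (i j : ℕ) (φ : OpFamily G E F) (ψ : OpFamily G D E) (χ : OpFamily G C D) :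
    compAt Γ (i + j) (compAt Γ i φ ψ) χ = compAt Γ i φ (compAt Γ j ψ χ) := by
  funext x y g
  unfold compAt
  rw [Γ.vertex_take y g (Nat.le_add_right i j), Γ.vertex_drop y g i j,
    List.take_take, min_eq_left (Nat.le_add_right i j), List.drop_drop, List.drop_take,
    Nat.add_sub_cancel_left, LinearMap.comp_assoc]

theorem compAt_zero_idOp (φ : OpFamily G D E) : compAt Γ 0 (idOp G E) φ = φ := by
  funext x y g
  unfold compAt
  rw [Γ.vertex_zero, List.take_zero, idOp_nil_self, List.drop_zero, LinearMap.id_comp]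

theorem compAt_zero (φ : OpFamily G E F) (ψ : OpFamily G D E) (x y : M) (g : List G) :
    compAt Γ 0 φ ψ x y g = φ y y [] ∘ₗ ψ x y g := by
  unfold compAt
  rw [Γ.vertex_zero, List.take_zero, List.drop_zero]

theorem compAt_length (φ : OpFamily G E F) (ψ : OpFamily G D E) {x y : M} {g : List G}
    (hg : Γ.IsString x y g) {k : ℕ} (hk : g.length = k) :
    compAt Γ k φ ψ x y g = φ x y g ∘ₗ ψ x x [] := by
  subst hk
  unfold compAt
  rw [hg.vertex_length, List.take_length, List.drop_length]

theorem compAt_idOp (φ : OpFamily G D E) (k : ℕ) : OpEqAt Γ k (compAt Γ k φ (idOp G D)) φ := by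
  intro x y g hg hk
  rw [compAt_length _ _ hg hk, idOp_nil_self, LinearMap.comp_id]

theorem compAt_mulAt_of_lt {x y : M} {g : List G} (hg : Γ.IsString x y g) {i j : ℕ} (h : i < j)
    (hj : j < g.length) (φ : OpFamily G E F) (ψ : OpFamily G D E) :
    compAt Γ j φ ψ x y (Γ.mulAt i g) = compAt Γ (j + 1) (mulOp Γ i φ) ψ x y g := by
  unfold compAt mulOp
  rw [hg.vertex_mulAt h hj, LieGroupoid.mulAt_take _ h, LieGroupoid.mulAt_drop h hj]

theorem compAt_mulAt_of_le (x y : M) (g : List G) {i j : ℕ} (h : j ≤ i)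
    (φ : OpFamily G E F) (ψ : OpFamily G D E) :
    compAt Γ j φ ψ x y (Γ.mulAt i g) = compAt Γ j φ (mulOp Γ (i - j) ψ) x y g := by
  unfold compAt mulOp
  rw [LieGroupoid.vertex_mulAt_of_le _ _ h, LieGroupoid.mulAt_take_of_le _ h,
    LieGroupoid.mulAt_drop_of_le _ h]

theorem treeOp_compAt (φ : OpFamily G E F) (ψ : OpFamily G D E) (X : List ℕ+) (j : ℕ) :
    OpEqAt Γ (treeOrder X) (treeOp Γ (compAt Γ j φ ψ) X)
      (compAt Γ (treeOrder (X.take j)) (treeOp Γ φ (X.take j)) (treeOp Γ ψ (X.drop j))) := by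
  intro x y g hg hk
  unfold treeOp compAt
  rw [hg.vertex_collapse hk.ge, LieGroupoid.collapse_take hk.ge, LieGroupoid.collapse_drop hk.ge]

theorem treeOp_mergeAt (φ : OpFamily G E F) (X : List ℕ+) {j : ℕ} (hj : j + 1 < X.length) :
    OpEqAt Γ (treeOrder X) (treeOp Γ (mulOp Γ j φ) X) (treeOp Γ φ (mergeAt j X)) := by
  intro x y g hg hk
  unfold treeOp mulOp
  rw [hg.collapse_mergeAt hk.ge hj]

theorem treeOp_dupTree (φ : OpFamily G E F) (X : List ℕ+) {i : ℕ} (hi : i < treeOrder X) :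
    OpEqAt Γ (treeOrder X + 1) (treeOp Γ φ (dupTree i X)) (mulOp Γ i (treeOp Γ φ X)) := by
  intro x y g hg hk
  unfold treeOp mulOp
  rw [hg.collapse_dupTree (by omega) hi]

/-! ### Degrees -/

theorem hasOpDegree_iff {c : ℤ} {φ : OpFamily G E F} :
    HasOpDegree Γ c φ ↔ ∀ k : ℕ, HasOpDegreeAt Γ k (c - k) φ := by
  constructor
  · rintro h k x y g hg rfl
    exact h x y g hg
  · intro h x y g hg
    exact h _ x y g hg rfl

theorem HasOpDegreeAt.compAt {j k : ℕ} {d e : ℤ} {φ : OpFamily G E F} {ψ : OpFamily G D E}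
    (hφ : HasOpDegreeAt Γ j d φ) (hψ : HasOpDegreeAt Γ k e ψ) :
    HasOpDegreeAt Γ (j + k) (d + e) (compAt Γ j φ ψ) := by
  intro x y g hg hk n v hv
  have h1 := hψ _ _ _ (hg.drop j) (by rw [List.length_drop]; omega) n v hv
  have h2 := hφ _ _ _ (hg.take j) (by rw [List.length_take]; omega) _ _ h1
  rw [show n + (d + e) = n + e + d by ring]
  exact h2

theorem HasOpDegreeAt.treeOp {d : ℤ} {φ : OpFamily G E F} {X : List ℕ+}
    (hφ : HasOpDegreeAt Γ X.length d φ) : HasOpDegreeAt Γ (treeOrder X) d (treeOp Γ φ X) :=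
  fun x y _ hg hk => hφ x y _ (hg.collapse hk) (LieGroupoid.length_collapse hk.ge)

theorem hasOpDegreeAt_idOp : HasOpDegreeAt Γ 0 0 (idOp G E) := by
  intro x y g hg hk n v hv
  obtain rfl := List.length_eq_zero_iff.1 hk
  obtain rfl : x = y := hg
  simpa [idOp_nil_self] using hv

/-! ### Smoothness -/

variable (Γ) in
/-- A smooth family of strings. -/
structure IsStringFamily {V : Type*} [NormedAddCommGroup V] [NormedSpace ℝ V] (U : Set V)
    (x y : V → M) (γ : List (V → G)) : Prop where
  smooth_src : ContMDiffOn 𝓘(ℝ, V) 𝓘(ℝ, EM) ∞ x U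
  smooth_tgt : ContMDiffOn 𝓘(ℝ, V) 𝓘(ℝ, EM) ∞ y U
  smooth : ∀ c ∈ γ, ContMDiffOn 𝓘(ℝ, V) 𝓘(ℝ, EG) ∞ c U
  isString : ∀ u ∈ U, Γ.IsString (x u) (y u) (γ.map fun c => c u)

variable (Γ) in
/-- The operators depend smoothly on strings of length `k`. -/
def IsSmoothOpAt (k : ℕ) (φ : OpFamily G E F) : Prop :=
  ∀ (N : ℕ) (U : Set (EuclideanSpace ℝ (Fin N))), IsOpen U →
    ∀ (x y : EuclideanSpace ℝ (Fin N) → M) (γ : List (EuclideanSpace ℝ (Fin N) → G)),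
    IsStringFamily Γ U x y γ → γ.length = k → ∀ u₀ ∈ U,
    SmoothFamilyAt E F U u₀ x y (fun u => φ (x u) (y u) (γ.map fun c => c u))

theorem isSmoothOp_iff {φ : OpFamily G E F} :
    IsSmoothOp Γ φ ↔ ∀ k, IsSmoothOpAt Γ k φ := by
  constructor
  · intro h k N U hU x y γ hγ _ u₀ hu₀
    have ha := E.isFrame _ (E.frameAt_mem (x u₀))
    have hb := F.isFrame _ (F.frameAt_mem (y u₀))
    let W := (U ∩ x ⁻¹' (E.frameAt (x u₀)).dom) ∩ (U ∩ y ⁻¹' (F.frameAt (y u₀)).dom)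
    have hW : IsOpen W := (hγ.smooth_src.continuousOn.isOpen_inter_preimage hU ha.isOpen).inter
      (hγ.smooth_tgt.continuousOn.isOpen_inter_preimage hU hb.isOpen)
    have hWU : W ⊆ U := fun u hu => hu.1.1
    have hu₀W : u₀ ∈ W := ⟨⟨hu₀, E.mem_frameAt _⟩, hu₀, F.mem_frameAt _⟩
    obtain ⟨A, hA, hAφ⟩ := h N W hW x y γ (hγ.smooth_src.mono hWU) (hγ.smooth_tgt.mono hWU)
      (fun c hc => (hγ.smooth c hc).mono hWU) (fun u hu => hγ.isString u (hWU hu))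
      _ (E.frameAt_mem (x u₀)) _ (F.frameAt_mem (y u₀)) (fun u hu => ⟨hu.1.2, hu.2.2⟩)
    refine ⟨_, E.frameAt_mem (x u₀), _, F.frameAt_mem (y u₀), E.mem_frameAt _, F.mem_frameAt _,
      A, fun j i => ((hA j i).contDiffAt (hW.mem_nhds hu₀W)).contDiffWithinAt, ?_⟩
    filter_upwards [mem_nhdsWithin_of_mem_nhds (hW.mem_nhds hu₀W)] with u hu
    exact hAφ u hu
  · intro h N U hU x y γ hx hy hc hs a ha b hb hab
    have hγ : IsStringFamily Γ U x y γ := ⟨hx, hy, hc, hs⟩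
    classical
    let A : a.idx → b.idx → EuclideanSpace ℝ (Fin N) → ℝ := fun j i u =>
      if hu : y u ∈ b.dom then ((F.isFrame b hb).basis hu).repr
        (φ (x u) (y u) (γ.map fun c => c u) (a.sec j (x u))) i else 0
    refine ⟨A, fun j i u₀ hu₀ => ?_, fun u hu j => ?_⟩
    · obtain ⟨B, hB, hBφ⟩ := (h _ N U hU x y γ hγ rfl u₀ hu₀).exists_coeff (hx u₀ hu₀) (hy u₀ hu₀)
        (E.isSmoothFrame_of_mem ha) (hab u₀ hu₀).1 (F.isSmoothFrame_of_mem hb) (hab u₀ hu₀).2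
      have hAB : ∀ u ∈ U, (∀ j, φ (x u) (y u) (γ.map fun c => c u) (a.sec j (x u))
          = ∑ i, B j i u • b.sec i (y u)) → A j i u = B j i u := by
        intro u hu hu'
        simp only [A, dif_pos (hab u hu).2]
        rw [hu' j, show (fun i => B j i u • b.sec i (y u))
          = fun i => B j i u • (F.isFrame b hb).basis (hab u hu).2 i from
            funext fun i => by rw [(F.isFrame b hb).basis_apply], Module.Basis.repr_sum_self]
      refine (hB j i).congr_of_eventuallyEq ?_ (hAB u₀ hu₀ (hBφ.self_of_nhdsWithin hu₀))
      filter_upwards [hBφ, self_mem_nhdsWithin] with u h1 h2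
      exact hAB u h2 h1
    · simp only [A, dif_pos (hab u hu).2]
      conv_lhs => rw [← ((F.isFrame b hb).basis (hab u hu).2).sum_repr
        (φ (x u) (y u) (γ.map fun c => c u) (a.sec j (x u)))]
      refine Finset.sum_congr rfl fun i _ => ?_
      rw [(F.isFrame b hb).basis_apply]

theorem IsSmoothOpAt.congr {k : ℕ} {φ ψ : OpFamily G E F} (hφ : IsSmoothOpAt Γ k φ)
    (h : OpEqAt Γ k ψ φ) : IsSmoothOpAt Γ k ψ := by
  intro N U hU x y γ hγ hk u₀ hu₀
  refine (hφ N U hU x y γ hγ hk u₀ hu₀).congr ?_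
  filter_upwards [self_mem_nhdsWithin] with u hu
  exact h _ _ _ (hγ.isString u hu) (by rwa [List.length_map])

section StringFamily

variable {V : Type*} [NormedAddCommGroup V] [NormedSpace ℝ V] {U : Set V} {x y : V → M}
  {γ : List (V → G)}

theorem LieGroupoid.contMDiff_src : ContMDiff 𝓘(ℝ, EG) 𝓘(ℝ, EM) ∞ Γ.src :=
  fun g => (Γ.src_submersion g).contMDiffAt

theorem contMDiffOn_vertex (hy : ContMDiffOn 𝓘(ℝ, V) 𝓘(ℝ, EM) ∞ y U)
    (hγ : ∀ c ∈ γ, ContMDiffOn 𝓘(ℝ, V) 𝓘(ℝ, EG) ∞ c U) (j : ℕ) :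
    ContMDiffOn 𝓘(ℝ, V) 𝓘(ℝ, EM) ∞ (fun u => Γ.vertex (y u) (γ.map fun c => c u) j) U := by
  induction γ generalizing y j with
  | nil => simpa using hy
  | cons c γ ih =>
    cases j with
    | zero => simpa using hy
    | succ j =>
      exact ih (Γ.contMDiff_src.comp_contMDiffOn (hγ c List.mem_cons_self))
        (fun d hd => hγ d (List.mem_cons_of_mem _ hd)) j

theorem IsStringFamily.take (h : IsStringFamily Γ U x y γ) (j : ℕ) :
    IsStringFamily Γ U (fun u => Γ.vertex (y u) (γ.map fun c => c u) j) y (γ.take j) where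
  smooth_src := contMDiffOn_vertex h.smooth_tgt h.smooth j
  smooth_tgt := h.smooth_tgt
  smooth c hc := h.smooth c (List.mem_of_mem_take hc)
  isString u hu := by
    rw [List.map_take]
    exact (h.isString u hu).take j

theorem IsStringFamily.drop (h : IsStringFamily Γ U x y γ) (j : ℕ) :
    IsStringFamily Γ U x (fun u => Γ.vertex (y u) (γ.map fun c => c u) j) (γ.drop j) where
  smooth_src := h.smooth_src
  smooth_tgt := contMDiffOn_vertex h.smooth_tgt h.smooth j
  smooth c hc := h.smooth c (List.mem_of_mem_drop hc)
  isString u hu := by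
    rw [List.map_drop]
    exact (h.isString u hu).drop j

theorem contMDiffOn_foldl_mul {a : V → G} (ha : ContMDiffOn 𝓘(ℝ, V) 𝓘(ℝ, EG) ∞ a U)
    (hγ : ∀ c ∈ γ, ContMDiffOn 𝓘(ℝ, V) 𝓘(ℝ, EG) ∞ c U)
    (h : ∀ u ∈ U, Γ.IsString (x u) (Γ.src (a u)) (γ.map fun c => c u)) :
    ContMDiffOn 𝓘(ℝ, V) 𝓘(ℝ, EG) ∞ (fun u => (γ.map fun c => c u).foldl Γ.mul (a u)) U := by
  induction γ generalizing a with
  | nil => exact ha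
  | cons c γ ih =>
    have hm : ContMDiffOn 𝓘(ℝ, V) 𝓘(ℝ, EG) ∞ (fun u => Γ.mul (a u) (c u)) U :=
      Γ.smooth_mul.comp (ha.prodMk (hγ c List.mem_cons_self)) fun u hu => (h u hu).1.symm
    refine ih hm (fun d hd => hγ d (List.mem_cons_of_mem _ hd)) fun u hu => ?_
    rw [Γ.src_mul _ _ (h u hu).1.symm]
    exact (h u hu).2

theorem IsStringFamily.exists_collapse (h : IsStringFamily Γ U x y γ) {X : List ℕ+}
    (hX : γ.length = treeOrder X) :
    ∃ δ : List (V → G), δ.length = X.length ∧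
      (∀ c ∈ δ, ContMDiffOn 𝓘(ℝ, V) 𝓘(ℝ, EG) ∞ c U) ∧
      ∀ u, Γ.collapse X (γ.map fun c => c u) = δ.map fun c => c u := by
  induction X generalizing y γ with
  | nil => exact ⟨[], rfl, by simp, by simp⟩
  | cons n X ih =>
    obtain ⟨a, l, rfl, hl⟩ := exists_eq_cons_of_treeOrder_le hX.ge
    rw [treeOrder_cons, List.length_cons] at hX
    have hn := n.pos
    have hl' : IsStringFamily Γ U x (fun u => Γ.src (a u)) l :=
      ⟨h.smooth_src, Γ.contMDiff_src.comp_contMDiffOn (h.smooth a List.mem_cons_self),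
        fun c hc => h.smooth c (List.mem_cons_of_mem _ hc), fun u hu => (h.isString u hu).2⟩
    obtain ⟨δ, hδ, hδs, hδc⟩ := ih (hl'.drop (n - 1)) (by rw [List.length_drop]; omega)
    refine ⟨(fun u => ((l.take (n - 1)).map fun c => c u).foldl Γ.mul (a u)) :: δ, by simp [hδ],
      ?_, fun u => ?_⟩
    · intro c hc
      rcases List.mem_cons.1 hc with rfl | hc
      · exact contMDiffOn_foldl_mul (h.smooth a List.mem_cons_self)
          (hl'.take (n - 1)).smooth (hl'.take (n - 1)).isString
      · exact hδs c hc
    · rw [List.map_cons, LieGroupoid.collapse_cons, List.map_cons, ← hδc]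
      simp only [List.map_take, List.map_drop]

theorem IsStringFamily.collapse (h : IsStringFamily Γ U x y γ) {X : List ℕ+}
    (hX : γ.length = treeOrder X) :
    ∃ δ : List (V → G), δ.length = X.length ∧ IsStringFamily Γ U x y δ ∧
      ∀ u, Γ.collapse X (γ.map fun c => c u) = δ.map fun c => c u := by
  obtain ⟨δ, h1, h2, h3⟩ := h.exists_collapse hX
  refine ⟨δ, h1, ⟨h.smooth_src, h.smooth_tgt, h2, fun u hu => ?_⟩, h3⟩
  rw [← h3]
  exact (h.isString u hu).collapse (by rw [List.length_map, hX])

end StringFamily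

theorem IsSmoothOpAt.compAt {j k : ℕ} {φ : OpFamily G E F} {ψ : OpFamily G D E}
    (hφ : IsSmoothOpAt Γ j φ) (hψ : IsSmoothOpAt Γ k ψ) :
    IsSmoothOpAt Γ (j + k) (compAt Γ j φ ψ) := by
  intro N U hU x y γ hγ hk u₀ hu₀
  unfold _root_.compAt
  simp only [← List.map_take, ← List.map_drop]
  exact (hφ N U hU _ y _ (hγ.take j) (by rw [List.length_take]; omega) u₀ hu₀).comp
    (hψ N U hU x _ _ (hγ.drop j) (by rw [List.length_drop]; omega) u₀ hu₀)
    ((hγ.take j).smooth_src u₀ hu₀) (hγ.smooth_tgt u₀ hu₀)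

theorem IsSmoothOpAt.treeOp {φ : OpFamily G E F} {X : List ℕ+}
    (hφ : IsSmoothOpAt Γ X.length φ) : IsSmoothOpAt Γ (treeOrder X) (treeOp Γ φ X) := by
  intro N U hU x y γ hγ hk u₀ hu₀
  obtain ⟨δ, h1, h2, h3⟩ := hγ.collapse hk
  unfold _root_.treeOp
  simp only [h3]
  exact hφ N U hU x y δ h2 h1 u₀ hu₀

theorem isSmoothOpAt_idOp (k : ℕ) : IsSmoothOpAt Γ k (idOp G E) := by
  intro N U hU x y γ hγ hk u₀ hu₀
  cases γ with
  | nil =>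
    refine SmoothFamilyAt.idOp G ?_ (hγ.isString u₀ hu₀)
    filter_upwards [self_mem_nhdsWithin] with u hu
    exact hγ.isString u hu
  | cons c γ =>
    refine SmoothFamilyAt.zero.congr (Eventually.of_forall fun u => ?_)
    exact idOp_ne_nil (by simp)

end Operators


/-! ## Characteristic maps -/

section Characteristic

open Finsupp (linearCombination)

variable {EM : Type*} [NormedAddCommGroup EM] [NormedSpace ℝ EM]
  {M : Type uM} [TopologicalSpace M] [ChartedSpace EM M]
  {EG : Type*} [NormedAddCommGroup EG] [NormedSpace ℝ EG]
  {G : Type*} [TopologicalSpace G] [ChartedSpace EG G]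
  {C D E F : GradedBundle.{uM, uV} EM M} {Γ : LieGroupoid EM M EG G}

/-- The graded commutator of operators of degree `d` with the differentials. -/
def commOp (R : OpFamily G E E) (R' : OpFamily G F F) (d : ℤ) (φ : OpFamily G E F) :
    OpFamily G E F :=
  fun x y g => R' y y [] ∘ₗ φ x y g - sg d • (φ x y g ∘ₗ R x x [])

theorem commOp_smul (R : OpFamily G E E) (R' : OpFamily G F F) (d : ℤ) (c : ℝ)
    (φ : OpFamily G E F) : commOp R R' d (c • φ) = c • commOp R R' d φ := by
  funext x y g
  change R' y y [] ∘ₗ (c • φ x y g) - sg d • ((c • φ x y g) ∘ₗ R x x [])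
    = c • (R' y y [] ∘ₗ φ x y g - sg d • (φ x y g ∘ₗ R x x []))
  rw [LinearMap.comp_smul, LinearMap.smul_comp, smul_sub, smul_comm]

theorem commOp_compAt (R : OpFamily G D D) (R' : OpFamily G E E) (R'' : OpFamily G F F)
    (d e : ℤ) (j : ℕ) (φ : OpFamily G E F) (ψ : OpFamily G D E) :
    commOp R R'' (d + e) (compAt Γ j φ ψ) = compAt Γ j (commOp R' R'' d φ) ψ
      + sg d • compAt Γ j φ (commOp R R' e ψ) := by
  funext x y g
  simp only [Pi.add_apply, Pi.smul_apply]
  unfold compAt commOp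
  ext v
  simp only [LinearMap.sub_apply, LinearMap.add_apply, LinearMap.comp_apply, LinearMap.smul_apply,
    map_sub, map_smul, sg_add, smul_sub, smul_smul]
  abel

theorem treeOrder_take_add_drop (X : List ℕ+) (j : ℕ) :
    treeOrder (X.take j) + treeOrder (X.drop j) = treeOrder X := by
  rw [treeOrder, treeOrder, treeOrder, ← List.sum_append, ← List.map_append,
    List.take_append_drop]

theorem treeOrder_mergeAt (X : List ℕ+) (j : ℕ) : treeOrder (mergeAt j X) = treeOrder X := by
  induction X generalizing j with
  | nil => cases j <;> rfl
  | cons n X ih =>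
    cases j with
    | zero =>
      cases X with
      | nil => rfl
      | cons n' X => simp [mergeAt, add_assoc]
    | succ j => simp [mergeAt, ih]

theorem treeOrder_dupTree {X : List ℕ+} {i : ℕ} (h : i < treeOrder X) :
    treeOrder (dupTree i X) = treeOrder X + 1 := by
  induction X generalizing i with
  | nil => simp at h
  | cons n X ih =>
    rw [treeOrder_cons] at h
    rw [dupTree]
    split_ifs with hi
    · simp only [treeOrder_cons, PNat.add_coe, PNat.one_coe]
      omega
    · rw [treeOrder_cons, treeOrder_cons, ih (by omega)]
      omega

/-! ### Forests -/

section Forest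

variable {R : OpFamily G E E}

theorem evalForest_cons (R : OpFamily G E E) (X : List ℕ+) (A : List (List ℕ+)) :
    evalForest Γ R (X :: A) = compAt Γ (treeOrder X) (treeOp Γ R X) (evalForest Γ R A) := rfl

theorem evalForest_append (R : OpFamily G E E) (A B : List (List ℕ+)) :
    evalForest Γ R (A ++ B) = compAt Γ (forestOrder A) (evalForest Γ R A) (evalForest Γ R B) := by
  induction A with
  | nil => exact (compAt_zero_idOp _).symm
  | cons X A ih =>
    rw [List.cons_append, evalForest_cons, ih, evalForest_cons, forestOrder_cons, compAt_assoc]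

theorem evalForest_singleton (R : OpFamily G E E) (X : List ℕ+) :
    OpEqAt Γ (treeOrder X) (evalForest Γ R [X]) (treeOp Γ R X) :=
  compAt_idOp (treeOp Γ R X) (treeOrder X)

theorem evalForest_degree (hR : HasOpDegree Γ 1 R) (A : List (List ℕ+)) :
    HasOpDegreeAt Γ (forestOrder A) (forestDeg A) (evalForest Γ R A) := by
  induction A with
  | nil => exact hasOpDegreeAt_idOp
  | cons X A ih =>
    rw [forestOrder_cons, forestDeg_cons]
    exact HasOpDegreeAt.compAt (hasOpDegree_iff.1 hR _).treeOp ih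

theorem evalForest_smooth (hR : IsSmoothOp Γ R) (A : List (List ℕ+)) :
    IsSmoothOpAt Γ (forestOrder A) (evalForest Γ R A) := by
  induction A with
  | nil => exact isSmoothOpAt_idOp 0
  | cons X A ih =>
    rw [forestOrder_cons]
    exact IsSmoothOpAt.compAt (isSmoothOp_iff.1 hR _).treeOp ih

theorem evalForest_dupForest (R : OpFamily G E E) (A : List (List ℕ+)) :
    ∀ i < forestOrder A, OpEqAt Γ (forestOrder A + 1) (evalForest Γ R (dupForest i A))
      (mulOp Γ i (evalForest Γ R A)) := by
  induction A with
  | nil => intro i hi; simp at hi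
  | cons X A ih =>
    intro i hi x y g hg hk
    rw [forestOrder_cons] at hi hk
    rw [mulOp, evalForest_cons]
    by_cases h : i < treeOrder X
    · rw [dupForest_cons_lt _ h, compAt_mulAt_of_lt hg h (by omega), evalForest_cons,
        treeOrder_dupTree h]
      exact (treeOp_dupTree R X h).compAt (OpEqAt.refl (forestOrder A) _) x y g hg (by omega)
    · rw [dupForest_cons_ge _ (by omega), compAt_mulAt_of_le _ _ _ (by omega), evalForest_cons]
      exact (OpEqAt.refl (treeOrder X) _).compAt (ih (i - treeOrder X) (by omega)) x y g hg
        (by omega)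

theorem forestOrder_dupForest {A : List (List ℕ+)} {i : ℕ} (h : i < forestOrder A) :
    forestOrder (dupForest i A) = forestOrder A + 1 := by
  induction A generalizing i with
  | nil => simp at h
  | cons X A ih =>
    rw [forestOrder_cons] at h
    rw [dupForest]
    split_ifs with hi
    · rw [forestOrder_cons, forestOrder_cons, treeOrder_dupTree hi]
      omega
    · rw [forestOrder_cons, forestOrder_cons, ih (by omega)]
      omega

/-- The equation of a representation up to homotopy, with the terms containing the differential
separated. -/
theorem IsRepresentation.commOp_eq (hR : IsRepresentation Γ R) {k : ℕ} (hk : 0 < k) :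
    OpEqAt Γ k (∑ j ∈ range (k - 1), (-1 : ℝ) ^ j • (compAt Γ (j + 1) R R - mulOp Γ j R))
      (commOp R R (1 - k) R) := by
  rintro x y g hg rfl
  have h := hR.equation x y g hg
  obtain ⟨n, hn⟩ : ∃ n, g.length = n + 1 := ⟨g.length - 1, by omega⟩
  rw [hn, Nat.add_sub_cancel, sum_range_succ', sum_range_succ, compAt_zero, ← hn,
    compAt_length _ _ hg rfl, hn] at h
  simp only [pow_succ', neg_one_mul, neg_smul, sum_neg_distrib, pow_zero, one_smul] at h
  rw [hn, Nat.add_sub_cancel]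
  simp only [Finset.sum_apply, Pi.smul_apply, Pi.sub_apply, smul_sub, sum_sub_distrib]
  change _ - ∑ j ∈ range n, (-1 : ℝ) ^ j • R x y (Γ.mulAt j g) = R y y [] ∘ₗ R x y g -
    sg (1 - ((n + 1 : ℕ) : ℤ)) • (R x y g ∘ₗ R x x [])
  rw [sg_congr (-(n : ℤ)) (show 1 - ((n + 1 : ℕ) : ℤ) = (n : ℤ) + 2 * (-(n : ℤ)) by push_cast; ring),
    ← negOne_pow_eq_sg, sub_eq_add_neg, h]
  abel

theorem lc_evalForest_bdryTree (hR : IsRepresentation Γ R) {X : List ℕ+} (hX : X ≠ []) :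
    OpEqAt Γ (treeOrder X) (linearCombination ℝ (evalForest Γ R) (bdryTree X))
      (commOp R R (1 - X.length) (treeOp Γ R X)) := by
  have h := (hR.commOp_eq (k := X.length) (List.length_pos_iff.2 hX)).treeOp X
  refine OpEqAt.trans ?_ h
  rw [bdryTree, map_sum]
  simp only [map_smul, map_sub, Finsupp.linearCombination_single, one_smul]
  intro x y g hg hk
  simp only [treeOp, Finset.sum_apply, Pi.smul_apply, Pi.sub_apply]
  refine Finset.sum_congr rfl fun j hj => ?_
  have hj' : j + 1 < X.length := by rw [mem_range] at hj; omega
  congr 2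
  · refine Eq.trans ?_ (treeOp_compAt R R X (j + 1) x y g hg hk).symm
    rw [evalForest_cons]
    exact (OpEqAt.refl _ _).compAt (evalForest_singleton R (X.drop (j + 1))) x y g hg
      (by rw [treeOrder_take_add_drop, hk])
  · refine Eq.trans ?_ (treeOp_mergeAt R X hj' x y g hg hk).symm
    exact evalForest_singleton R _ x y g hg (by rw [treeOrder_mergeAt, hk])

theorem lc_evalForest_push_append (A : List (List ℕ+)) (z : List (List ℕ+) →₀ ℝ) {k : ℕ}
    (hz : ∀ v ∈ z.support, forestOrder v = k) :
    linearCombination ℝ (evalForest Γ R) (push (fun Y => Y ++ A) z)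
      = compAt Γ k (linearCombination ℝ (evalForest Γ R) z) (evalForest Γ R A) := by
  rw [linearCombination_push, ← compAtL_apply, ← LinearMap.flip_apply, map_linearCombination']
  refine linearCombination_congr fun v hv => ?_
  rw [evalForest_append, hz v hv]
  rfl

theorem lc_evalForest_push_cons (X : List ℕ+) (z : List (List ℕ+) →₀ ℝ) :
    linearCombination ℝ (evalForest Γ R) (push (fun Y => X :: Y) z)
      = compAt Γ (treeOrder X) (treeOp Γ R X) (linearCombination ℝ (evalForest Γ R) z) := by
  rw [linearCombination_push, ← compAtL_apply, map_linearCombination']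
  rfl

theorem lc_evalForest_bdryForest (hR : IsRepresentation Γ R) {A : List (List ℕ+)}
    (hA : GoodForest A) :
    OpEqAt Γ (forestOrder A) (linearCombination ℝ (evalForest Γ R) (bdryForest A))
      (commOp R R (forestDeg A) (evalForest Γ R A)) := by
  induction A with
  | nil =>
    intro x y g hg hk
    obtain rfl := List.length_eq_zero_iff.1 hk
    obtain rfl : x = y := hg
    change linearCombination ℝ (evalForest Γ R) (bdryForest []) x x []
      = R x x [] ∘ₗ idOp G E x x [] - sg 0 • (idOp G E x x [] ∘ₗ R x x [])
    rw [idOp_nil_self, LinearMap.comp_id, LinearMap.id_comp, sg_zero, one_smul, sub_self]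
    simp [bdryForest]
  | cons X A ih =>
    have hX : X ≠ [] := hA X List.mem_cons_self
    have hA' : GoodForest A := fun Y hY => hA Y (List.mem_cons_of_mem _ hY)
    have hXb : ∀ v ∈ (bdryTree X).support, forestOrder v = treeOrder X := by
      have h := mem_bdryForest (F := [X]) (by simpa [GoodForest] using hX)
      intro v hv
      have h1 : bdryForest [X] = bdryTree X := by
        rw [bdryForest_cons]
        simp only [bdryForest, map_zero, smul_zero, add_zero, List.append_nil]
        exact Finsupp.mapDomain_id
      rw [h1] at h
      simpa using (h v hv).2.1
    rw [bdryForest_cons, map_add, map_smul, lc_evalForest_push_append _ _ hXb,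
      lc_evalForest_push_cons, forestDeg_cons, evalForest_cons, commOp_compAt R R R,
      forestOrder_cons]
    exact ((lc_evalForest_bdryTree hR hX).compAt (OpEqAt.refl _ _)).add
      (((OpEqAt.refl _ _).compAt (ih hA')).smul _)

end Forest

/-! ### Marked forests -/

section Marked

variable {R : OpFamily G E E} {R' : OpFamily G F F}

theorem evalMarked_mk (R : OpFamily G E E) (R' : OpFamily G F F) (φ : OpFamily G E F)
    (A : List (List ℕ+)) (X : List ℕ+) (B : List (List ℕ+)) :
    evalMarked Γ R R' φ ⟨A, X, B⟩ = compAt Γ (forestOrder A) (evalForest Γ R' A)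
      (compAt Γ (treeOrder X) (treeOp Γ φ X) (evalForest Γ R B)) := rfl

theorem evalMarked_leftMul (R : OpFamily G E E) (R' : OpFamily G F F) (φ : OpFamily G E F)
    (C : List (List ℕ+)) (t : MarkedForest) :
    evalMarked Γ R R' φ (leftMul C t)
      = compAt Γ (forestOrder C) (evalForest Γ R' C) (evalMarked Γ R R' φ t) := by
  change evalMarked Γ R R' φ ⟨C ++ t.left, t.mid, t.right⟩ = _
  rw [evalMarked_mk, evalForest_append, forestOrder_append, compAt_assoc]
  rfl

theorem evalMarked_rightMul (R : OpFamily G E E) (R' : OpFamily G F F) (φ : OpFamily G E F)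
    (t : MarkedForest) (C : List (List ℕ+)) :
    evalMarked Γ R R' φ (rightMul t C)
      = compAt Γ (markedOrder t) (evalMarked Γ R R' φ t) (evalForest Γ R C) := by
  change evalMarked Γ R R' φ ⟨t.left, t.mid, t.right ++ C⟩ = _
  obtain ⟨A, X, B⟩ := t
  simp only [evalMarked_mk, markedOrder]
  rw [evalForest_append, add_assoc, compAt_assoc, compAt_assoc]

theorem evalMarked_degree (hR : HasOpDegree Γ 1 R) (hR' : HasOpDegree Γ 1 R') {c : ℤ}
    {φ : OpFamily G E F} (hφ : HasOpDegree Γ c φ) (t : MarkedForest) :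
    HasOpDegreeAt Γ (markedOrder t) (c + markedDeg t) (evalMarked Γ R R' φ t) := by
  have := (evalForest_degree hR' t.left).compAt
    ((hasOpDegree_iff.1 hφ t.mid.length).treeOp.compAt (evalForest_degree hR t.right))
  rw [markedOrder, add_assoc, markedDeg, show c + (forestDeg t.left - (t.mid.length : ℤ) +
    forestDeg t.right) = forestDeg t.left + (c - t.mid.length + forestDeg t.right) by ring]
  exact this

theorem evalMarked_smooth (hR : IsSmoothOp Γ R) (hR' : IsSmoothOp Γ R') {φ : OpFamily G E F}
    (hφ : IsSmoothOp Γ φ) (t : MarkedForest) :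
    IsSmoothOpAt Γ (markedOrder t) (evalMarked Γ R R' φ t) := by
  rw [markedOrder, add_assoc]
  exact (evalForest_smooth hR' t.left).compAt
    ((isSmoothOp_iff.1 hφ t.mid.length).treeOp.compAt (evalForest_smooth hR t.right))

theorem evalMarked_dupMarked (R : OpFamily G E E) (R' : OpFamily G F F) (φ : OpFamily G E F)
    (t : MarkedForest) {i : ℕ} (hi : i < markedOrder t) :
    OpEqAt Γ (markedOrder t + 1) (evalMarked Γ R R' φ (dupMarked i t))
      (mulOp Γ i (evalMarked Γ R R' φ t)) := by
  obtain ⟨A, X, B⟩ := t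
  intro x y g hg hk
  simp only [markedOrder] at hi hk
  simp only [dupMarked, mulOp]
  split_ifs with h1 h2 <;> simp only [evalMarked_mk]
  · rw [compAt_mulAt_of_lt hg h1 (by omega), forestOrder_dupForest h1]
    exact (evalForest_dupForest R' A i h1).compAt (OpEqAt.refl (treeOrder X + forestOrder B) _)
      x y g hg (by omega)
  · rw [compAt_mulAt_of_le _ _ _ (by omega), treeOrder_dupTree (by omega)]
    refine (OpEqAt.refl (forestOrder A) _).compAt (k := treeOrder X + 1 + forestOrder B) ?_
      x y g hg (by omega)
    intro x y g hg hk
    rw [mulOp, compAt_mulAt_of_lt hg (by omega) (by omega)]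
    exact (treeOp_dupTree φ X (by omega)).compAt (OpEqAt.refl (forestOrder B) _) x y g hg hk
  · rw [compAt_mulAt_of_le _ _ _ (by omega)]
    refine (OpEqAt.refl (forestOrder A) _).compAt (k := treeOrder X + (forestOrder B + 1)) ?_
      x y g hg (by omega)
    intro x y g hg hk
    rw [mulOp, compAt_mulAt_of_le _ _ _ (by omega)]
    exact (OpEqAt.refl (treeOrder X) _).compAt (evalForest_dupForest R B _ (by omega))
      x y g hg hk

/-- The operators `φ_k`, of degree `c - k`, satisfy the equation of a morphism up to `Δ`. -/
def IsTwisted (R : OpFamily G E E) (R' : OpFamily G F F) (Γ : LieGroupoid EM M EG G) (c : ℤ)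
    (φ Δ : OpFamily G E F) : Prop :=
  ∀ k : ℕ, OpEqAt Γ k (∑ i ∈ range k, (-1 : ℝ) ^ i • compAt Γ i φ R
      - ∑ i ∈ range k, sg (c * i) • compAt Γ (i + 1) R' φ
      + ∑ j ∈ range (k - 1), (-1 : ℝ) ^ j • mulOp Γ j φ)
    (sg c • commOp R R' (c - k) φ + Δ)

theorem IsMorphism.isTwisted {φ : OpFamily G E F} (h : IsMorphism Γ R R' φ) :
    IsTwisted R R' Γ 0 φ 0 := by
  rintro _ x y g hg rfl
  have h := h.equation x y g hg
  rw [sum_range_succ, sum_range_succ', compAt_zero, compAt_length _ _ hg rfl,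
    ← eq_sub_iff_add_eq] at h
  simp only [negOne_pow_eq_sg] at h
  simp only [Finset.sum_apply, Pi.smul_apply, Pi.add_apply, Pi.sub_apply, zero_mul, sg_zero,
    one_smul, h, zero_sub, mulOp, commOp, Pi.zero_apply, sg_neg, negOne_pow_eq_sg]
  rw [show (∑ j ∈ range (g.length - 1), sg ((j + 1 : ℕ) : ℤ) • φ x y (Γ.mulAt j g))
    = -∑ j ∈ range (g.length - 1), sg (j : ℤ) • φ x y (Γ.mulAt j g) by
      rw [← sum_neg_distrib]
      refine Finset.sum_congr rfl fun j _ => ?_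
      rw [Nat.cast_succ, sg_add_one, neg_smul]]
  abel

theorem IsHomotopy.isTwisted {φ ψ h : OpFamily G E F} (hh : IsHomotopy Γ R R' φ ψ h) :
    IsTwisted R R' Γ (-1) h (φ - ψ) := by
  rintro _ x y g hg rfl
  have h1 := hh.equation x y g hg
  rw [sum_range_succ, sum_range_succ', compAt_zero, compAt_length _ _ hg rfl] at h1
  simp only [Finset.sum_apply, Pi.smul_apply, Pi.add_apply, Pi.sub_apply, mulOp, commOp, h1]
  simp only [negOne_pow_eq_sg, neg_one_mul, sg_neg, sg_one, Nat.cast_succ, sg_add_one, neg_smul,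
    sum_neg_distrib, Nat.cast_zero, sg_zero, one_smul, sg_sub, sg_neg]
  abel

/-- The evaluation of triples at operators of degree `c`, with the Koszul sign. -/
def evalSigned (Γ : LieGroupoid EM M EG G) (R : OpFamily G E E) (R' : OpFamily G F F) (c : ℤ)
    (φ : OpFamily G E F) (t : MarkedForest) : OpFamily G E F :=
  sg (c * forestDeg t.left) • evalMarked Γ R R' φ t

theorem lc_evalSigned_bdryMid {c : ℤ} {φ Δ : OpFamily G E F} (h : IsTwisted R R' Γ c φ Δ)
    (A : List (List ℕ+)) (X : List ℕ+) (B : List (List ℕ+)) :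
    OpEqAt Γ (forestOrder A + (treeOrder X + forestOrder B))
      (linearCombination ℝ (evalSigned Γ R R' c φ) (bdryMid A X B))
      (sg (c * forestDeg A) • compAt Γ (forestOrder A) (evalForest Γ R' A)
        (compAt Γ (treeOrder X) (sg c • commOp R R' (c - X.length) (treeOp Γ φ X) + treeOp Γ Δ X)
          (evalForest Γ R B))) := by
  have h1 := ((OpEqAt.refl (forestOrder A) (evalForest Γ R' A)).compAt
    (((h X.length).treeOp X).compAt (OpEqAt.refl (forestOrder B) (evalForest Γ R B)))).smul
    (sg (c * forestDeg A))
  refine OpEqAt.trans ?_ h1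
  clear h1
  let S : OpFamily G E F →ₗ[ℝ] OpFamily G E F :=
    compAtL Γ (forestOrder A) (evalForest Γ R' A) ∘ₗ
      (compAtL Γ (treeOrder X)).flip (evalForest Γ R B)
  let mid : OpFamily G E F :=
    ∑ i ∈ range X.length, (-1 : ℝ) ^ i • compAt Γ (treeOrder (X.take i))
        (treeOp Γ φ (X.take i)) (treeOp Γ R (X.drop i))
      - ∑ i ∈ range X.length, sg (c * i) • compAt Γ (treeOrder (X.take (i + 1)))
        (treeOp Γ R' (X.take (i + 1))) (treeOp Γ φ (X.drop (i + 1)))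
      + ∑ j ∈ range (X.length - 1), (-1 : ℝ) ^ j • treeOp Γ φ (mergeAt j X)
  have hS : ∀ {χ χ' : OpFamily G E F}, OpEqAt Γ (treeOrder X) χ χ' →
      OpEqAt Γ (forestOrder A + (treeOrder X + forestOrder B)) (S χ) (S χ') := fun hχ =>
    (OpEqAt.refl (forestOrder A) _).compAt (hχ.compAt (OpEqAt.refl (forestOrder B) _))
  have hmid : OpEqAt Γ (treeOrder X) mid (treeOp Γ
      (∑ i ∈ range X.length, (-1 : ℝ) ^ i • compAt Γ i φ R
      - ∑ i ∈ range X.length, sg (c * i) • compAt Γ (i + 1) R' φ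
      + ∑ j ∈ range (X.length - 1), (-1 : ℝ) ^ j • mulOp Γ j φ) X) := by
    intro x y g hg hk
    simp only [mid, treeOp, Finset.sum_apply, Pi.smul_apply, Pi.add_apply, Pi.sub_apply]
    congr 1
    · congr 1
      · refine Finset.sum_congr rfl fun i _ => congrArg _ ?_
        exact (treeOp_compAt φ R X i x y g hg hk).symm
      · refine Finset.sum_congr rfl fun i _ => congrArg _ ?_
        exact (treeOp_compAt R' φ X (i + 1) x y g hg hk).symm
    · refine Finset.sum_congr rfl fun j hj => congrArg _ ?_
      exact (treeOp_mergeAt φ X (by rw [mem_range] at hj; omega) x y g hg hk).symm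
  refine OpEqAt.trans ?_ ((hS hmid).smul (sg (c * forestDeg A)))
  simp only [mid, bdryMid, map_add, map_sub, map_sum, map_smul, Finsupp.linearCombination_single,
    one_smul, smul_add, smul_sub, Finset.smul_sum]
  refine OpEqAt.add (OpEqAt.sub (OpEqAt.sum _ fun i _ => ?_) (OpEqAt.sum _ fun i _ => ?_))
    (OpEqAt.sum _ fun j _ => ?_)
  · rw [smul_comm]
    refine OpEqAt.smul (OpEqAt.smul ?_ _) _
    rw [evalMarked_mk, evalForest_cons,
      ← compAt_assoc (treeOrder (X.take i)) (treeOrder (X.drop i)), treeOrder_take_add_drop]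
    exact OpEqAt.refl _ _
  · rw [evalSigned, smul_smul, ← sg_add]
    have h2 : sg (c * forestDeg (A ++ [X.take (i + 1)])) = sg (c * forestDeg A + c * i) ∨
        X.length ≤ i := by
      by_cases hi : i < X.length
      · left
        rw [forestDeg_append]
        refine sg_congr (-(c * i)) ?_
        simp only [forestDeg_cons, forestDeg_nil, List.length_take]
        rw [min_eq_left (by omega)]
        push_cast
        ring
      · exact Or.inr (by omega)
    rcases h2 with h2 | h2
    · rw [h2]
      refine OpEqAt.smul ?_ _
      simp only [evalMarked_mk]
      rw [evalForest_append, forestOrder_append, compAt_assoc]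
      refine (OpEqAt.refl (forestOrder A) _).compAt ?_
      simp only [LinearMap.flip_apply, compAtL_apply]
      rw [← treeOrder_take_add_drop X (i + 1), compAt_assoc, forestOrder_cons, forestOrder_nil,
        add_zero, add_assoc]
      exact (evalForest_singleton R' _).compAt (OpEqAt.refl _ _)
    · exact absurd (mem_range.1 ‹_›) (by omega)
  · rw [smul_comm]
    refine OpEqAt.smul (OpEqAt.smul ?_ _) _
    rw [evalMarked_mk, treeOrder_mergeAt]
    exact OpEqAt.refl _ _

theorem lc_evalSigned_bdryMarked (hR : IsRepresentation Γ R) (hR' : IsRepresentation Γ R')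
    {c : ℤ} {φ Δ : OpFamily G E F} (h : IsTwisted R R' Γ c φ Δ) {t : MarkedForest}
    (ht : GoodMarked t) :
    OpEqAt Γ (markedOrder t) (linearCombination ℝ (evalSigned Γ R R' c φ) (bdryMarked t))
      (sg c • commOp R R' (c + markedDeg t) (evalSigned Γ R R' c φ t)
        + (sg (forestDeg t.left) * sg (c * forestDeg t.left)) • evalMarked Γ R R' Δ t) := by
  obtain ⟨A, X, B⟩ := t
  obtain ⟨hA, hB⟩ := ht
  have e1 : linearCombination ℝ (evalSigned Γ R R' c φ)
      (push (fun A => MarkedForest.mk A X B) (bdryForest A))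
      = sg (c * (forestDeg A + 1)) • compAt Γ (forestOrder A)
        (linearCombination ℝ (evalForest Γ R') (bdryForest A))
        (compAt Γ (treeOrder X) (treeOp Γ φ X) (evalForest Γ R B)) := by
    rw [linearCombination_push, ← compAtL_apply, ← LinearMap.flip_apply, map_linearCombination',
      ← linearCombination_smul_right]
    refine linearCombination_congr fun v hv => ?_
    obtain ⟨-, h1, h2, -⟩ := mem_bdryForest hA v hv
    simp only [evalSigned, evalMarked_mk, h1, h2]
    rfl
  have e2 : linearCombination ℝ (evalSigned Γ R R' c φ)
      (push (fun B => MarkedForest.mk A X B) (bdryForest B))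
      = sg (c * forestDeg A) • compAt Γ (forestOrder A) (evalForest Γ R' A)
        (compAt Γ (treeOrder X) (treeOp Γ φ X)
          (linearCombination ℝ (evalForest Γ R) (bdryForest B))) := by
    rw [linearCombination_push, ← compAtL_apply, ← compAtL_apply, map_linearCombination',
      map_linearCombination', ← linearCombination_smul_right]
    rfl
  rw [bdryMarked_mk, map_add, map_add, map_smul, map_smul, e1, e2]
  simp only [markedOrder, markedDeg]
  rw [add_assoc (forestOrder A)]
  have h1 := ((lc_evalForest_bdryForest hR' hA).compAt (OpEqAt.refl
    (treeOrder X + forestOrder B) (compAt Γ (treeOrder X) (treeOp Γ φ X) (evalForest Γ R B)))).smul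
      (sg (c * (forestDeg A + 1)))
  have h2 := (lc_evalSigned_bdryMid h A X B).smul (sg (forestDeg A))
  have h3 := (((OpEqAt.refl (forestOrder A) (evalForest Γ R' A)).compAt
    ((OpEqAt.refl (treeOrder X) (treeOp Γ φ X)).compAt
      (lc_evalForest_bdryForest hR hB))).smul (sg (c * forestDeg A))).smul
        (sg (forestDeg A - X.length))
  refine ((h1.add h2).add h3).trans ?_
  have e3 : commOp R R' (c + (forestDeg A - X.length + forestDeg B))
      (evalSigned Γ R R' c φ ⟨A, X, B⟩) = sg (c * forestDeg A) •
        (compAt Γ (forestOrder A) (commOp R' R' (forestDeg A) (evalForest Γ R' A))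
          (compAt Γ (treeOrder X) (treeOp Γ φ X) (evalForest Γ R B))
        + sg (forestDeg A) • compAt Γ (forestOrder A) (evalForest Γ R' A)
          (compAt Γ (treeOrder X) (commOp R R' (c - X.length) (treeOp Γ φ X)) (evalForest Γ R B)
          + sg (c - X.length) • compAt Γ (treeOrder X) (treeOp Γ φ X)
            (commOp R R (forestDeg B) (evalForest Γ R B)))) := by
    rw [evalSigned, commOp_smul, evalMarked_mk, show c + (forestDeg A - (X.length : ℤ)
      + forestDeg B) = forestDeg A + (c - X.length + forestDeg B) by ring, commOp_compAt R R' R',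
      commOp_compAt R R R']
  rw [e3]
  simp only [← compAtL_apply, map_add, map_smul, LinearMap.add_apply, LinearMap.smul_apply,
    smul_add, smul_smul, evalMarked_mk]
  rw [show sg (c * (forestDeg A + 1)) = sg c * sg (c * forestDeg A) by
      rw [mul_add, mul_one, sg_add, mul_comm],
    show sg (forestDeg A - X.length) * sg (c * forestDeg A)
      = sg c * (sg (c * forestDeg A) * (sg (forestDeg A) * sg (c - X.length))) by
        rw [sg_sub, sg_sub]
        linear_combination (- (sg (forestDeg A) * sg X.length * sg (c * forestDeg A)))
          * sg_mul_self c,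
    show sg (forestDeg A) * (sg (c * forestDeg A) * sg c)
      = sg c * (sg (c * forestDeg A) * sg (forestDeg A)) by ring]
  intro x y g _ _
  simp only [Pi.add_apply]
  abel

end Marked

end Characteristic


/-! ## Tensor products of operators -/

section TensorOperators

open Finsupp (linearCombination linearCombination_single)

variable {EM : Type*} [NormedAddCommGroup EM] [NormedSpace ℝ EM]
  {M : Type uM} [TopologicalSpace M] [ChartedSpace EM M]

/-- A linear map between fibres is homogeneous of degree `d`. -/
def IsHomogeneousMap {E F : GradedBundle.{uM, uV} EM M} {x y : M} (d : ℤ)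
    (f : E.fiber x →ₗ[ℝ] F.fiber y) : Prop :=
  ∀ n, ∀ v ∈ E.gr x n, f v ∈ F.gr y (n + d)

theorem isHomogeneousMap_id {E : GradedBundle.{uM, uV} EM M} {x : M} :
    IsHomogeneousMap (E := E) (F := E) (x := x) 0 LinearMap.id := by
  intro n v hv
  simpa using hv

theorem GradedBundle.linearMap_ext (E : GradedBundle.{uM, uV} EM M) {x : M} {W : Type*}
    [AddCommGroup W] [Module ℝ W] {f g : E.fiber x →ₗ[ℝ] W}
    (h : ∀ n, ∀ v ∈ E.gr x n, f v = g v) : f = g := by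
  have hf := E.isFrame _ (E.frameAt_mem x)
  refine (hf.basis (E.mem_frameAt x)).ext fun j => ?_
  refine h ((E.frameAt x).deg j) _ ?_
  rw [hf.basis_apply, hf.gr_eq x (E.mem_frameAt x)]
  exact Submodule.subset_span ⟨j, rfl, rfl⟩

theorem GradedBundle.twist_zero (E : GradedBundle.{uM, uV} EM M) (x : M) :
    E.twist x 0 = LinearMap.id := by
  refine E.linearMap_ext fun n v hv => ?_
  rw [E.twist_apply x _ n v hv]
  simp

theorem GradedBundle.twist_comp_twist (E : GradedBundle.{uM, uV} EM M) (x : M) (a b : ℤ) :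
    E.twist x a ∘ₗ E.twist x b = E.twist x (a + b) := by
  refine E.linearMap_ext fun n v hv => ?_
  rw [LinearMap.comp_apply, E.twist_apply x b n v hv, map_smul, E.twist_apply x _ n v hv,
    E.twist_apply x _ n v hv, smul_smul, negOne_zpow_eq_sg, negOne_zpow_eq_sg, negOne_zpow_eq_sg,
    ← sg_add]
  congr 2
  ring

theorem IsHomogeneousMap.twist_comp {E F : GradedBundle.{uM, uV} EM M} {x y : M} {d : ℤ}
    {f : E.fiber x →ₗ[ℝ] F.fiber y} (hf : IsHomogeneousMap d f) (a : ℤ) :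
    F.twist y a ∘ₗ f = sg (a * d) • f ∘ₗ E.twist x a := by
  refine E.linearMap_ext fun n v hv => ?_
  rw [LinearMap.comp_apply, LinearMap.smul_apply, LinearMap.comp_apply,
    F.twist_apply y a _ _ (hf n v hv), E.twist_apply x a n v hv, map_smul, smul_smul,
    negOne_zpow_eq_sg, negOne_zpow_eq_sg, ← sg_add]
  congr 2
  ring

theorem signForm_eq_sum_lt {m : ℕ} (l l' : Fin m → ℤ) :
    signForm l l' = ∑ i, (∑ j ∈ univ.filter (fun j => i < j), l j) * l' i := by
  simp only [signForm, Finset.sum_filter, Finset.sum_mul]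
  rw [Finset.sum_comm]
  refine Finset.sum_congr rfl fun i _ => Finset.sum_congr rfl fun j _ => ?_
  split_ifs <;> simp

theorem linearMap_sum_comp {ι A B C : Type*} [AddCommGroup A] [Module ℝ A] [AddCommGroup B]
    [Module ℝ B] [AddCommGroup C] [Module ℝ C] (s : Finset ι) (f : ι → B →ₗ[ℝ] C)
    (g : A →ₗ[ℝ] B) : (∑ i ∈ s, f i) ∘ₗ g = ∑ i ∈ s, f i ∘ₗ g :=
  map_sum (LinearMap.lcomp ℝ C g) f s

theorem linearMap_comp_sum {ι A B C : Type*} [AddCommGroup A] [Module ℝ A] [AddCommGroup B]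
    [Module ℝ B] [AddCommGroup C] [Module ℝ C] (s : Finset ι) (f : B →ₗ[ℝ] C)
    (g : ι → A →ₗ[ℝ] B) : f ∘ₗ (∑ i ∈ s, g i) = ∑ i ∈ s, f ∘ₗ g i :=
  map_sum (LinearMap.llcomp ℝ A B C f) g s

theorem BarBasis.mulL_comp_ext {X Y Z : BarBasis} {m : ℕ} {A B C : Type*} [AddCommGroup A]
    [Module ℝ A] [AddCommGroup B] [Module ℝ B] [AddCommGroup C] [Module ℝ C]
    {op : X.carrier → Y.carrier → Z.carrier} {k k' : ℕ} {l l' : ℤ}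
    (T : Z.Pow m →ₗ[ℝ] A →ₗ[ℝ] C) (T₁ : X.Pow m →ₗ[ℝ] B →ₗ[ℝ] C) (T₂ : Y.Pow m →ₗ[ℝ] A →ₗ[ℝ] B)
    (h : ∀ u v, X.IsPowBasis k u → Y.IsPowBasis k' v →
      T (mulL m op (Finsupp.single u 1) (Finsupp.single v 1))
        = T₁ (Finsupp.single u 1) ∘ₗ T₂ (Finsupp.single v 1))
    {a : X.Pow m} (ha : a ∈ X.piece m k l) {b : Y.Pow m} (hb : b ∈ Y.piece m k' l') :
    T (mulL m op a b) = T₁ a ∘ₗ T₂ b :=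
  piece_ext₂ (T := (mulL m op).compr₂ T) (T' := (LinearMap.llcomp ℝ A B C).compl₁₂ T₁ T₂)
    (fun u v hu _ hv _ => h u v hu hv) ha hb

section Koszul

variable {m : ℕ} {D E F : Fin m → GradedBundle.{uM, uV} EM M} {x y z : M}

theorem map_smul_univ (c : Fin m → ℝ) (φ : ∀ i, (E i).fiber x →ₗ[ℝ] (F i).fiber y) :
    PiTensorProduct.map (fun i => c i • φ i) = (∏ i, c i) • PiTensorProduct.map φ :=
  (PiTensorProduct.mapMultilinear ℝ (fun i => (E i).fiber x)
    (fun i => (F i).fiber y)).map_smul_univ c φ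

theorem koszulMap_comp (l l' : Fin m → ℤ) (φ : ∀ i, (E i).fiber y →ₗ[ℝ] (F i).fiber z)
    (ψ : ∀ i, (D i).fiber x →ₗ[ℝ] (E i).fiber y) (hψ : ∀ i, IsHomogeneousMap (l' i) (ψ i)) :
    GradedBundle.koszulMap l φ ∘ₗ GradedBundle.koszulMap l' ψ
      = sg (signForm l l') • GradedBundle.koszulMap (l + l') (fun i => φ i ∘ₗ ψ i) := by
  refine (PiTensorProduct.map_comp _ _).symm.trans ?_
  have h : ∀ i, (φ i ∘ₗ (E i).twist y (∑ j ∈ univ.filter (fun j => i < j), l j)) ∘ₗ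
      (ψ i ∘ₗ (D i).twist x (∑ j ∈ univ.filter (fun j => i < j), l' j))
      = sg ((∑ j ∈ univ.filter (fun j => i < j), l j) * l' i) • ((φ i ∘ₗ ψ i) ∘ₗ
        (D i).twist x (∑ j ∈ univ.filter (fun j => i < j), (l + l') j)) := by
    intro i
    rw [LinearMap.comp_assoc, ← LinearMap.comp_assoc _ (ψ i), (hψ i).twist_comp,
      LinearMap.smul_comp, LinearMap.comp_assoc, GradedBundle.twist_comp_twist,
      LinearMap.comp_smul, LinearMap.comp_assoc]
    simp only [Pi.add_apply, Finset.sum_add_distrib]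
  simp only [h]
  rw [map_smul_univ, ← sg_sum, signForm_eq_sum_lt]
  rfl

/-- `koszulMap` as a linear function of its `i`-th entry. -/
def koszulSlot (l : Fin m → ℤ) (φ : ∀ i, (E i).fiber x →ₗ[ℝ] (F i).fiber y) (i : Fin m) :
    ((E i).fiber x →ₗ[ℝ] (F i).fiber y) →ₗ[ℝ]
      ((GradedBundle.tensorBundle E).fiber x →ₗ[ℝ] (GradedBundle.tensorBundle F).fiber y) :=
  ((PiTensorProduct.mapMultilinear ℝ (fun i => (E i).fiber x)
    (fun i => (F i).fiber y)).compLinearMap fun j => LinearMap.lcomp ℝ _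
      ((E j).twist x (∑ k ∈ univ.filter (fun k => j < k), l k))).toLinearMap φ i

theorem koszulSlot_apply (l : Fin m → ℤ) (φ : ∀ i, (E i).fiber x →ₗ[ℝ] (F i).fiber y)
    (i : Fin m) (f : (E i).fiber x →ₗ[ℝ] (F i).fiber y) :
    koszulSlot l φ i f = GradedBundle.koszulMap l (Function.update φ i f) := rfl

theorem IsHomogeneousMap.koszulMap {l : Fin m → ℤ}
    {φ : ∀ i, (E i).fiber x →ₗ[ℝ] (F i).fiber y} (hφ : ∀ i, IsHomogeneousMap (l i) (φ i)) :
    IsHomogeneousMap (E := GradedBundle.tensorBundle E) (F := GradedBundle.tensorBundle F)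
      (∑ i, l i) (GradedBundle.koszulMap l φ) := by
  intro n v hv
  change v ∈ GradedBundle.tensorGr E x n at hv
  change _ ∈ GradedBundle.tensorGr F y _
  induction hv using Submodule.span_induction with
  | mem v hv =>
    obtain ⟨d, v, hv, hd, rfl⟩ := hv
    have h : GradedBundle.koszulMap l φ (PiTensorProduct.tprod ℝ v) = PiTensorProduct.tprod ℝ
        fun i => (φ i ∘ₗ (E i).twist x (∑ j ∈ univ.filter (fun j => i < j), l j)) (v i) :=
      PiTensorProduct.map_tprod _ _
    refine Submodule.subset_span ⟨fun i => d i + l i, _, fun i => ?_, ?_, h⟩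
    · refine hφ i (d i) _ ?_
      rw [(E i).twist_apply x _ (d i) _ (hv i)]
      exact Submodule.smul_mem _ _ (hv i)
    · rw [Finset.sum_add_distrib, hd]
  | zero =>
    rw [map_zero]
    exact Submodule.zero_mem _
  | add u v _ _ hu hv =>
    rw [map_add]
    exact Submodule.add_mem _ hu hv
  | smul c v _ hv =>
    rw [map_smul]
    exact Submodule.smul_mem _ _ hv

/-- The tensor product of endomorphisms `d i` of degree one, as a differential. -/
def koszulSum (d : ∀ i, (E i).fiber x →ₗ[ℝ] (E i).fiber x) :
    (GradedBundle.tensorBundle E).fiber x →ₗ[ℝ] (GradedBundle.tensorBundle E).fiber x :=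
  ∑ i, GradedBundle.koszulMap (Pi.single i 1)
    (Function.update (fun j => (LinearMap.id : (E j).fiber x →ₗ[ℝ] (E j).fiber x)) i (d i))

theorem koszulSum_comp (d : ∀ i, (F i).fiber y →ₗ[ℝ] (F i).fiber y) (l : Fin m → ℤ)
    (φ : ∀ i, (E i).fiber x →ₗ[ℝ] (F i).fiber y) (hφ : ∀ i, IsHomogeneousMap (l i) (φ i)) :
    koszulSum d ∘ₗ GradedBundle.koszulMap l φ = ∑ i, sg (signForm (Pi.single i 1) l) •
      GradedBundle.koszulMap (l + Pi.single i 1) (Function.update φ i (d i ∘ₗ φ i)) := by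
  rw [koszulSum, linearMap_sum_comp]
  refine Finset.sum_congr rfl fun i _ => ?_
  rw [koszulMap_comp _ _ _ _ hφ, add_comm]
  congr 2
  funext j
  by_cases hj : j = i
  · subst hj
    simp
  · simp [hj]

theorem comp_koszulSum (d : ∀ i, (E i).fiber x →ₗ[ℝ] (E i).fiber x)
    (hd : ∀ i, IsHomogeneousMap 1 (d i)) (l : Fin m → ℤ)
    (φ : ∀ i, (E i).fiber x →ₗ[ℝ] (F i).fiber y) :
    GradedBundle.koszulMap l φ ∘ₗ koszulSum d = ∑ i, sg (signForm l (Pi.single i 1)) •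
      GradedBundle.koszulMap (l + Pi.single i 1) (Function.update φ i (φ i ∘ₗ d i)) := by
  rw [koszulSum, linearMap_comp_sum]
  refine Finset.sum_congr rfl fun i _ => ?_
  rw [koszulMap_comp]
  · congr 2
    funext j
    by_cases hj : j = i
    · subst hj
      simp
    · simp [hj]
  · intro j
    by_cases hj : j = i
    · subst hj
      simpa using hd j
    · simpa [hj] using isHomogeneousMap_id

theorem koszulSum_comp_sub (d : ∀ i, (E i).fiber x →ₗ[ℝ] (E i).fiber x)
    (hd : ∀ i, IsHomogeneousMap 1 (d i)) (d' : ∀ i, (F i).fiber y →ₗ[ℝ] (F i).fiber y)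
    (l : Fin m → ℤ) (φ : ∀ i, (E i).fiber x →ₗ[ℝ] (F i).fiber y)
    (hφ : ∀ i, IsHomogeneousMap (l i) (φ i)) :
    koszulSum d' ∘ₗ GradedBundle.koszulMap l φ
      - sg (∑ i, l i) • GradedBundle.koszulMap l φ ∘ₗ koszulSum d
      = ∑ i, sg (signForm (Pi.single i 1) l) • GradedBundle.koszulMap (l + Pi.single i 1)
        (Function.update φ i (d' i ∘ₗ φ i - sg (l i) • (φ i ∘ₗ d i))) := by
  rw [koszulSum_comp d' l φ hφ, comp_koszulSum d hd, Finset.smul_sum, ← Finset.sum_sub_distrib]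
  refine Finset.sum_congr rfl fun i _ => ?_
  rw [← koszulSlot_apply _ φ, ← koszulSlot_apply _ φ, ← koszulSlot_apply _ φ, map_sub, map_smul,
    smul_sub, smul_smul, smul_smul]
  congr 2
  rw [← signForm_single_add l i, sg_add, sg_add]
  linear_combination (sg (signForm (Pi.single i 1) l) * sg (l i)) *
    sg_mul_self (signForm l (Pi.single i 1))

end Koszul

/-! ### Evaluations -/

variable {EG : Type*} [NormedAddCommGroup EG] [NormedSpace ℝ EG]
  {G : Type*} [TopologicalSpace G] [ChartedSpace EG G]

/-- A map from the basis of a bimodule `Y` to operators, compatible with all structures. -/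
structure IsEvaluation (Γ : LieGroupoid EM M EG G) {Y : BarBasis}
    (L : omegaBar.carrier → Y.carrier → Y.carrier) (Q : Y.carrier → omegaBar.carrier → Y.carrier)
    {E F : GradedBundle.{uM, uV} EM M} (R : OpFamily G E E) (R' : OpFamily G F F)
    (ev : Y.carrier → OpFamily G E F) : Prop where
  smooth : ∀ u, Y.IsBasis u → IsSmoothOpAt Γ (Y.order u) (ev u)
  degree : ∀ u, Y.IsBasis u → HasOpDegreeAt Γ (Y.order u) (Y.deg u) (ev u)
  bdry : ∀ u, Y.IsBasis u → OpEqAt Γ (Y.order u) (linearCombination ℝ ev (Y.bdry u))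
    (commOp R R' (Y.deg u) (ev u))
  dup : ∀ u, Y.IsBasis u → ∀ i < Y.order u,
    OpEqAt Γ (Y.order u + 1) (ev (Y.dup i u)) (mulOp Γ i (ev u))
  left : ∀ A u, omegaBar.IsBasis A → Y.IsBasis u → OpEqAt Γ (omegaBar.order A + Y.order u)
    (ev (L A u)) (compAt Γ (omegaBar.order A) (evalForest Γ R' A) (ev u))
  right : ∀ u A, Y.IsBasis u → omegaBar.IsBasis A → OpEqAt Γ (Y.order u + omegaBar.order A)
    (ev (Q u A)) (compAt Γ (Y.order u) (ev u) (evalForest Γ R A))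

/-- The characteristic map of a representation on the basis of `Ω`. -/
def forestEval (Γ : LieGroupoid EM M EG G) {E : GradedBundle.{uM, uV} EM M}
    (R : OpFamily G E E) (A : omegaBar.carrier) : OpFamily G E E := evalForest Γ R A

/-- The characteristic map of a morphism on the basis of `𝒯`. -/
def markedEval (Γ : LieGroupoid EM M EG G) {E F : GradedBundle.{uM, uV} EM M}
    (R : OpFamily G E E) (R' : OpFamily G F F) (Φ : OpFamily G E F) (t : moduleBar.carrier) :
    OpFamily G E F := evalMarked Γ R R' Φ t

section Evaluation

variable {m : ℕ} {E F : Fin m → GradedBundle.{uM, uV} EM M} {Γ : LieGroupoid EM M EG G}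

/-- The evaluation of tensors at a string. -/
def evalAt {Y : BarBasis} (ev : ∀ i, Y.carrier → OpFamily G (E i) (F i)) (x y : M)
    (g : List G) : Y.Pow m →ₗ[ℝ]
      ((GradedBundle.tensorBundle E).fiber x →ₗ[ℝ] (GradedBundle.tensorBundle F).fiber y) :=
  linearCombination ℝ fun u => GradedBundle.koszulMap (Y.degs u) fun i => ev i (u i) x y g

theorem evalAt_single {Y : BarBasis} (ev : ∀ i, Y.carrier → OpFamily G (E i) (F i)) (x y : M)
    (g : List G) (u : Fin m → Y.carrier) : evalAt ev x y g (Finsupp.single u 1)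
      = GradedBundle.koszulMap (Y.degs u) fun i => ev i (u i) x y g := by
  simp [evalAt]

/-- The evaluation of a sequence of tensors. -/
def evalSeq {Y : BarBasis} (ev : ∀ i, Y.carrier → OpFamily G (E i) (F i)) (z : ℕ → Y.Pow m) :
    OpFamily G (GradedBundle.tensorBundle E) (GradedBundle.tensorBundle F) :=
  fun x y g => evalAt ev x y g (z g.length)

theorem tensorRep_nil (w : ℕ → omegaBar.Pow m) (R : ∀ i, OpFamily G (E i) (E i)) (x : M) :
    tensorRep Γ w R x x [] = koszulSum fun i => R i x x [] := by
  unfold tensorRep koszulSum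
  refine Finset.sum_congr rfl fun i _ => congrArg _ (funext fun j => ?_)
  by_cases hj : j = i
  · subst hj
    simp
  · simp [hj, idOp_nil_self]

theorem tensorRep_of_ne_nil (w : ℕ → omegaBar.Pow m) (R : ∀ i, OpFamily G (E i) (E i)) (x y : M)
    {g : List G} (hg : g ≠ []) :
    tensorRep Γ w R x y g = evalSeq (fun i => forestEval Γ (R i)) w x y g := by
  cases g with
  | nil => exact absurd rfl hg
  | cons a g => rfl

theorem tensorMor_eq (z : ℕ → moduleBar.Pow m) (R : ∀ i, OpFamily G (E i) (E i))
    (R' : ∀ i, OpFamily G (F i) (F i)) (Φ : ∀ i, OpFamily G (E i) (F i)) :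
    tensorMor Γ z R R' Φ = evalSeq (fun i => markedEval Γ (R i) (R' i) (Φ i)) z := rfl

variable {Y : BarBasis} {L : omegaBar.carrier → Y.carrier → Y.carrier}
  {Q : Y.carrier → omegaBar.carrier → Y.carrier} {R : ∀ i, OpFamily G (E i) (E i)}
  {R' : ∀ i, OpFamily G (F i) (F i)} {ev : ∀ i, Y.carrier → OpFamily G (E i) (F i)}

theorem evalAt_bdryPow (hY : Y.IsLawful) (hev : ∀ i, IsEvaluation Γ L Q (R i) (R' i) (ev i))
    (hR : ∀ i, HasOpDegree Γ 1 (R i)) {k : ℕ} {l : ℤ} {z : Y.Pow m} (hz : z ∈ Y.piece m k l)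
    {x y : M} {g : List G} (hg : Γ.IsString x y g) (hk : g.length = k) :
    evalAt ev x y g (Y.bdryPow m z) = koszulSum (fun i => R' i y y []) ∘ₗ evalAt ev x y g z
      - sg l • evalAt ev x y g z ∘ₗ koszulSum fun i => R i x x [] := by
  refine BarBasis.piece_ext (T := evalAt ev x y g ∘ₗ Y.bdryPow m)
    (T' := LinearMap.llcomp ℝ _ _ _ (koszulSum fun i => R' i y y []) ∘ₗ evalAt ev x y g
      - sg l • LinearMap.lcomp ℝ _ (koszulSum fun i => R i x x []) ∘ₗ evalAt ev x y g)
    (fun u hu hl => ?_) hz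
  have hdeg : ∀ i, IsHomogeneousMap (Y.degs u i) (ev i (u i) x y g) := fun i =>
    (hev i).degree _ (hu i).1 x y g hg (by rw [(hu i).2, hk])
  have hd : ∀ i, IsHomogeneousMap 1 (R i x x []) := fun i => by
    have := hR i x x [] rfl
    simpa [IsHomogeneousMap] using this
  change evalAt ev x y g (Y.bdryPow m (Finsupp.single u 1))
    = koszulSum _ ∘ₗ evalAt ev x y g (Finsupp.single u 1)
      - sg l • evalAt ev x y g (Finsupp.single u 1) ∘ₗ koszulSum _
  rw [evalAt_single, ← hl]
  refine Eq.trans ?_ (koszulSum_comp_sub _ hd _ _ _ hdeg).symm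
  rw [BarBasis.bdryPow_eq_sum, LinearMap.sum_apply, map_sum]
  refine Finset.sum_congr rfl fun i _ => ?_
  rw [BarBasis.slotOp_single, map_smul, one_mul, BarBasis.map_ins]
  congr 1
  rw [← koszulSlot_apply, show R' i y y [] ∘ₗ ev i (u i) x y g
    - sg (Y.degs u i) • ev i (u i) x y g ∘ₗ R i x x []
    = linearCombination ℝ (fun v => ev i v x y g) (Y.bdry (u i)) by
      refine Eq.trans ((hev i).bdry _ (hu i).1 x y g hg (by rw [(hu i).2, hk])).symm ?_
      simp only [Finsupp.linearCombination_apply, Finsupp.sum, Finset.sum_apply, Pi.smul_apply],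
    map_linearCombination']
  refine linearCombination_congr fun v hv => ?_
  rw [evalAt_single, koszulSlot_apply, BarBasis.degs_update u i v 1
    ((hY.bdry_mem _ (hu i).1 v hv).2.2), one_smul]
  congr 1
  funext j
  by_cases hj : j = i
  · subst hj
    simp
  · simp [hj]

theorem evalAt_dupPow (hY : Y.IsLawful) (hev : ∀ i, IsEvaluation Γ L Q (R i) (R' i) (ev i))
    {k : ℕ} {l : ℤ} {z : Y.Pow m} (hz : z ∈ Y.piece m k l)
    {x y : M} {g : List G} (hg : Γ.IsString x y g) (hk : g.length = k + 1) {i : ℕ} (hi : i < k) :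
    evalAt ev x y g (Y.dupPow m i z) = evalAt ev x y (Γ.mulAt i g) z := by
  refine BarBasis.piece_ext (T := evalAt ev x y g ∘ₗ Y.dupPow m i)
    (T' := evalAt ev x y (Γ.mulAt i g)) (fun u hu hl => ?_) hz
  rw [LinearMap.comp_apply, BarBasis.dupPow_single, evalAt_single, evalAt_single]
  congr 1
  · funext j
    exact (hY.dup_mem _ (hu j).1 i (by rw [(hu j).2]; exact hi)).2.2
  · funext j
    exact (hev j).dup _ (hu j).1 i (by rw [(hu j).2]; exact hi) x y g hg (by rw [(hu j).2, hk])

theorem evalAt_mulL_left (hL : BarBasis.IsLawfulMul L)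
    (hev : ∀ i, IsEvaluation Γ L Q (R i) (R' i) (ev i)) {p q : ℕ} {l l' : ℤ}
    {a : omegaBar.Pow m} (ha : a ∈ omegaBar.piece m p l) {z : Y.Pow m} (hz : z ∈ Y.piece m q l')
    {x y : M} {g : List G} (hg : Γ.IsString x y g) (hk : g.length = p + q) :
    evalAt ev x y g (BarBasis.mulL m L a z)
      = evalAt (fun i => forestEval Γ (R' i)) (Γ.vertex y g p) y (g.take p) a
        ∘ₗ evalAt ev x (Γ.vertex y g p) (g.drop p) z := by
  refine BarBasis.mulL_comp_ext _ _ _ (fun u v hu hv => ?_) ha hz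
  rw [BarBasis.mulL_single, BarBasis.single_eq_smul, map_smul, evalAt_single, evalAt_single,
    evalAt_single, koszulMap_comp, BarBasis.degs_op hL hu hv]
  · congr 3
    funext i
    refine ((hev i).left _ _ (hu i).1 (hv i).1 x y g hg (by rw [(hu i).2, (hv i).2, hk])).trans ?_
    rw [(hu i).2]
    rfl
  · intro i
    exact (hev i).degree _ (hv i).1 _ _ _ (hg.drop p) (by rw [(hv i).2, List.length_drop]; omega)

theorem evalAt_mulL_right (hQ : BarBasis.IsLawfulMul Q)
    (hev : ∀ i, IsEvaluation Γ L Q (R i) (R' i) (ev i)) (hR : ∀ i, HasOpDegree Γ 1 (R i))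
    {p q : ℕ} {l l' : ℤ} {z : Y.Pow m} (hz : z ∈ Y.piece m p l)
    {a : omegaBar.Pow m} (ha : a ∈ omegaBar.piece m q l')
    {x y : M} {g : List G} (hg : Γ.IsString x y g) (hk : g.length = p + q) :
    evalAt ev x y g (BarBasis.mulL m Q z a)
      = evalAt ev (Γ.vertex y g p) y (g.take p) z
        ∘ₗ evalAt (fun i => forestEval Γ (R i)) x (Γ.vertex y g p) (g.drop p) a := by
  refine BarBasis.mulL_comp_ext _ _ _ (fun u v hu hv => ?_) hz ha
  rw [BarBasis.mulL_single, BarBasis.single_eq_smul, map_smul, evalAt_single, evalAt_single,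
    evalAt_single, koszulMap_comp, BarBasis.degs_op hQ hu hv]
  · congr 3
    funext i
    refine ((hev i).right _ _ (hu i).1 (hv i).1 x y g hg (by rw [(hu i).2, (hv i).2, hk])).trans ?_
    rw [(hu i).2]
    rfl
  · intro i
    refine evalForest_degree (hR i) _ _ _ _ (hg.drop p) ?_
    rw [show forestOrder (v i) = q from (hv i).2, List.length_drop]
    omega

theorem evalSeq_degree (hev : ∀ i, IsEvaluation Γ L Q (R i) (R' i) (ev i)) {n : ℤ}
    {z : ℕ → Y.Pow m} (hz : BarBasis.HasTotalDegree n z) : HasOpDegree Γ n (evalSeq ev z) := by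
  intro x y g hg d v hv
  have hs := hz g.length
  rw [evalSeq, evalAt, Finsupp.linearCombination_apply, Finsupp.sum, LinearMap.sum_apply]
  refine Submodule.sum_mem _ fun u hu => ?_
  obtain ⟨hu, hl⟩ := hs hu
  rw [LinearMap.smul_apply, ← hl]
  refine Submodule.smul_mem _ _ (IsHomogeneousMap.koszulMap (fun i => ?_) d v hv)
  exact (hev i).degree _ (hu i).1 x y g hg (hu i).2.symm

theorem evalSeq_smoothAt (hev : ∀ i, IsEvaluation Γ L Q (R i) (R' i) (ev i)) {n : ℤ}
    {z : ℕ → Y.Pow m} (hz : BarBasis.HasTotalDegree n z) (k : ℕ) :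
    IsSmoothOpAt Γ k (evalSeq ev z) := by
  rintro N U hU x y γ hγ rfl u₀ hu₀
  have hx := hγ.smooth_src u₀ hu₀
  have hy := hγ.smooth_tgt u₀ hu₀
  have h := SmoothFamilyAt.sum (z γ.length).support
    (S := fun w u => z γ.length w • GradedBundle.koszulMap (E := E) (F := F) (Y.degs w)
      fun i => ev i (w i) (x u) (y u) (γ.map fun c => c u)) (U := U) (u₀ := u₀)
    (fun w hw => SmoothFamilyAt.const_smul _ (SmoothFamilyAt.koszulMap (fun i => ?_) _ hx hy))
    hx hy
  · refine h.congr (Filter.Eventually.of_forall fun u => ?_)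
    rw [evalSeq, List.length_map, evalAt, Finsupp.linearCombination_apply, Finsupp.sum]
  · obtain ⟨hw, hl⟩ := hz γ.length hw
    exact (hev i).smooth _ (hw i).1 N U hU x y γ hγ (hw i).2.symm u₀ hu₀

end Evaluation

end TensorOperators


/-! ## Tensor products of representations and of morphisms -/

section TensorRepresentation

variable {EM : Type*} [NormedAddCommGroup EM] [NormedSpace ℝ EM]
  {M : Type uM} [TopologicalSpace M] [ChartedSpace EM M]
  {EG : Type*} [NormedAddCommGroup EG] [NormedSpace ℝ EG]
  {G : Type*} [TopologicalSpace G] [ChartedSpace EG G] {Γ : LieGroupoid EM M EG G}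

theorem isEvaluation_forest {E : GradedBundle.{uM, uV} EM M} {R : OpFamily G E E}
    (hR : IsRepresentation Γ R) :
    IsEvaluation Γ omegaMul omegaMul R R (forestEval Γ R) where
  smooth u _ := evalForest_smooth hR.smooth u
  degree u _ := evalForest_degree hR.degree u
  bdry u hu := lc_evalForest_bdryForest hR hu.2
  dup u _ i hi := evalForest_dupForest R u i hi
  left A u _ _ := by
    rw [show forestEval Γ R (omegaMul A u) = _ from evalForest_append R A u]
    exact OpEqAt.refl _ _
  right u A _ _ := by
    rw [show forestEval Γ R (omegaMul u A) = _ from evalForest_append R u A]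
    exact OpEqAt.refl _ _

theorem isEvaluation_marked {E F : GradedBundle.{uM, uV} EM M} {R : OpFamily G E E}
    {R' : OpFamily G F F} {Φ : OpFamily G E F} (hR : IsRepresentation Γ R)
    (hR' : IsRepresentation Γ R') (hΦ : IsMorphism Γ R R' Φ) :
    IsEvaluation Γ leftMul rightMul R R' (markedEval Γ R R' Φ) where
  smooth u _ := evalMarked_smooth hR.smooth hR'.smooth hΦ.smooth u
  degree u _ := by
    have := evalMarked_degree hR.degree hR'.degree hΦ.degree u
    rw [zero_add] at this
    exact this
  bdry u hu := by
    have h := lc_evalSigned_bdryMarked hR hR' hΦ.isTwisted hu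
    have h0 : evalSigned Γ R R' 0 Φ = evalMarked Γ R R' Φ := by
      funext t
      rw [evalSigned, zero_mul, sg_zero, one_smul]
    have h1 : evalMarked Γ R R' (0 : OpFamily G E F) u = 0 := by
      funext x y g
      refine LinearMap.ext fun v => ?_
      exact map_zero (evalForest Γ R' _ _ _ _)
    rw [h0, h1, sg_zero, one_smul, zero_add, smul_zero, add_zero] at h
    exact h
  dup u _ i hi := evalMarked_dupMarked R R' Φ u hi
  left A u _ _ := by
    rw [show markedEval Γ R R' Φ (leftMul A u) = _ from evalMarked_leftMul R R' Φ A u]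
    exact OpEqAt.refl _ _
  right u A _ _ := by
    rw [show markedEval Γ R R' Φ (rightMul u A) = _ from evalMarked_rightMul R R' Φ u A]
    exact OpEqAt.refl _ _

variable {m : ℕ} {E F : Fin m → GradedBundle.{uM, uV} EM M}
  {Y : BarBasis} {L : omegaBar.carrier → Y.carrier → Y.carrier}
  {Q : Y.carrier → omegaBar.carrier → Y.carrier} {R : ∀ i, OpFamily G (E i) (E i)}
  {R' : ∀ i, OpFamily G (F i) (F i)} {ev : ∀ i, Y.carrier → OpFamily G (E i) (F i)}
  {ω θ : ℕ → omegaBar.Pow m}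

theorem evalAt_dTot (hY : Y.IsLawful) (hev : ∀ i, IsEvaluation Γ L Q (R i) (R' i) (ev i))
    (hR : ∀ i, HasOpDegree Γ 1 (R i)) {n : ℤ} {z : ℕ → Y.Pow m}
    (hz : BarBasis.HasTotalDegree n z) {x y : M} {g : List G} (hg : Γ.IsString x y g) :
    evalAt ev x y g (BarBasis.dTot n z g.length)
      = tensorRep Γ θ R' y y [] ∘ₗ evalSeq ev z x y g
        - sg (n - g.length) • evalSeq ev z x y g ∘ₗ tensorRep Γ ω R x x []
        + sg n • ∑ i ∈ range (g.length - 1), (-1 : ℝ) ^ (i + 1) • evalSeq ev z x y (Γ.mulAt i g)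
      := by
  have h := evalAt_bdryPow hY hev hR (hz g.length) hg rfl
  rw [tensorRep_nil, tensorRep_nil]
  obtain hk | ⟨k, hk⟩ : g.length = 0 ∨ ∃ k, g.length = k + 1 := by
    cases g.length <;> simp
  · rw [hk] at h ⊢
    rw [BarBasis.dTot_zero, h, Nat.zero_sub, range_zero, Finset.sum_empty, smul_zero, add_zero,
      evalSeq, hk]
  · rw [hk] at h ⊢
    rw [BarBasis.dTot_succ, map_add, map_smul, h, BarBasis.dupAlt_apply, map_sum,
      Nat.add_sub_cancel, evalSeq, hk]
    congr 2
    refine Finset.sum_congr rfl fun i hi => ?_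
    have hi' := mem_range.1 hi
    rw [map_smul, evalAt_dupPow hY hev (hz k) hg hk hi', evalSeq,
      LieGroupoid.length_mulAt (by omega), hk, Nat.add_sub_cancel]

theorem evalAt_star_right (hQ : BarBasis.IsLawfulMul Q)
    (hev : ∀ i, IsEvaluation Γ L Q (R i) (R' i) (ev i)) (hR : ∀ i, HasOpDegree Γ 1 (R i))
    (hω : BarBasis.HasTotalDegree 1 ω) (h0 : ω 0 = 0) {n : ℤ} {z : ℕ → Y.Pow m}
    (hz : BarBasis.HasTotalDegree n z) {x y : M} {g : List G} (hg : Γ.IsString x y g) :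
    evalAt ev x y g (BarBasis.star Q 1 z ω g.length)
      = ∑ j ∈ range g.length, (-1 : ℝ) ^ j •
        compAt Γ j (evalSeq ev z) (tensorRep Γ ω R) x y g := by
  rw [BarBasis.star_apply, Nat.sum_antidiagonal_eq_sum_range_succ_mk, map_sum, sum_range_succ]
  simp only [Nat.sub_self, h0, map_zero, smul_zero, add_zero]
  refine Finset.sum_congr rfl fun j hj => ?_
  have hj' := mem_range.1 hj
  rw [map_smul, mul_one, ← negOne_pow_eq_sg,
    evalAt_mulL_right hQ hev hR (hz j) (hω (g.length - j)) hg (by omega)]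
  congr 1
  unfold compAt
  rw [tensorRep_of_ne_nil _ _ _ _ (fun h => by
    have := congrArg List.length h
    simp at this
    omega), evalSeq, evalSeq, List.length_take, List.length_drop, min_eq_left (by omega)]

theorem evalAt_star_left (hL : BarBasis.IsLawfulMul L)
    (hev : ∀ i, IsEvaluation Γ L Q (R i) (R' i) (ev i))
    (hθ : BarBasis.HasTotalDegree 1 θ) (h0 : θ 0 = 0) {n : ℤ} {z : ℕ → Y.Pow m}
    (hz : BarBasis.HasTotalDegree n z) {x y : M} {g : List G} (hg : Γ.IsString x y g) :
    evalAt ev x y g (BarBasis.star L n θ z g.length)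
      = ∑ j ∈ range g.length, sg ((j + 1 : ℕ) * n) •
        compAt Γ (j + 1) (tensorRep Γ θ R') (evalSeq ev z) x y g := by
  rw [BarBasis.star_apply, Nat.sum_antidiagonal_eq_sum_range_succ_mk, map_sum, sum_range_succ']
  simp only [h0, map_zero, LinearMap.zero_apply, smul_zero, add_zero]
  refine Finset.sum_congr rfl fun j hj => ?_
  have hj' := mem_range.1 hj
  rw [map_smul, evalAt_mulL_left hL hev (hθ (j + 1)) (hz (g.length - (j + 1))) hg (by omega)]
  congr 1
  unfold compAt
  rw [tensorRep_of_ne_nil _ _ _ _ (fun h => by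
    have := congrArg List.length h
    simp only [List.length_take, List.length_nil] at this
    omega), evalSeq, evalSeq, List.length_take, List.length_drop, min_eq_left (by omega)]

theorem evalAt_twDiff (hY : BarBasis.IsLawfulBimodule Y L Q)
    (hev : ∀ i, IsEvaluation Γ L Q (R i) (R' i) (ev i)) (hR : ∀ i, HasOpDegree Γ 1 (R i))
    (hω : BarBasis.HasTotalDegree 1 ω) (hω0 : ω 0 = 0) (hθ : BarBasis.HasTotalDegree 1 θ)
    (hθ0 : θ 0 = 0) {n : ℤ} {z : ℕ → Y.Pow m}
    (hz : BarBasis.HasTotalDegree n z) {x y : M} {g : List G} (hg : Γ.IsString x y g) :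
    evalAt ev x y g (BarBasis.twDiff L Q ω θ n z g.length)
      = sg n • ∑ i ∈ range (g.length - 1), (-1 : ℝ) ^ (i + 1) • evalSeq ev z x y (Γ.mulAt i g)
        - sg n • ∑ j ∈ range (g.length + 1), (-1 : ℝ) ^ j •
          compAt Γ j (evalSeq ev z) (tensorRep Γ ω R) x y g
        + ∑ j ∈ range (g.length + 1), sg (j * n) •
          compAt Γ j (tensorRep Γ θ R') (evalSeq ev z) x y g := by
  change evalAt ev x y g (BarBasis.dTot n z g.length - sg n • BarBasis.star Q 1 z ω g.length
    + BarBasis.star L n θ z g.length) = _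
  rw [map_add, map_sub, map_smul, evalAt_dTot (ω := ω) (θ := θ) hY.lawful hev hR hz hg,
    evalAt_star_right hY.right hev hR hω hω0 hz hg, evalAt_star_left hY.left hev hθ hθ0 hz hg,
    sum_range_succ _ g.length, sum_range_succ' _ g.length, compAt_zero, compAt_length _ _ hg rfl,
    Nat.cast_zero, zero_mul, sg_zero, one_smul, smul_add, smul_smul, negOne_pow_eq_sg, ← sg_add,
    sg_congr (g.length : ℤ) (show n + g.length = n - g.length + 2 * (g.length : ℤ) by ring)]
  abel

theorem koszulSum_koszulSum {x : M} {d : ∀ i, (E i).fiber x →ₗ[ℝ] (E i).fiber x}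
    (hd : ∀ i, IsHomogeneousMap 1 (d i)) (hdd : ∀ i, d i ∘ₗ d i = 0) :
    koszulSum d ∘ₗ koszulSum d = 0 := by
  have hdeg : ∀ i j, IsHomogeneousMap ((Pi.single i 1 : Fin m → ℤ) j) (Function.update
      (fun j => (LinearMap.id : (E j).fiber x →ₗ[ℝ] (E j).fiber x)) i (d i) j) := by
    intro i j
    by_cases hj : j = i
    · subst hj
      simpa using hd j
    · simpa [hj] using isHomogeneousMap_id
  have h : koszulSum d ∘ₗ koszulSum d = ∑ j, koszulSum d ∘ₗ GradedBundle.koszulMap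
      (Pi.single j 1) (Function.update (fun j => LinearMap.id) j (d j)) :=
    linearMap_comp_sum _ _ _
  rw [h]
  simp only [fun j => koszulSum_comp d _ _ (hdeg j)]
  rw [BarBasis.sum_anticomm]
  · refine Finset.sum_eq_zero fun i _ => ?_
    rw [Function.update_self, hdd, ← koszulSlot_apply, map_zero, smul_zero]
  · intro i j hij
    rw [Function.update_of_ne hij.symm, Function.update_of_ne hij, LinearMap.comp_id,
      LinearMap.comp_id, Function.update_comm hij, add_comm (Pi.single i 1), ← neg_smul]
    congr 1
    have h1 := signForm_single_single hij
    rw [← sg_add_one]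
    refine sg_congr (-signForm (Pi.single i 1) (Pi.single j 1)) ?_
    linarith

theorem tensorRep_degree (hR : ∀ i, IsRepresentation Γ (R i)) (hω : IsUniversalMC m ω) :
    HasOpDegree Γ 1 (tensorRep Γ ω R) := by
  intro x y g hg n v hv
  by_cases h : g = []
  · subst h
    obtain rfl : x = y := hg
    rw [tensorRep_nil, koszulSum, LinearMap.sum_apply]
    refine Submodule.sum_mem _ fun i _ => ?_
    have h1 : IsHomogeneousMap (E := GradedBundle.tensorBundle E)
        (F := GradedBundle.tensorBundle E) (∑ j, (Pi.single i 1 : Fin m → ℤ) j) _ :=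
      IsHomogeneousMap.koszulMap (φ := Function.update
        (fun j => (LinearMap.id : (E j).fiber x →ₗ[ℝ] (E j).fiber x)) i (R i x x [])) fun j => by
        by_cases hj : j = i
        · subst hj
          have := (hR j).degree x x [] rfl
          simpa [IsHomogeneousMap] using this
        · simpa [hj] using isHomogeneousMap_id
    have := h1 n v hv
    simpa using this
  · rw [tensorRep_of_ne_nil _ _ _ _ h]
    exact evalSeq_degree (fun i => isEvaluation_forest (hR i)) hω.degree x y g hg n v hv

theorem tensorRep_smooth (hR : ∀ i, IsRepresentation Γ (R i)) (hω : IsUniversalMC m ω) :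
    IsSmoothOp Γ (tensorRep Γ ω R) := by
  refine isSmoothOp_iff.2 fun k => ?_
  cases k with
  | zero =>
    intro N U hU x y γ hγ hk u₀ hu₀
    obtain rfl := List.length_eq_zero_iff.1 hk
    refine SmoothFamilyAt.sum _ (fun i _ => SmoothFamilyAt.koszulMap (fun j => ?_) _
      (hγ.smooth_src u₀ hu₀) (hγ.smooth_tgt u₀ hu₀)) (hγ.smooth_src u₀ hu₀)
      (hγ.smooth_tgt u₀ hu₀)
    by_cases hj : j = i
    · simp only [hj, if_true]
      exact isSmoothOp_iff.1 (hR j).smooth 0 N U hU x y [] hγ rfl u₀ hu₀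
    · simp only [hj, if_false]
      exact isSmoothOpAt_idOp (Γ := Γ) 0 N U hU x y [] hγ rfl u₀ hu₀
  | succ k =>
    refine (evalSeq_smoothAt (fun i => isEvaluation_forest (hR i)) hω.degree (k + 1)).congr ?_
    intro x y g _ hk
    exact tensorRep_of_ne_nil _ _ _ _ (by rintro rfl; simp at hk)

theorem isRepresentation_tensorRep (hm : 0 < m) (hR : ∀ i, IsRepresentation Γ (R i))
    (hω : IsUniversalMC m ω) : IsRepresentation Γ (tensorRep Γ ω R) where
  degree := tensorRep_degree hR hω
  smooth := tensorRep_smooth hR hω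
  equation x y g hg := by
    obtain hk | ⟨k, hk⟩ : g.length = 0 ∨ ∃ k, g.length = k + 1 := by
      cases g.length <;> simp
    · obtain rfl := List.length_eq_zero_iff.1 hk
      obtain rfl : x = y := hg
      simp only [List.length_nil, Nat.zero_sub, range_zero, Finset.sum_empty, zero_add, range_one,
        Finset.sum_singleton, pow_zero, one_smul, compAt_zero, tensorRep_nil]
      refine (koszulSum_koszulSum (fun i => ?_) fun i => ?_).symm
      · have := (hR i).degree x x [] rfl
        simpa [IsHomogeneousMap] using this
      · have := (hR i).equation x x [] rfl
        simpa [compAt_zero] using this.symm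
    · have hev := fun i => isEvaluation_forest (hR i)
      have h0 := hω.zero hm
      have h := hω.maurerCartan g.length
      have h1 := congrArg (evalAt (fun i => forestEval Γ (R i)) x y g) h
      rw [map_add, evalAt_dTot (ω := ω) (θ := ω) omegaBar_isLawful hev
        (fun i => (hR i).degree) hω.degree hg, evalAt_star_right omegaMul_isLawful hev
        (fun i => (hR i).degree) hω.degree h0 hω.degree hg, map_zero] at h1
      have h2 : ∑ i ∈ range (g.length - 1), (-1 : ℝ) ^ (i + 1) •
          evalSeq (fun i => forestEval Γ (R i)) ω x y (Γ.mulAt i g)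
          = ∑ i ∈ range (g.length - 1), (-1 : ℝ) ^ (i + 1) •
            tensorRep Γ ω R x y (Γ.mulAt i g) := by
        refine Finset.sum_congr rfl fun i hi => ?_
        have hi' := mem_range.1 hi
        rw [tensorRep_of_ne_nil]
        intro hn
        have := congrArg List.length hn
        rw [LieGroupoid.length_mulAt (by omega), List.length_nil] at this
        omega
      have hg0 : g ≠ [] := by rintro rfl; simp at hk
      rw [h2, ← tensorRep_of_ne_nil _ _ _ _ hg0] at h1
      rw [hk] at h1 ⊢
      rw [sum_range_succ'] at h1
      rw [sum_range_succ, sum_range_succ', compAt_zero, ← hk, compAt_length _ _ hg rfl]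
      rw [compAt_zero, show evalSeq (fun i => forestEval Γ (R i)) ω y y [] = 0 by
        rw [evalSeq, List.length_nil, h0, map_zero]] at h1
      have h3 : ∑ j ∈ range k, (-1 : ℝ) ^ (j + 1) •
          compAt Γ (j + 1) (evalSeq (fun i => forestEval Γ (R i)) ω) (tensorRep Γ ω R) x y g
          = ∑ j ∈ range k, (-1 : ℝ) ^ (j + 1) •
            compAt Γ (j + 1) (tensorRep Γ ω R) (tensorRep Γ ω R) x y g := by
        refine Finset.sum_congr rfl fun i hi => ?_
        have ht : g.take (i + 1) ≠ [] := fun hn => by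
          have := congrArg List.length hn
          simp only [List.length_take, List.length_nil] at this
          omega
        unfold compAt
        rw [tensorRep_of_ne_nil ω R _ _ ht]
      rw [h3, ← hk] at h1
      simp only [LinearMap.zero_comp, smul_zero, add_zero, sg_one, neg_one_smul, pow_zero,
        one_smul] at h1 ⊢
      rw [negOne_pow_eq_sg, sg_congr ((g.length : ℤ) - 1) (show (g.length : ℤ)
        = 1 - g.length + 1 + 2 * ((g.length : ℤ) - 1) by ring), sg_add_one]
      linear_combination (norm := module) (-1 : ℝ) • h1

theorem isMorphism_evalSeq (hm : 0 < m) (hY : BarBasis.IsLawfulBimodule Y L Q)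
    (hev : ∀ i, IsEvaluation Γ L Q (R i) (R' i) (ev i)) (hR : ∀ i, HasOpDegree Γ 1 (R i))
    (hω : IsUniversalMC m ω) (hθ : IsUniversalMC m θ) {z : ℕ → Y.Pow m}
    (hz : BarBasis.HasTotalDegree 0 z) (h : BarBasis.twDiff L Q ω θ 0 z = 0) :
    IsMorphism Γ (tensorRep Γ ω R) (tensorRep Γ θ R') (evalSeq ev z) where
  degree := evalSeq_degree hev hz
  smooth := isSmoothOp_iff.2 (evalSeq_smoothAt hev hz)
  equation x y g hg := by
    have h1 := evalAt_twDiff hY hev hR hω.degree (hω.zero hm) hθ.degree (hθ.zero hm) hz hg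
    rw [h, Pi.zero_apply, map_zero] at h1
    simp only [sg_zero, one_smul, mul_zero] at h1
    rw [eq_comm, sub_add, sub_eq_zero] at h1
    rw [h1]
    abel

theorem isHomotopy_evalSeq (hm : 0 < m) (hY : BarBasis.IsLawfulBimodule Y L Q)
    (hev : ∀ i, IsEvaluation Γ L Q (R i) (R' i) (ev i)) (hR : ∀ i, HasOpDegree Γ 1 (R i))
    (hω : IsUniversalMC m ω) (hθ : IsUniversalMC m θ) {z : ℕ → Y.Pow m}
    (hz : BarBasis.HasTotalDegree (-1) z)
    {Φ Ψ : OpFamily G (GradedBundle.tensorBundle E) (GradedBundle.tensorBundle F)}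
    (h : ∀ x y g, Γ.IsString x y g →
      evalSeq ev (BarBasis.twDiff L Q ω θ (-1) z) x y g = Φ x y g - Ψ x y g) :
    IsHomotopy Γ (tensorRep Γ ω R) (tensorRep Γ θ R') Φ Ψ (evalSeq ev z) where
  degree := evalSeq_degree hev hz
  smooth := isSmoothOp_iff.2 (evalSeq_smoothAt hev hz)
  equation x y g hg := by
    have h1 := evalAt_twDiff hY hev hR hω.degree (hω.zero hm) hθ.degree (hθ.zero hm) hz hg
    rw [show evalAt ev x y g (BarBasis.twDiff L Q ω θ (-1) z g.length)
      = evalSeq ev (BarBasis.twDiff L Q ω θ (-1) z) x y g from rfl, h x y g hg] at h1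
    rw [h1]
    simp only [negOne_pow_eq_sg, sg_neg, sg_one, mul_neg_one, Nat.cast_succ, sg_add_one, neg_smul,
      sum_neg_distrib, one_smul, smul_neg, neg_neg, sub_neg_eq_add]
    abel

end TensorRepresentation


/-! ## Homotopies between tensor products of morphisms -/

section TensorHomotopies

open Finsupp (linearCombination linearCombination_single single)

variable {EM : Type*} [NormedAddCommGroup EM] [NormedSpace ℝ EM]
  {M : Type uM} [TopologicalSpace M] [ChartedSpace EM M]
  {EG : Type*} [NormedAddCommGroup EG] [NormedSpace ℝ EG]
  {G : Type*} [TopologicalSpace G] [ChartedSpace EG G] {Γ : LieGroupoid EM M EG G}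

/-- The evaluation of the unital Maurer-Cartan algebra at a representation. -/
def unitalEval (Γ : LieGroupoid EM M EG G) {E : GradedBundle.{uM, uV} EM M}
    (R : OpFamily G E E) (A : omegaUnital.carrier) : OpFamily G E E := evalForest Γ R A

theorem isEvaluation_unital {E : GradedBundle.{uM, uV} EM M} {R : OpFamily G E E}
    (hR : IsRepresentation Γ R) :
    IsEvaluation Γ unitalLeft unitalRight R R (unitalEval Γ R) where
  smooth u _ := evalForest_smooth hR.smooth u
  degree u _ := evalForest_degree hR.degree u
  bdry u hu := lc_evalForest_bdryForest hR hu
  dup u _ i hi := evalForest_dupForest R u i hi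
  left A u _ _ := by
    rw [show unitalEval Γ R (unitalLeft A u) = _ from evalForest_append R A u]
    exact OpEqAt.refl _ _
  right u A _ _ := by
    rw [show unitalEval Γ R (unitalRight u A) = _ from evalForest_append R u A]
    exact OpEqAt.refl _ _

/-- The evaluation of the cylinder at a homotopy. -/
def cylEval (Γ : LieGroupoid EM M EG G) {E F : GradedBundle.{uM, uV} EM M} (R : OpFamily G E E)
    (R' : OpFamily G F F) (Φ : Bool → OpFamily G E F) (h : OpFamily G E F)
    (t : MarkedForest × Option Bool) : OpFamily G E F :=
  evalMarked Γ R R' (t.2.elim h Φ) t.1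

section

variable {E F : GradedBundle.{uM, uV} EM M} {R : OpFamily G E E} {R' : OpFamily G F F}

theorem evalMarked_sub (φ ψ : OpFamily G E F) (t : MarkedForest) :
    evalMarked Γ R R' (φ - ψ) t = evalMarked Γ R R' φ t - evalMarked Γ R R' ψ t := by
  funext x y g
  exact (congrArg _ (LinearMap.sub_comp _ _ _)).trans (LinearMap.comp_sub _ _ _)

theorem cylEval_bdryCyl {Φ : Bool → OpFamily G E F} {h : OpFamily G E F}
    (hR : IsRepresentation Γ R) (hR' : IsRepresentation Γ R')
    (hΦ : ∀ b, IsMorphism Γ R R' (Φ b)) (hh : IsHomotopy Γ R R' (Φ true) (Φ false) h)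
    {t : MarkedForest × Option Bool} (ht : GoodMarked t.1) :
    OpEqAt Γ (markedOrder t.1) (linearCombination ℝ (cylEval Γ R R' Φ h) (bdryCyl t))
      (commOp R R' (cylDeg t) (cylEval Γ R R' Φ h t)) := by
  obtain ⟨t, _ | b⟩ := t
  · have h1 := lc_evalSigned_bdryMarked hR hR' hh.isTwisted ht
    have h2 : linearCombination ℝ (cylEval Γ R R' Φ h) ∘ₗ linearCombination ℝ cylJ
        = linearCombination ℝ (evalSigned Γ R R' (-1) h) := by
      refine Finsupp.lhom_ext' fun s => LinearMap.ext_ring ?_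
      simp only [LinearMap.comp_apply, Finsupp.lsingle_apply, linearCombination_single, one_smul,
        cylJ, evalSigned, neg_one_mul, sg_neg, cylEval, Option.elim_none]
    have h3 : linearCombination ℝ (cylEval Γ R R' Φ h) (bdryCyl (t, none))
        = sg (forestDeg t.left) • (evalMarked Γ R R' (Φ true - Φ false) t
          - linearCombination ℝ (evalSigned Γ R R' (-1) h) (bdryMarked t)) := by
      rw [bdryCyl, map_smul, map_sub, map_sub, ← h2, linearCombination_single,
        linearCombination_single, one_smul, one_smul, evalMarked_sub]
      rfl
    rw [h3]
    refine (((OpEqAt.refl _ _).sub h1).smul _).trans ?_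
    have h4 : sg (forestDeg t.left) • (evalMarked Γ R R' (Φ true - Φ false) t
        - (sg (-1) • commOp R R' (-1 + markedDeg t) (evalSigned Γ R R' (-1) h t)
          + (sg (forestDeg t.left) * sg (-1 * forestDeg t.left)) •
            evalMarked Γ R R' (Φ true - Φ false) t))
        = commOp R R' (cylDeg (t, none)) (cylEval Γ R R' Φ h (t, none)) := by
      rw [evalSigned, commOp_smul, neg_one_mul, sg_neg, sg_neg, sg_mul_self, one_smul, sg_one,
        sub_add_cancel_right, neg_one_smul, neg_neg, smul_smul, sg_mul_self, one_smul,
        neg_add_eq_sub]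
      rfl
    exact h4 ▸ OpEqAt.refl _ _
  · exact (show linearCombination ℝ (cylEval Γ R R' Φ h) (bdryCyl (t, some b))
      = linearCombination ℝ (evalMarked Γ R R' (Φ b)) (bdryMarked t) from
        linearCombination_push _ _ _) ▸ (isEvaluation_marked hR hR' (hΦ b)).bdry t ht

theorem isEvaluation_cyl {Φ : Bool → OpFamily G E F} {h : OpFamily G E F}
    (hR : IsRepresentation Γ R) (hR' : IsRepresentation Γ R')
    (hΦ : ∀ b, IsMorphism Γ R R' (Φ b)) (hh : IsHomotopy Γ R R' (Φ true) (Φ false) h) :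
    IsEvaluation (Y := cylBar) Γ cylLeft cylRight R R' (cylEval Γ R R' Φ h) where
  smooth u _ := by
    refine evalMarked_smooth hR.smooth hR'.smooth ?_ u.1
    obtain ⟨t, _ | b⟩ := u
    · exact hh.smooth
    · exact (hΦ b).smooth
  degree u _ := by
    obtain ⟨t, _ | b⟩ := u
    · have := evalMarked_degree hR.degree hR'.degree hh.degree t
      rw [neg_add_eq_sub] at this
      exact this
    · have := evalMarked_degree hR.degree hR'.degree (hΦ b).degree t
      rw [zero_add] at this
      exact this
  bdry u hu := cylEval_bdryCyl hR hR' hΦ hh hu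
  dup u _ i hi := evalMarked_dupMarked R R' _ u.1 hi
  left A u _ _ := by
    refine (congrArg (OpEqAt Γ _ · _) ?_).mpr (OpEqAt.refl _ _)
    exact evalMarked_leftMul R R' _ A u.1
  right u A _ _ := by
    refine (congrArg (OpEqAt Γ _ · _) ?_).mpr (OpEqAt.refl _ _)
    exact evalMarked_rightMul R R' _ u.1 A

end

variable {m : ℕ} {E F : Fin m → GradedBundle.{uM, uV} EM M}

theorem koszulMap_eq_zero {x y : M} {l : Fin m → ℤ}
    {φ : ∀ i, (E i).fiber x →ₗ[ℝ] (F i).fiber y} (i : Fin m) (h : φ i = 0) :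
    GradedBundle.koszulMap l φ = 0 := by
  have h2 := map_zero (koszulSlot l φ i)
  rw [koszulSlot_apply, ← h, Function.update_eq_self] at h2
  exact h2

theorem koszulMap_smul_univ {x y : M} (l : Fin m → ℤ) (c : Fin m → ℝ)
    (φ : ∀ i, (E i).fiber x →ₗ[ℝ] (F i).fiber y) :
    GradedBundle.koszulMap l (fun i => c i • φ i) = (∏ i, c i) • GradedBundle.koszulMap l φ :=
  (congrArg PiTensorProduct.map (funext fun _ => LinearMap.smul_comp _ _ _)).trans
    (map_smul_univ c fun i => φ i ∘ₗ (E i).twist x (∑ j ∈ univ.filter (fun j => i < j), l j))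

theorem koszulMap_zero_left {x y : M} (φ : ∀ i, (E i).fiber x →ₗ[ℝ] (F i).fiber y) :
    GradedBundle.koszulMap 0 φ = PiTensorProduct.map φ := by
  refine congrArg PiTensorProduct.map (funext fun i => ?_)
  simp only [Pi.zero_apply, Finset.sum_const_zero, GradedBundle.twist_zero]
  rfl

theorem BarBasis.WMap.evalAt_pow {X Y : BarBasis} (P : WMap X Y)
    {ev : ∀ i, X.carrier → OpFamily G (E i) (F i)} {ev' : ∀ i, Y.carrier → OpFamily G (E i) (F i)}
    {k : ℕ} (h : ∀ i u, X.IsBasis u → X.order u = k → OpEqAt Γ k (ev i u) (P.wt u • ev' i (P.map u)))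
    {l : ℤ} {z : X.Pow m} (hz : z ∈ X.piece m k l) {x y : M} {g : List G}
    (hg : Γ.IsString x y g) (hk : g.length = k) :
    evalAt ev' x y g (P.pow m z) = evalAt ev x y g z := by
  refine piece_ext (T := evalAt ev' x y g ∘ₗ P.pow m) (T' := evalAt ev x y g)
    (fun u hu _ => ?_) hz
  rw [LinearMap.comp_apply, pow_single, evalAt_single, evalAt, linearCombination_single]
  by_cases hw : ∏ i, P.wt (u i) = 0
  · obtain ⟨i, -, hi⟩ := Finset.prod_eq_zero_iff.1 hw
    rw [hw, zero_smul]
    have h1 : ev i (u i) x y g = 0 := by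
      rw [h i (u i) (hu i).1 (hu i).2 x y g hg hk, hi, zero_smul]
      rfl
    exact (koszulMap_eq_zero i h1).symm
  · have hd : Y.degs (fun i => P.map (u i)) = X.degs u := by
      funext i
      exact (P.mem _ (hu i).1 (Finset.prod_ne_zero_iff.1 hw i (mem_univ i))).2.2
    rw [hd]
    have h1 : (fun i => ev i (u i) x y g) = fun i => P.wt (u i) • ev' i (P.map (u i)) x y g :=
      funext fun i => h i (u i) (hu i).1 (hu i).2 x y g hg hk
    rw [h1]
    exact (koszulMap_smul_univ _ _ _).symm

variable {R : ∀ i, OpFamily G (E i) (E i)} {R' : ∀ i, OpFamily G (F i) (F i)}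
  {ω θ : ℕ → omegaBar.Pow m} {x : ℕ → moduleBar.Pow m}

theorem areHomotopic_tensorMor (hm : 0 < m) (hω : IsUniversalMC m ω) (hθ : IsUniversalMC m θ)
    (hx : IsUniversalMCMorphism ω θ x) (hR : ∀ i, IsRepresentation Γ (R i))
    (hR' : ∀ i, IsRepresentation Γ (R' i)) {Φ' Φ : ∀ i, OpFamily G (E i) (F i)}
    (hΦ' : ∀ i, IsMorphism Γ (R i) (R' i) (Φ' i)) (hΦ : ∀ i, IsMorphism Γ (R i) (R' i) (Φ i))
    (h : ∀ i, AreHomotopic Γ (R i) (R' i) (Φ' i) (Φ i)) :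
    AreHomotopic Γ (tensorRep Γ ω R) (tensorRep Γ θ R')
      (tensorMor Γ x R R' Φ') (tensorMor Γ x R R' Φ) := by
  choose η hη using h
  obtain ⟨z, hz, hz'⟩ := exists_cyl_homotopy hm hω hθ hx
  have hev : ∀ i, IsEvaluation (Y := cylBar) Γ cylLeft cylRight (R i) (R' i)
      (cylEval Γ (R i) (R' i) (fun b => bif b then Φ' i else Φ i) (η i)) := fun i =>
    isEvaluation_cyl (hR i) (hR' i) (fun b => by cases b; exacts [hΦ i, hΦ' i]) (hη i)
  refine ⟨_, isHomotopy_evalSeq hm cylBar_isLawfulBimodule hev (fun i => (hR i).degree) hω hθ hz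
    fun p q g hg => ?_⟩
  have key : ∀ b, evalAt (Y := cylBar)
      (fun i => cylEval Γ (R i) (R' i) (fun b => bif b then Φ' i else Φ i) (η i)) p q g
        ((cylIncl b).pow m (x g.length))
      = tensorMor Γ x R R' (fun i => bif b then Φ' i else Φ i) p q g := fun b =>
    (cylIncl b).evalAt_pow (ev := fun i => markedEval Γ (R i) (R' i) (bif b then Φ' i else Φ i))
      (fun i u _ _ => by
        refine (congrArg (OpEqAt Γ _ _) ?_).mpr (OpEqAt.refl _ _)
        exact one_smul ℝ _) (hx.degree g.length) hg rfl
  refine (congrArg (evalAt _ p q g) (congrFun hz' g.length)).trans ?_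
  exact (map_sub _ _ _).trans (congrArg₂ _ (key true) (key false))

theorem isHomotopy_tensorMor (hm : 0 < m) (hω : IsUniversalMC m ω) (hθ : IsUniversalMC m θ)
    {y h : ℕ → moduleBar.Pow m} (hh : IsMCHomotopy ω θ x y h)
    (hR : ∀ i, IsRepresentation Γ (R i))
    (hR' : ∀ i, IsRepresentation Γ (R' i)) {Φ : ∀ i, OpFamily G (E i) (F i)}
    (hΦ : ∀ i, IsMorphism Γ (R i) (R' i) (Φ i)) :
    IsHomotopy Γ (tensorRep Γ ω R) (tensorRep Γ θ R') (tensorMor Γ x R R' Φ)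
      (tensorMor Γ y R R' Φ) (tensorMor Γ h R R' Φ) := by
  rw [isMCHomotopy_iff] at hh
  refine isHomotopy_evalSeq hm moduleBar_isLawfulBimodule
    (fun i => isEvaluation_marked (hR i) (hR' i) (hΦ i)) (fun i => (hR i).degree) hω hθ hh.1
    fun p q g _ => ?_
  exact (congrArg (evalAt _ p q g) (congrFun hh.2 g.length)).trans (map_sub _ _ _)

theorem isMorphism_tensorMor (hm : 0 < m) (hω : IsUniversalMC m ω) (hθ : IsUniversalMC m θ)
    (hx : IsUniversalMCMorphism ω θ x) (hR : ∀ i, IsRepresentation Γ (R i))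
    (hR' : ∀ i, IsRepresentation Γ (R' i)) {Φ : ∀ i, OpFamily G (E i) (F i)}
    (hΦ : ∀ i, IsMorphism Γ (R i) (R' i) (Φ i)) :
    IsMorphism Γ (tensorRep Γ ω R) (tensorRep Γ θ R') (tensorMor Γ x R R' Φ) := by
  rw [isUniversalMCMorphism_iff] at hx
  exact isMorphism_evalSeq hm moduleBar_isLawfulBimodule
    (fun i => isEvaluation_marked (hR i) (hR' i) (hΦ i)) (fun i => (hR i).degree) hω hθ hx.1 hx.2.1

theorem evalMarked_idOp {E : GradedBundle.{uM, uV} EM M} (R : OpFamily G E E) (t : MarkedForest) :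
    OpEqAt Γ (markedOrder t) (evalMarked Γ R R (idOp G E) t)
      ((if t.mid = [] then (1 : ℝ) else 0) • evalForest Γ R (t.left ++ t.right)) := by
  obtain ⟨A, X, B⟩ := t
  simp only [evalMarked_mk, markedOrder]
  split_ifs with hX
  · subst hX
    rw [one_smul, evalForest_append, treeOrder_nil, add_zero]
    refine (OpEqAt.refl (forestOrder A) _).compAt ?_
    exact (compAt_zero_idOp (Γ := Γ) (evalForest Γ R B)).symm ▸ OpEqAt.refl _ _
  · have h1 : OpEqAt Γ (treeOrder X) (treeOp Γ (idOp G E) X) 0 := by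
      intro x y g _ hk
      refine idOp_ne_nil fun h => hX (List.length_eq_zero_iff.1 ?_)
      rw [← LieGroupoid.length_collapse (Γ := Γ) hk.ge, h, List.length_nil]
    rw [zero_smul, add_assoc]
    refine ((OpEqAt.refl (forestOrder A) _).compAt
      (h1.compAt (OpEqAt.refl (forestOrder B) _))).trans fun x y g _ _ => ?_
    exact (congrArg _ (LinearMap.zero_comp _)).trans (LinearMap.comp_zero _)

theorem areHomotopic_tensorMor_idOp (hm : 0 < m) (hω : IsUniversalMC m ω)
    (hx : IsUniversalMCMorphism ω ω x) (hR : ∀ i, IsRepresentation Γ (R i)) :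
    AreHomotopic Γ (tensorRep Γ ω R) (tensorRep Γ ω R)
      (tensorMor Γ x R R fun i => idOp G (E i)) (idOp G (GradedBundle.tensorBundle E)) := by
  obtain ⟨z, hz, hz'⟩ := exists_unital_homotopy hm hω hx
  refine ⟨_, isHomotopy_evalSeq hm unital_isLawfulBimodule
    (fun i => isEvaluation_unital (hR i)) (fun i => (hR i).degree) hω hω hz
    fun p q g hg => ?_⟩
  have h1 : evalAt (fun i => unitalEval Γ (R i)) p q g (joinEndsMap.pow m (x g.length))
      = tensorMor Γ x R R (fun i => idOp G (E i)) p q g :=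
    joinEndsMap.evalAt_pow (ev := fun i => markedEval Γ (R i) (R i) (idOp G (E i)))
      (fun i u _ hu => hu ▸ evalMarked_idOp (R i) u) (hx.degree g.length) hg rfl
  have h2 : evalAt (fun i => unitalEval Γ (R i)) p q g (unitSeq m g.length)
      = idOp G (GradedBundle.tensorBundle E) p q g := by
    cases g with
    | nil =>
      obtain rfl : p = q := hg
      rw [unitSeq, List.length_nil, Pi.single_eq_same, evalAt_single, idOp_nil_self,
        show omegaUnital.degs (fun _ : Fin m => emptyForest) = 0 from rfl, koszulMap_zero_left,
        show (fun i => unitalEval Γ (R i) emptyForest p p []) = fun i => LinearMap.id from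
          funext fun i => idOp_nil_self G p]
      exact PiTensorProduct.map_id
    | cons a g =>
      rw [unitSeq, List.length_cons, Pi.single_eq_of_ne (by omega), map_zero,
        idOp_ne_nil (by simp)]
  refine (congrArg (evalAt _ p q g) (congrFun hz' g.length)).trans ?_
  exact (map_sub _ _ _).trans (congrArg₂ _ h1 h2)

end TensorHomotopies


/-! ## Components of tensor products of morphisms -/

section Strict

variable {EM : Type*} [NormedAddCommGroup EM] [NormedSpace ℝ EM]
  {M : Type uM} [TopologicalSpace M] [ChartedSpace EM M]
  {EG : Type*} [NormedAddCommGroup EG] [NormedSpace ℝ EG]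
  {G : Type*} [TopologicalSpace G] [ChartedSpace EG G] {Γ : LieGroupoid EM M EG G}

section

variable {D E F : GradedBundle.{uM, uV} EM M}

theorem compAt_opEqAt_zero_left {j k : ℕ} {φ : OpFamily G E F} (h : OpEqAt Γ j φ 0)
    (ψ : OpFamily G D E) : OpEqAt Γ (j + k) (compAt Γ j φ ψ) 0 :=
  (h.compAt (OpEqAt.refl k ψ)).trans fun _ _ _ _ _ => LinearMap.zero_comp _

theorem compAt_opEqAt_zero_right {j k : ℕ} {ψ : OpFamily G D E} (h : OpEqAt Γ k ψ 0)
    (φ : OpFamily G E F) : OpEqAt Γ (j + k) (compAt Γ j φ ψ) 0 :=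
  ((OpEqAt.refl j φ).compAt h).trans fun _ _ _ _ _ => LinearMap.comp_zero _

theorem VanishesFrom.treeOp {n : ℕ} {φ : OpFamily G E F} (h : VanishesFrom Γ n φ) {X : List ℕ+}
    (hX : n ≤ X.length) : OpEqAt Γ (treeOrder X) (treeOp Γ φ X) 0 := fun x y _ hg hk =>
  h x y _ (hg.collapse hk) (hX.trans_eq (LieGroupoid.length_collapse hk.ge).symm)

theorem VanishesFrom.evalForest {R : OpFamily G E E} (h : VanishesFrom Γ 2 R)
    {A : List (List ℕ+)} (hd : forestDeg A < 0) :
    OpEqAt Γ (forestOrder A) (evalForest Γ R A) 0 := by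
  induction A with
  | nil => simp at hd
  | cons X A ih =>
    rw [forestDeg_cons] at hd
    rw [forestOrder_cons, evalForest_cons]
    by_cases hX : 2 ≤ X.length
    · exact compAt_opEqAt_zero_left (h.treeOp hX) _
    · exact compAt_opEqAt_zero_right (ih (by omega)) _

theorem evalMarked_eq_zero {R : OpFamily G E E} {R' : OpFamily G F F} {Φ : OpFamily G E F}
    (hR : VanishesFrom Γ 2 R) (hR' : VanishesFrom Γ 2 R') (hΦ : VanishesFrom Γ 1 Φ)
    {t : MarkedForest} (hd : markedDeg t < 0) :
    OpEqAt Γ (markedOrder t) (evalMarked Γ R R' Φ t) 0 := by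
  obtain ⟨A, X, B⟩ := t
  simp only [markedDeg] at hd
  simp only [evalMarked_mk, markedOrder]
  rw [add_assoc]
  by_cases hA : forestDeg A < 0
  · exact compAt_opEqAt_zero_left (hR'.evalForest hA) _
  by_cases hX : 1 ≤ X.length
  · exact compAt_opEqAt_zero_right (compAt_opEqAt_zero_left (hΦ.treeOp hX) _) _
  · exact compAt_opEqAt_zero_right (compAt_opEqAt_zero_right (hR.evalForest (by omega)) _) _

end

variable {m : ℕ} {E F : Fin m → GradedBundle.{uM, uV} EM M}
  {R : ∀ i, OpFamily G (E i) (E i)} {R' : ∀ i, OpFamily G (F i) (F i)}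
  {Φ : ∀ i, OpFamily G (E i) (F i)} {ω θ : ℕ → omegaBar.Pow m} {x : ℕ → moduleBar.Pow m}

theorem tensorMor_nil (hx : x 0 = Finsupp.single (fun _ => unitTriple) 1) (p : M) :
    tensorMor Γ x R R' Φ p p [] = PiTensorProduct.map fun i => Φ i p p [] := by
  have h : ∀ i, markedEval Γ (R i) (R' i) (Φ i) unitTriple p p [] = Φ i p p [] := fun i =>
    (congrFun (congrFun (congrFun (compAt_zero_idOp _) p) p) []).trans
      (compAt_idOp _ 0 p p [] rfl rfl)
  rw [tensorMor_eq, evalSeq, List.length_nil, hx, evalAt_single,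
    show moduleBar.degs (fun _ : Fin m => unitTriple) = 0 from rfl, koszulMap_zero_left]
  exact congrArg PiTensorProduct.map (funext h)

theorem vanishesFrom_tensorMor (hx : BarBasis.HasTotalDegree 0 x)
    (hR : ∀ i, VanishesFrom Γ 2 (R i)) (hR' : ∀ i, VanishesFrom Γ 2 (R' i))
    (hΦ : ∀ i, VanishesFrom Γ 1 (Φ i)) : VanishesFrom Γ 1 (tensorMor Γ x R R' Φ) := by
  intro p q g hg hk
  refine (BarBasis.piece_ext (T := evalAt (fun i => markedEval Γ (R i) (R' i) (Φ i)) p q g)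
    (T' := 0) (fun u hu hl => ?_) (hx g.length)).trans rfl
  obtain ⟨i, -, hi⟩ : ∃ i ∈ univ, moduleBar.deg (u i) < 0 := by
    refine Finset.exists_lt_of_sum_lt (g := fun _ => (0 : ℤ)) ?_
    rw [Finset.sum_const_zero]
    refine lt_of_eq_of_lt hl ?_
    omega
  rw [evalAt_single]
  exact koszulMap_eq_zero i
    (evalMarked_eq_zero (hR i) (hR' i) (hΦ i) hi p q g hg (hu i).2.symm)

end Strict


/-! ## Symmetric powers -/

section SymmetricPowers

open Finsupp (linearCombination linearCombination_single)

variable {EM : Type*} [NormedAddCommGroup EM] [NormedSpace ℝ EM]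
  {M : Type uM} [TopologicalSpace M] [ChartedSpace EM M]
  {EG : Type*} [NormedAddCommGroup EG] [NormedSpace ℝ EG]
  {G : Type*} [TopologicalSpace G] [ChartedSpace EG G] {Γ : LieGroupoid EM M EG G}
  {m : ℕ}

theorem sg_invForm_congr (σ : Equiv.Perm (Fin m)) {l l' : Fin m → ℤ}
    (h : ∀ i, ∃ k, l i = l' i + 2 * k) : sg (invForm σ l) = sg (invForm σ l') := by
  choose k hk using h
  refine sg_congr (∑ i, ∑ j, if i < j ∧ σ j < σ i then
    k i * l' j + l' i * k j + 2 * k i * k j else 0) ?_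
  simp only [invForm, Finset.mul_sum, ← Finset.sum_add_distrib]
  refine Finset.sum_congr rfl fun i _ => Finset.sum_congr rfl fun j _ => ?_
  split_ifs
  · rw [hk, hk]
    ring
  · ring

namespace GradedBundle

/-- Decomposable tensors in the fibres of a tensor product. -/
def tensor {E : Fin m → GradedBundle.{uM, uV} EM M} {x : M} (v : ∀ i, (E i).fiber x) :
    (tensorBundle E).fiber x := PiTensorProduct.tprod ℝ v

theorem tensorBundle_ext {E : Fin m → GradedBundle.{uM, uV} EM M} {x : M} {W : Type*}
    [AddCommGroup W] [Module ℝ W] {f g : (tensorBundle E).fiber x →ₗ[ℝ] W}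
    (h : ∀ (d : Fin m → ℤ) (v : ∀ i, (E i).fiber x), (∀ i, v i ∈ (E i).gr x (d i)) →
      f (tensor v) = g (tensor v)) : f = g := by
  refine (tensorBundle E).linearMap_ext fun n v hv => ?_
  change v ∈ tensorGr E x n at hv
  induction hv using Submodule.span_induction with
  | mem v hv =>
    obtain ⟨d, v, hv, -, rfl⟩ := hv
    exact h d v hv
  | zero => rw [map_zero, map_zero]
  | add u v _ _ hu hv => rw [map_add, map_add, hu, hv]
  | smul c v _ hv => rw [map_smul, map_smul, hv]

theorem koszulMap_tensor {E F : Fin m → GradedBundle.{uM, uV} EM M} {x y : M} (l d : Fin m → ℤ)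
    (φ : ∀ i, (E i).fiber x →ₗ[ℝ] (F i).fiber y) {v : ∀ i, (E i).fiber x}
    (hv : ∀ i, v i ∈ (E i).gr x (d i)) : koszulMap l φ (tensor v)
      = sg (signForm l d) • tensor fun i => φ i (v i) := by
  refine (PiTensorProduct.map_tprod _ _).trans ?_
  have h : ∀ i, (φ i ∘ₗ (E i).twist x (∑ j ∈ univ.filter (fun j => i < j), l j)) (v i)
      = sg ((∑ j ∈ univ.filter (fun j => i < j), l j) * d i) • φ i (v i) := fun i => by
    rw [LinearMap.comp_apply, (E i).twist_apply x _ _ _ (hv i), map_smul, negOne_zpow_eq_sg]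
  simp only [h]
  rw [MultilinearMap.map_smul_univ, ← sg_sum, signForm_eq_sum_lt]
  rfl

variable (E : GradedBundle.{uM, uV} EM M)

theorem parityProj_apply {x : M} {d : ℤ} {v : E.fiber x} (hv : v ∈ E.gr x d) (p : Bool) :
    E.parityProj x p v = if p = decide (Odd d) then v else 0 := by
  have h : E.parityProj x p v = (1 / 2 : ℝ) • (v + (if p then (-1 : ℝ) else 1) • sg d • v) := by
    rw [parityProj, LinearMap.smul_apply, LinearMap.add_apply, LinearMap.smul_apply,
      E.twist_apply x _ d v hv, one_mul, negOne_zpow_eq_sg]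
    rfl
  rw [h]
  rcases Int.even_or_odd d with hd | hd
  · have h1 : sg d = 1 := by
      obtain ⟨k, rfl⟩ := hd
      rw [sg_add, sg_mul_self]
    have h2 : ¬ Odd d := Int.not_odd_iff_even.2 hd
    cases p <;> simp [h1, h2, ← two_smul ℝ v, smul_smul]
  · have h1 : sg d = -1 := by
      obtain ⟨k, rfl⟩ := hd
      rw [sg_add_one, sg_congr k (b := 0) (by ring), sg_zero]
    cases p <;> simp [h1, hd, ← two_smul ℝ v, smul_smul]

theorem permAction_tensor {x : M} (σ : Equiv.Perm (Fin m)) {d : Fin m → ℤ}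
    {v : Fin m → E.fiber x} (hv : ∀ i, v i ∈ E.gr x (d i)) :
    E.permAction x σ (tensor v) = sg (invForm σ d) • tensor fun i => v (σ.symm i) := by
  have h : ∀ p : Fin m → Bool, (PiTensorProduct.reindex ℝ (fun _ : Fin m => E.fiber x) σ)
      (PiTensorProduct.map (fun i => E.parityProj x (p i)) (PiTensorProduct.tprod ℝ v))
      = if p = fun i => decide (Odd (d i)) then PiTensorProduct.tprod ℝ fun i => v (σ.symm i)
        else 0 := by
    intro p
    rw [PiTensorProduct.map_tprod]
    split_ifs with hp
    · subst hp
      simp only [E.parityProj_apply (hv _), if_true]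
      exact PiTensorProduct.reindex_tprod _ _
    · obtain ⟨i, hi⟩ := Function.ne_iff.1 hp
      rw [MultilinearMap.map_coord_zero _ i, map_zero]
      rw [E.parityProj_apply (hv i), if_neg hi]
  have h2 : E.permAction x σ (tensor v) = ∑ p : Fin m → Bool,
      koszulSign σ (fun i => if p i then 1 else 0) •
      (PiTensorProduct.reindex ℝ (fun _ : Fin m => E.fiber x) σ)
      (PiTensorProduct.map (fun i => E.parityProj x (p i)) (PiTensorProduct.tprod ℝ v)) :=
    LinearMap.sum_apply (M := ⨂[ℝ] _ : Fin m, E.fiber x) (M₂ := ⨂[ℝ] _ : Fin m, E.fiber x) _ _ _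
  refine h2.trans ?_
  rw [Finset.sum_eq_single fun i => decide (Odd (d i))]
  · rw [h, if_pos rfl, koszulSign_eq]
    refine congrArg (· • _) ?_
    refine sg_invForm_congr σ fun i => ?_
    rcases Int.even_or_odd' (d i) with ⟨k, hk | hk⟩
    · exact ⟨-k, by simp [hk]⟩
    · exact ⟨-k, by simp [hk]⟩
  · intro p _ hp
    rw [h, if_neg hp, smul_zero]
  · exact fun h => absurd (mem_univ _) h

theorem permAction_comp (x : M) (σ τ : Equiv.Perm (Fin m)) :
    E.permAction x σ ∘ₗ E.permAction x τ = E.permAction x (σ * τ) := by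
  refine tensorBundle_ext fun d v hv => ?_
  rw [LinearMap.comp_apply]
  refine (congrArg _ (E.permAction_tensor τ hv)).trans ?_
  rw [map_smul]
  refine (congrArg _ (E.permAction_tensor σ (d := fun i => d (τ.symm i)) fun i => hv _)).trans ?_
  refine Eq.trans ?_ (E.permAction_tensor (σ * τ) hv).symm
  rw [smul_smul, sg_invForm_mul, sg_add, mul_comm]
  rfl

variable {E} {F : GradedBundle.{uM, uV} EM M} {x y : M}

theorem permAction_comp_koszulMap (σ : Equiv.Perm (Fin m)) (l : Fin m → ℤ)
    {φ : Fin m → (E.fiber x →ₗ[ℝ] F.fiber y)} (hφ : ∀ i, IsHomogeneousMap (l i) (φ i)) :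
    F.permAction y σ ∘ₗ koszulMap (E := fun _ => E) (F := fun _ => F) l φ
      = sg (invForm σ l) • koszulMap (E := fun _ => E) (F := fun _ => F)
        (fun i => l (σ.symm i)) (fun i => φ (σ.symm i)) ∘ₗ E.permAction x σ := by
  refine tensorBundle_ext fun d v hv => ?_
  rw [LinearMap.comp_apply, LinearMap.smul_apply, LinearMap.comp_apply]
  have h1 := koszulMap_tensor (E := fun _ => E) (F := fun _ => F) l d φ hv
  have h2 := F.permAction_tensor (x := y) σ (d := d + l) fun i => hφ i _ _ (hv i)
  have h3 := E.permAction_tensor σ hv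
  have h4 := koszulMap_tensor (E := fun _ => E) (F := fun _ => F) (fun i => l (σ.symm i))
    (fun i => d (σ.symm i)) (fun i => φ (σ.symm i)) fun i => hv (σ.symm i)
  refine (congrArg _ h1).trans ?_
  refine ((map_smul _ _ _).trans (congrArg _ h2)).trans ?_
  refine Eq.trans ?_ (congrArg _ ((congrArg _ h3).trans ((map_smul _ _ _).trans
    (congrArg _ h4)))).symm
  rw [smul_smul, smul_smul, smul_smul, ← sg_add, ← sg_add, ← sg_add, ← sg_invForm_add,
    add_comm d l, add_comm]

theorem mem_symPower {v : (tensorBundle fun _ : Fin m => E).fiber x} :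
    v ∈ E.symPower m x ↔ ∀ σ, E.permAction x σ v = v := by
  simp [symPower]

end GradedBundle

end SymmetricPowers


/-! ## Operators on symmetric powers -/

section SymmetricOperators

variable {EM : Type*} [NormedAddCommGroup EM] [NormedSpace ℝ EM]
  {M : Type uM} [TopologicalSpace M] [ChartedSpace EM M]
  {EG : Type*} [NormedAddCommGroup EG] [NormedSpace ℝ EG]
  {G : Type*} [TopologicalSpace G] [ChartedSpace EG G] {Γ : LieGroupoid EM M EG G}

section Equivariance

variable {m : ℕ} {E F : GradedBundle.{uM, uV} EM M} {R : OpFamily G E E} {R' : OpFamily G F F}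

theorem permAction_comp_evalAt {Y : BarBasis} {ev : Y.carrier → OpFamily G E F} {k : ℕ} {l : ℤ}
    (hev : ∀ u, Y.IsBasis u → HasOpDegreeAt Γ (Y.order u) (Y.deg u) (ev u)) {z : Y.Pow m}
    (hz : z ∈ Y.piece m k l) (σ : Equiv.Perm (Fin m)) {x y : M} {g : List G}
    (hg : Γ.IsString x y g) (hk : g.length = k) :
    F.permAction y σ ∘ₗ evalAt (E := fun _ => E) (F := fun _ => F) (fun _ => ev) x y g z
      = evalAt (E := fun _ => E) (F := fun _ => F) (fun _ => ev) x y g (Y.permPow m σ z)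
        ∘ₗ E.permAction x σ := by
  refine LinearMap.ext fun v => ?_
  refine BarBasis.piece_ext
    (T := F.permAction y σ ∘ₗ
      (evalAt (E := fun _ => E) (F := fun _ => F) (fun _ => ev) x y g).flip v)
    (T' := (evalAt (E := fun _ => E) (F := fun _ => F) (fun _ => ev) x y g).flip
      (E.permAction x σ v) ∘ₗ Y.permPow m σ) (fun u hu _ => ?_) hz
  have hdeg : ∀ i, IsHomogeneousMap (Y.degs u i) (ev (u i) x y g) := fun i =>
    hev _ (hu i).1 x y g hg (by rw [(hu i).2, hk])
  have h := LinearMap.congr_fun (GradedBundle.permAction_comp_koszulMap σ (Y.degs u) hdeg) v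
  have h1 : evalAt (E := fun _ => E) (F := fun _ => F) (fun _ => ev) x y g
      (Y.permPow m σ (Finsupp.single u 1)) = sg (invForm σ (Y.degs u)) •
        GradedBundle.koszulMap (E := fun _ => E) (F := fun _ => F)
        (fun i => Y.degs u (σ.symm i)) (fun i => ev (u (σ.symm i)) x y g) := by
    rw [BarBasis.permPow_single, evalAt, Finsupp.linearCombination_single]
    rfl
  have h2 := evalAt_single (E := fun _ => E) (F := fun _ => F) (fun _ => ev) x y g u
  refine ((congrArg (fun T => F.permAction y σ (T v)) h2).trans h).trans ?_
  exact (congrArg (fun T => T (E.permAction x σ v)) h1).symm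

theorem preservesSub_of_comp {φ : OpFamily G (GradedBundle.tensorBundle fun _ : Fin m => E)
    (GradedBundle.tensorBundle fun _ : Fin m => F)}
    (h : ∀ x y g, Γ.IsString x y g → ∀ σ, F.permAction y σ ∘ₗ φ x y g
      = φ x y g ∘ₗ E.permAction x σ) :
    PreservesSub Γ (E.symPower m) (F.symPower m) φ := by
  intro x y g hg v hv
  rw [GradedBundle.mem_symPower] at hv ⊢
  intro σ
  have := LinearMap.congr_fun (h x y g hg σ) v
  exact this.trans (congrArg _ (hv σ))

theorem preservesSub_evalSeq {Y : BarBasis} {ev : Y.carrier → OpFamily G E F} {n : ℤ}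
    (hev : ∀ u, Y.IsBasis u → HasOpDegreeAt Γ (Y.order u) (Y.deg u) (ev u)) {z : ℕ → Y.Pow m}
    (hz : BarBasis.HasTotalDegree n z) (hs : BarBasis.IsSymmetric z) {x y : M} {g : List G}
    (hg : Γ.IsString x y g) (σ : Equiv.Perm (Fin m)) :
    F.permAction y σ ∘ₗ evalSeq (E := fun _ => E) (F := fun _ => F) (fun _ => ev) z x y g
      = evalSeq (E := fun _ => E) (F := fun _ => F) (fun _ => ev) z x y g ∘ₗ E.permAction x σ := by
  have h := permAction_comp_evalAt hev (hz g.length) σ hg rfl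
  rw [hs] at h
  exact h

theorem permAction_comp_koszulSum {x : M} {d : E.fiber x →ₗ[ℝ] E.fiber x}
    (hd : IsHomogeneousMap 1 d) (σ : Equiv.Perm (Fin m)) :
    E.permAction x σ ∘ₗ koszulSum (E := fun _ : Fin m => E) (fun _ => d)
      = koszulSum (E := fun _ : Fin m => E) (fun _ => d) ∘ₗ E.permAction x σ := by
  refine (linearMap_comp_sum _ _ _).trans (Eq.trans ?_ (linearMap_sum_comp _ _ _).symm)
  refine Eq.trans ?_ (Equiv.sum_comp σ _)
  refine Finset.sum_congr rfl fun i _ => ?_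
  have hdeg : ∀ j, IsHomogeneousMap ((Pi.single i 1 : Fin m → ℤ) j)
      (Function.update (fun _ => (LinearMap.id : E.fiber x →ₗ[ℝ] E.fiber x)) i d j) := by
    intro j
    by_cases hj : j = i
    · subst hj
      simpa using hd
    · simpa [hj] using isHomogeneousMap_id
  have h := GradedBundle.permAction_comp_koszulMap σ _ hdeg
  rw [invForm_single, sg_zero, one_smul] at h
  refine h.trans ?_
  congr 2
  · funext j
    by_cases hj : j = σ i
    · subst hj
      simp
    · have : σ.symm j ≠ i := fun h => hj (by simp [← h])
      simp [hj, this]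
  · funext j
    by_cases hj : j = σ i
    · subst hj
      simp
    · have : σ.symm j ≠ i := fun h => hj (by simp [← h])
      simp [hj, this]

theorem preservesSub_tensorRep {ω : ℕ → omegaBar.Pow m} (hω : IsUniversalMC m ω)
    (hs : BarBasis.IsSymmetric ω) (hR : IsRepresentation Γ R) :
    PreservesSub Γ (E.symPower m) (E.symPower m) (tensorRep Γ ω fun _ => R) := by
  refine preservesSub_of_comp fun x y g hg σ => ?_
  by_cases h : g = []
  · subst h
    obtain rfl : x = y := hg
    rw [tensorRep_nil]
    refine permAction_comp_koszulSum ?_ σ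
    have := hR.degree x x [] rfl
    simpa [IsHomogeneousMap] using this
  · rw [tensorRep_of_ne_nil _ _ _ _ h]
    exact preservesSub_evalSeq (isEvaluation_forest hR).degree hω.degree hs hg σ

theorem preservesSub_tensorMor {ω θ : ℕ → omegaBar.Pow m} {x : ℕ → moduleBar.Pow m}
    (hx : IsUniversalMCMorphism ω θ x) (hs : BarBasis.IsSymmetric x)
    (hR : IsRepresentation Γ R) (hR' : IsRepresentation Γ R') {Φ : OpFamily G E F}
    (hΦ : IsMorphism Γ R R' Φ) : PreservesSub Γ (E.symPower m) (F.symPower m)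
      (tensorMor Γ x (fun _ => R) (fun _ => R') fun _ => Φ) :=
  preservesSub_of_comp fun _ _ _ hg σ =>
    preservesSub_evalSeq (isEvaluation_marked hR hR' hΦ).degree hx.degree hs hg σ

end Equivariance

section Restriction

variable {D E F : GradedBundle.{uM, uV} EM M} {W : ∀ x, Submodule ℝ (E.fiber x)}
  {W' : ∀ x, Submodule ℝ (F.fiber x)} {W'' : ∀ x, Submodule ℝ (D.fiber x)}

/-- The inclusion of the fibres of a graded subbundle. -/
def GradedBundle.subIncl (hW : E.IsSubbundle W) (x : M) :
    (E.subBundle W hW).fiber x →ₗ[ℝ] E.fiber x := (W x).subtype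

theorem GradedBundle.subIncl_comp_injective {V : Type*} [AddCommGroup V] [Module ℝ V]
    {hW : E.IsSubbundle W} {x : M} {f f' : V →ₗ[ℝ] (E.subBundle W hW).fiber x}
    (h : GradedBundle.subIncl hW x ∘ₗ f = GradedBundle.subIncl hW x ∘ₗ f') : f = f' :=
  LinearMap.ext fun v => (W x).injective_subtype (LinearMap.congr_fun h v)

variable {hW : E.IsSubbundle W} {hW' : F.IsSubbundle W'} {hW'' : D.IsSubbundle W''}

theorem subIncl_comp_restrictOp {φ : OpFamily G E F} (hφ : PreservesSub Γ W W' φ) {x y : M}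
    {g : List G} (hg : Γ.IsString x y g) :
    GradedBundle.subIncl hW' y ∘ₗ restrictOp hW hW' φ x y g
      = φ x y g ∘ₗ GradedBundle.subIncl hW x := by
  refine LinearMap.ext fun v => ?_
  have : restrictOp hW hW' φ x y g = (φ x y g).restrict (hφ x y g hg) := dif_pos (hφ x y g hg)
  exact congrArg (fun T => GradedBundle.subIncl hW' y (T v)) this

theorem subIncl_comp_compAt {φ : OpFamily G E F} (hφ : PreservesSub Γ W W' φ)
    {ψ : OpFamily G D E} (hψ : PreservesSub Γ W'' W ψ) (j : ℕ) {x y : M}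
    {g : List G} (hg : Γ.IsString x y g) :
    GradedBundle.subIncl hW' y ∘ₗ compAt Γ j (restrictOp hW hW' φ) (restrictOp hW'' hW ψ) x y g
      = compAt Γ j φ ψ x y g ∘ₗ GradedBundle.subIncl hW'' x := by
  unfold compAt
  rw [← LinearMap.comp_assoc, subIncl_comp_restrictOp hφ (hg.take j), LinearMap.comp_assoc,
    subIncl_comp_restrictOp hψ (hg.drop j), LinearMap.comp_assoc]

theorem comp_sum_smul_eq {A B C D : Type*} [AddCommGroup A] [Module ℝ A] [AddCommGroup B]
    [Module ℝ B] [AddCommGroup C] [Module ℝ C] [AddCommGroup D] [Module ℝ D] {ι : Type*}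
    {s : Finset ι} {c : ι → ℝ} {i : A →ₗ[ℝ] B} {i' : C →ₗ[ℝ] D} {f : ι → A →ₗ[ℝ] C}
    {f' : ι → B →ₗ[ℝ] D} (h : ∀ k, i' ∘ₗ f k = f' k ∘ₗ i) :
    i' ∘ₗ (∑ k ∈ s, c k • f k) = (∑ k ∈ s, c k • f' k) ∘ₗ i := by
  simp only [linearMap_comp_sum, linearMap_sum_comp, LinearMap.comp_smul, LinearMap.smul_comp, h]

theorem restrictOp_degree {φ : OpFamily G E F} (hφ : PreservesSub Γ W W' φ) {c : ℤ}
    (h : HasOpDegree Γ c φ) : HasOpDegree Γ c (restrictOp hW hW' φ) := by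
  intro x y g hg n v hv
  have h1 := LinearMap.congr_fun (subIncl_comp_restrictOp (hW := hW) (hW' := hW') hφ hg) v
  change GradedBundle.subIncl hW' y (restrictOp hW hW' φ x y g v) ∈ F.gr y _
  exact h1 ▸ h x y g hg n _ hv

theorem restrictOp_smooth {φ : OpFamily G E F} (hφ : PreservesSub Γ W W' φ)
    (h : IsSmoothOp Γ φ) : IsSmoothOp Γ (restrictOp hW hW' φ) := by
  refine isSmoothOp_iff.2 fun k N U hU x y γ hγ hk u₀ hu₀ => ?_
  refine (isSmoothOp_iff.1 h k N U hU x y γ hγ hk u₀ hu₀).restrict hW hW' ?_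
    (hγ.smooth_src u₀ hu₀) (hγ.smooth_tgt u₀ hu₀)
  filter_upwards [self_mem_nhdsWithin] with u hu v
  exact LinearMap.congr_fun (subIncl_comp_restrictOp (hW := hW) (hW' := hW') hφ
    (hγ.isString u hu)) v

theorem IsRepresentation.restrictOp {R : OpFamily G E E} (hR : IsRepresentation Γ R)
    (hp : PreservesSub Γ W W R) : IsRepresentation Γ (restrictOp hW hW R) where
  degree := restrictOp_degree hp hR.degree
  smooth := restrictOp_smooth hp hR.smooth
  equation x y g hg := by
    refine GradedBundle.subIncl_comp_injective ?_
    rw [comp_sum_smul_eq fun j => subIncl_comp_restrictOp hp (hg.mulAt j), hR.equation x y g hg,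
      comp_sum_smul_eq fun j => subIncl_comp_compAt hp hp j hg]

theorem IsMorphism.restrictOp {R : OpFamily G E E} {R' : OpFamily G F F} {Φ : OpFamily G E F}
    (hΦ : IsMorphism Γ R R' Φ) (hp : PreservesSub Γ W W R) (hp' : PreservesSub Γ W' W' R')
    (h : PreservesSub Γ W W' Φ) :
    IsMorphism Γ (restrictOp hW hW R) (restrictOp hW' hW' R') (restrictOp hW hW' Φ) where
  degree := restrictOp_degree h hΦ.degree
  smooth := restrictOp_smooth h hΦ.smooth
  equation x y g hg := by
    refine GradedBundle.subIncl_comp_injective ?_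
    have h1 := comp_sum_smul_eq (s := range (g.length + 1)) (c := fun _ => 1) fun j =>
      subIncl_comp_compAt (hW := hW') (hW' := hW') (hW'' := hW) hp' h j hg
    simp only [one_smul] at h1
    rw [comp_sum_smul_eq fun j => subIncl_comp_compAt h hp j hg, hΦ.equation x y g hg,
      LinearMap.comp_add, h1, comp_sum_smul_eq fun j => subIncl_comp_restrictOp h (hg.mulAt j),
      LinearMap.add_comp]

end Restriction

end SymmetricOperators


/-! ## Symmetric powers are graded subbundles -/

section SymmetricSubbundle

variable {EM : Type*} [NormedAddCommGroup EM] [NormedSpace ℝ EM]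
  {M : Type uM} [TopologicalSpace M] [ChartedSpace EM M]

/-- The frame obtained from a frame by a constant change of basis. -/
def LocalFrame.changeBasis {V : M → Type uV} [∀ x, AddCommGroup (V x)] [∀ x, Module ℝ (V x)]
    (t : LocalFrame V) {K : Type} [Fintype K] (b : K → t.idx → ℝ) (deg : K → ℤ) :
    LocalFrame V where
  dom := t.dom
  idx := K
  deg := deg
  sec k y := ∑ J, b k J • t.sec J y

namespace GradedBundle

variable {E : GradedBundle.{uM, uV} EM M}

section ChangeBasis

variable {t : LocalFrame E.fiber} {K : Type} [Fintype K] (b : Module.Basis K ℝ (t.idx → ℝ))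

theorem repr_single_eq_zero [DecidableEq t.idx] {deg : K → ℤ}
    (hb : ∀ k J, b k J ≠ 0 → t.deg J = deg k) {J : t.idx} {k : K} (h : deg k ≠ t.deg J) :
    b.repr (Pi.single J 1) k = 0 := by
  let π : (t.idx → ℝ) →ₗ[ℝ] (t.idx → ℝ) :=
    LinearMap.pi fun I => if t.deg I = t.deg J then LinearMap.proj I else 0
  have hπ : ∀ c I, π c I = if t.deg I = t.deg J then c I else 0 := fun c I => by
    simp only [π, LinearMap.pi_apply]
    split_ifs <;> rfl
  have h1 : ∀ k, π (b k) = if deg k = t.deg J then b k else 0 := by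
    intro k
    funext I
    rw [hπ]
    by_cases hI : b k I = 0
    · split_ifs <;> simp [hI]
    · rw [hb k I hI]
      split_ifs <;> simp
  have h2 : π (Pi.single J 1) = Pi.single J 1 := by
    funext I
    rw [hπ]
    by_cases hI : I = J
    · simp [hI]
    · simp [hI]
  have h3 : Pi.single J 1
      = ∑ k, (if deg k = t.deg J then b.repr (Pi.single J 1) k else 0) • b k := by
    have h4 := congrArg π (b.sum_repr (Pi.single J 1))
    rw [map_sum, h2] at h4
    refine h4.symm.trans (Finset.sum_congr rfl fun k _ => ?_)
    rw [map_smul, h1]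
    split_ifs <;> simp
  rw [h3, Module.Basis.repr_sum_self, if_neg h]

theorem isSmoothFrame_changeBasis (ht : E.IsSmoothFrame t) {deg : K → ℤ}
    (hb : ∀ k J, b k J ≠ 0 → t.deg J = deg k) : E.IsSmoothFrame (t.changeBasis b deg) := by
  classical
  have hT : ∀ y (hy : y ∈ t.dom) (c : t.idx → ℝ), (ht.1.basis hy).equivFun.symm c
      = ∑ J, c J • t.sec J y := fun y hy c => by
    simp only [Module.Basis.equivFun_symm_apply, LocalFrame.IsHomogeneousFrame.basis_apply]
  have hsec : ∀ y (hy : y ∈ t.dom), (fun k => (t.changeBasis b deg).sec k y)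
      = b.map (ht.1.basis hy).equivFun.symm := fun y hy => funext fun k =>
    ((Module.Basis.map_apply _ _ _).trans (hT y hy _)).symm
  have hinv : ∀ y ∈ t.dom, ∀ J, t.sec J y
      = ∑ k, b.repr (Pi.single J 1) k • (t.changeBasis b deg).sec k y := by
    intro y hy J
    have h1 := congrArg (ht.1.basis hy).equivFun.symm (b.sum_repr (Pi.single J 1))
    rw [map_sum, hT] at h1
    have h2 : ∑ I, (Pi.single J 1 : t.idx → ℝ) I • t.sec I y = t.sec J y := by
      rw [Finset.sum_eq_single J] <;> simp +contextual
    rw [← h2, ← h1]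
    refine Finset.sum_congr rfl fun k _ => ?_
    rw [map_smul, hT]
    rfl
  refine ⟨⟨ht.1.isOpen, fun y hy => ?_, fun y hy => ?_, fun y hy n => ?_⟩, fun a ha => ⟨?_, ?_⟩⟩
  · rw [hsec y hy]
    exact (b.map _).linearIndependent
  · rw [hsec y hy]
    exact (b.map _).span_eq
  · rw [ht.1.gr_eq y hy]
    refine le_antisymm (Submodule.span_le.2 ?_) (Submodule.span_le.2 ?_)
    · rintro _ ⟨J, hJ, rfl⟩
      change t.sec J y ∈ _
      rw [hinv y hy]
      refine Submodule.sum_mem _ fun k _ => ?_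
      by_cases hk : deg k = t.deg J
      · exact Submodule.smul_mem _ _ (Submodule.subset_span ⟨k, hk.trans hJ, rfl⟩)
      · rw [repr_single_eq_zero b hb hk, zero_smul]
        exact Submodule.zero_mem _
    · rintro _ ⟨k, hk, rfl⟩
      refine Submodule.sum_mem _ fun J _ => ?_
      by_cases hJ : b k J = 0
      · rw [hJ, zero_smul]
        exact Submodule.zero_mem _
      · exact Submodule.smul_mem _ _ (Submodule.subset_span ⟨J, (hb k J hJ).trans hk, rfl⟩)
  · obtain ⟨A, hA, hAx⟩ := (ht.2 a ha).1
    refine ⟨fun k i x => ∑ J, b k J * A J i x, fun k i => ?_, fun x hx k => ?_⟩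
    · exact contMDiffOn_finsetSum fun J _ => contMDiffOn_const.mul (hA J i)
    · rw [← sum_smul_sum_smul]
      exact Finset.sum_congr rfl fun J _ => congrArg _ (hAx x hx J)
  · obtain ⟨A, hA, hAx⟩ := (ht.2 a ha).2
    refine ⟨fun j k x => ∑ J, A j J x * b.repr (Pi.single J 1) k, fun j k => ?_, fun x hx j => ?_⟩
    · exact contMDiffOn_finsetSum fun J _ => (hA j J).mul contMDiffOn_const
    · refine (hAx x hx j).trans (Eq.trans ?_ (sum_smul_sum_smul _ _ _))
      exact Finset.sum_congr rfl fun J _ => congrArg _ (hinv x hx.1 J)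

end ChangeBasis

/-- The sum of the actions of all permutations. -/
def symmetrizer (E : GradedBundle.{uM, uV} EM M) (m : ℕ) (x : M) :
    (tensorBundle fun _ : Fin m => E).fiber x →ₗ[ℝ] (tensorBundle fun _ : Fin m => E).fiber x :=
  ∑ σ, E.permAction x σ

variable {m : ℕ} {x : M}

theorem symmetrizer_mem (v : (tensorBundle fun _ : Fin m => E).fiber x) :
    E.symmetrizer m x v ∈ E.symPower m x := by
  refine mem_symPower.2 fun σ => ?_
  rw [← LinearMap.comp_apply, symmetrizer, linearMap_comp_sum]
  simp only [permAction_comp]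
  exact LinearMap.congr_fun (Equiv.sum_comp (Equiv.mulLeft σ) fun τ => E.permAction x τ) v

theorem symmetrizer_eq {v : (tensorBundle fun _ : Fin m => E).fiber x} (hv : v ∈ E.symPower m x) :
    E.symmetrizer m x v = (m.factorial : ℝ) • v := by
  rw [mem_symPower] at hv
  rw [symmetrizer, LinearMap.sum_apply, Finset.sum_congr rfl fun σ _ => hv σ, Finset.sum_const,
    card_univ, Fintype.card_perm, Fintype.card_fin, Nat.cast_smul_eq_nsmul]

theorem isSubbundle_symPower (E : GradedBundle.{uM, uV} EM M) (m : ℕ) :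
    IsSubbundle (tensorBundle fun _ : Fin m => E) (E.symPower m) := by
  classical
  intro x
  let a := E.frameAt x
  let t : LocalFrame (tensorBundle fun _ : Fin m => E).fiber :=
    tensorFrame (fun _ : Fin m => E) fun _ => a
  have ha := E.isFrame a (E.frameAt_mem x)
  have ht : IsSmoothFrame (tensorBundle fun _ : Fin m => E) t :=
    isSmoothFrame_of_mem _ ⟨fun _ => a, fun _ => E.frameAt_mem x, rfl⟩
  have hdom : ∀ {y}, y ∈ t.dom → ∀ _ : Fin m, y ∈ a.dom := fun hy => Set.mem_iInter.1 hy
  let act : Equiv.Perm (Fin m) → t.idx → t.idx := fun σ J i => J (σ.symm i)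
  let v : t.idx ⊕ t.idx → (t.idx → ℝ) := Sum.elim
    (fun J => ∑ σ : Equiv.Perm (Fin m), sg (invForm σ fun i => a.deg (J i)) •
      Pi.single (act σ J) 1) fun J => Pi.single J 1
  let δ : t.idx ⊕ t.idx → ℤ := Sum.elim t.deg t.deg
  have hδ : ∀ k J, v k J ≠ 0 → t.deg J = δ k := by
    rintro (K | K) J h
    · have h1 : v (Sum.inl K) J = ∑ σ : Equiv.Perm (Fin m),
          sg (invForm σ fun i => a.deg (K i)) *
            (Pi.single (act σ K) 1 : t.idx → ℝ) J := by
        simp only [v, Sum.elim_inl, Finset.sum_apply, Pi.smul_apply, smul_eq_mul]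
      rw [h1] at h
      obtain ⟨σ, -, hσ⟩ := Finset.exists_ne_zero_of_sum_ne_zero h
      have h2 : J = act σ K := by
        by_contra hne
        exact hσ (by rw [Pi.single_eq_of_ne hne, mul_zero])
      rw [h2]
      exact Equiv.sum_comp σ.symm fun i => a.deg (K i)
    · have h2 : J = K := by
        by_contra hne
        exact h (Pi.single_eq_of_ne hne _)
      rw [h2]
      rfl
  obtain ⟨b₁, hr, -, hs₁, hi₁⟩ := exists_linearIndepOn_extension (linearIndepOn_empty ℝ v)
    (Set.empty_subset (Set.range Sum.inl))
  obtain ⟨b₂, -, hb, hs₂, hi₂⟩ := exists_linearIndepOn_extension hi₁ (Set.subset_univ b₁)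
  have : Fintype b₂ := Fintype.ofFinite _
  have htop : ⊤ ≤ Submodule.span ℝ (Set.range fun k : b₂ => v k) := by
    rw [← (Pi.basisFun ℝ t.idx).span_eq, Submodule.span_le, ← Set.image_eq_range]
    rintro _ ⟨J, rfl⟩
    rw [Pi.basisFun_apply]
    exact hs₂ ⟨Sum.inr J, trivial, rfl⟩
  let b : Module.Basis b₂ ℝ (t.idx → ℝ) := Module.Basis.mk hi₂ htop
  have hbv : ∀ k, b k = v k := fun k => Module.Basis.mk_apply hi₂ htop k
  refine ⟨t.changeBasis b fun k => δ k, {k : b₂ | (k : t.idx ⊕ t.idx) ∈ b₁},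
    ⟨isSmoothFrame_changeBasis b ht fun k J h => hδ k J (by rwa [← hbv]), fun y hy => ?_⟩,
    Set.mem_iInter.2 fun _ => E.mem_frameAt x⟩
  let T := Fintype.linearCombination ℝ fun J => t.sec J y
  have hT : ∀ J, E.symmetrizer m y (t.sec J y) = T (v (Sum.inl J)) := by
    intro J
    rw [symmetrizer, LinearMap.sum_apply]
    simp only [v, Sum.elim_inl]
    rw [map_sum]
    refine Finset.sum_congr rfl fun σ _ => ?_
    rw [map_smul, Fintype.linearCombination_apply_single, one_smul]
    refine E.permAction_tensor σ fun i => ?_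
    rw [ha.gr_eq y (hdom hy i)]
    exact Submodule.subset_span ⟨J i, rfl, rfl⟩
  have h1 : (fun k : b₂ => (t.changeBasis b fun k => δ k).sec k y) ''
      {k : b₂ | (k : t.idx ⊕ t.idx) ∈ b₁} = T '' (v '' b₁) := by
    have h2 : ∀ k : b₂, (t.changeBasis b fun k => δ k).sec k y = T (v k) := fun k => by
      rw [← hbv]
      rfl
    ext w
    constructor
    · rintro ⟨k, hk, rfl⟩
      exact ⟨_, ⟨k, hk, rfl⟩, (h2 k).symm⟩
    · rintro ⟨_, ⟨k, hk, rfl⟩, rfl⟩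
      exact ⟨⟨k, hb hk⟩, hk, h2 _⟩
  refine Eq.trans ?_ (congrArg (Submodule.span ℝ) h1).symm
  rw [← Submodule.map_span]
  refine le_antisymm (fun w hw => ?_) (Submodule.map_le_iff_le_comap.2 (Submodule.span_le.2 ?_))
  · have h3 : E.symmetrizer m y w ∈ (Submodule.span ℝ (v '' b₁)).map T := by
      rw [← (ht.1.basis hy).sum_repr w, map_sum]
      refine Submodule.sum_mem _ fun J _ => ?_
      rw [map_smul]
      refine Submodule.smul_mem _ _
        ((congrArg (fun u => E.symmetrizer m y u ∈ _) (ht.1.basis_apply hy J)).mpr ?_)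
      rw [hT]
      exact ⟨_, hs₁ ⟨_, ⟨J, rfl⟩, rfl⟩, rfl⟩
    rw [symmetrizer_eq hw] at h3
    exact (Submodule.smul_mem_iff _ (Nat.cast_ne_zero.2 m.factorial_ne_zero)).1 h3
  · rintro _ ⟨k, hk, rfl⟩
    obtain ⟨J, rfl⟩ := hr hk
    refine Submodule.mem_comap.2 ?_
    rw [← hT]
    exact symmetrizer_mem _

end GradedBundle

end SymmetricSubbundle

end

theorem mainTheorem7
    {EM : Type*} [NormedAddCommGroup EM] [NormedSpace ℝ EM] [FiniteDimensional ℝ EM]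
    {M : Type uM} [TopologicalSpace M] [ChartedSpace EM M]
    [IsManifold 𝓘(ℝ, EM) ((⊤ : ℕ∞) : WithTop ℕ∞) M]
    {EG : Type*} [NormedAddCommGroup EG] [NormedSpace ℝ EG] [FiniteDimensional ℝ EG]
    {G : Type*} [TopologicalSpace G] [ChartedSpace EG G]
    [IsManifold 𝓘(ℝ, EG) ((⊤ : ℕ∞) : WithTop ℕ∞) G]
    (Γ : LieGroupoid EM M EG G)
    (m : ℕ) (hm : 0 < m)
    (ω θ : ℕ → omegaBar.Pow m) (hω : IsUniversalMC m ω) (hθ : IsUniversalMC m θ)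
    (E F : Fin m → GradedBundle.{uM, uV} EM M)
    (R : ∀ i, OpFamily G (E i) (E i)) (hR : ∀ i, IsRepresentation Γ (R i))
    (R' : ∀ i, OpFamily G (F i) (F i)) (hR' : ∀ i, IsRepresentation Γ (R' i))
    (Φ : ∀ i, OpFamily G (E i) (F i)) (hΦ : ∀ i, IsMorphism Γ (R i) (R' i) (Φ i)) :
    -- the tensor products are representations up to homotopy and morphisms between them
    (IsRepresentation Γ (tensorRep Γ ω R) ∧ IsRepresentation Γ (tensorRep Γ θ R') ∧
      ∀ x, IsUniversalMCMorphism ω θ x →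
        IsMorphism Γ (tensorRep Γ ω R) (tensorRep Γ θ R') (tensorMor Γ x R R' Φ)) ∧
    -- (1) existence and uniqueness up to homotopy of universal Maurer-Cartan morphisms
    ((∃ x, IsUniversalMCMorphism ω θ x) ∧
      ∀ x y, IsUniversalMCMorphism ω θ x → IsUniversalMCMorphism ω θ y →
        ∃ h, IsMCHomotopy ω θ x y h) ∧
    -- (2) homotopies induce homotopies
    (∀ x y h, IsUniversalMCMorphism ω θ x → IsUniversalMCMorphism ω θ y →
      IsMCHomotopy ω θ x y h →
      IsHomotopy Γ (tensorRep Γ ω R) (tensorRep Γ θ R')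
        (tensorMor Γ x R R' Φ) (tensorMor Γ y R R' Φ) (tensorMor Γ h R R' Φ)) ∧
    -- (3) the zeroth component; strict morphisms of strict representations
    (∀ x, IsUniversalMCMorphism ω θ x →
      (∀ p : M, tensorMor Γ x R R' Φ p p [] = PiTensorProduct.map fun i => Φ i p p []) ∧
      ((∀ i, VanishesFrom Γ 2 (R i)) → (∀ i, VanishesFrom Γ 2 (R' i)) →
        (∀ i, VanishesFrom Γ 1 (Φ i)) → VanishesFrom Γ 1 (tensorMor Γ x R R' Φ))) ∧
    -- (4) symmetric universal Maurer-Cartan morphisms and symmetric powers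
    (BarBasis.IsSymmetric ω → BarBasis.IsSymmetric θ →
      (∃ x, IsUniversalMCMorphism ω θ x ∧ BarBasis.IsSymmetric x) ∧
      ∀ x, IsUniversalMCMorphism ω θ x → BarBasis.IsSymmetric x →
        ∀ (E₀ F₀ : GradedBundle.{uM, uV} EM M) (R₀ : OpFamily G E₀ E₀) (R₀' : OpFamily G F₀ F₀)
          (Φ₀ : OpFamily G E₀ F₀), IsRepresentation Γ R₀ → IsRepresentation Γ R₀' →
          IsMorphism Γ R₀ R₀' Φ₀ →
          PreservesSub Γ (E₀.symPower m) (E₀.symPower m) (tensorRep Γ ω fun _ => R₀) ∧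
          PreservesSub Γ (F₀.symPower m) (F₀.symPower m) (tensorRep Γ θ fun _ => R₀') ∧
          PreservesSub Γ (E₀.symPower m) (F₀.symPower m)
            (tensorMor Γ x (fun _ => R₀) (fun _ => R₀') fun _ => Φ₀) ∧
          ∃ (hE : GradedBundle.IsSubbundle _ (E₀.symPower m))
            (hF : GradedBundle.IsSubbundle _ (F₀.symPower m)),
            IsRepresentation Γ (restrictOp hE hE (tensorRep Γ ω fun _ => R₀)) ∧
            IsRepresentation Γ (restrictOp hF hF (tensorRep Γ θ fun _ => R₀')) ∧
            IsMorphism Γ (restrictOp hE hE (tensorRep Γ ω fun _ => R₀))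
              (restrictOp hF hF (tensorRep Γ θ fun _ => R₀'))
              (restrictOp hE hF (tensorMor Γ x (fun _ => R₀) (fun _ => R₀') fun _ => Φ₀))) ∧
    -- (5) compatibility with homotopies of the factors
    (∀ x, IsUniversalMCMorphism ω θ x →
      ∀ Φ' : ∀ i, OpFamily G (E i) (F i), (∀ i, IsMorphism Γ (R i) (R' i) (Φ' i)) →
        (∀ i, AreHomotopic Γ (R i) (R' i) (Φ' i) (Φ i)) →
        AreHomotopic Γ (tensorRep Γ ω R) (tensorRep Γ θ R')
          (tensorMor Γ x R R' Φ') (tensorMor Γ x R R' Φ)) ∧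
    -- (6) tensor products of identities
    (∀ x, IsUniversalMCMorphism ω ω x →
      AreHomotopic Γ (tensorRep Γ ω R) (tensorRep Γ ω R)
        (tensorMor Γ x R R fun i => idOp G (E i)) (idOp G (GradedBundle.tensorBundle E))) := by
  refine ⟨⟨isRepresentation_tensorRep hm hR hω, isRepresentation_tensorRep hm hR' hθ,
    fun x hx => isMorphism_tensorMor hm hω hθ hx hR hR' hΦ⟩,
    ⟨exists_mcMorphism hm hω hθ, fun x y hx hy => exists_mcHomotopy hm hω hθ hx hy⟩,
    fun x y h _ _ hh => isHomotopy_tensorMor hm hω hθ hh hR hR' hΦ,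
    fun x hx => ⟨tensorMor_nil hx.zero, vanishesFrom_tensorMor hx.degree⟩,
    fun hωs hθs => ⟨exists_symmetric_mcMorphism hm hω hθ hωs hθs,
      fun x hx hs E₀ F₀ R₀ R₀' Φ₀ hR₀ hR₀' hΦ₀ => ?_⟩,
    fun x hx Φ' hΦ' h => areHomotopic_tensorMor hm hω hθ hx hR hR' hΦ' hΦ h,
    fun x hx => areHomotopic_tensorMor_idOp hm hω hx hR⟩
  have h1 := preservesSub_tensorRep hω hωs hR₀
  have h2 := preservesSub_tensorRep hθ hθs hR₀'
  have h3 := preservesSub_tensorMor hx hs hR₀ hR₀' hΦ₀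
  exact ⟨h1, h2, h3, E₀.isSubbundle_symPower m, F₀.isSubbundle_symPower m,
    (isRepresentation_tensorRep hm (fun _ => hR₀) hω).restrictOp h1,
    (isRepresentation_tensorRep hm (fun _ => hR₀') hθ).restrictOp h2,
    (isMorphism_tensorMor hm hω hθ hx (fun _ => hR₀) (fun _ => hR₀') fun _ => hΦ₀).restrictOp
      h1 h2 h3⟩
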